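/- Let $M$ be a Sasakian sub-Riemannian $3$-manifold: a connected $3$-manifold without boundary with an oriented contact distribution $\mathcal H$ and a Riemannian metric $g_h$ on $\mathcal H$. Let $\eta$ be the contact form with $\operatorname{Ker}\eta=\mathcal H$ such that $d\eta|_{\mathcal H}$ is the area form of $(\mathcal H,g_h)$, where $d\eta(U,V)=\frac12\big(U(\eta(V))-V(\eta(U))-\eta([U,V])\big)$; let $T$ be the Reeb field ($\eta(T)=1$, $d\eta(T,\cdot)=0$), $J$ the rotation by $+90^\circ$ in $\mathcal H$ extended by $J(T)=0$, and $g=\langle\cdot,\cdot\rangle$ the metric extending $g_h$ for which $T$ is a unit field orthogonal to $\mathcal H$. Sasakian means that the flow of $T$ acts by isometries. Orient $M$ by $\eta\wedge d\eta$, let $dv$ be the volume form and $D$ the Levi-Civita connection of $g$, and let $K=\frac14(K_h+3)$ be the Webster scalar curvature, $K_h$ being the sectional curvature of $\mathcal H$ in $(M,g)$. Let $\varphi_0:\Sigma\to M$ be an oriented $C^2$ immersed surface without boundary, with unit normal $N$ compatible with the orientations of $\Sigma$ and $M$, Riemannian area element $da$ and shape operator $B(U)=-D_UN$. Its singular set $\Sigma_0$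 is the set of points where the tangent plane is horizontal. Put $N_h=N-\langle N,T\rangle T$ and, on $\Sigma-\Sigma_0$, $$\nu_h=\frac{N_h}{|N_h|},\qquad Z=J(\nu_h),\qquad S=\langle N,T\rangle\,\nu_h-|N_h|\,T,\qquad -2H=\langle D_Z\nu_h,Z\rangle+\langle D_S\nu_h,S\rangle .$$ With $q=|B(Z)+S|^2+4(K-1)|N_h|^2$, the Jacobi operator and the index form are $$\mathcal L(\psi)=|N_h|^{-1}\big\{Z(Z(\psi))+2|N_h|^{-1}\langle N,T\rangle\langle B(Z),S\rangle\,Z(\psi)+q\,\psi\big\},\qquad \mathcal Q(u,v)=\int_\Sigma|N_h|^{-1}\{Z(u)Z(v)-q\,uv\}\,da .$$ A variation of $\Sigma-\Sigma_0$ is a $C^3$ map $\varphi:I\times(\Sigma-\Sigma_0)\to M$, with $I$ an open interval containing $0$, such that $\varphi(0,\cdot)=\varphi_0$, each $\varphi_s=\varphi(s,\cdot)$ is an immersion, and $\varphi_s=\varphi_0$ off a compact set $C\subseteq\Sigma-\Sigma_0$. Let $A(s)=\int_C|N_h|\,da$, computed for $\varphi_s$, and $V(s)=\int_{[0,s]\times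 C}\varphi^*(dv)$. When $\Sigma-\Sigma_0$ has constant mean curvature $H$, it is called strongly stable if $A'(0)=0$ for every variation with $V$ constant near $s=0$ and, for every variation, $A+2HV$ is of class $C^2$ near $s=0$ with $(A+2HV)'(0)=0$ and $(A+2HV)''(0)\ge0$. It is called strictly stable if, moreover, $(A+2HV)''(0)=0$ holds if and only if the velocity field $\partial\varphi/\partial s|_{s=0}$ is tangent to $\Sigma$. **Theorem.** Suppose that $\Sigma-\Sigma_0$ is of class $C^3$ and has constant mean curvature $H$, and that there is a nowhere vanishing function $\psi\in C^2(\Sigma-\Sigma_0)$ with $\psi\,\mathcal L(\psi)\le0$ (resp. $\psi\,\mathcal L(\psi)<0$) on $\Sigma-\Sigma_0$. Then, for every $C^1$ function $w\neq0$ with compact support in $\Sigma-\Sigma_0$, the integral defining $\mathcal Q(w,w)$ converges and $\mathcal Q(w,w)\ge0$ (resp. $\mathcal Q(w,w)>0$). Moreover, $\Sigma-\Sigma_0$ is strongly stable (resp. strictly stable). -/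

import Mathlib

open Bundle Manifold MeasureTheory Set Filter
open scoped Manifold ContDiff Topology ENNReal

noncomputable section

namespace SubRiem

/-- The model space of surfaces. -/
abbrev E2 : Type := EuclideanSpace ℝ (Fin 2)

/-- The model space of `3`-manifolds. -/
abbrev E3 : Type := EuclideanSpace ℝ (Fin 3)

/-- The standard basis of `ℝ²`. -/
abbrev b2 (i : Fin 2) : E2 := EuclideanSpace.single i 1

/-- The standard basis of `ℝ³`. -/
abbrev b3 (i : Fin 3) : E3 := EuclideanSpace.single i 1

/-! ### Sasakian sub-Riemannian 3-manifolds -/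

/-- A Sasakian sub-Riemannian structure on a `3`-manifold `M`, recorded through its normalized
contact form `η`, Reeb field `T`, rotation `J` and the canonical extension `g` of the horizontal
metric.  The horizontal distribution is `ker η`, with the metric `g` restricted to it and the
orientation for which `J` is the rotation by `+90` degrees.  The exterior derivative is normalized
by `dη(U,V) = ½ (U η(V) - V η(U) - η([U,V]))`. -/
structure SasakianStructure (M : Type*) [TopologicalSpace M] [ChartedSpace E3 M]
    [IsManifold 𝓘(ℝ, E3) ∞ M] where
  /-- the canonical extension of the horizontal metric -/
  g : ContMDiffRiemannianMetric 𝓘(ℝ, E3) ∞ E3 (fun x : M => TangentSpace 𝓘(ℝ, E3) x)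
  /-- the normalized contact form -/
  η : ∀ x : M, TangentSpace 𝓘(ℝ, E3) x →L[ℝ] ℝ
  /-- the Reeb vector field -/
  T : ∀ x : M, TangentSpace 𝓘(ℝ, E3) x
  /-- the rotation by `90` degrees in the horizontal planes, extended by `J T = 0` -/
  J : ∀ x : M, TangentSpace 𝓘(ℝ, E3) x →L[ℝ] TangentSpace 𝓘(ℝ, E3) x
  contMDiff_η : ContMDiff 𝓘(ℝ, E3) (𝓘(ℝ, E3).prod 𝓘(ℝ, E3 →L[ℝ] ℝ)) ∞
    (fun x => TotalSpace.mk' (E3 →L[ℝ] ℝ)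
      (E := fun x : M => TangentSpace 𝓘(ℝ, E3) x →L[ℝ] Bundle.Trivial M ℝ x) x (η x))
  contMDiff_T : ContMDiff 𝓘(ℝ, E3) 𝓘(ℝ, E3).tangent ∞
    (fun x => (⟨x, T x⟩ : TangentBundle 𝓘(ℝ, E3) M))
  contMDiff_J : ContMDiff 𝓘(ℝ, E3) (𝓘(ℝ, E3).prod 𝓘(ℝ, E3 →L[ℝ] E3)) ∞
    (fun x => TotalSpace.mk' (E3 →L[ℝ] E3)
      (E := fun x : M => TangentSpace 𝓘(ℝ, E3) x →L[ℝ] TangentSpace 𝓘(ℝ, E3) x) x (J x))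
  /-- `T` is a unit field orthogonal to `ker η`, and `η T = 1` -/
  η_T : ∀ x, η x (T x) = 1
  g_T : ∀ x (u : TangentSpace 𝓘(ℝ, E3) x), g.inner x (T x) u = η x u
  /-- on horizontal planes `J` is a rotation by `90` degrees -/
  J_J : ∀ x (u : TangentSpace 𝓘(ℝ, E3) x), J x (J x u) = -u + η x u • T x
  J_T : ∀ x, J x (T x) = 0
  /-- `dη(U,V) = ⟨J U, V⟩`: on horizontal planes `dη` is the area form, and `dη(T, ·) = 0` -/
  dη_eq : ∀ (x : M) (U V : ∀ y : M, TangentSpace 𝓘(ℝ, E3) y),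
    MDifferentiableAt 𝓘(ℝ, E3) 𝓘(ℝ, E3).tangent
      (fun y => (⟨y, U y⟩ : TangentBundle 𝓘(ℝ, E3) M)) x →
    MDifferentiableAt 𝓘(ℝ, E3) 𝓘(ℝ, E3).tangent
      (fun y => (⟨y, V y⟩ : TangentBundle 𝓘(ℝ, E3) M)) x →
    (1 / 2 : ℝ) * (mvfderiv 𝓘(ℝ, E3) (fun y => η y (V y)) x (U x)
      - mvfderiv 𝓘(ℝ, E3) (fun y => η y (U y)) x (V x)
      - η x (VectorField.mlieBracket 𝓘(ℝ, E3) U V x)) = g.inner x (J x (U x)) (V x)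
  /-- the Sasakian condition: the flow of `T` acts by isometries, i.e. the Lie derivative of `g`
  along `T` vanishes -/
  killing : ∀ (x : M) (U V : ∀ y : M, TangentSpace 𝓘(ℝ, E3) y),
    MDifferentiableAt 𝓘(ℝ, E3) 𝓘(ℝ, E3).tangent
      (fun y => (⟨y, U y⟩ : TangentBundle 𝓘(ℝ, E3) M)) x →
    MDifferentiableAt 𝓘(ℝ, E3) 𝓘(ℝ, E3).tangent
      (fun y => (⟨y, V y⟩ : TangentBundle 𝓘(ℝ, E3) M)) x →
    mvfderiv 𝓘(ℝ, E3) (fun y => g.inner y (U y) (V y)) x (T x)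
      = g.inner x (VectorField.mlieBracket 𝓘(ℝ, E3) T U x) (V x)
        + g.inner x (U x) (VectorField.mlieBracket 𝓘(ℝ, E3) T V x)

variable {M : Type*} [TopologicalSpace M] [ChartedSpace E3 M] [IsManifold 𝓘(ℝ, E3) ∞ M]

namespace SasakianStructure

variable (𝒮 : SasakianStructure M)

/-- The length of a tangent vector. -/
def len (x : M) (u : TangentSpace 𝓘(ℝ, E3) x) : ℝ := √(𝒮.g.inner x u u)

/-- The volume form `η ∧ dη` of `(M, g)`; it takes the value `1` on `(X, J X, T)` for every unit
horizontal `X`. -/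
def volForm (x : M) (u v w : TangentSpace 𝓘(ℝ, E3) x) : ℝ :=
  𝒮.η x u * 𝒮.g.inner x (𝒮.J x v) w + 𝒮.η x v * 𝒮.g.inner x (𝒮.J x w) u
    + 𝒮.η x w * 𝒮.g.inner x (𝒮.J x u) v

/-- The cross product of the oriented Euclidean space `T_x M`, characterized by
`⟨u × v, w⟩ = volForm w u v`. -/
def cross (x : M) (u v : TangentSpace 𝓘(ℝ, E3) x) : TangentSpace 𝓘(ℝ, E3) x :=
  𝒮.g.inner x (𝒮.J x u) v • 𝒮.T x + 𝒮.η x u • 𝒮.J x v - 𝒮.η x v • 𝒮.J x u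

/-- The metric at the point with coordinates `y`, in the coordinates of the preferred chart
at `x₀`. -/
def metricInChart (x₀ : M) (y : E3) (u v : E3) : ℝ :=
  𝒮.g.inner ((extChartAt 𝓘(ℝ, E3) x₀).symm y)
    (mfderiv 𝓘(ℝ, E3) 𝓘(ℝ, E3) (extChartAt 𝓘(ℝ, E3) x₀).symm y u)
    (mfderiv 𝓘(ℝ, E3) 𝓘(ℝ, E3) (extChartAt 𝓘(ℝ, E3) x₀).symm y v)

/-- The matrix `(g_{ij})` in the preferred chart at `x₀`. -/
def metricMatrix (x₀ : M) (y : E3) : Matrix (Fin 3) (Fin 3) ℝ :=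
  Matrix.of fun i j => 𝒮.metricInChart x₀ y (b3 i) (b3 j)

/-- The Christoffel symbols `∑ Γ^k_{ij} uⁱ vʲ ∂_k` of the Levi-Civita connection of `g`, in the
preferred chart at `x₀`, at the point with coordinates `y`. -/
def christoffel (x₀ : M) (y : E3) (u v : E3) : E3 :=
  WithLp.toLp 2 fun k => (1 / 2 : ℝ) * ∑ l, (𝒮.metricMatrix x₀ y)⁻¹ k l *
    (fderiv ℝ (fun y' => 𝒮.metricInChart x₀ y' v (b3 l)) y u
      + fderiv ℝ (fun y' => 𝒮.metricInChart x₀ y' u (b3 l)) y v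
      - fderiv ℝ (fun y' => 𝒮.metricInChart x₀ y' u v) y (b3 l))

/-- The Riemann curvature tensor `R(u,v)w`, where `R(U,V) = D_U D_V - D_V D_U - D_{[U,V]}`, computed
in the preferred chart at `x`. -/
def curvature (x : M) (u v w : TangentSpace 𝓘(ℝ, E3) x) : TangentSpace 𝓘(ℝ, E3) x :=
  let y : E3 := extChartAt 𝓘(ℝ, E3) x x
  let Γ : E3 → E3 → E3 → E3 := 𝒮.christoffel x
  (fderiv ℝ (fun y' => Γ y' v w) y u - fderiv ℝ (fun y' => Γ y' u w) y v
    + Γ y u (Γ y v w) - Γ y v (Γ y u w) : E3)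

/-- The sectional curvature in `(M, g)` of the plane spanned by `u` and `v`. -/
def sectionalCurvature (x : M) (u v : TangentSpace 𝓘(ℝ, E3) x) : ℝ :=
  𝒮.g.inner x (𝒮.curvature x u v v) u /
    (𝒮.g.inner x u u * 𝒮.g.inner x v v - 𝒮.g.inner x u v ^ 2)

/-- The Webster scalar curvature `K = (K_h + 3) / 4` at `x`, where `K_h` is the sectional curvature
in `(M, g)` of the horizontal plane.  That plane is entered through a basis `u, J u`, for a nonzero
horizontal vector `u`, on which the value does not depend. -/
def webster (x : M) (u : TangentSpace 𝓘(ℝ, E3) x) : ℝ :=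
  (1 / 4 : ℝ) * (𝒮.sectionalCurvature x u (𝒮.J x u) + 3)

end SasakianStructure

/-! ### Oriented immersed surfaces -/

/-- The atlas of the surface `S` is oriented: the changes of coordinates have positive Jacobian. -/
class OrientedAtlas (S : Type*) [TopologicalSpace S] [ChartedSpace E2 S] : Prop where
  det_pos : ∀ e ∈ atlas E2 S, ∀ e' ∈ atlas E2 S, ∀ y ∈ (e.symm.trans e').source,
    0 < (fderiv ℝ (e.symm.trans e') y).det

variable {S : Type*} [TopologicalSpace S] [ChartedSpace E2 S]

/-- The differential at `p` of a map `φ` from the surface into `M`. -/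
abbrev dmap (φ : S → M) (p : S) :
    TangentSpace 𝓘(ℝ, E2) p →L[ℝ] TangentSpace 𝓘(ℝ, E3) (φ p) :=
  mfderiv 𝓘(ℝ, E2) 𝓘(ℝ, E3) φ p

/-- `∂_i φ` at `p`, in the preferred chart at `p`, which is positively oriented when the atlas
is oriented. -/
def tangentFrame (φ : S → M) (i : Fin 2) (p : S) : TangentSpace 𝓘(ℝ, E3) (φ p) :=
  dmap φ p (b2 i)

/-- The tangent vector of the immersed surface that `dφ` sends to `w`. -/
def lift (φ : S → M) (p : S) (w : TangentSpace 𝓘(ℝ, E3) (φ p)) : TangentSpace 𝓘(ℝ, E2) p :=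
  haveI : Nonempty (TangentSpace 𝓘(ℝ, E2) p) := ⟨0⟩
  Function.invFun (dmap φ p) w

namespace SasakianStructure

variable (𝒮 : SasakianStructure M) (φ : S → M)

/-- The singular set: the points where the tangent plane is the horizontal plane. -/
def singularSet : Set S :=
  {p | LinearMap.range (dmap φ p).toLinearMap = LinearMap.ker (𝒮.η (φ p)).toLinearMap}

/-- The regular set. -/
def regularSet : Set S := (𝒮.singularSet φ)ᶜ

/-- The covariant derivative `D_v W` at `p` of a vector field `W` along `φ`, for the Levi-Civita
connection of `(M, g)`, computed in the preferred chart at `φ p`. -/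
def covDeriv (W : ∀ q : S, TangentSpace 𝓘(ℝ, E3) (φ q)) (p : S) (v : TangentSpace 𝓘(ℝ, E2) p) :
    TangentSpace 𝓘(ℝ, E3) (φ p) :=
  let e := extChartAt 𝓘(ℝ, E3) (φ p)
  let W' : S → E3 := fun q => mfderiv 𝓘(ℝ, E3) 𝓘(ℝ, E3) e (φ q) (W q)
  (mvfderiv 𝓘(ℝ, E2) W' p v + 𝒮.christoffel (φ p) (e (φ p)) (dmap φ p v) (W p) : E3)

/-- The unit normal compatible with the orientations of the surface and of `M`. -/
def normal (p : S) : TangentSpace 𝓘(ℝ, E3) (φ p) :=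
  let n := 𝒮.cross (φ p) (tangentFrame φ 0 p) (tangentFrame φ 1 p)
  (𝒮.len (φ p) n)⁻¹ • n

/-- The function `⟨N, T⟩`. -/
def normalT (p : S) : ℝ := 𝒮.g.inner (φ p) (𝒮.normal φ p) (𝒮.T (φ p))

/-- The horizontal projection `N_h` of the unit normal. -/
def normalH (p : S) : TangentSpace 𝓘(ℝ, E3) (φ p) :=
  𝒮.normal φ p - 𝒮.normalT φ p • 𝒮.T (φ p)

/-- The function `|N_h|`. -/
def absNormalH (p : S) : ℝ := 𝒮.len (φ p) (𝒮.normalH φ p)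

/-- The horizontal Gauss map `ν_h = N_h / |N_h|`. -/
def nuH (p : S) : TangentSpace 𝓘(ℝ, E3) (φ p) := (𝒮.absNormalH φ p)⁻¹ • 𝒮.normalH φ p

/-- The characteristic field `Z = J ν_h`, as a field along `φ`. -/
def Z (p : S) : TangentSpace 𝓘(ℝ, E3) (φ p) := 𝒮.J (φ p) (𝒮.nuH φ p)

/-- The field `S = ⟨N, T⟩ ν_h - |N_h| T`. -/
def sField (p : S) : TangentSpace 𝓘(ℝ, E3) (φ p) :=
  𝒮.normalT φ p • 𝒮.nuH φ p - 𝒮.absNormalH φ p • 𝒮.T (φ p)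

/-- The derivative `Z(u)` of a function on the surface. -/
def Zderiv (u : S → ℝ) (p : S) : ℝ := mvfderiv 𝓘(ℝ, E2) u p (lift φ p (𝒮.Z φ p))

/-- `B(Z)`, where `B(U) = - D_U N` is the shape operator in `(M, g)`. -/
def shapeZ (p : S) : TangentSpace 𝓘(ℝ, E3) (φ p) :=
  -𝒮.covDeriv φ (𝒮.normal φ) p (lift φ p (𝒮.Z φ p))

/-- The sub-Riemannian mean curvature: `-2H = ⟨D_Z ν_h, Z⟩ + ⟨D_S ν_h, S⟩`. -/
def meanCurvature (p : S) : ℝ :=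
  -(1 / 2 : ℝ) *
    (𝒮.g.inner (φ p) (𝒮.covDeriv φ (𝒮.nuH φ) p (lift φ p (𝒮.Z φ p))) (𝒮.Z φ p)
      + 𝒮.g.inner (φ p) (𝒮.covDeriv φ (𝒮.nuH φ) p (lift φ p (𝒮.sField φ p))) (𝒮.sField φ p))

/-- The potential `|B(Z) + S|² + 4 (K - 1) |N_h|²`. -/
def potential (p : S) : ℝ :=
  𝒮.len (φ p) (𝒮.shapeZ φ p + 𝒮.sField φ p) ^ 2
    + 4 * (𝒮.webster (φ p) (𝒮.Z φ p) - 1) * 𝒮.absNormalH φ p ^ 2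

/-- The sub-Riemannian Jacobi operator. -/
def jacobi (ψ : S → ℝ) (p : S) : ℝ :=
  (𝒮.absNormalH φ p)⁻¹ *
    (𝒮.Zderiv φ (𝒮.Zderiv φ ψ) p
      + 2 * (𝒮.absNormalH φ p)⁻¹ * 𝒮.normalT φ p
          * 𝒮.g.inner (φ p) (𝒮.shapeZ φ p) (𝒮.sField φ p) * 𝒮.Zderiv φ ψ p
      + 𝒮.potential φ p * ψ p)

/-! ### Area, volume, index form -/

/-- The area density `√det(⟨∂_i φ, ∂_j φ⟩)` of `φ` in the preferred chart at `p₀`, at the point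
with coordinates `y`. -/
def areaDensity (p₀ : S) (y : E2) : ℝ :=
  let e := extChartAt 𝓘(ℝ, E2) p₀
  let a : Fin 2 → TangentSpace 𝓘(ℝ, E3) (φ (e.symm y)) := fun i =>
    mfderiv 𝓘(ℝ, E2) 𝓘(ℝ, E3) (φ ∘ e.symm) y (b2 i)
  √((Matrix.of fun i j => 𝒮.g.inner (φ (e.symm y)) (a i) (a j)).det)

/-- The Riemannian area measure `da` of the immersion `φ` into `(M, g)`.  On the domain of each
preferred chart it is the Lebesgue measure of the coordinates weighted by the area density; these
measures agree on overlaps, and `da` is their supremum. -/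
def areaMeasure [MeasurableSpace S] : Measure S :=
  ⨆ p₀ : S, Measure.map (extChartAt 𝓘(ℝ, E2) p₀).symm
    ((volume.restrict (extChartAt 𝓘(ℝ, E2) p₀).target).withDensity
      fun y => ENNReal.ofReal (𝒮.areaDensity φ p₀ y))

/-- The integrand `|N_h|⁻¹ (Z(u) Z(v) - (|B(Z) + S|² + 4 (K - 1) |N_h|²) u v)`. -/
def indexIntegrand (u v : S → ℝ) (p : S) : ℝ :=
  (𝒮.absNormalH φ p)⁻¹ *
    (𝒮.Zderiv φ u p * 𝒮.Zderiv φ v p - 𝒮.potential φ p * u p * v p)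

/-- The sub-Riemannian index form. -/
def indexForm [MeasurableSpace S] (u v : S → ℝ) : ℝ :=
  ∫ p in 𝒮.regularSet φ, 𝒮.indexIntegrand φ u v p ∂(𝒮.areaMeasure φ)

/-- The functions of class `C¹` with compact support in the regular set (extended by zero). -/
structure IsTestFunction (w : S → ℝ) : Prop where
  contMDiff : ContMDiff 𝓘(ℝ, E2) 𝓘(ℝ, ℝ) 1 w
  hasCompactSupport : HasCompactSupport w
  tsupport_subset : tsupport w ⊆ 𝒮.regularSet φ

/-! ### Variations and stability of the regular set -/

/-- A variation `Φ : I × S → M` of the regular set of `φ`, of class `C³` there: `Φ 0 = φ`, every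
`Φ s` is an immersion, and `Φ s = φ` off a compact subset `A` of the regular set. -/
structure IsVariation (I : Set ℝ) (A : Set S) (Φ : ℝ → S → M) : Prop where
  isOpen : IsOpen I
  ordConnected : I.OrdConnected
  zero_mem : (0 : ℝ) ∈ I
  isCompact : IsCompact A
  subset : A ⊆ 𝒮.regularSet φ
  contMDiffOn : ContMDiffOn (𝓘(ℝ, ℝ).prod 𝓘(ℝ, E2)) 𝓘(ℝ, E3) 3
    (fun q : ℝ × S => Φ q.1 q.2) (I ×ˢ 𝒮.regularSet φ)
  zero_eq : ∀ p, Φ 0 p = φ p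
  immersion : ∀ s ∈ I, ∀ p, Function.Injective (dmap (Φ s) p)
  eq_off : ∀ s ∈ I, ∀ p ∉ A, Φ s p = φ p

/-- `∂Φ/∂s` at `(s, p)`. -/
def velocity (Φ : ℝ → S → M) (s : ℝ) (p : S) : TangentSpace 𝓘(ℝ, E3) (Φ s p) :=
  mfderiv 𝓘(ℝ, ℝ) 𝓘(ℝ, E3) (fun t => Φ t p) s (1 : ℝ)

/-- The sub-Riemannian area `∫_A |N_h| da` of the immersed surface `Φ s`, over `A`. -/
def areaFunctional [MeasurableSpace S] (A : Set S) (Φ : ℝ → S → M) (s : ℝ) : ℝ :=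
  ∫ p in A, 𝒮.absNormalH (Φ s) p ∂(𝒮.areaMeasure (Φ s))

/-- The signed volume `∫_{[0,s] × A} Φ^*(dv)`.  On `I × S` one has `Φ^*(dv) = f dt ∧ da_t`, where
`f` is the quotient of the volume form and the area form of `Φ t` on `(∂_t, ∂_1, ∂_2)`. -/
def volumeFunctional [MeasurableSpace S] (A : Set S) (Φ : ℝ → S → M) (s : ℝ) : ℝ :=
  ∫ t in (0 : ℝ)..s, ∫ p in A,
    𝒮.volForm (Φ t p) (velocity Φ t p) (tangentFrame (Φ t) 0 p) (tangentFrame (Φ t) 1 p)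
      / 𝒮.len (Φ t p) (𝒮.cross (Φ t p) (tangentFrame (Φ t) 0 p) (tangentFrame (Φ t) 1 p))
    ∂(𝒮.areaMeasure (Φ t))

/-- The functional `area + 2 H volume`. -/
def areaVolume [MeasurableSpace S] (H : ℝ) (A : Set S) (Φ : ℝ → S → M) (s : ℝ) : ℝ :=
  𝒮.areaFunctional A Φ s + 2 * H * 𝒮.volumeFunctional A Φ s

/-- The regular set is area-stationary under a volume constraint. -/
def IsVolumePreservingAreaStationary [MeasurableSpace S] : Prop :=
  ∀ (I : Set ℝ) (A : Set S) (Φ : ℝ → S → M), 𝒮.IsVariation φ I A Φ →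
    (∀ᶠ s in 𝓝 (0 : ℝ), 𝒮.volumeFunctional A Φ s = 𝒮.volumeFunctional A Φ 0) →
    HasDerivAt (𝒮.areaFunctional A Φ) 0 0

/-- The regular set, of constant mean curvature `H`, is strongly stable: it is area-stationary under
a volume constraint and, for each variation, `A + 2HV` is twice continuously differentiable near
`0`, with `(A + 2HV)'(0) = 0` and `(A + 2HV)''(0) ≥ 0`. -/
def StronglyStable [MeasurableSpace S] (H : ℝ) : Prop :=
  𝒮.IsVolumePreservingAreaStationary φ ∧
  ∀ (I : Set ℝ) (A : Set S) (Φ : ℝ → S → M), 𝒮.IsVariation φ I A Φ →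
    ContDiffAt ℝ 2 (𝒮.areaVolume H A Φ) 0 ∧ deriv (𝒮.areaVolume H A Φ) 0 = 0 ∧
      0 ≤ iteratedDeriv 2 (𝒮.areaVolume H A Φ) 0

/-- The regular set is strictly stable: it is strongly stable, and `(A + 2HV)''(0) = 0` exactly when
the velocity of the variation is tangent to the surface. -/
def StrictlyStable [MeasurableSpace S] (H : ℝ) : Prop :=
  𝒮.StronglyStable φ H ∧
  ∀ (I : Set ℝ) (A : Set S) (Φ : ℝ → S → M), 𝒮.IsVariation φ I A Φ →
    (iteratedDeriv 2 (𝒮.areaVolume H A Φ) 0 = 0 ↔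
      ∀ p ∈ 𝒮.regularSet φ, ∃ v : TangentSpace 𝓘(ℝ, E2) p,
        mfderiv 𝓘(ℝ, E2) 𝓘(ℝ, E3) (Φ 0) p v = velocity Φ 0 p)

end SasakianStructure

end SubRiem

end

/-!
The proof computes in an adapted frame.  Off the singular set, the horizontal Gauss map `ν_h`, the
characteristic field `Z = J(ν_h)` and the Reeb field `T` are an orthonormal frame along each slice of a
variation.  Let `β`, `α`, `η` be the pulled back dual forms and `ω` the connection form of the frame for
the Tanaka-Webster connection.  In a Sasakian manifold they satisfy

  `dα = -ω ∧ β`,  `dβ = ω ∧ α`,  `dη = 2 β ∧ α`,  `dω = -4K β ∧ α`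

(`IsAdaptedFrame.d_form_Z`, `d_form_ν`, `d_form_T`, `d_conn`).  On a slice `β = m η` with
`m = -⟨N, T⟩ / |N_h|`, the form `α ∧ η` is the area element `|N_h| da`, and `ω ∧ η = -2H α ∧ η`.

These equations carry all the curvature that is needed.  By the structure equations, the derivative of
`α ∧ η` in the parameter is `f ω ∧ η` plus an exact form, where `f` is the velocity along `N` divided by
`|N_h|`.  As the derivative of `V` has the integrand `f α ∧ η`, the first derivative of the integrand of
`A + 2HV` is exact where the mean curvature is `H`, and the second one is, up to an exact form, `f` times
the derivative of `ω ∧ η + 2H α ∧ η`.  The equation for `dω` expresses that derivative by `Z(Z(f))`, `Z(f)`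
and `f`, and contains the Codazzi equation for `Z(Z(m))` (`IsVariationCoframe.codazzi_and_variation`).  With
`u = |N_h| f = ⟨∂φ/∂s, N⟩` the result is the integrand of `Q(u, u)`, up to the exact form
`-d(|N_h|⁻² u Z(u) η)` (`IsVariationCoframe.variation_eq`).  Hence `(A + 2HV)'(0) = 0` and
`(A + 2HV)''(0) = Q(u, u)` (`IsVariation.deriv_areaVolume`, `IsVariation.iteratedDeriv_areaVolume`), and `u`
vanishes exactly when the velocity is tangent to the surface.

For a test function `w` and the given function `ψ`, the integrand of `Q(w, w)` is

  `|N_h|⁻¹ (Z(w) - w Z(ψ) / ψ)² - w² ψ⁻² ψ L(ψ)`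

up to the exact form `d(w² |N_h|⁻² ψ⁻¹ Z(ψ) η)` (`IsVariationCoframe.positivity_eq`), so that a sign of
`ψ L(ψ)` gives a sign of `Q(w, w)` (`IsCMCSlice.indexForm_nonneg`, `IsCMCSlice.indexForm_pos`).

Exact forms are removed by the divergence theorem for forms with compact support
(`IsCurl.integral_eq_zero`).  The identities are proved in charts of the surface and of `M`; the metric, the
connection and the curvature are transported between the charts of `M` by the uniqueness of the
Levi-Civita connection (`IsSasakianChart.cov_fderiv_transition`).
-/

open Bundle Manifold MeasureTheory Set Filter
open scoped Manifold ContDiff Topology ENNReal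
noncomputable section
set_option maxSynthPendingDepth 3
namespace SubRiem

/-! ### Calculus along maps into a chart -/

/-- The expression in coordinates of a Sasakian structure on the open set `O` of the model space: the
metric `G`, its Levi-Civita connection, given by the Christoffel symbols `Γ`, the Reeb field `T` and
the rotation `J`.  The contact form is `G y (T y)`. -/
structure IsSasakianChart {E : Type*} [NormedAddCommGroup E] [NormedSpace ℝ E]
    (G : E → E →L[ℝ] E →L[ℝ] ℝ) (Γ : E → E →L[ℝ] E →L[ℝ] E)
    (T : E → E) (J : E → E →L[ℝ] E) (O : Set E) : Prop where
  isOpen : IsOpen O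
  contDiffOn_G : ContDiffOn ℝ ∞ G O
  contDiffOn_Γ : ContDiffOn ℝ ∞ Γ O
  contDiffOn_T : ContDiffOn ℝ ∞ T O
  contDiffOn_J : ContDiffOn ℝ ∞ J O
  G_symm : ∀ y ∈ O, ∀ u v, G y u v = G y v u
  G_pos : ∀ y ∈ O, ∀ u, u ≠ 0 → 0 < G y u u
  Γ_symm : ∀ y ∈ O, ∀ u v, Γ y u v = Γ y v u
  compat : ∀ y ∈ O, ∀ a b u,
    fderiv ℝ (fun y => G y a b) y u = G y (Γ y u a) b + G y a (Γ y u b)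
  T_unit : ∀ y ∈ O, G y (T y) (T y) = 1
  J_J : ∀ y ∈ O, ∀ u, J y (J y u) = -u + G y (T y) u • T y
  J_skew : ∀ y ∈ O, ∀ u v, G y (J y u) v = -G y u (J y v)
  cov_T : ∀ y ∈ O, ∀ u, fderiv ℝ T y u + Γ y u (T y) = J y u

/-- The covariant derivative `D_v A` at `q` of a field `A` along the map `F`. -/
def cov {E D : Type*} [NormedAddCommGroup E] [NormedSpace ℝ E] [NormedAddCommGroup D] [NormedSpace ℝ D]
    (Γ : E → E →L[ℝ] E →L[ℝ] E) (F : D → E) (A : D → E) (v : D) (q : D) : E :=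
  fderiv ℝ A q v + Γ (F q) (fderiv ℝ F q v) (A q)

/-- The Riemann curvature `R(u,v)w` of the connection with Christoffel symbols `Γ`. -/
def riem {E : Type*} [NormedAddCommGroup E] [NormedSpace ℝ E] (Γ : E → E →L[ℝ] E →L[ℝ] E) (y u v w : E) : E :=
  fderiv ℝ Γ y u v w - fderiv ℝ Γ y v u w + Γ y u (Γ y v w) - Γ y v (Γ y u w)

/-- The product rule for a field of bilinear maps applied to two fields along a map. -/
theorem fderiv_bilin_apply {E D V : Type*} [NormedAddCommGroup E] [NormedSpace ℝ E]
    [NormedAddCommGroup D] [NormedSpace ℝ D] [NormedAddCommGroup V] [NormedSpace ℝ V]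
    {H : E → E →L[ℝ] E →L[ℝ] V} {F A B : D → E} {q : D} (hH : DifferentiableAt ℝ H (F q))
    (hF : DifferentiableAt ℝ F q) (hA : DifferentiableAt ℝ A q) (hB : DifferentiableAt ℝ B q) :
    DifferentiableAt ℝ (fun q => H (F q) (A q) (B q)) q ∧
    ∀ v, fderiv ℝ (fun q => H (F q) (A q) (B q)) q v
      = fderiv ℝ H (F q) (fderiv ℝ F q v) (A q) (B q) + H (F q) (fderiv ℝ A q v) (B q)
        + H (F q) (A q) (fderiv ℝ B q v) := by
  have h1 : HasFDerivAt (fun q => H (F q)) ((fderiv ℝ H (F q)).comp (fderiv ℝ F q)) q :=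
    hH.hasFDerivAt.comp q hF.hasFDerivAt
  have h2 := (h1.clm_apply hA.hasFDerivAt).clm_apply hB.hasFDerivAt
  refine ⟨h2.differentiableAt, fun v => ?_⟩
  rw [h2.fderiv]
  simp only [_root_.add_apply, ContinuousLinearMap.comp_apply, ContinuousLinearMap.flip_apply]
  abel

namespace IsSasakianChart

variable {E : Type*} [NormedAddCommGroup E] [NormedSpace ℝ E]
  {G : E → E →L[ℝ] E →L[ℝ] ℝ} {Γ : E → E →L[ℝ] E →L[ℝ] E} {T : E → E}
  {J : E → E →L[ℝ] E} {O : Set E}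
variable {D : Type*} [NormedAddCommGroup D] [NormedSpace ℝ D]

section along

variable (h : IsSasakianChart G Γ T J O) {F A B : D → E} {q : D}
include h

theorem contDiffAt_G {y : E} (hy : y ∈ O) : ContDiffAt ℝ ∞ G y :=
  h.contDiffOn_G.contDiffAt (h.isOpen.mem_nhds hy)

theorem contDiffAt_Γ {y : E} (hy : y ∈ O) : ContDiffAt ℝ ∞ Γ y :=
  h.contDiffOn_Γ.contDiffAt (h.isOpen.mem_nhds hy)

theorem contDiffAt_T {y : E} (hy : y ∈ O) : ContDiffAt ℝ ∞ T y :=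
  h.contDiffOn_T.contDiffAt (h.isOpen.mem_nhds hy)

theorem contDiffAt_J {y : E} (hy : y ∈ O) : ContDiffAt ℝ ∞ J y :=
  h.contDiffOn_J.contDiffAt (h.isOpen.mem_nhds hy)

theorem differentiableAt_G {y : E} (hy : y ∈ O) : DifferentiableAt ℝ G y :=
  (h.contDiffAt_G hy).differentiableAt (by simp)

theorem differentiableAt_Γ {y : E} (hy : y ∈ O) : DifferentiableAt ℝ Γ y :=
  (h.contDiffAt_Γ hy).differentiableAt (by simp)

theorem differentiableAt_T {y : E} (hy : y ∈ O) : DifferentiableAt ℝ T y :=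
  (h.contDiffAt_T hy).differentiableAt (by simp)

theorem differentiableAt_J {y : E} (hy : y ∈ O) : DifferentiableAt ℝ J y :=
  (h.contDiffAt_J hy).differentiableAt (by simp)

theorem J_T {y : E} (hy : y ∈ O) : J y (T y) = 0 := by
  by_contra hne
  have h1 := h.G_pos y hy _ hne
  have h2 : J y (J y (T y)) = 0 := by rw [h.J_J y hy, h.T_unit y hy]; simp
  rw [h.J_skew y hy, h2] at h1
  simp at h1

theorem G_T_J {y : E} (hy : y ∈ O) (u : E) : G y (T y) (J y u) = 0 := by
  have := h.J_skew y hy (T y) u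
  rw [h.J_T hy] at this
  simp at this
  linarith

theorem G_J_J {y : E} (hy : y ∈ O) (u v : E) :
    G y (J y u) (J y v) = G y u v - G y (T y) u * G y (T y) v := by
  rw [h.J_skew y hy, h.J_J y hy]
  simp [h.G_symm y hy u (T y)]
  ring

theorem fderiv_G {y : E} (hy : y ∈ O) (u a b : E) :
    fderiv ℝ G y u a b = G y (Γ y u a) b + G y a (Γ y u b) := by
  rw [← h.compat y hy a b u]
  have e := (fderiv_bilin_apply (F := id) (A := fun _ => a) (B := fun _ => b)
    (h.differentiableAt_G hy) differentiableAt_id (differentiableAt_const a)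
    (differentiableAt_const b)).2 u
  simpa using e.symm

/-- The Levi-Civita connection is metric. -/
theorem fderiv_inner (hF : DifferentiableAt ℝ F q) (hq : F q ∈ O) (hA : DifferentiableAt ℝ A q)
    (hB : DifferentiableAt ℝ B q) (v : D) :
    fderiv ℝ (fun q => G (F q) (A q) (B q)) q v
      = G (F q) (cov Γ F A v q) (B q) + G (F q) (A q) (cov Γ F B v q) := by
  rw [(fderiv_bilin_apply (h.differentiableAt_G hq) hF hA hB).2 v, h.fderiv_G hq]
  simp only [cov, map_add, _root_.add_apply]
  ring

omit h in
theorem fderiv_fderiv_comm (hF : ContDiffAt ℝ 2 F q) (u v : D) :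
    fderiv ℝ (fun q => fderiv ℝ F q v) q u = fderiv ℝ (fun q => fderiv ℝ F q u) q v := by
  have hd : DifferentiableAt ℝ (fderiv ℝ F) q :=
    (hF.fderiv_right (m := 1) (by norm_num)).differentiableAt (by simp)
  have e : ∀ w, fderiv ℝ (fun q => fderiv ℝ F q w) q = (fderiv ℝ (fderiv ℝ F) q).flip w := by
    intro w
    have := (hd.hasFDerivAt.clm_apply (hasFDerivAt_const w q)).fderiv
    rw [this]; ext; simp
  rw [e, e]
  have := (hF.isSymmSndFDerivAt (by simp)).eq u v
  simpa using this

omit h in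
theorem differentiableAt_fderiv_apply (hF : ContDiffAt ℝ 2 F q) (v : D) :
    DifferentiableAt ℝ (fun q => fderiv ℝ F q v) q :=
  ((hF.fderiv_right (m := 1) (by norm_num)).differentiableAt (by simp)).clm_apply
    (differentiableAt_const v)

/-- The Levi-Civita connection is torsion free. -/
theorem cov_fderiv_comm (hF : ContDiffAt ℝ 2 F q) (hq : F q ∈ O) (u v : D) :
    cov Γ F (fun q => fderiv ℝ F q v) u q = cov Γ F (fun q => fderiv ℝ F q u) v q := by
  simp only [cov]
  rw [fderiv_fderiv_comm hF u v, h.Γ_symm _ hq]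

theorem cov_reeb (hF : DifferentiableAt ℝ F q) (hq : F q ∈ O) (v : D) :
    cov Γ F (fun q => T (F q)) v q = J (F q) (fderiv ℝ F q v) := by
  have h1 := (((h.differentiableAt_T hq).hasFDerivAt).comp q hF.hasFDerivAt).fderiv
  have h3 : fderiv ℝ (fun q => T (F q)) q = _ := h1
  rw [← h.cov_T _ hq, cov, h3]
  simp

/-- The curvature is the commutator of covariant derivatives. -/
theorem cov_cov_sub (hF : ContDiffAt ℝ 2 F q) (hq : F q ∈ O) (hA : ContDiffAt ℝ 2 A q) (u v : D) :
    cov Γ F (cov Γ F A v) u q - cov Γ F (cov Γ F A u) v q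
      = riem Γ (F q) (fderiv ℝ F q u) (fderiv ℝ F q v) (A q) := by
  have hF1 : DifferentiableAt ℝ F q := hF.differentiableAt (by simp)
  have hA1 : DifferentiableAt ℝ A q := hA.differentiableAt (by simp)
  have e : ∀ u v : D, fderiv ℝ (cov Γ F A v) q u
      = fderiv ℝ (fun q => fderiv ℝ A q v) q u
        + (fderiv ℝ Γ (F q) (fderiv ℝ F q u) (fderiv ℝ F q v) (A q)
          + Γ (F q) (fderiv ℝ (fun q => fderiv ℝ F q v) q u) (A q)
          + Γ (F q) (fderiv ℝ F q v) (fderiv ℝ A q u)) := by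
    intro u v
    have h2 := differentiableAt_fderiv_apply hF v
    have h3 := differentiableAt_fderiv_apply hA v
    have h4 := fderiv_bilin_apply (h.differentiableAt_Γ hq) hF1 h2 hA1
    have h5 : fderiv ℝ (cov Γ F A v) q = _ := fderiv_fun_add h3 h4.1
    rw [h5, _root_.add_apply, h4.2 u]
  simp only [cov] at e ⊢
  rw [e u v, e v u, fderiv_fderiv_comm hF u v, fderiv_fderiv_comm hA u v]
  simp only [riem, map_add]
  abel

end along

/-! ### Curvature identities -/

section curvature

variable (h : IsSasakianChart G Γ T J O) {y : E} (hy : y ∈ O)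
include h hy

omit h hy in
theorem riem_swap (u v w : E) : riem Γ y u v w = -riem Γ y v u w := by
  simp only [riem]; abel

omit h hy in
@[simp] theorem riem_add_left (u u' v w : E) :
    riem Γ y (u + u') v w = riem Γ y u v w + riem Γ y u' v w := by
  simp only [riem, ContinuousLinearMap.map_add, _root_.add_apply]; abel

omit h hy in
@[simp] theorem riem_smul_left (c : ℝ) (u v w : E) :
    riem Γ y (c • u) v w = c • riem Γ y u v w := by
  simp only [riem, ContinuousLinearMap.map_smul, _root_.smul_apply, smul_sub, smul_add]

omit h hy in
@[simp] theorem riem_add_mid (u v v' w : E) :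
    riem Γ y u (v + v') w = riem Γ y u v w + riem Γ y u v' w := by
  simp only [riem, ContinuousLinearMap.map_add, _root_.add_apply]; abel

omit h hy in
@[simp] theorem riem_smul_mid (c : ℝ) (u v w : E) :
    riem Γ y u (c • v) w = c • riem Γ y u v w := by
  simp only [riem, ContinuousLinearMap.map_smul, _root_.smul_apply, smul_sub, smul_add]

theorem fderiv_Γ_symm (u v w : E) : fderiv ℝ Γ y u v w = fderiv ℝ Γ y u w v := by
  have e : ∀ v w, fderiv ℝ (fun y => Γ y v w) y u = fderiv ℝ Γ y u v w := by
    intro v w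
    simpa using (fderiv_bilin_apply (F := id) (A := fun _ => v) (B := fun _ => w)
      (h.differentiableAt_Γ hy) differentiableAt_id (differentiableAt_const v)
      (differentiableAt_const w)).2 u
  rw [← e, ← e]
  congr 1
  apply Filter.EventuallyEq.fderiv_eq
  filter_upwards [h.isOpen.mem_nhds hy] with z hz using h.Γ_symm z hz v w

/-- The first Bianchi identity. -/
theorem riem_bianchi (u v w : E) : riem Γ y u v w + riem Γ y v w u + riem Γ y w u v = 0 := by
  simp only [riem]
  rw [h.fderiv_Γ_symm hy u v w, h.fderiv_Γ_symm hy v w u, h.fderiv_Γ_symm hy w u v,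
    h.Γ_symm y hy v w, h.Γ_symm y hy u w, h.Γ_symm y hy u v]
  abel

omit h hy in
theorem cov_id_const (a v : E) : cov Γ id (fun _ : E => a) v = fun y => Γ y v a := by
  funext y; simp [cov]

theorem differentiableAt_Γ_apply (a b : E) : DifferentiableAt ℝ (fun y => Γ y a b) y :=
  ((h.differentiableAt_Γ hy).clm_apply (differentiableAt_const a)).clm_apply
    (differentiableAt_const b)

/-- The curvature operators are skew-symmetric, because second derivatives of `G` commute. -/
theorem riem_skew (u v a b : E) : G y (riem Γ y u v a) b = -G y a (riem Γ y u v b) := by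
  have hid : ContDiffAt ℝ 2 (id : E → E) y := contDiffAt_id
  have hid' : DifferentiableAt ℝ (id : E → E) y := differentiableAt_id
  have hR : ∀ u v a, cov Γ id (fun y => Γ y v a) u y - cov Γ id (fun y => Γ y u a) v y
      = riem Γ y u v a := by
    intro u v a
    have := h.cov_cov_sub (A := fun _ => a) hid hy contDiffAt_const u v
    rw [cov_id_const, cov_id_const] at this
    simpa using this
  -- the second derivatives of `G(a, b)` along constant fields commute
  have h2 : ContDiffAt ℝ 2 (fun y => G y a b) y :=
    (((h.contDiffAt_G hy).clm_apply contDiffAt_const).clm_apply contDiffAt_const).of_le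
      (by norm_cast)
  have hd : DifferentiableAt ℝ (fderiv ℝ (fun y => G y a b)) y :=
    (h2.fderiv_right (m := 1) (by norm_num)).differentiableAt (by simp)
  have e : ∀ u v, fderiv ℝ (fderiv ℝ (fun y => G y a b)) y u v
      = G y (cov Γ id (fun y => Γ y v a) u y) b + G y (Γ y v a) (Γ y u b)
        + (G y (Γ y u a) (Γ y v b) + G y a (cov Γ id (fun y => Γ y v b) u y)) := by
    intro u v
    have e1 : fderiv ℝ (fderiv ℝ (fun y => G y a b)) y u v
        = fderiv ℝ (fun z => fderiv ℝ (fun y => G y a b) z v) y u := by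
      rw [(hd.hasFDerivAt.clm_apply (hasFDerivAt_const v y)).fderiv]; simp
    have e2 : (fun z => fderiv ℝ (fun y => G y a b) z v)
        =ᶠ[𝓝 y] fun z => G (id z) (Γ z v a) b + G (id z) a (Γ z v b) := by
      filter_upwards [h.isOpen.mem_nhds hy] with z hz using h.compat z hz a b v
    have k1 : DifferentiableAt ℝ (fun z => G (id z) (Γ z v a) b) y :=
      ((h.differentiableAt_G hy).clm_apply (h.differentiableAt_Γ_apply hy v a)).clm_apply
        (differentiableAt_const b)
    have k2 : DifferentiableAt ℝ (fun z => G (id z) a (Γ z v b)) y :=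
      ((h.differentiableAt_G hy).clm_apply (differentiableAt_const a)).clm_apply
        (h.differentiableAt_Γ_apply hy v b)
    rw [e1, e2.fderiv_eq, fderiv_fun_add k1 k2, _root_.add_apply,
      h.fderiv_inner hid' hy (h.differentiableAt_Γ_apply hy v a) (differentiableAt_const b) u,
      h.fderiv_inner hid' hy (differentiableAt_const a) (h.differentiableAt_Γ_apply hy v b) u,
      cov_id_const, cov_id_const]
    simp only [id]
  have hs := (h2.isSymmSndFDerivAt (by simp)).eq u v
  rw [e, e] at hs
  rw [← hR u v a, ← hR u v b]
  simp only [map_sub, _root_.sub_apply]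
  linarith

/-- The pair symmetry of the curvature: a combination of the first Bianchi identities for the four
triples of the vectors `a`, `b`, `c`, `d` and of the skew symmetries. -/
theorem riem_pair_symm (a b c d : E) :
    G y (riem Γ y a b c) d = G y (riem Γ y c d a) b := by
  have B : ∀ u v w z, G y (riem Γ y u v w) z + G y (riem Γ y v w u) z + G y (riem Γ y w u v) z = 0 := by
    intro u v w z
    have := congrArg (fun x => G y x z) (h.riem_bianchi hy u v w)
    simpa using this
  have S : ∀ u v w z, G y (riem Γ y u v w) z = -G y (riem Γ y u v z) w := by
    intro u v w z
    rw [h.riem_skew hy, h.G_symm y hy]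
  have A : ∀ u v w z, G y (riem Γ y u v w) z = -G y (riem Γ y v u w) z := by
    intro u v w z
    rw [riem_swap]; simp
  have b1 := B a b c d
  have b2 := B b c d a
  have b3 := B c d a b
  have b4 := B d a b c
  have s1 := S b c a d
  have s2 := S c a b d
  have s3 := S a b c d
  have s4 := S c d b a
  have s5 := S d b c a
  have s6 := S d a c b
  have s7 := S a c d b
  have s8 := S b d a c
  have a1 := A c a d b
  have a2 := A d b a c
  have a3 := A c a b d
  have a4 := A b c a d
  have a5 := A d a c b
  have s9 := S d a b c
  have s10 := S b c d a
  have s11 := S a b d c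
  linarith

end curvature
end IsSasakianChart
end SubRiem

namespace SubRiem

/-- In dimension three, three vectors and three functionals dual to them are a basis and its dual
basis. -/
theorem eq_of_dual_three {E : Type*} [AddCommGroup E] [Module ℝ E]
    (hE : Module.finrank ℝ E = 3) (a b c : E →ₗ[ℝ] ℝ) {x y z : E}
    (hax : a x = 1) (hay : a y = 0) (haz : a z = 0) (hbx : b x = 0) (hby : b y = 1) (hbz : b z = 0)
    (hcx : c x = 0) (hcy : c y = 0) (hcz : c z = 1) (u : E) :
    u = a u • x + b u • y + c u • z := by
  have : FiniteDimensional ℝ E := FiniteDimensional.of_finrank_pos (by omega)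
  let L : E →ₗ[ℝ] (Fin 3 → ℝ) := LinearMap.pi ![a, b, c]
  have hs : Function.Surjective L := by
    intro w
    refine ⟨w 0 • x + w 1 • y + w 2 • z, ?_⟩
    funext i
    fin_cases i <;> simp [L, *]
  have hi : Function.Injective L :=
    (LinearMap.injective_iff_surjective_of_finrank_eq_finrank (by simp [hE])).2 hs
  apply hi
  funext i
  fin_cases i <;> simp [L, *]

namespace IsSasakianChart

variable {E : Type*} [NormedAddCommGroup E] [NormedSpace ℝ E]
  {G : E → E →L[ℝ] E →L[ℝ] ℝ} {Γ : E → E →L[ℝ] E →L[ℝ] E} {T : E → E}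
  {J : E → E →L[ℝ] E} {O : Set E}

theorem expand (h : IsSasakianChart G Γ T J O) (hE : Module.finrank ℝ E = 3) {y : E} (hy : y ∈ O)
    {n : E} (hn : G y n n = 1) (hT : G y (T y) n = 0) (u : E) :
    u = G y n u • n + G y (J y n) u • J y n + G y (T y) u • T y := by
  have h1 := h.G_J_J hy n n
  have h2 : G y n (J y n) = 0 := by
    have := h.J_skew y hy n n
    rw [h.G_symm y hy (J y n)] at this
    linarith
  refine eq_of_dual_three hE (G y n : E →L[ℝ] ℝ).toLinearMap (G y (J y n)).toLinearMap
    (G y (T y)).toLinearMap ?_ ?_ ?_ ?_ ?_ ?_ ?_ ?_ ?_ u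
  · simpa using hn
  · simpa using h2
  · simpa [h.G_symm y hy n (T y)] using hT
  · simpa [h.G_symm y hy _ n] using h2
  · simpa [hn, hT] using h1
  · simpa [h.G_symm y hy _ (T y)] using h.G_T_J hy n
  · simpa using hT
  · simpa using h.G_T_J hy n
  · simpa using h.T_unit y hy

/-- The covariant derivative `(D_u J) v` of the tensor `J`. -/
def covJ (Γ : E → E →L[ℝ] E →L[ℝ] E) (J : E → E →L[ℝ] E) (y u v : E) : E :=
  cov Γ id (fun z => J z v) u y - J y (Γ y u v)

section covJ

variable (h : IsSasakianChart G Γ T J O) {y : E} (hy : y ∈ O)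
include h hy

theorem differentiableAt_J_apply (v : E) : DifferentiableAt ℝ (fun z => J z v) y :=
  (h.differentiableAt_J hy).clm_apply (differentiableAt_const v)

theorem cov_J_apply {A : E → E} (hA : DifferentiableAt ℝ A y) (u : E) :
    cov Γ id (fun z => J z (A z)) u y = covJ Γ J y u (A y) + J y (cov Γ id A u y) := by
  have e1 := ((h.differentiableAt_J hy).hasFDerivAt.clm_apply hA.hasFDerivAt).fderiv
  have e2 := ((h.differentiableAt_J hy).hasFDerivAt.clm_apply
    (hasFDerivAt_const (A y) y)).fderiv
  simp only [covJ, cov, e1, e2]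
  simp
  abel

theorem covJ_skew (u v w : E) : G y (covJ Γ J y u v) w = -G y v (covJ Γ J y u w) := by
  have e : (fun z => G (id z) (J z v) w) =ᶠ[𝓝 y] fun z => -G (id z) v (J z w) := by
    filter_upwards [h.isOpen.mem_nhds hy] with z hz using h.J_skew z hz v w
  have e1 := h.fderiv_inner (F := id) differentiableAt_id hy (h.differentiableAt_J_apply hy v)
    (differentiableAt_const w) u
  have e2 := h.fderiv_inner (F := id) differentiableAt_id hy (differentiableAt_const v)
    (h.differentiableAt_J_apply hy w) u
  rw [e.fderiv_eq, fderiv_fun_neg, _root_.neg_apply, e2, cov_id_const, cov_id_const] at e1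
  have e3 := h.J_skew y hy v (Γ y u w)
  have e4 := h.J_skew y hy (Γ y u v) w
  simp only [covJ, map_sub, _root_.sub_apply, id] at e1 ⊢
  linarith

/-- The derivative of the identity `J² = -1 + η ⊗ T`, where `D_u T = J u`. -/
theorem covJ_J (u v : E) : covJ Γ J y u (J y v) + J y (covJ Γ J y u v)
    = G y (J y u) v • T y + G y (T y) v • J y u := by
  have e : (fun z => J z (J z v)) =ᶠ[𝓝 y] fun z => -v + G (id z) (T z) v • T z := by
    filter_upwards [h.isOpen.mem_nhds hy] with z hz using h.J_J z hz v
  have e1 := h.cov_J_apply hy (h.differentiableAt_J_apply hy v) u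
  have d1 : DifferentiableAt ℝ (fun z => G (id z) (T z) v) y :=
    ((h.differentiableAt_G hy).clm_apply (h.differentiableAt_T hy)).clm_apply
      (differentiableAt_const v)
  have e2 : cov Γ id (fun z => J z (J z v)) u y
      = (G y (J y u) v + G y (T y) (Γ y u v)) • T y + G y (T y) v • J y u - Γ y u v := by
    have e3 := h.fderiv_inner (F := id) differentiableAt_id hy (h.differentiableAt_T hy)
      (differentiableAt_const v) u
    have e4 := h.cov_reeb (F := id) differentiableAt_id hy u
    have e5 := ((hasFDerivAt_const (-v) y).add
      (d1.hasFDerivAt.smul (h.differentiableAt_T hy).hasFDerivAt)).fderiv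
    have e6 : fderiv ℝ (fun z => J z (J z v)) y = _ := e.fderiv_eq.trans e5
    rw [cov_id_const] at e3
    simp only [id, fderiv_id, ContinuousLinearMap.id_apply] at e3 e4
    rw [e4] at e3
    have e7 : fderiv ℝ T y u = J y u - Γ y u (T y) := by rw [← h.cov_T y hy u]; abel
    simp only [cov, e6]
    simp only [_root_.add_apply, _root_.smul_apply, _root_.zero_apply,
      ContinuousLinearMap.smulRight_apply, id, fderiv_id, ContinuousLinearMap.id_apply, e3, e7,
      h.J_J y hy v, map_add, map_neg, map_smul]
    module
  have e3 : cov Γ id (fun z => J z v) u y = covJ Γ J y u v + J y (Γ y u v) := by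
    simp [covJ]
  rw [e2, e3, map_add, h.J_J y hy] at e1
  rw [← sub_eq_zero] at e1 ⊢
  rw [← neg_eq_zero, ← e1]
  module

/-- The derivative of `J` maps horizontal vectors to vertical ones. -/
theorem covJ_horizontal {n : E} (hT : G y (T y) n = 0) (u : E) :
    G y (covJ Γ J y u n) (J y n) = 0 ∧ G y (covJ Γ J y u (J y n)) n = 0 := by
  have e1 := congrArg (fun w => G y w n) (h.covJ_J hy u n)
  have e2 := h.J_skew y hy (covJ Γ J y u n) n
  have e3 := h.covJ_skew hy u n (J y n)
  have e4 := h.G_symm y hy (covJ Γ J y u (J y n)) n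
  simp [hT] at e1
  constructor <;> linarith

theorem covJ_self (u v : E) : G y (covJ Γ J y u v) v = 0 := by
  have e1 := h.covJ_skew hy u v v
  have e2 := h.G_symm y hy (covJ Γ J y u v) v
  linarith

theorem riem_reeb_eq_covJ (a b : E) :
    riem Γ y a b (T y) = covJ Γ J y a b - covJ Γ J y b a := by
  have e1 := h.cov_cov_sub (F := id) (A := T) contDiffAt_id hy
    ((h.contDiffAt_T hy).of_le (by norm_cast)) a b
  have e2 : ∀ b a, cov Γ id (cov Γ id T b) a y = cov Γ id (fun z => J z b) a y := by
    intro b a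
    have : cov Γ id T b =ᶠ[𝓝 y] fun z => J z b := by
      filter_upwards [h.isOpen.mem_nhds hy] with z hz
      simpa using h.cov_reeb (F := id) differentiableAt_id hz b
    simp [cov, this.fderiv_eq]
    rw [← this.eq_of_nhds]; simp [cov]
  rw [e2, e2] at e1
  simp only [id, fderiv_id, ContinuousLinearMap.id_apply] at e1
  rw [← e1, covJ, covJ, h.Γ_symm y hy a b]
  abel

/-- In a Sasakian manifold the horizontal part of the curvature operators `R(w, T)` vanishes: a
horizontal unit vector `n` and `J n` span the horizontal plane. -/
theorem riem_reeb (hE : Module.finrank ℝ E = 3) {n : E} (hn : G y n n = 1)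
    (hT : G y (T y) n = 0) (w : E) :
    G y (riem Γ y w (T y) n) (J y n) = 0 ∧ G y (riem Γ y (T y) w n) (J y n) = 0 := by
  have k : G y (riem Γ y w (T y) n) (J y n) = 0 := by
    rw [h.riem_pair_symm hy, h.riem_skew hy, h.G_symm y hy, neg_eq_zero,
      h.riem_reeb_eq_covJ hy]
    have e1 := h.covJ_horizontal hy hT n
    have e2 := h.covJ_horizontal hy hT (J y n)
    have e3 := h.covJ_self hy n (J y n)
    have e4 := h.covJ_self hy (J y n) n
    have e5 : G y (riem Γ y n (J y n) (T y)) (T y) = 0 := by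
      have := h.riem_skew hy n (J y n) (T y) (T y)
      rw [h.G_symm y hy (T y)] at this
      linarith
    rw [h.riem_reeb_eq_covJ hy] at e5
    rw [h.expand hE hy hn hT w]
    simp only [map_sub, _root_.sub_apply, map_add, map_smul, smul_eq_mul] at e5 ⊢
    rw [e1.2, e2.1, e3, e4]
    linear_combination (G y (T y) w) * e5
  refine ⟨k, ?_⟩
  rw [riem_swap]
  simp [k]

end covJ

end IsSasakianChart
end SubRiem

namespace SubRiem

/-! ### The structure equations of an adapted frame along a map -/

/-- The `1`-form `⟨A, dF⟩` on the domain of `F`. -/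
def form {E D : Type*} [NormedAddCommGroup E] [NormedSpace ℝ E] [NormedAddCommGroup D]
    [NormedSpace ℝ D] (G : E → E →L[ℝ] E →L[ℝ] ℝ) (F A : D → E) (v : D) (q : D) : ℝ :=
  G (F q) (A q) (fderiv ℝ F q v)

/-- The connection form of the frame `ν, Z` along `F`, for the Tanaka-Webster connection. -/
def conn {E D : Type*} [NormedAddCommGroup E] [NormedSpace ℝ E] [NormedAddCommGroup D]
    [NormedSpace ℝ D] (G : E → E →L[ℝ] E →L[ℝ] ℝ) (Γ : E → E →L[ℝ] E →L[ℝ] E) (T : E → E)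
    (F ν Z : D → E) (v : D) (q : D) : ℝ :=
  G (F q) (cov Γ F ν v q) (Z q) - form G F (fun q => T (F q)) v q

/-- An oriented orthonormal horizontal frame `ν, Z = J ν` along the map `F`, near the point `q₀`. -/
structure IsAdaptedFrame {E D : Type*} [NormedAddCommGroup E] [NormedSpace ℝ E]
    [NormedAddCommGroup D] [NormedSpace ℝ D] (G : E → E →L[ℝ] E →L[ℝ] ℝ)
    (T : E → E) (J : E → E →L[ℝ] E) (O : Set E) (F ν Z : D → E) (q₀ : D) : Prop where
  contDiffAt_F : ContDiffAt ℝ 3 F q₀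
  mem : F q₀ ∈ O
  contDiffAt_ν : ContDiffAt ℝ 2 ν q₀
  contDiffAt_Z : ContDiffAt ℝ 2 Z q₀
  unit : ∀ᶠ q in 𝓝 q₀, G (F q) (ν q) (ν q) = 1
  horizontal : ∀ᶠ q in 𝓝 q₀, G (F q) (T (F q)) (ν q) = 0
  Z_eq : ∀ᶠ q in 𝓝 q₀, Z q = J (F q) (ν q)

namespace IsAdaptedFrame

variable {E : Type*} [NormedAddCommGroup E] [NormedSpace ℝ E]
  {G : E → E →L[ℝ] E →L[ℝ] ℝ} {Γ : E → E →L[ℝ] E →L[ℝ] E} {T : E → E}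
  {J : E → E →L[ℝ] E} {O : Set E}
variable {D : Type*} [NormedAddCommGroup D] [NormedSpace ℝ D] {F ν Z : D → E} {q : D}

section

variable (a : IsAdaptedFrame G T J O F ν Z q) (h : IsSasakianChart G Γ T J O)
include a

theorem differentiableAt_F : DifferentiableAt ℝ F q := a.contDiffAt_F.differentiableAt (by simp)

theorem contDiffAt_F2 : ContDiffAt ℝ 2 F q := a.contDiffAt_F.of_le (by norm_num)

theorem differentiableAt_ν : DifferentiableAt ℝ ν q := a.contDiffAt_ν.differentiableAt (by simp)

theorem differentiableAt_Z : DifferentiableAt ℝ Z q := a.contDiffAt_Z.differentiableAt (by simp)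

theorem Z_eq_self : Z q = J (F q) (ν q) := a.Z_eq.self_of_nhds

include h

theorem eventually : ∀ᶠ q' in 𝓝 q, IsAdaptedFrame G T J O F ν Z q' := by
  filter_upwards [a.contDiffAt_F.eventually (by simp),
    a.contDiffAt_F.continuousAt.eventually (h.isOpen.mem_nhds a.mem),
    a.contDiffAt_ν.eventually (by simp), a.contDiffAt_Z.eventually (by simp),
    a.unit.eventually_nhds, a.horizontal.eventually_nhds, a.Z_eq.eventually_nhds]
    with q' h1 h2 h3 h4 h5 h6 h7
  exact ⟨h1, h2, h3, h4, h5, h6, h7⟩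

omit h in
theorem contDiffAt_fderiv_apply (v : D) : ContDiffAt ℝ 2 (fun q => fderiv ℝ F q v) q :=
  (a.contDiffAt_F.fderiv_right (m := 2) (by norm_num)).clm_apply contDiffAt_const

theorem contDiffAt_G_comp : ContDiffAt ℝ 2 (fun q => G (F q)) q :=
  ((h.contDiffAt_G a.mem).of_le (by norm_cast)).comp q a.contDiffAt_F2

theorem contDiffAt_form {A : D → E} (hA : ContDiffAt ℝ 2 A q) (v : D) :
    ContDiffAt ℝ 2 (form G F A v) q :=
  ((a.contDiffAt_G_comp h).clm_apply hA).clm_apply (a.contDiffAt_fderiv_apply v)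

theorem contDiffAt_T_comp : ContDiffAt ℝ 2 (fun q => T (F q)) q :=
  ((h.contDiffAt_T a.mem).of_le (by norm_cast)).comp q a.contDiffAt_F2

theorem contDiffAt_cov {A : D → E} (hA : ContDiffAt ℝ 2 A q) (v : D) :
    ContDiffAt ℝ 1 (cov Γ F A v) q := by
  have h1 : ContDiffAt ℝ 1 (fun q => Γ (F q)) q :=
    ((h.contDiffAt_Γ a.mem).of_le (by norm_cast)).comp q (a.contDiffAt_F.of_le (by norm_num))
  exact ((hA.fderiv_right (m := 1) (by norm_num)).clm_apply contDiffAt_const).add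
    ((h1.clm_apply ((a.contDiffAt_fderiv_apply v).of_le (by norm_num))).clm_apply
      (hA.of_le (by norm_num)))

theorem contDiffAt_conn (v : D) : ContDiffAt ℝ 1 (conn G Γ T F ν Z v) q :=
  (((a.contDiffAt_G_comp h).of_le (by norm_num)).clm_apply
    (a.contDiffAt_cov h a.contDiffAt_ν v)).clm_apply (a.contDiffAt_Z.of_le (by norm_num)) |>.sub
    ((a.contDiffAt_form h (a.contDiffAt_T_comp h) v).of_le (by norm_num))

theorem inner_ν_Z : G (F q) (ν q) (Z q) = 0 := by
  have h1 := h.J_skew _ a.mem (ν q) (ν q)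
  rw [← a.Z_eq_self, h.G_symm _ a.mem (Z q)] at h1
  linarith

theorem inner_Z_Z : G (F q) (Z q) (Z q) = 1 := by
  rw [a.Z_eq_self, h.G_J_J a.mem, a.unit.self_of_nhds, a.horizontal.self_of_nhds]; simp

theorem inner_T_Z : G (F q) (T (F q)) (Z q) = 0 := by
  rw [a.Z_eq_self, h.G_T_J a.mem]

theorem J_Z : J (F q) (Z q) = -ν q := by
  rw [a.Z_eq_self, h.J_J _ a.mem, a.horizontal.self_of_nhds]; simp

theorem expand (hE : Module.finrank ℝ E = 3) (u : E) :
    u = G (F q) (ν q) u • ν q + G (F q) (Z q) u • Z q + G (F q) (T (F q)) u • T (F q) := by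
  have := h.expand hE a.mem a.unit.self_of_nhds a.horizontal.self_of_nhds u
  rwa [← a.Z_eq_self] at this

theorem inner_expand (hE : Module.finrank ℝ E = 3) (u v : E) :
    G (F q) u v = G (F q) (ν q) u * G (F q) (ν q) v + G (F q) (Z q) u * G (F q) (Z q) v
      + G (F q) (T (F q)) u * G (F q) (T (F q)) v := by
  conv_lhs => rw [a.expand h hE u]
  simp

theorem fderiv_inner_eq_zero {A B : D → E} (hA : DifferentiableAt ℝ A q)
    (hB : DifferentiableAt ℝ B q) {c : ℝ} (hc : ∀ᶠ q in 𝓝 q, G (F q) (A q) (B q) = c) (v : D) :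
    G (F q) (cov Γ F A v q) (B q) + G (F q) (A q) (cov Γ F B v q) = 0 := by
  rw [← h.fderiv_inner a.differentiableAt_F a.mem hA hB]
  have : (fun q => G (F q) (A q) (B q)) =ᶠ[𝓝 q] fun _ => c := hc
  rw [this.fderiv_eq]; simp

theorem inner_cov_ν_ν (v : D) : G (F q) (cov Γ F ν v q) (ν q) = 0 := by
  have := a.fderiv_inner_eq_zero h a.differentiableAt_ν a.differentiableAt_ν a.unit v
  rw [h.G_symm _ a.mem (ν q)] at this
  linarith

theorem inner_cov_Z_Z (v : D) : G (F q) (cov Γ F Z v q) (Z q) = 0 := by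
  have := a.fderiv_inner_eq_zero h a.differentiableAt_Z a.differentiableAt_Z (c := 1)
    ((a.eventually h).mono fun q' a' => a'.inner_Z_Z h) v
  rw [h.G_symm _ a.mem (Z q)] at this
  linarith

theorem inner_cov_Z_ν (v : D) :
    G (F q) (cov Γ F Z v q) (ν q) = -G (F q) (cov Γ F ν v q) (Z q) := by
  have := a.fderiv_inner_eq_zero h a.differentiableAt_ν a.differentiableAt_Z (c := 0)
    ((a.eventually h).mono fun q' a' => a'.inner_ν_Z h) v
  rw [h.G_symm _ a.mem (ν q)] at this
  linarith

theorem inner_cov_ν_T (v : D) : G (F q) (cov Γ F ν v q) (T (F q)) = form G F Z v q := by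
  have := a.fderiv_inner_eq_zero h ((a.contDiffAt_T_comp h).differentiableAt (by simp))
    a.differentiableAt_ν a.horizontal v
  rw [h.cov_reeb a.differentiableAt_F a.mem, h.J_skew _ a.mem, ← a.Z_eq_self,
    h.G_symm _ a.mem (T (F q)), h.G_symm _ a.mem _ (Z q)] at this
  rw [form]
  linarith

theorem inner_cov_Z_T (v : D) : G (F q) (cov Γ F Z v q) (T (F q)) = -form G F ν v q := by
  have := a.fderiv_inner_eq_zero h ((a.contDiffAt_T_comp h).differentiableAt (by simp))
    a.differentiableAt_Z (c := 0) ((a.eventually h).mono fun q' a' => a'.inner_T_Z h) v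
  rw [h.cov_reeb a.differentiableAt_F a.mem, h.J_skew _ a.mem, a.J_Z h,
    h.G_symm _ a.mem (T (F q)), h.G_symm _ a.mem _ (-ν q)] at this
  rw [form]
  simp at this
  linarith

theorem fderiv_form_sub {A : D → E} (hA : DifferentiableAt ℝ A q) (u v : D) :
    fderiv ℝ (form G F A v) q u - fderiv ℝ (form G F A u) q v
      = G (F q) (cov Γ F A u q) (fderiv ℝ F q v) - G (F q) (cov Γ F A v q) (fderiv ℝ F q u) := by
  have e : ∀ u v, fderiv ℝ (form G F A v) q u = _ := fun u v =>
    h.fderiv_inner a.differentiableAt_F a.mem hA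
      (IsSasakianChart.differentiableAt_fderiv_apply a.contDiffAt_F2 v) u
  rw [e, e, h.cov_fderiv_comm a.contDiffAt_F2 a.mem u v]
  ring

/-- `d⟨Z, dF⟩ = -ω ∧ ⟨ν, dF⟩`. -/
theorem d_form_Z (hE : Module.finrank ℝ E = 3) (u v : D) :
    fderiv ℝ (form G F Z v) q u - fderiv ℝ (form G F Z u) q v
      = -(conn G Γ T F ν Z u q * form G F ν v q - conn G Γ T F ν Z v q * form G F ν u q) := by
  rw [a.fderiv_form_sub h a.differentiableAt_Z, a.inner_expand h hE (cov Γ F Z u q),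
    a.inner_expand h hE (cov Γ F Z v q)]
  simp only [h.G_symm _ a.mem _ (cov Γ F Z _ q), a.inner_cov_Z_T h, a.inner_cov_Z_Z h,
    a.inner_cov_Z_ν h, conn]
  simp only [form]
  ring

/-- `d⟨ν, dF⟩ = ω ∧ ⟨Z, dF⟩`. -/
theorem d_form_ν (hE : Module.finrank ℝ E = 3) (u v : D) :
    fderiv ℝ (form G F ν v) q u - fderiv ℝ (form G F ν u) q v
      = conn G Γ T F ν Z u q * form G F Z v q - conn G Γ T F ν Z v q * form G F Z u q := by
  rw [a.fderiv_form_sub h a.differentiableAt_ν, a.inner_expand h hE (cov Γ F ν u q),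
    a.inner_expand h hE (cov Γ F ν v q)]
  simp only [h.G_symm _ a.mem _ (cov Γ F ν _ q), a.inner_cov_ν_T h, a.inner_cov_ν_ν h, conn]
  simp only [form]
  ring

theorem inner_J (hE : Module.finrank ℝ E = 3) (u v : E) :
    G (F q) (J (F q) u) v
      = G (F q) (ν q) u * G (F q) (Z q) v - G (F q) (Z q) u * G (F q) (ν q) v := by
  conv_lhs => rw [a.expand h hE u]
  simp [h.J_T a.mem, ← a.Z_eq_self, a.J_Z h]
  ring

/-- `dη = 2 ⟨ν, dF⟩ ∧ ⟨Z, dF⟩`. -/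
theorem d_form_T (hE : Module.finrank ℝ E = 3) (u v : D) :
    fderiv ℝ (form G F (fun q => T (F q)) v) q u - fderiv ℝ (form G F (fun q => T (F q)) u) q v
      = 2 * (form G F ν u q * form G F Z v q - form G F Z u q * form G F ν v q) := by
  rw [a.fderiv_form_sub h ((a.contDiffAt_T_comp h).differentiableAt (by simp)),
    h.cov_reeb a.differentiableAt_F a.mem, h.cov_reeb a.differentiableAt_F a.mem,
    a.inner_J h hE, a.inner_J h hE]
  simp only [form]
  ring

/-- The curvature form of an adapted frame has only a horizontal component. -/
theorem inner_riem (hE : Module.finrank ℝ E = 3) (u v : E) :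
    G (F q) (riem Γ (F q) u v (ν q)) (Z q) = G (F q) (riem Γ (F q) (ν q) (Z q) (ν q)) (Z q)
      * (G (F q) (ν q) u * G (F q) (Z q) v - G (F q) (Z q) u * G (F q) (ν q) v) := by
  have k1 := fun w => h.riem_reeb a.mem hE a.unit.self_of_nhds a.horizontal.self_of_nhds w
  rw [← a.Z_eq_self] at k1
  have k2 : ∀ w z, G (F q) (riem Γ (F q) w w z) (Z q) = 0 := by
    intro w z; simp [riem]
  have k3 : G (F q) (riem Γ (F q) (Z q) (ν q) (ν q)) (Z q)
      = - G (F q) (riem Γ (F q) (ν q) (Z q) (ν q)) (Z q) := by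
    rw [IsSasakianChart.riem_swap]; simp
  conv_lhs => rw [a.expand h hE u, a.expand h hE v]
  simp only [IsSasakianChart.riem_add_left, IsSasakianChart.riem_smul_left,
    IsSasakianChart.riem_add_mid, IsSasakianChart.riem_smul_mid, map_add, map_smul,
    _root_.add_apply, _root_.smul_apply, (k1 _).1, (k1 _).2, k2, k3, smul_eq_mul]
  ring

/-- `dω = (⟨R(ν,Z)ν, Z⟩ - 3) ⟨ν, dF⟩ ∧ ⟨Z, dF⟩`.  Of the constant `-3`, the part `-1` comes from the
vertical components of `Dν` and `DZ`, and the part `-2` from `dη`. -/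
theorem d_conn (hE : Module.finrank ℝ E = 3) (u v : D) :
    fderiv ℝ (conn G Γ T F ν Z v) q u - fderiv ℝ (conn G Γ T F ν Z u) q v
      = (G (F q) (riem Γ (F q) (ν q) (Z q) (ν q)) (Z q) - 3)
        * (form G F ν u q * form G F Z v q - form G F Z u q * form G F ν v q) := by
  have hT := a.contDiffAt_form h (a.contDiffAt_T_comp h)
  have hc : ∀ v, DifferentiableAt ℝ (cov Γ F ν v) q := fun v =>
    (a.contDiffAt_cov h a.contDiffAt_ν v).differentiableAt (by simp)
  have hd : ∀ v, DifferentiableAt ℝ (fun q => G (F q) (cov Γ F ν v q) (Z q)) q := fun v =>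
    ((a.contDiffAt_G_comp h).differentiableAt (by simp)).clm_apply (hc v) |>.clm_apply
      a.differentiableAt_Z
  have e : ∀ u v, fderiv ℝ (conn G Γ T F ν Z v) q u
      = G (F q) (cov Γ F (cov Γ F ν v) u q) (Z q) + G (F q) (cov Γ F ν v q) (cov Γ F Z u q)
        - fderiv ℝ (form G F (fun q => T (F q)) v) q u := by
    intro u v
    have e1 : fderiv ℝ (conn G Γ T F ν Z v) q = _ :=
      fderiv_fun_sub (hd v) ((hT v).differentiableAt (by simp))
    rw [e1, _root_.sub_apply,
      h.fderiv_inner a.differentiableAt_F a.mem (hc v) a.differentiableAt_Z]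
  have e2 := congrArg (fun w => G (F q) w (Z q))
    (h.cov_cov_sub a.contDiffAt_F2 a.mem a.contDiffAt_ν u v)
  have e3 := a.d_form_T h hE u v
  have e4 := a.inner_riem h hE (fderiv ℝ F q u) (fderiv ℝ F q v)
  simp only [map_sub, _root_.sub_apply] at e2
  rw [e, e, a.inner_expand h hE (cov Γ F ν v q), a.inner_expand h hE (cov Γ F ν u q)]
  simp only [h.G_symm _ a.mem _ (cov Γ F ν _ q), h.G_symm _ a.mem _ (cov Γ F Z _ q),
    a.inner_cov_ν_T h, a.inner_cov_ν_ν h, a.inner_cov_Z_T h, a.inner_cov_Z_Z h,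
    a.inner_cov_Z_ν h]
  simp only [form] at e3 ⊢
  linear_combination e2 - e3 + e4

end

end IsAdaptedFrame
end SubRiem

namespace SubRiem

/-! ### The second variation of the area density -/

/-- The coordinate directions of `ℝ × ℝ²`: the parameter of the variation, then the two coordinates
of the surface. -/
def dir : Fin 3 → ℝ × E2 := ![(1, 0), (0, b2 0), (0, b2 1)]

@[simp] theorem dir_zero : dir 0 = (1, 0) := rfl
@[simp] theorem dir_one : dir 1 = (0, b2 0) := rfl
@[simp] theorem dir_two : dir 2 = (0, b2 1) := rfl

/-- The directional derivative of `h` along a coordinate direction. -/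
def dd (i : Fin 3) (h : ℝ × E2 → ℝ) (q : ℝ × E2) : ℝ := fderiv ℝ h q (dir i)

theorem fderiv_slice {h : ℝ × E2 → ℝ} {s : ℝ} {y : E2} (hd : DifferentiableAt ℝ h (s, y)) (v : E2) :
    fderiv ℝ (fun y => h (s, y)) y v = fderiv ℝ h (s, y) (0, v) := by
  have h1 : HasFDerivAt (fun y : E2 => (s, y)) (ContinuousLinearMap.inr ℝ ℝ E2) y :=
    hasFDerivAt_prodMk_right s y
  have h2 : HasFDerivAt (fun y => h (s, y)) _ y := hd.hasFDerivAt.comp y h1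
  rw [h2.fderiv]
  simp

theorem dd_sub {h k : ℝ × E2 → ℝ} {q : ℝ × E2} (hh : DifferentiableAt ℝ h q)
    (hk : DifferentiableAt ℝ k q) (i : Fin 3) :
    dd i (fun q => h q - k q) q = dd i h q - dd i k q := by
  simp [dd, fderiv_fun_sub hh hk]

theorem dd_add {h k : ℝ × E2 → ℝ} {q : ℝ × E2} (hh : DifferentiableAt ℝ h q)
    (hk : DifferentiableAt ℝ k q) (i : Fin 3) :
    dd i (fun q => h q + k q) q = dd i h q + dd i k q := by
  simp [dd, fderiv_fun_add hh hk]

theorem dd_mul {h k : ℝ × E2 → ℝ} {q : ℝ × E2} (hh : DifferentiableAt ℝ h q)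
    (hk : DifferentiableAt ℝ k q) (i : Fin 3) :
    dd i (fun q => h q * k q) q = dd i h q * k q + h q * dd i k q := by
  simp [dd, fderiv_fun_mul hh hk]; ring

theorem dd_const_mul {h : ℝ × E2 → ℝ} {q : ℝ × E2} (hh : DifferentiableAt ℝ h q) (c : ℝ)
    (i : Fin 3) : dd i (fun q => c * h q) q = c * dd i h q := by
  simp [dd, fderiv_const_mul hh]

/-- The `2`-form `a ∧ b` on the pair of directions `i, j`. -/
def wedge (a b : Fin 3 → ℝ × E2 → ℝ) (i j : Fin 3) (q : ℝ × E2) : ℝ :=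
  a i q * b j q - a j q * b i q

/-- The pulled back coframe of a variation of a surface, near `q₀ = (0, y₀)`, as components in the
coordinate directions: `al`, `be`, `ga` are the forms dual to `Z`, `ν_h` and `T`, and `om` is the
connection form, with curvature form `κ be ∧ al` at `q₀`.  On the slices one has `be = m ga`, and `f`
is the transversal component of the velocity. The number `H` is the mean curvature of the
slice `s = 0`. -/
structure IsVariationCoframe (al be ga om : Fin 3 → ℝ × E2 → ℝ) (m f : ℝ × E2 → ℝ)
    (κ H : ℝ) (y₀ : E2) : Prop where
  cd_al : ∀ i, ContDiffAt ℝ 2 (al i) (0, y₀)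
  cd_be : ∀ i, ContDiffAt ℝ 2 (be i) (0, y₀)
  cd_ga : ∀ i, ContDiffAt ℝ 2 (ga i) (0, y₀)
  cd_om : ∀ i, ContDiffAt ℝ 1 (om i) (0, y₀)
  cd_m : ContDiffAt ℝ 2 m (0, y₀)
  cd_f : ContDiffAt ℝ 2 f (0, y₀)
  d_al : ∀ᶠ q in 𝓝 (0, y₀), ∀ i j, dd i (al j) q - dd j (al i) q = -wedge om be i j q
  d_be : ∀ᶠ q in 𝓝 (0, y₀), ∀ i j, dd i (be j) q - dd j (be i) q = wedge om al i j q
  d_ga : ∀ᶠ q in 𝓝 (0, y₀), ∀ i j, dd i (ga j) q - dd j (ga i) q = 2 * wedge be al i j q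
  d_om : ∀ i j, dd i (om j) (0, y₀) - dd j (om i) (0, y₀) = κ * wedge be al i j (0, y₀)
  be_zero : ∀ᶠ q in 𝓝 (0, y₀), be 0 q = m q * ga 0 q + f q
  be_one : ∀ᶠ q in 𝓝 (0, y₀), be 1 q = m q * ga 1 q
  be_two : ∀ᶠ q in 𝓝 (0, y₀), be 2 q = m q * ga 2 q
  density_ne : wedge al ga 1 2 (0, y₀) ≠ 0
  mean : ∀ᶠ y in 𝓝 y₀, wedge om ga 1 2 (0, y) = -2 * H * wedge al ga 1 2 (0, y)

theorem dd_wedge {a b : Fin 3 → ℝ × E2 → ℝ} {q : ℝ × E2} (ha : ∀ i, DifferentiableAt ℝ (a i) q)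
    (hb : ∀ i, DifferentiableAt ℝ (b i) q) (k i j : Fin 3) :
    dd k (wedge a b i j) q = dd k (a i) q * b j q + a i q * dd k (b j) q
      - (dd k (a j) q * b i q + a j q * dd k (b i) q) := by
  have e := dd_sub ((ha i).fun_mul (hb j)) ((ha j).fun_mul (hb i)) k
  rw [dd_mul (ha i) (hb j), dd_mul (ha j) (hb i)] at e
  exact e

namespace IsVariationCoframe

variable {al be ga om : Fin 3 → ℝ × E2 → ℝ} {m f : ℝ × E2 → ℝ} {κ H : ℝ} {y₀ : E2}

/-- The derivative along `Z` of a function on the slice `s = 0`. -/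
def zd (al ga : Fin 3 → ℝ × E2 → ℝ) (h : E2 → ℝ) (y : E2) : ℝ :=
  (fderiv ℝ h y (b2 0) * ga 2 (0, y) - fderiv ℝ h y (b2 1) * ga 1 (0, y)) / wedge al ga 1 2 (0, y)

variable (c : IsVariationCoframe al be ga om m f κ H y₀)
include c

theorem diff_al : ∀ᶠ q in 𝓝 (0, y₀), ∀ i, DifferentiableAt ℝ (al i) q :=
  eventually_all.2 fun i => ((c.cd_al i).eventually (by simp)).mono fun _ h =>
    h.differentiableAt (by simp)

theorem diff_ga : ∀ᶠ q in 𝓝 (0, y₀), ∀ i, DifferentiableAt ℝ (ga i) q :=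
  eventually_all.2 fun i => ((c.cd_ga i).eventually (by simp)).mono fun _ h =>
    h.differentiableAt (by simp)

theorem diff_m : ∀ᶠ q in 𝓝 (0, y₀), DifferentiableAt ℝ m q :=
  (c.cd_m.eventually (by simp)).mono fun _ h => h.differentiableAt (by simp)

theorem diff_f : ∀ᶠ q in 𝓝 (0, y₀), DifferentiableAt ℝ f q :=
  (c.cd_f.eventually (by simp)).mono fun _ h => h.differentiableAt (by simp)

theorem density_ne_nhds : ∀ᶠ q in 𝓝 (0, y₀), wedge al ga 1 2 q ≠ 0 := by
  have h1 : ContinuousAt (wedge al ga 1 2) (0, y₀) :=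
    ((c.cd_al 1).continuousAt.mul (c.cd_ga 2).continuousAt).sub
      ((c.cd_al 2).continuousAt.mul (c.cd_ga 1).continuousAt)
  exact h1.eventually_ne c.density_ne

/-- The variation of the area density: `∂ₛP = f (ω ∧ η)₁₂ + (dξ)₁₂`, where
`ξ = al(∂ₛ) ga - ga(∂ₛ) al`. -/
theorem dd_density : ∀ᶠ q in 𝓝 (0, y₀), dd 0 (wedge al ga 1 2) q
    = f q * wedge om ga 1 2 q + (dd 1 (wedge al ga 0 2) q - dd 2 (wedge al ga 0 1) q) := by
  filter_upwards [c.diff_al, c.diff_ga, c.d_al, c.d_ga, c.be_zero, c.be_one, c.be_two]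
    with q h1 h2 h3 h4 b0 b1 b2
  rw [dd_wedge h1 h2, dd_wedge h1 h2, dd_wedge h1 h2]
  simp only [wedge] at *
  have a1 := h3 0 1
  have a2 := h3 0 2
  have a3 := h3 1 2
  have g1 := h4 0 1
  have g2 := h4 0 2
  have g3 := h4 1 2
  rw [b0, b1] at a1 g1
  rw [b0, b2] at a2 g2
  rw [b1, b2] at a3 g3
  linear_combination ga 2 q * a1 - ga 1 q * a2 + ga 0 q * a3 - al 2 q * g1 + al 1 q * g2 - al 0 q * g3

omit c in
theorem eventually_slice {p : ℝ × E2 → Prop} (hp : ∀ᶠ q in 𝓝 ((0 : ℝ), y₀), p q) :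
    ∀ᶠ y in 𝓝 y₀, p (0, y) :=
  (Continuous.prodMk_right (0 : ℝ)).continuousAt.eventually hp

/-- On the slice `s = 0` the connection form is `λ η - 2H ⟨Z, ·⟩ + (2mf - Z(f)) ds`, where
`λ = 2m² - Z(m)`. -/
theorem conn_slice : ∀ᶠ y in 𝓝 y₀,
    (∀ j, j ≠ 0 → om j (0, y) = (2 * m (0, y) ^ 2 - zd al ga (fun y => m (0, y)) y) * ga j (0, y)
      - 2 * H * al j (0, y)) ∧
    om 0 (0, y) = (2 * m (0, y) ^ 2 - zd al ga (fun y => m (0, y)) y) * ga 0 (0, y)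
      - 2 * H * al 0 (0, y)
      + (2 * m (0, y) * f (0, y) - zd al ga (fun y => f (0, y)) y) := by
  have b0' := c.be_zero.eventually_nhds
  have b1' := c.be_one.eventually_nhds
  have b2' := c.be_two.eventually_nhds
  filter_upwards [eventually_slice c.diff_al, eventually_slice c.diff_ga,
    eventually_slice c.diff_m, eventually_slice c.diff_f,
    eventually_slice c.d_be, eventually_slice c.d_ga, eventually_slice b0',
    eventually_slice b1', eventually_slice b2', c.mean,
    eventually_slice c.density_ne_nhds] with y h1 h2 h3 h4 h5 h6 b0 b1 b2 hm hP
  have e0 : ∀ i, dd i (be 0) (0, y) = dd i m (0, y) * ga 0 (0, y) + m (0, y) * dd i (ga 0) (0, y)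
      + dd i f (0, y) := by
    intro i
    have : be 0 =ᶠ[𝓝 (0, y)] fun q => m q * ga 0 q + f q := b0
    rw [dd, this.fderiv_eq, ← dd, dd_add (h3.fun_mul (h2 0)) h4, dd_mul h3 (h2 0)]
  have e1 : ∀ i, dd i (be 1) (0, y) = dd i m (0, y) * ga 1 (0, y)
      + m (0, y) * dd i (ga 1) (0, y) := by
    intro i
    have : be 1 =ᶠ[𝓝 (0, y)] fun q => m q * ga 1 q := b1
    rw [dd, this.fderiv_eq, ← dd, dd_mul h3 (h2 1)]
  have e2 : ∀ i, dd i (be 2) (0, y) = dd i m (0, y) * ga 2 (0, y)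
      + m (0, y) * dd i (ga 2) (0, y) := by
    intro i
    have : be 2 =ᶠ[𝓝 (0, y)] fun q => m q * ga 2 q := b2
    rw [dd, this.fderiv_eq, ← dd, dd_mul h3 (h2 2)]
  have z : ∀ h : ℝ × E2 → ℝ, DifferentiableAt ℝ h (0, y) →
      zd al ga (fun y => h (0, y)) y * wedge al ga 1 2 (0, y)
        = dd 1 h (0, y) * ga 2 (0, y) - dd 2 h (0, y) * ga 1 (0, y) := by
    intro h hd
    rw [zd, div_mul_cancel₀ _ hP, fderiv_slice hd, fderiv_slice hd]
    rfl
  have zm := z m h3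
  have zf := z f h4
  set Zm := zd al ga (fun y => m (0, y)) y
  set Zf := zd al ga (fun y => f (0, y)) y
  have d12 := h5 1 2
  have d01 := h5 0 1
  have d02 := h5 0 2
  rw [e1, e2] at d12
  rw [e0, e1] at d01
  rw [e0, e2] at d02
  have g12 := h6 1 2
  have g01 := h6 0 1
  have g02 := h6 0 2
  simp only [wedge] at *
  rw [b1.self_of_nhds, b2.self_of_nhds] at g12
  rw [b0.self_of_nhds, b1.self_of_nhds] at g01
  rw [b0.self_of_nhds, b2.self_of_nhds] at g02
  -- `be = m η` along the slice, so that `d be = ω ∧ al` and `dη = 2 be ∧ al` determine `ω ∧ al`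
  have k : om 1 (0, y) * al 2 (0, y) - om 2 (0, y) * al 1 (0, y)
      = -(2 * m (0, y) ^ 2 - Zm) * (al 1 (0, y) * ga 2 (0, y) - al 2 (0, y) * ga 1 (0, y)) := by
    linear_combination -d12 + m (0, y) * g12 - zm
  -- `ω ∧ η` is given by the mean curvature, and `al`, `η` are linearly independent on the slice
  refine ⟨?_, ?_⟩
  · intro j hj
    apply mul_right_cancel₀ hP
    fin_cases j
    · exact absurd rfl hj
    · simp only [Fin.mk_one]
      linear_combination al 1 (0, y) * hm - ga 1 (0, y) * k
    · simp only [Fin.reduceFinMk]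
      linear_combination al 2 (0, y) * hm - ga 2 (0, y) * k
  · apply mul_right_cancel₀ hP
    linear_combination -(ga 2 (0, y) * d01 - ga 1 (0, y) * d02) + al 0 (0, y) * hm
      + m (0, y) * (ga 2 (0, y) * g01 - ga 1 (0, y) * g02) + ga 0 (0, y) * zm + zf

omit c in
/-- The slice derivative of a function that agrees with an explicit expression on `s = 0`. -/
theorem dd_eq_of_slice {h : ℝ × E2 → ℝ} {k : E2 → ℝ} (hd : DifferentiableAt ℝ h (0, y₀))
    (hk : ∀ᶠ y in 𝓝 y₀, h (0, y) = k y) :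
    dd 1 h (0, y₀) = fderiv ℝ k y₀ (b2 0) ∧ dd 2 h (0, y₀) = fderiv ℝ k y₀ (b2 1) := by
  have : (fun y => h (0, y)) =ᶠ[𝓝 y₀] k := hk
  rw [← this.fderiv_eq, fderiv_slice hd, fderiv_slice hd]
  exact ⟨rfl, rfl⟩

omit c in
theorem contDiffAt_slice {h : ℝ × E2 → ℝ} {n : WithTop ℕ∞} (hh : ContDiffAt ℝ n h (0, y₀)) :
    ContDiffAt ℝ n (fun y => h (0, y)) y₀ :=
  hh.comp y₀ (contDiffAt_const.prodMk contDiffAt_id)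

theorem contDiffAt_zd {h : E2 → ℝ} (hh : ContDiffAt ℝ 2 h y₀) :
    ContDiffAt ℝ 1 (zd al ga h) y₀ := by
  have h1 := fun i => (contDiffAt_slice (c.cd_al i)).of_le (m := 1) (by norm_num)
  have h2 := fun i => (contDiffAt_slice (c.cd_ga i)).of_le (m := 1) (by norm_num)
  have h3 := hh.fderiv_right (m := 1) (by norm_num)
  exact ((h3.clm_apply contDiffAt_const).mul (h2 2) |>.sub
    ((h3.clm_apply contDiffAt_const).mul (h2 1))).div
    (((h1 1).mul (h2 2)).sub ((h1 2).mul (h2 1))) c.density_ne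

theorem zd_mul_density (h : E2 → ℝ) : zd al ga h y₀ * wedge al ga 1 2 (0, y₀)
    = fderiv ℝ h y₀ (b2 0) * ga 2 (0, y₀) - fderiv ℝ h y₀ (b2 1) * ga 1 (0, y₀) := by
  rw [zd, div_mul_cancel₀ _ c.density_ne]

omit c in
theorem zd_sub {h k : E2 → ℝ} {y : E2} (hh : DifferentiableAt ℝ h y) (hk : DifferentiableAt ℝ k y) :
    zd al ga (fun y => h y - k y) y = zd al ga h y - zd al ga k y := by
  simp only [zd, fderiv_fun_sub hh hk, _root_.sub_apply]; ring

omit c in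
theorem zd_mul {h k : E2 → ℝ} {y : E2} (hh : DifferentiableAt ℝ h y) (hk : DifferentiableAt ℝ k y) :
    zd al ga (fun y => h y * k y) y = zd al ga h y * k y + h y * zd al ga k y := by
  simp only [zd, fderiv_fun_mul hh hk, _root_.add_apply, _root_.smul_apply, smul_eq_mul]; ring

omit c in
theorem zd_const_mul {h : E2 → ℝ} {y : E2} (hh : DifferentiableAt ℝ h y) (r : ℝ) :
    zd al ga (fun y => r * h y) y = r * zd al ga h y := by
  simp only [zd, fderiv_const_mul hh, _root_.smul_apply, smul_eq_mul]; ring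

/-- The Codazzi equation of the slice `s = 0`, and the derivative in `s` of the mean curvature
density, which is the Jacobi operator applied to `f`. -/
theorem codazzi_and_variation :
    zd al ga (zd al ga fun y => m (0, y)) y₀
        = 6 * m (0, y₀) * zd al ga (fun y => m (0, y)) y₀ - 4 * m (0, y₀) ^ 3
          + (κ - 4 * H ^ 2) * m (0, y₀) ∧
    dd 0 (wedge om ga 1 2) (0, y₀) + 2 * H * dd 0 (wedge al ga 1 2) (0, y₀)
      = wedge al ga 1 2 (0, y₀) * (-zd al ga (zd al ga fun y => f (0, y)) y₀
        + 2 * m (0, y₀) * zd al ga (fun y => f (0, y)) y₀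
        + 4 * zd al ga (fun y => m (0, y)) y₀ * f (0, y₀)
        + (κ - 4 * H ^ 2 - 4 * m (0, y₀) ^ 2) * f (0, y₀)) := by
  have hal := c.diff_al.self_of_nhds
  have hga := c.diff_ga.self_of_nhds
  have hom : ∀ i, DifferentiableAt ℝ (om i) (0, y₀) := fun i =>
    (c.cd_om i).differentiableAt (by simp)
  have hm := contDiffAt_slice c.cd_m
  have hf := contDiffAt_slice c.cd_f
  have hm1 : DifferentiableAt ℝ (fun y => m (0, y)) y₀ := hm.differentiableAt (by simp)
  have hf1 : DifferentiableAt ℝ (fun y => f (0, y)) y₀ := hf.differentiableAt (by simp)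
  have hzm : DifferentiableAt ℝ (zd al ga fun y => m (0, y)) y₀ :=
    (c.contDiffAt_zd hm).differentiableAt (by simp)
  have hzf : DifferentiableAt ℝ (zd al ga fun y => f (0, y)) y₀ :=
    (c.contDiffAt_zd hf).differentiableAt (by simp)
  have sal : ∀ i, DifferentiableAt ℝ (fun y => al i (0, y)) y₀ := fun i =>
    (contDiffAt_slice (c.cd_al i)).differentiableAt (by simp)
  have sga : ∀ i, DifferentiableAt ℝ (fun y => ga i (0, y)) y₀ := fun i =>
    (contDiffAt_slice (c.cd_ga i)).differentiableAt (by simp)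
  -- the coefficients in `ω = L η - 2H al + N ds`, the formula of `conn_slice`
  obtain ⟨L, hL⟩ : ∃ L : E2 → ℝ, L = fun y =>
    2 * (m (0, y) * m (0, y)) - zd al ga (fun y => m (0, y)) y := ⟨_, rfl⟩
  obtain ⟨N, hN⟩ : ∃ N : E2 → ℝ, N = fun y =>
    2 * (m (0, y) * f (0, y)) - zd al ga (fun y => f (0, y)) y := ⟨_, rfl⟩
  have dL : DifferentiableAt ℝ L y₀ := by
    rw [hL]; exact ((hm1.fun_mul hm1).const_mul 2).sub hzm
  have dN : DifferentiableAt ℝ N y₀ := by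
    rw [hN]; exact ((hm1.fun_mul hf1).const_mul 2).sub hzf
  have zL : zd al ga L y₀ = 4 * m (0, y₀) * zd al ga (fun y => m (0, y)) y₀
      - zd al ga (zd al ga fun y => m (0, y)) y₀ := by
    rw [hL, zd_sub ((hm1.fun_mul hm1).const_mul 2) hzm, zd_const_mul (hm1.fun_mul hm1),
      zd_mul hm1 hm1]
    ring
  have zN : zd al ga N y₀ = 2 * (zd al ga (fun y => m (0, y)) y₀ * f (0, y₀)
      + m (0, y₀) * zd al ga (fun y => f (0, y)) y₀)
      - zd al ga (zd al ga fun y => f (0, y)) y₀ := by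
    rw [hN, zd_sub ((hm1.fun_mul hf1).const_mul 2) hzf, zd_const_mul (hm1.fun_mul hf1),
      zd_mul hm1 hf1]
  have L0 : L y₀ = 2 * m (0, y₀) ^ 2 - zd al ga (fun y => m (0, y)) y₀ := by rw [hL]; ring
  -- the connection form on the slice, and its tangential derivatives
  have o1 : ∀ j, j ≠ 0 → ∀ᶠ y in 𝓝 y₀, om j (0, y) = L y * ga j (0, y) - 2 * H * al j (0, y) := by
    intro j hj
    filter_upwards [c.conn_slice] with y hy
    rw [hy.1 j hj, hL]; ring
  have o0 : ∀ᶠ y in 𝓝 y₀, om 0 (0, y) = L y * ga 0 (0, y) - 2 * H * al 0 (0, y) + N y := by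
    filter_upwards [c.conn_slice] with y hy
    rw [hy.2, hL, hN]; ring
  have t1 : ∀ j, ∀ v, fderiv ℝ (fun y => L y * ga j (0, y) - 2 * H * al j (0, y)) y₀ v
      = fderiv ℝ L y₀ v * ga j (0, y₀) + L y₀ * fderiv ℝ (ga j) (0, y₀) (0, v)
        - 2 * H * fderiv ℝ (al j) (0, y₀) (0, v) := by
    intro j v
    rw [fderiv_fun_sub (dL.fun_mul (sga j)) ((sal j).const_mul _), fderiv_fun_mul dL (sga j),
      fderiv_const_mul (sal j)]
    simp only [_root_.add_apply, _root_.sub_apply, _root_.smul_apply, smul_eq_mul,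
      fderiv_slice (hga j), fderiv_slice (hal j)]
    ring
  have t0 : ∀ v, fderiv ℝ (fun y => L y * ga 0 (0, y) - 2 * H * al 0 (0, y) + N y) y₀ v
      = fderiv ℝ L y₀ v * ga 0 (0, y₀) + L y₀ * fderiv ℝ (ga 0) (0, y₀) (0, v)
        - 2 * H * fderiv ℝ (al 0) (0, y₀) (0, v) + fderiv ℝ N y₀ v := by
    intro v
    rw [fderiv_fun_add ((dL.fun_mul (sga 0)).fun_sub ((sal 0).const_mul _)) dN, _root_.add_apply, t1]
  have s0 := dd_eq_of_slice (hom 0) o0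
  have s1 := dd_eq_of_slice (hom 1) (o1 1 (by simp))
  have s2 := dd_eq_of_slice (hom 2) (o1 2 (by simp))
  rw [t0, t0] at s0
  rw [t1, t1] at s1 s2
  have pL := c.zd_mul_density L
  have pN := c.zd_mul_density N
  have v0 := o0.self_of_nhds
  have v1 := (o1 1 (by simp)).self_of_nhds
  have v2 := (o1 2 (by simp)).self_of_nhds
  have N0 : N y₀ = 2 * m (0, y₀) * f (0, y₀) - zd al ga (fun y => f (0, y)) y₀ := by rw [hN]; ring
  have w12 := c.d_om 1 2
  have w01 := c.d_om 0 1
  have w02 := c.d_om 0 2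
  have a12 := c.d_al.self_of_nhds 1 2
  have a01 := c.d_al.self_of_nhds 0 1
  have a02 := c.d_al.self_of_nhds 0 2
  have g12 := c.d_ga.self_of_nhds 1 2
  have g01 := c.d_ga.self_of_nhds 0 1
  have g02 := c.d_ga.self_of_nhds 0 2
  have b0 := c.be_zero.self_of_nhds
  have b1 := c.be_one.self_of_nhds
  have b2' := c.be_two.self_of_nhds
  have hP := c.density_ne
  rw [dd_wedge hom hga, dd_wedge hal hga]
  change dd 1 (om 0) _ = _ * _ + _ * dd 1 (ga 0) _ - _ * dd 1 (al 0) _ + _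
    ∧ dd 2 (om 0) _ = _ * _ + _ * dd 2 (ga 0) _ - _ * dd 2 (al 0) _ + _ at s0
  change dd 1 (om 1) _ = _ * _ + _ * dd 1 (ga 1) _ - _ * dd 1 (al 1) _
    ∧ dd 2 (om 1) _ = _ * _ + _ * dd 2 (ga 1) _ - _ * dd 2 (al 1) _ at s1
  change dd 1 (om 2) _ = _ * _ + _ * dd 1 (ga 2) _ - _ * dd 1 (al 2) _
    ∧ dd 2 (om 2) _ = _ * _ + _ * dd 2 (ga 2) _ - _ * dd 2 (al 2) _ at s2
  simp only [wedge] at *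
  rw [b1, b2', v1, v2] at a12
  rw [b1, b2'] at g12 w12
  rw [b0, b1, v0, v1] at a01
  rw [b0, b1] at g01 w01
  rw [b0, b2', v0, v2] at a02
  rw [b0, b2'] at g02 w02
  rw [s1.2, s2.1] at w12
  rw [s0.1] at w01
  rw [s0.2] at w02
  -- the tangential component of `dω = κ be ∧ al`, an equation for `Z(L)`
  have Lk : zd al ga L y₀ = 2 * L y₀ * m (0, y₀) + 4 * H ^ 2 * m (0, y₀) - κ * m (0, y₀) := by
    apply mul_right_cancel₀ hP
    linear_combination pL + w12 - L y₀ * g12 + 2 * H * a12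
  refine ⟨?_, ?_⟩
  · rw [L0, zL] at Lk
    linear_combination -Lk
  -- the other two components of `dω = κ be ∧ al` are equations for the derivatives of `ω` in `s`
  · rw [v1, v2]
    linear_combination ga 2 (0, y₀) * w01 - ga 1 (0, y₀) * w02
      + (L y₀ * ga 1 (0, y₀) - 2 * H * al 1 (0, y₀)) * g02
      - (L y₀ * ga 2 (0, y₀) - 2 * H * al 2 (0, y₀)) * g01
      + 2 * H * (ga 2 (0, y₀) * a01 + al 1 (0, y₀) * g02 - ga 1 (0, y₀) * a02
        - al 2 (0, y₀) * g01)
      - ga 0 (0, y₀) * pL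
      + ga 0 (0, y₀) * (al 1 (0, y₀) * ga 2 (0, y₀) - al 2 (0, y₀) * ga 1 (0, y₀)) * Lk
      - pN + (al 1 (0, y₀) * ga 2 (0, y₀) - al 2 (0, y₀) * ga 1 (0, y₀)) * zN
      - 2 * f (0, y₀) * (al 1 (0, y₀) * ga 2 (0, y₀) - al 2 (0, y₀) * ga 1 (0, y₀)) * L0

end IsVariationCoframe
end SubRiem

namespace SubRiem

/-! ### The coframe of a variation in a chart -/

section surface

variable {E : Type*} [NormedAddCommGroup E] [NormedSpace ℝ E]

/-- The components of the pulled back contact form. -/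
def etaForm (G : E → E →L[ℝ] E →L[ℝ] ℝ) (T : E → E) (F : ℝ × E2 → E) (i : Fin 3) : ℝ × E2 → ℝ :=
  form G F (fun q => T (F q)) (dir i)

/-- The horizontal vector `η(∂₁F) ∂₂F - η(∂₂F) ∂₁F` tangent to the slice through `q`. -/
def charVec (G : E → E →L[ℝ] E →L[ℝ] ℝ) (T : E → E) (F : ℝ × E2 → E) (q : ℝ × E2) : E :=
  etaForm G T F 1 q • fderiv ℝ F q (dir 2) - etaForm G T F 2 q • fderiv ℝ F q (dir 1)

/-- The sub-Riemannian area density of the slice through `q`. -/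
def density (G : E → E →L[ℝ] E →L[ℝ] ℝ) (T : E → E) (F : ℝ × E2 → E) (q : ℝ × E2) : ℝ :=
  √(G (F q) (charVec G T F q) (charVec G T F q))

/-- The characteristic field of the slices. -/
def charField (G : E → E →L[ℝ] E →L[ℝ] ℝ) (T : E → E) (F : ℝ × E2 → E) (q : ℝ × E2) : E :=
  -(density G T F q)⁻¹ • charVec G T F q

/-- The horizontal Gauss map of the slices. -/
def gaussField (G : E → E →L[ℝ] E →L[ℝ] ℝ) (T : E → E) (J : E → E →L[ℝ] E) (F : ℝ × E2 → E)
    (q : ℝ × E2) : E :=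
  -J (F q) (charField G T F q)

/-- The components of the form dual to the characteristic field. -/
def zForm (G : E → E →L[ℝ] E →L[ℝ] ℝ) (T : E → E) (F : ℝ × E2 → E) (i : Fin 3) : ℝ × E2 → ℝ :=
  form G F (charField G T F) (dir i)

/-- The components of the form dual to the horizontal Gauss map. -/
def nuForm (G : E → E →L[ℝ] E →L[ℝ] ℝ) (T : E → E) (J : E → E →L[ℝ] E) (F : ℝ × E2 → E)
    (i : Fin 3) : ℝ × E2 → ℝ :=
  form G F (gaussField G T J F) (dir i)

/-- The components of the connection form of the adapted frame. -/
def connForm (G : E → E →L[ℝ] E →L[ℝ] ℝ) (Γ : E → E →L[ℝ] E →L[ℝ] E) (T : E → E)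
    (J : E → E →L[ℝ] E) (F : ℝ × E2 → E) (i : Fin 3) : ℝ × E2 → ℝ :=
  conn G Γ T F (gaussField G T J F) (charField G T F) (dir i)

/-- The function `-⟨N, T⟩ / |N_h|` of the slices. -/
def slope (G : E → E →L[ℝ] E →L[ℝ] ℝ) (T : E → E) (J : E → E →L[ℝ] E) (F : ℝ × E2 → E)
    (q : ℝ × E2) : ℝ :=
  -G (F q) (J (F q) (fderiv ℝ F q (dir 1))) (fderiv ℝ F q (dir 2)) / density G T F q

/-- The function `⟨∂ₛF, N⟩ / |N_h|`. -/
def speed (G : E → E →L[ℝ] E →L[ℝ] ℝ) (T : E → E) (J : E → E →L[ℝ] E) (F : ℝ × E2 → E)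
    (q : ℝ × E2) : ℝ :=
  nuForm G T J F 0 q - slope G T J F q * etaForm G T F 0 q

end surface

namespace IsSasakianChart

variable {E : Type*} [NormedAddCommGroup E] [NormedSpace ℝ E]
  {G : E → E →L[ℝ] E →L[ℝ] ℝ} {Γ : E → E →L[ℝ] E →L[ℝ] E} {T : E → E}
  {J : E → E →L[ℝ] E} {O : Set E} {F : ℝ × E2 → E} {q : ℝ × E2}

variable (h : IsSasakianChart G Γ T J O) (hF : ContDiffAt ℝ 3 F q) (hq : F q ∈ O)
  (hP : density G T F q ≠ 0)
include h hF hq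

theorem contDiffAt_etaForm (i : Fin 3) : ContDiffAt ℝ 2 (etaForm G T F i) q :=
  ((((h.contDiffAt_G hq).of_le (by norm_cast)).comp q (hF.of_le (by norm_num))).clm_apply
    (((h.contDiffAt_T hq).of_le (by norm_cast)).comp q (hF.of_le (by norm_num)))).clm_apply
    ((hF.fderiv_right (m := 2) (by norm_num)).clm_apply contDiffAt_const)

theorem contDiffAt_charVec : ContDiffAt ℝ 2 (charVec G T F) q :=
  ((h.contDiffAt_etaForm hF hq 1).smul
    ((hF.fderiv_right (m := 2) (by norm_num)).clm_apply contDiffAt_const)).sub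
  ((h.contDiffAt_etaForm hF hq 2).smul
    ((hF.fderiv_right (m := 2) (by norm_num)).clm_apply contDiffAt_const))

theorem contDiffAt_inner_charVec :
    ContDiffAt ℝ 2 (fun q => G (F q) (charVec G T F q) (charVec G T F q)) q :=
  ((((h.contDiffAt_G hq).of_le (by norm_cast)).comp q (hF.of_le (by norm_num))).clm_apply
    (h.contDiffAt_charVec hF hq)).clm_apply (h.contDiffAt_charVec hF hq)

omit h hF hq in
theorem density_sq_ne (hP : density G T F q ≠ 0) :
    G (F q) (charVec G T F q) (charVec G T F q) ≠ 0 := by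
  intro h0; exact hP (by simp [density, h0])

theorem continuousAt_density : ContinuousAt (density G T F) q :=
  (h.contDiffAt_inner_charVec hF hq).continuousAt.sqrt

include hP

theorem contDiffAt_density : ContDiffAt ℝ 2 (density G T F) q :=
  (h.contDiffAt_inner_charVec hF hq).sqrt (density_sq_ne hP)

theorem contDiffAt_charField : ContDiffAt ℝ 2 (charField G T F) q :=
  ((h.contDiffAt_density hF hq hP).inv hP).neg.smul (h.contDiffAt_charVec hF hq)

theorem contDiffAt_gaussField : ContDiffAt ℝ 2 (gaussField G T J F) q :=
  ((((h.contDiffAt_J hq).of_le (by norm_cast)).comp q (hF.of_le (by norm_num))).clm_apply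
    (h.contDiffAt_charField hF hq hP)).neg

omit h hF hP hq in
theorem inner_T_charVec : G (F q) (T (F q)) (charVec G T F q) = 0 := by
  simp [charVec, etaForm, form]; ring

omit h hF hq in
theorem density_pos : 0 < density G T F q := lt_of_le_of_ne (Real.sqrt_nonneg _) hP.symm

omit h hF hq in
theorem density_mul_self : density G T F q * density G T F q
    = G (F q) (charVec G T F q) (charVec G T F q) := by
  apply Real.mul_self_sqrt
  by_contra hlt
  exact hP (Real.sqrt_eq_zero_of_nonpos (le_of_lt (not_le.1 hlt)))

theorem eventually_density : ∀ᶠ q' in 𝓝 q, ContDiffAt ℝ 3 F q' ∧ F q' ∈ O ∧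
    density G T F q' ≠ 0 := by
  filter_upwards [hF.eventually (by simp), hF.continuousAt.eventually (h.isOpen.mem_nhds hq),
    (h.continuousAt_density hF hq).eventually_ne hP] with q' h1 h2 h3 using ⟨h1, h2, h3⟩

theorem isAdaptedFrame :
    IsAdaptedFrame G T J O F (gaussField G T J F) (charField G T F) q := by
  have key : ∀ q', F q' ∈ O → density G T F q' ≠ 0 →
      G (F q') (gaussField G T J F q') (gaussField G T J F q') = 1 ∧
      G (F q') (T (F q')) (gaussField G T J F q') = 0 ∧
      charField G T F q' = J (F q') (gaussField G T J F q') := by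
    intro q' hq' hP'
    have hT : G (F q') (T (F q')) (charField G T F q') = 0 := by
      simp [charField, inner_T_charVec]
    refine ⟨?_, ?_, ?_⟩
    · simp only [gaussField, map_neg, _root_.neg_apply, neg_neg, h.G_J_J hq', hT]
      simp only [charField, map_smul, map_neg, _root_.smul_apply, neg_smul,
        _root_.neg_apply, smul_eq_mul, ← density_mul_self hP']
      field_simp
      ring
    · simp [gaussField, h.G_T_J hq']
    · simp [gaussField, h.J_J _ hq', hT]
  have ev := h.eventually_density hF hq hP
  exact ⟨hF, hq, h.contDiffAt_gaussField hF hq hP, h.contDiffAt_charField hF hq hP,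
    ev.mono fun q' e => (key q' e.2.1 e.2.2).1, ev.mono fun q' e => (key q' e.2.1 e.2.2).2.1,
    ev.mono fun q' e => (key q' e.2.1 e.2.2).2.2⟩

omit h hF hq in
theorem charVec_eq : charVec G T F q = -density G T F q • charField G T F q := by
  rw [charField, smul_smul]; simp [mul_inv_cancel₀ hP]

theorem wedge_zForm_etaForm :
    wedge (zForm G T F) (etaForm G T F) 1 2 q = density G T F q := by
  have a := h.isAdaptedFrame hF hq hP
  have e := congrArg (G (F q) (charField G T F q)) (charVec_eq hP)
  rw [map_smul, a.inner_Z_Z h, charVec, map_sub, map_smul, map_smul] at e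
  simp only [smul_eq_mul] at e
  simp only [wedge, zForm, form]
  linarith

variable (hE : Module.finrank ℝ E = 3)
include hE

theorem nuForm_eq : nuForm G T J F 1 q = slope G T J F q * etaForm G T F 1 q ∧
    nuForm G T J F 2 q = slope G T J F q * etaForm G T F 2 q := by
  have a := h.isAdaptedFrame hF hq hP
  have e1 := h.wedge_zForm_etaForm hF hq hP
  have e2 := congrArg (G (F q) (gaussField G T J F q)) (charVec_eq hP)
  rw [map_smul, a.inner_ν_Z h, charVec, map_sub, map_smul, map_smul] at e2
  have e3 := a.inner_J h hE (fderiv ℝ F q (dir 1)) (fderiv ℝ F q (dir 2))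
  simp only [wedge, smul_eq_mul] at e1 e2
  have e4 : slope G T J F q * density G T F q
      = -G (F q) (J (F q) (fderiv ℝ F q (dir 1))) (fderiv ℝ F q (dir 2)) := by
    rw [slope, div_mul_cancel₀ _ hP]
  rw [e3] at e4
  have e5 : G (F q) (gaussField G T J F q) (fderiv ℝ F q (dir 1)) = nuForm G T J F 1 q := rfl
  have e6 : G (F q) (gaussField G T J F q) (fderiv ℝ F q (dir 2)) = nuForm G T J F 2 q := rfl
  have e7 : G (F q) (charField G T F q) (fderiv ℝ F q (dir 1)) = zForm G T F 1 q := rfl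
  have e8 : G (F q) (charField G T F q) (fderiv ℝ F q (dir 2)) = zForm G T F 2 q := rfl
  rw [e5, e6, e7, e8] at e4
  rw [e5, e6] at e2
  constructor
  · apply mul_right_cancel₀ hP
    linear_combination -nuForm G T J F 1 q * e1 - etaForm G T F 1 q * e4 - zForm G T F 1 q * e2
  · apply mul_right_cancel₀ hP
    linear_combination -nuForm G T J F 2 q * e1 - etaForm G T F 2 q * e4 - zForm G T F 2 q * e2

omit hE in
theorem contDiffAt_slope : ContDiffAt ℝ 2 (slope G T J F) q := by
  have h1 := fun i => (hF.fderiv_right (m := 2) (by norm_num)).clm_apply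
    (contDiffAt_const (c := dir i))
  exact (((((h.contDiffAt_G hq).of_le (by norm_cast)).comp q (hF.of_le (by norm_num))).clm_apply
    ((((h.contDiffAt_J hq).of_le (by norm_cast)).comp q (hF.of_le (by norm_num))).clm_apply
      (h1 1))).clm_apply (h1 2)).neg.div (h.contDiffAt_density hF hq hP) hP

omit hE in
theorem contDiffAt_speed : ContDiffAt ℝ 2 (speed G T J F) q :=
  ((h.isAdaptedFrame hF hq hP).contDiffAt_form h (h.contDiffAt_gaussField hF hq hP) _).sub
    ((h.contDiffAt_slope hF hq hP).mul (h.contDiffAt_etaForm hF hq 0))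

omit h hF hq hP hE in
/-- The coframe of a variation of a surface of constant mean curvature `H`. -/
theorem isVariationCoframe (h : IsSasakianChart G Γ T J O) (hE : Module.finrank ℝ E = 3) {y₀ : E2}
    (hF : ContDiffAt ℝ 3 F (0, y₀)) (hq : F (0, y₀) ∈ O) (hP : density G T F (0, y₀) ≠ 0) {H : ℝ}
    (hm : ∀ᶠ y in 𝓝 y₀, wedge (connForm G Γ T J F) (etaForm G T F) 1 2 (0, y)
      = -2 * H * density G T F (0, y)) :
    IsVariationCoframe (zForm G T F) (nuForm G T J F) (etaForm G T F) (connForm G Γ T J F)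
      (slope G T J F) (speed G T J F)
      (G (F (0, y₀)) (riem Γ (F (0, y₀)) (gaussField G T J F (0, y₀)) (charField G T F (0, y₀))
        (gaussField G T J F (0, y₀))) (charField G T F (0, y₀)) - 3) H y₀ := by
  have ev := h.eventually_density hF hq hP
  have a := h.isAdaptedFrame hF hq hP
  refine ⟨fun i => a.contDiffAt_form h a.contDiffAt_Z _, fun i => a.contDiffAt_form h a.contDiffAt_ν _,
    fun i => h.contDiffAt_etaForm hF hq i, fun i => a.contDiffAt_conn h _,
    h.contDiffAt_slope hF hq hP, h.contDiffAt_speed hF hq hP, ?_, ?_, ?_, ?_, ?_, ?_, ?_, ?_, ?_⟩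
  · filter_upwards [ev] with q e i j
    exact (h.isAdaptedFrame e.1 e.2.1 e.2.2).d_form_Z h hE (dir i) (dir j)
  · filter_upwards [ev] with q e i j
    exact (h.isAdaptedFrame e.1 e.2.1 e.2.2).d_form_ν h hE (dir i) (dir j)
  · filter_upwards [ev] with q e i j
    refine ((h.isAdaptedFrame e.1 e.2.1 e.2.2).d_form_T h hE (dir i) (dir j)).trans ?_
    simp only [wedge, nuForm, zForm]
    ring
  · intro i j
    refine (a.d_conn h hE (dir i) (dir j)).trans ?_
    simp only [wedge, nuForm, zForm]
    ring
  · filter_upwards with q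
    simp [speed]
  · filter_upwards [ev] with q e using (h.nuForm_eq e.1 e.2.1 e.2.2 hE).1
  · filter_upwards [ev] with q e using (h.nuForm_eq e.1 e.2.1 e.2.2 hE).2
  · rwa [h.wedge_zForm_etaForm hF hq hP]
  · filter_upwards [hm, IsVariationCoframe.eventually_slice ev] with y hy e
    rw [hy, h.wedge_zForm_etaForm e.1 e.2.1 e.2.2]

end IsSasakianChart
end SubRiem

namespace SubRiem

/-! ### Differentials of charts -/

section chartD

variable {E : Type*} [NormedAddCommGroup E] [NormedSpace ℝ E]
  {N : Type*} [TopologicalSpace N] [ChartedSpace E N]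

/-- The differential at `x` of the preferred chart at `x₀`. -/
def chartD (x₀ x : N) : TangentSpace 𝓘(ℝ, E) x →L[ℝ] E :=
  mfderiv 𝓘(ℝ, E) 𝓘(ℝ, E) (extChartAt 𝓘(ℝ, E) x₀) x

/-- The differential at `y` of the inverse of the preferred chart at `x₀`. -/
def chartDinv (x₀ : N) (y : E) : E →L[ℝ] TangentSpace 𝓘(ℝ, E) ((extChartAt 𝓘(ℝ, E) x₀).symm y) :=
  mfderiv 𝓘(ℝ, E) 𝓘(ℝ, E) (extChartAt 𝓘(ℝ, E) x₀).symm y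

theorem exists_symm_eq {x₀ x : N} (hx : x ∈ (extChartAt 𝓘(ℝ, E) x₀).source) :
    ∃ y ∈ (extChartAt 𝓘(ℝ, E) x₀).target, (extChartAt 𝓘(ℝ, E) x₀).symm y = x :=
  ⟨_, (extChartAt 𝓘(ℝ, E) x₀).map_source hx, (extChartAt 𝓘(ℝ, E) x₀).left_inv hx⟩

theorem mem_nhds_target {x₀ : N} {y : E} (hy : y ∈ (extChartAt 𝓘(ℝ, E) x₀).target) :
    (extChartAt 𝓘(ℝ, E) x₀).target ∈ 𝓝 y :=
  (isOpen_extChartAt_target x₀).mem_nhds hy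

theorem mem_nhds_source {x₀ x : N} (hx : x ∈ (extChartAt 𝓘(ℝ, E) x₀).source) :
    (extChartAt 𝓘(ℝ, E) x₀).source ∈ 𝓝 x :=
  (isOpen_extChartAt_source x₀).mem_nhds hx

section regular

variable [IsManifold 𝓘(ℝ, E) 1 N] {x₀ : N} {y : E}

theorem mdifferentiableAt_chart {x : N} (hx : x ∈ (extChartAt 𝓘(ℝ, E) x₀).source) :
    MDifferentiableAt 𝓘(ℝ, E) 𝓘(ℝ, E) (extChartAt 𝓘(ℝ, E) x₀) x :=
  mdifferentiableAt_extChartAt (by rwa [extChartAt_source] at hx)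

theorem mdifferentiableAt_chart_symm (hy : y ∈ (extChartAt 𝓘(ℝ, E) x₀).target) :
    MDifferentiableAt 𝓘(ℝ, E) 𝓘(ℝ, E) (extChartAt 𝓘(ℝ, E) x₀).symm y :=
  (mdifferentiableOn_extChartAt_symm y hy).mdifferentiableAt (mem_nhds_target hy)

theorem chartD_comp_chartDinv (hy : y ∈ (extChartAt 𝓘(ℝ, E) x₀).target) :
    chartD x₀ ((extChartAt 𝓘(ℝ, E) x₀).symm y) ∘L chartDinv x₀ y = ContinuousLinearMap.id ℝ E := by
  have := mfderiv_extChartAt_comp_mfderivWithin_extChartAt_symm hy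
  rw [ModelWithCorners.range_eq_univ, mfderivWithin_univ] at this
  exact this

theorem chartDinv_comp_chartD (hy : y ∈ (extChartAt 𝓘(ℝ, E) x₀).target) :
    chartDinv x₀ y ∘L chartD x₀ ((extChartAt 𝓘(ℝ, E) x₀).symm y) = ContinuousLinearMap.id ℝ _ := by
  have := mfderivWithin_extChartAt_symm_comp_mfderiv_extChartAt hy
  rw [ModelWithCorners.range_eq_univ, mfderivWithin_univ] at this
  exact this

theorem chartD_chartDinv (hy : y ∈ (extChartAt 𝓘(ℝ, E) x₀).target) (u : E) :
    chartD x₀ ((extChartAt 𝓘(ℝ, E) x₀).symm y) (chartDinv x₀ y u) = u :=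
  congrArg (fun L => L u) (chartD_comp_chartDinv hy)

theorem chartDinv_chartD (hy : y ∈ (extChartAt 𝓘(ℝ, E) x₀).target)
    (w : TangentSpace 𝓘(ℝ, E) ((extChartAt 𝓘(ℝ, E) x₀).symm y)) :
    chartDinv x₀ y (chartD x₀ ((extChartAt 𝓘(ℝ, E) x₀).symm y) w) = w :=
  congrArg (fun L => L w) (chartDinv_comp_chartD hy)

theorem chartD_self (x : N) : chartD x x = (ContinuousLinearMap.id ℝ E :) :=
  mfderiv_extChartAt_self

/-- The chart expression of a map into `N`. -/
theorem fderiv_chart_comp {D : Type*} [NormedAddCommGroup D] [NormedSpace ℝ D] {f : D → N} {q : D}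
    (hf : MDifferentiableAt 𝓘(ℝ, D) 𝓘(ℝ, E) f q) (hq : f q ∈ (extChartAt 𝓘(ℝ, E) x₀).source)
    (v : D) : fderiv ℝ (fun q => extChartAt 𝓘(ℝ, E) x₀ (f q)) q v
      = chartD x₀ (f q) (mfderiv 𝓘(ℝ, D) 𝓘(ℝ, E) f q v) := by
  have h1 := mfderiv_comp q (mdifferentiableAt_chart hq) hf
  rw [mfderiv_eq_fderiv] at h1
  exact congrArg (fun L => L v) h1

/-- The derivative of a function on `N` in terms of its chart expression. -/
theorem mvfderiv_comp_chart {V : Type*} [NormedAddCommGroup V] [NormedSpace ℝ V] {k : E → V} {x : N}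
    (hx : x ∈ (extChartAt 𝓘(ℝ, E) x₀).source)
    (hk : DifferentiableAt ℝ k (extChartAt 𝓘(ℝ, E) x₀ x)) (w : TangentSpace 𝓘(ℝ, E) x) :
    mvfderiv 𝓘(ℝ, E) (fun x => k (extChartAt 𝓘(ℝ, E) x₀ x)) x w
      = fderiv ℝ k (extChartAt 𝓘(ℝ, E) x₀ x) (chartD x₀ x w) := by
  have h1 := mfderiv_comp x hk.mdifferentiableAt (mdifferentiableAt_chart hx)
  rw [mfderiv_eq_fderiv] at h1
  exact congrArg (fun L => L w) h1

omit [IsManifold 𝓘(ℝ, E) 1 N] in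
theorem mvfderiv_congr {V : Type*} [NormedAddCommGroup V] [NormedSpace ℝ V] {f g : N → V} {x : N}
    (h : f =ᶠ[𝓝 x] g) (w : TangentSpace 𝓘(ℝ, E) x) :
    mvfderiv 𝓘(ℝ, E) f x w = mvfderiv 𝓘(ℝ, E) g x w := by
  have h1 : mvfderiv 𝓘(ℝ, E) f x = mvfderiv 𝓘(ℝ, E) g x := by
    have h2 := h.mfderiv_eq (I := 𝓘(ℝ, E)) (I' := 𝓘(ℝ, V))
    have h3 := h.eq_of_nhds
    unfold mvfderiv
    ext w
    exact congrArg (fun L : E →L[ℝ] V => L w) h2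
  rw [h1]

/-- The derivative of a function on `N` in terms of its chart expression, at a point given by its
coordinates. -/
theorem mvfderiv_eq_fderiv_chart {V : Type*} [NormedAddCommGroup V] [NormedSpace ℝ V] {f : N → V}
    (hy : y ∈ (extChartAt 𝓘(ℝ, E) x₀).target)
    (hf : DifferentiableAt ℝ (fun y => f ((extChartAt 𝓘(ℝ, E) x₀).symm y)) y)
    (w : TangentSpace 𝓘(ℝ, E) ((extChartAt 𝓘(ℝ, E) x₀).symm y)) :
    mvfderiv 𝓘(ℝ, E) f ((extChartAt 𝓘(ℝ, E) x₀).symm y) w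
      = fderiv ℝ (fun y => f ((extChartAt 𝓘(ℝ, E) x₀).symm y)) y (chartD x₀ _ w) := by
  have hx := (extChartAt 𝓘(ℝ, E) x₀).map_target hy
  have e : f =ᶠ[𝓝 ((extChartAt 𝓘(ℝ, E) x₀).symm y)]
      fun x => (fun y => f ((extChartAt 𝓘(ℝ, E) x₀).symm y)) (extChartAt 𝓘(ℝ, E) x₀ x) := by
    filter_upwards [mem_nhds_source hx] with x hx'
    exact congrArg f ((extChartAt 𝓘(ℝ, E) x₀).left_inv hx').symm
  have r := (extChartAt 𝓘(ℝ, E) x₀).right_inv hy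
  rw [mvfderiv_congr e]
  refine (mvfderiv_comp_chart (k := fun y => f ((extChartAt 𝓘(ℝ, E) x₀).symm y)) hx
    (by rwa [r]) w).trans ?_
  rw [r]

end regular

end chartD

namespace SasakianStructure

variable {M : Type*} [TopologicalSpace M] [ChartedSpace E3 M] [IsManifold 𝓘(ℝ, E3) ∞ M]
variable (𝒮 : SasakianStructure M)

/-- The metric in the preferred chart at `x₀`. -/
def chartG (x₀ : M) (y : E3) : E3 →L[ℝ] E3 →L[ℝ] ℝ :=
  let B : E3 →L[ℝ] E3 →L[ℝ] ℝ := 𝒮.g.inner ((extChartAt 𝓘(ℝ, E3) x₀).symm y)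
  let L : E3 →L[ℝ] E3 := chartDinv x₀ y
  B.bilinearComp L L

/-- The Reeb field in the preferred chart at `x₀`. -/
def chartT (x₀ : M) (y : E3) : E3 :=
  chartD x₀ _ (𝒮.T ((extChartAt 𝓘(ℝ, E3) x₀).symm y))

/-- The rotation in the preferred chart at `x₀`. -/
def chartJ (x₀ : M) (y : E3) : E3 →L[ℝ] E3 :=
  chartD x₀ _ ∘L 𝒮.J ((extChartAt 𝓘(ℝ, E3) x₀).symm y) ∘L chartDinv x₀ y

theorem metricInChart_eq (x₀ : M) (y u v : E3) : 𝒮.metricInChart x₀ y u v = 𝒮.chartG x₀ y u v :=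
  rfl

theorem contMDiffOn_symm (x₀ : M) : ContMDiffOn 𝓘(ℝ, E3) 𝓘(ℝ, E3) ∞
    (extChartAt 𝓘(ℝ, E3) x₀).symm (extChartAt 𝓘(ℝ, E3) x₀).target :=
  contMDiffOn_extChartAt_symm x₀

theorem contMDiffOn_chartDinv (x₀ : M) (u : E3) : ContMDiffOn 𝓘(ℝ, E3) 𝓘(ℝ, E3).tangent ∞
    (fun y => (⟨(extChartAt 𝓘(ℝ, E3) x₀).symm y, chartDinv x₀ y u⟩ : TangentBundle 𝓘(ℝ, E3) M))
    (extChartAt 𝓘(ℝ, E3) x₀).target := by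
  have h1 := (contMDiffOn_symm x₀).contMDiffOn_tangentMapWithin
    (m := ∞) (by simp) (isOpen_extChartAt_target x₀).uniqueMDiffOn
  have h2 : ContMDiff 𝓘(ℝ, E3) 𝓘(ℝ, E3).tangent ∞ (fun y => (⟨y, u⟩ : TangentBundle 𝓘(ℝ, E3) E3)) :=
    contMDiff_vectorSpace_iff_contDiff.2 contDiff_const
  refine (h1.comp h2.contMDiffOn (fun y hy => hy)).congr fun y hy => ?_
  have h3 : mfderivWithin 𝓘(ℝ, E3) 𝓘(ℝ, E3) (extChartAt 𝓘(ℝ, E3) x₀).symm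
      (extChartAt 𝓘(ℝ, E3) x₀).target y
      = mfderiv 𝓘(ℝ, E3) 𝓘(ℝ, E3) (extChartAt 𝓘(ℝ, E3) x₀).symm y :=
    mfderivWithin_of_mem_nhds (mem_nhds_target hy)
  simp only [Function.comp, tangentMapWithin, chartDinv]
  rw [h3]
  rfl

/-- The coordinates of a smooth vector field along the inverse of a chart are smooth. -/
theorem contDiffOn_chartD (x₀ : M) {V : ∀ y : E3, TangentSpace 𝓘(ℝ, E3) ((extChartAt 𝓘(ℝ, E3) x₀).symm y)}
    (hV : ContMDiffOn 𝓘(ℝ, E3) 𝓘(ℝ, E3).tangent ∞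
      (fun y => (⟨(extChartAt 𝓘(ℝ, E3) x₀).symm y, V y⟩ : TangentBundle 𝓘(ℝ, E3) M))
      (extChartAt 𝓘(ℝ, E3) x₀).target) :
    ContDiffOn ℝ ∞ (fun y => chartD x₀ _ (V y)) (extChartAt 𝓘(ℝ, E3) x₀).target := by
  have h0 : ContMDiffOn 𝓘(ℝ, E3) 𝓘(ℝ, E3) ∞ (extChartAt 𝓘(ℝ, E3) x₀)
    (extChartAt 𝓘(ℝ, E3) x₀).source := by
    rw [extChartAt_source]; exact contMDiffOn_extChartAt
  have h1 := h0.contMDiffOn_tangentMapWithin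
    (m := ∞) (by simp) (isOpen_extChartAt_source x₀).uniqueMDiffOn
  have h2 := h1.comp hV (fun y hy => (extChartAt 𝓘(ℝ, E3) x₀).map_target hy)
  let V' : E3 → E3 := fun y => chartD x₀ _ (V y)
  refine (contMDiffOn_vectorSpace_iff_contDiffOn (V := V')).1 ?_
  refine h2.congr fun y hy => ?_
  have h3 : mfderivWithin 𝓘(ℝ, E3) 𝓘(ℝ, E3) (extChartAt 𝓘(ℝ, E3) x₀)
      (extChartAt 𝓘(ℝ, E3) x₀).source ((extChartAt 𝓘(ℝ, E3) x₀).symm y)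
      = mfderiv 𝓘(ℝ, E3) 𝓘(ℝ, E3) (extChartAt 𝓘(ℝ, E3) x₀) ((extChartAt 𝓘(ℝ, E3) x₀).symm y) :=
    mfderivWithin_of_mem_nhds (mem_nhds_source ((extChartAt 𝓘(ℝ, E3) x₀).map_target hy))
  simp only [Function.comp, tangentMapWithin]
  rw [h3, (extChartAt 𝓘(ℝ, E3) x₀).right_inv hy]
  rfl

theorem contDiffOn_chartT (x₀ : M) :
    ContDiffOn ℝ ∞ (𝒮.chartT x₀) (extChartAt 𝓘(ℝ, E3) x₀).target :=
  contDiffOn_chartD x₀ (𝒮.contMDiff_T.comp_contMDiffOn (contMDiffOn_symm x₀))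

theorem contDiffOn_chartJ (x₀ : M) :
    ContDiffOn ℝ ∞ (𝒮.chartJ x₀) (extChartAt 𝓘(ℝ, E3) x₀).target := by
  rw [contDiffOn_clm_apply]
  intro u
  exact contDiffOn_chartD x₀ (ContMDiffOn.clm_bundle_apply (F₁ := E3) (F₂ := E3)
    (E₁ := fun x : M => TangentSpace 𝓘(ℝ, E3) x) (E₂ := fun x : M => TangentSpace 𝓘(ℝ, E3) x)
    (b := (extChartAt 𝓘(ℝ, E3) x₀).symm) (ϕ := fun y => 𝒮.J _) (v := fun y => chartDinv x₀ y u)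
    (𝒮.contMDiff_J.comp_contMDiffOn (contMDiffOn_symm x₀)) (contMDiffOn_chartDinv x₀ u))

theorem contDiffOn_chartG (x₀ : M) :
    ContDiffOn ℝ ∞ (𝒮.chartG x₀) (extChartAt 𝓘(ℝ, E3) x₀).target := by
  rw [contDiffOn_clm_apply]
  intro u
  rw [contDiffOn_clm_apply]
  intro v
  have := (ContMDiffOn.clm_bundle_apply₂ (F₁ := E3) (F₂ := E3) (F₃ := ℝ)
    (E₁ := fun x : M => TangentSpace 𝓘(ℝ, E3) x) (E₂ := fun x : M => TangentSpace 𝓘(ℝ, E3) x)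
    (E₃ := Bundle.Trivial M ℝ)
    (b := (extChartAt 𝓘(ℝ, E3) x₀).symm)
    (𝒮.g.contMDiff.comp_contMDiffOn (contMDiffOn_symm x₀)) (contMDiffOn_chartDinv x₀ u)
      (contMDiffOn_chartDinv x₀ v))
  rw [← contMDiffOn_iff_contDiffOn]
  intro y hy
  have h2 := this y hy
  rw [contMDiffWithinAt_totalSpace] at h2
  exact h2.2

end SasakianStructure
end SubRiem

namespace SubRiem
namespace SasakianStructure

variable {M : Type*} [TopologicalSpace M] [ChartedSpace E3 M] [IsManifold 𝓘(ℝ, E3) ∞ M]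
variable (𝒮 : SasakianStructure M)

/-! ### The structure in a chart -/

section fibre

variable {x₀ : M} {y : E3}

theorem chartDinv_chartT (hy : y ∈ (extChartAt 𝓘(ℝ, E3) x₀).target) :
    chartDinv x₀ y (𝒮.chartT x₀ y) = 𝒮.T ((extChartAt 𝓘(ℝ, E3) x₀).symm y) :=
  chartDinv_chartD hy _

theorem chartDinv_chartJ (hy : y ∈ (extChartAt 𝓘(ℝ, E3) x₀).target) (u : E3) :
    chartDinv x₀ y (𝒮.chartJ x₀ y u) = 𝒮.J ((extChartAt 𝓘(ℝ, E3) x₀).symm y) (chartDinv x₀ y u) :=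
  chartDinv_chartD hy _

theorem chartG_apply (u v : E3) : 𝒮.chartG x₀ y u v
    = 𝒮.g.inner ((extChartAt 𝓘(ℝ, E3) x₀).symm y) (chartDinv x₀ y u) (chartDinv x₀ y v) := rfl

theorem chartG_symm (u v : E3) : 𝒮.chartG x₀ y u v = 𝒮.chartG x₀ y v u := 𝒮.g.symm _ _ _

theorem chartG_pos (hy : y ∈ (extChartAt 𝓘(ℝ, E3) x₀).target) {u : E3} (hu : u ≠ 0) :
    0 < 𝒮.chartG x₀ y u u := by
  have h : chartDinv x₀ y u ≠ 0 := by
    intro h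
    apply hu
    rw [← chartD_chartDinv hy u]
    exact (congrArg (chartD x₀ ((extChartAt 𝓘(ℝ, E3) x₀).symm y)) h).trans (map_zero _)
  exact 𝒮.g.pos ((extChartAt 𝓘(ℝ, E3) x₀).symm y) (chartDinv x₀ y u) h

theorem chartG_chartT (hy : y ∈ (extChartAt 𝓘(ℝ, E3) x₀).target) (u : E3) :
    𝒮.chartG x₀ y (𝒮.chartT x₀ y) u = 𝒮.η ((extChartAt 𝓘(ℝ, E3) x₀).symm y) (chartDinv x₀ y u) := by
  rw [chartG_apply, 𝒮.chartDinv_chartT hy]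
  exact 𝒮.g_T _ _

theorem chartT_unit (hy : y ∈ (extChartAt 𝓘(ℝ, E3) x₀).target) :
    𝒮.chartG x₀ y (𝒮.chartT x₀ y) (𝒮.chartT x₀ y) = 1 := by
  rw [𝒮.chartG_chartT hy, 𝒮.chartDinv_chartT hy, 𝒮.η_T]

theorem chartJ_chartJ (hy : y ∈ (extChartAt 𝓘(ℝ, E3) x₀).target) (u : E3) :
    𝒮.chartJ x₀ y (𝒮.chartJ x₀ y u) = -u + 𝒮.chartG x₀ y (𝒮.chartT x₀ y) u • 𝒮.chartT x₀ y := by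
  rw [𝒮.chartG_chartT hy]
  have h1 : 𝒮.chartJ x₀ y (𝒮.chartJ x₀ y u) = chartD x₀ _
      (𝒮.J ((extChartAt 𝓘(ℝ, E3) x₀).symm y) (chartDinv x₀ y (𝒮.chartJ x₀ y u))) := rfl
  rw [h1, 𝒮.chartDinv_chartJ hy, 𝒮.J_J, map_add, map_neg, map_smul, chartD_chartDinv hy]
  rfl

end fibre

section bracket

variable {x₀ : M} {y : E3}

/-- The vector field whose components in the preferred chart at `x₀` are constant. -/
def constField (x₀ : M) (u : E3) (x : M) : TangentSpace 𝓘(ℝ, E3) x :=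
  (chartDinv x₀ (extChartAt 𝓘(ℝ, E3) x₀ x) u : E3)

omit [IsManifold 𝓘(ℝ, E3) ∞ M] in
theorem mk_tangent_congr {x x' : M} (h : x = x') (u : E3) :
    (⟨x, u⟩ : TangentBundle 𝓘(ℝ, E3) M) = ⟨x', u⟩ := by subst h; rfl

omit [IsManifold 𝓘(ℝ, E3) ∞ M] in
theorem constField_symm (hy : y ∈ (extChartAt 𝓘(ℝ, E3) x₀).target) (u : E3) :
    constField x₀ u ((extChartAt 𝓘(ℝ, E3) x₀).symm y) = chartDinv x₀ y u := by
  have h : ∀ z, z = y → (chartDinv x₀ z u : E3) = (chartDinv x₀ y u : E3) := by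
    rintro z rfl; rfl
  exact h _ ((extChartAt 𝓘(ℝ, E3) x₀).right_inv hy)

theorem mdifferentiableAt_constField (hy : y ∈ (extChartAt 𝓘(ℝ, E3) x₀).target) (u : E3) :
    MDifferentiableAt 𝓘(ℝ, E3) 𝓘(ℝ, E3).tangent
      (fun x => (⟨x, constField x₀ u x⟩ : TangentBundle 𝓘(ℝ, E3) M))
      ((extChartAt 𝓘(ℝ, E3) x₀).symm y) := by
  have hx := (extChartAt 𝓘(ℝ, E3) x₀).map_target hy
  have r := (extChartAt 𝓘(ℝ, E3) x₀).right_inv hy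
  have h1 := ((contMDiffOn_chartDinv x₀ u).contMDiffAt (mem_nhds_target hy)).mdifferentiableAt (by simp)
  rw [← r] at h1
  have h2 := MDifferentiableAt.comp _ h1 (mdifferentiableAt_chart hx)
  refine h2.congr_of_eventuallyEq ?_
  filter_upwards [mem_nhds_source hx] with x hx'
  exact mk_tangent_congr ((extChartAt 𝓘(ℝ, E3) x₀).left_inv hx').symm _

theorem inverse_chartDinv (hy : y ∈ (extChartAt 𝓘(ℝ, E3) x₀).target) :
    (chartDinv x₀ y).inverse = chartD x₀ ((extChartAt 𝓘(ℝ, E3) x₀).symm y) :=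
  ContinuousLinearMap.inverse_eq (chartDinv_comp_chartD hy) (chartD_comp_chartDinv hy)

/-- The Lie bracket in a chart. -/
theorem chartD_mlieBracket (hy : y ∈ (extChartAt 𝓘(ℝ, E3) x₀).target)
    {U V : ∀ x : M, TangentSpace 𝓘(ℝ, E3) x}
    (hU : MDifferentiableAt 𝓘(ℝ, E3) 𝓘(ℝ, E3).tangent
      (fun y => (⟨y, U y⟩ : TangentBundle 𝓘(ℝ, E3) M)) ((extChartAt 𝓘(ℝ, E3) x₀).symm y))
    (hV : MDifferentiableAt 𝓘(ℝ, E3) 𝓘(ℝ, E3).tangent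
      (fun y => (⟨y, V y⟩ : TangentBundle 𝓘(ℝ, E3) M)) ((extChartAt 𝓘(ℝ, E3) x₀).symm y))
    {U' V' : E3 → E3} (hU' : ∀ᶠ z in 𝓝 y, chartD x₀ ((extChartAt 𝓘(ℝ, E3) x₀).symm z) (U _) = U' z)
    (hV' : ∀ᶠ z in 𝓝 y, chartD x₀ ((extChartAt 𝓘(ℝ, E3) x₀).symm z) (V _) = V' z) :
    chartD x₀ _ (VectorField.mlieBracket 𝓘(ℝ, E3) U V ((extChartAt 𝓘(ℝ, E3) x₀).symm y))
      = fderiv ℝ V' y (U' y) - fderiv ℝ U' y (V' y) := by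
  have : IsManifold 𝓘(ℝ, E3) (minSmoothness ℝ 2) M := by
    rw [minSmoothness_of_isRCLikeNormedField]; infer_instance
  have h1 := VectorField.mpullback_mlieBracket (n := ∞) hU hV
    ((contMDiffOn_symm x₀).contMDiffAt (mem_nhds_target hy))
    (by rw [minSmoothness_of_isRCLikeNormedField]; exact WithTop.coe_le_coe.2 le_top)
  have e : ∀ {W : ∀ x : M, TangentSpace 𝓘(ℝ, E3) x} {W' : E3 → E3},
      (∀ᶠ z in 𝓝 y, chartD x₀ ((extChartAt 𝓘(ℝ, E3) x₀).symm z) (W _) = W' z) →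
      ∀ᶠ z in 𝓝 y, VectorField.mpullback 𝓘(ℝ, E3) 𝓘(ℝ, E3) (extChartAt 𝓘(ℝ, E3) x₀).symm W z = W' z := by
    intro W W' hW
    filter_upwards [hW, mem_nhds_target hy] with z hz hz'
    rw [← hz, ← inverse_chartDinv hz']
    rfl
  let P : E3 → E3 := VectorField.mpullback 𝓘(ℝ, E3) 𝓘(ℝ, E3) (extChartAt 𝓘(ℝ, E3) x₀).symm U
  let Q : E3 → E3 := VectorField.mpullback 𝓘(ℝ, E3) 𝓘(ℝ, E3) (extChartAt 𝓘(ℝ, E3) x₀).symm V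
  have h2 : VectorField.mlieBracket 𝓘(ℝ, E3) P Q y = VectorField.lieBracketWithin ℝ P Q univ y :=
    congrFun (VectorField.mlieBracketWithin_eq_lieBracketWithin (V := P) (W := Q) (s := univ)) y
  have h3 : VectorField.lieBracketWithin ℝ P Q univ y = fderiv ℝ V' y (U' y) - fderiv ℝ U' y (V' y) := by
    have eP : P =ᶠ[𝓝 y] U' := e hU'
    have eQ : Q =ᶠ[𝓝 y] V' := e hV'
    rw [VectorField.lieBracketWithin_univ]
    simp only [VectorField.lieBracket]
    rw [eP.fderiv_eq, eQ.fderiv_eq, eP.eq_of_nhds, eQ.eq_of_nhds]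
  rw [← inverse_chartDinv hy]
  exact h1.trans (h2.trans h3)

theorem mdifferentiableAt_T (x : M) : MDifferentiableAt 𝓘(ℝ, E3) 𝓘(ℝ, E3).tangent
    (fun x => (⟨x, 𝒮.T x⟩ : TangentBundle 𝓘(ℝ, E3) M)) x :=
  𝒮.contMDiff_T.contMDiffAt.mdifferentiableAt (by simp)

theorem eventually_constField (hy : y ∈ (extChartAt 𝓘(ℝ, E3) x₀).target) (u : E3) :
    ∀ᶠ z in 𝓝 y, chartD x₀ ((extChartAt 𝓘(ℝ, E3) x₀).symm z) (constField x₀ u _) = u := by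
  filter_upwards [mem_nhds_target hy] with z hz
  rw [constField_symm hz, chartD_chartDinv hz]

theorem mlieBracket_constField (hy : y ∈ (extChartAt 𝓘(ℝ, E3) x₀).target) (u v : E3) :
    VectorField.mlieBracket 𝓘(ℝ, E3) (constField x₀ u) (constField x₀ v)
      ((extChartAt 𝓘(ℝ, E3) x₀).symm y) = 0 := by
  have h1 := chartD_mlieBracket hy (mdifferentiableAt_constField hy u)
    (mdifferentiableAt_constField hy v) (eventually_constField hy u) (eventually_constField hy v)
  rw [← chartDinv_chartD hy (VectorField.mlieBracket 𝓘(ℝ, E3) (constField x₀ u) (constField x₀ v)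
      ((extChartAt 𝓘(ℝ, E3) x₀).symm y)), h1]
  simp only [fderiv_fun_const, Pi.zero_apply, _root_.zero_apply, sub_zero]
  exact map_zero _

theorem chartD_mlieBracket_T (hy : y ∈ (extChartAt 𝓘(ℝ, E3) x₀).target) (u : E3) :
    chartD x₀ _ (VectorField.mlieBracket 𝓘(ℝ, E3) 𝒮.T (constField x₀ u)
      ((extChartAt 𝓘(ℝ, E3) x₀).symm y)) = -fderiv ℝ (𝒮.chartT x₀) y u := by
  have h1 := chartD_mlieBracket (U' := 𝒮.chartT x₀) hy (𝒮.mdifferentiableAt_T _)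
    (mdifferentiableAt_constField hy u) (Eventually.of_forall fun z => rfl) (eventually_constField hy u)
  rw [h1]
  simp

/-- The exterior derivative of the contact form in a chart. -/
theorem chart_dη (hy : y ∈ (extChartAt 𝓘(ℝ, E3) x₀).target) (u v : E3) :
    (1 / 2 : ℝ) * (fderiv ℝ (fun y => 𝒮.chartG x₀ y (𝒮.chartT x₀ y) v) y u
      - fderiv ℝ (fun y => 𝒮.chartG x₀ y (𝒮.chartT x₀ y) u) y v) = 𝒮.chartG x₀ y (𝒮.chartJ x₀ y u) v := by
  have h1 := 𝒮.dη_eq _ _ _ (mdifferentiableAt_constField hy u) (mdifferentiableAt_constField hy v)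
  have key : ∀ v, (fun y => 𝒮.η ((extChartAt 𝓘(ℝ, E3) x₀).symm y) (constField x₀ v _))
      =ᶠ[𝓝 y] fun y => 𝒮.chartG x₀ y (𝒮.chartT x₀ y) v := by
    intro v
    filter_upwards [mem_nhds_target hy] with z hz
    rw [constField_symm hz, 𝒮.chartG_chartT hz]
  have kd : ∀ v, DifferentiableAt ℝ (fun y => 𝒮.chartG x₀ y (𝒮.chartT x₀ y) v) y := fun v =>
    ((((𝒮.contDiffOn_chartG x₀).contDiffAt (mem_nhds_target hy)).clm_apply
      ((𝒮.contDiffOn_chartT x₀).contDiffAt (mem_nhds_target hy))).clm_apply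
        contDiffAt_const).differentiableAt (by simp)
  have k2 : ∀ u v, mvfderiv 𝓘(ℝ, E3) (fun y => 𝒮.η y (constField x₀ v y))
      ((extChartAt 𝓘(ℝ, E3) x₀).symm y) (constField x₀ u _)
      = fderiv ℝ (fun y => 𝒮.chartG x₀ y (𝒮.chartT x₀ y) v) y u := by
    intro u v
    rw [mvfderiv_eq_fderiv_chart (f := fun y => 𝒮.η y (constField x₀ v y)) hy
      ((kd v).congr_of_eventuallyEq (key v)), (key v).fderiv_eq, constField_symm hy,
      chartD_chartDinv hy]
  rw [k2 u v, k2 v u, mlieBracket_constField hy, map_zero, sub_zero, constField_symm hy,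
    constField_symm hy] at h1
  rw [h1, chartG_apply, 𝒮.chartDinv_chartJ hy]

/-- The Killing equation in a chart. -/
theorem chart_killing (hy : y ∈ (extChartAt 𝓘(ℝ, E3) x₀).target) (u v : E3) :
    fderiv ℝ (fun y => 𝒮.chartG x₀ y u v) y (𝒮.chartT x₀ y)
      + 𝒮.chartG x₀ y (fderiv ℝ (𝒮.chartT x₀) y u) v
      + 𝒮.chartG x₀ y u (fderiv ℝ (𝒮.chartT x₀) y v) = 0 := by
  have h1 := 𝒮.killing _ _ _ (mdifferentiableAt_constField hy u) (mdifferentiableAt_constField hy v)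
  have key : (fun y => 𝒮.g.inner ((extChartAt 𝓘(ℝ, E3) x₀).symm y) (constField x₀ u _) (constField x₀ v _))
      =ᶠ[𝓝 y] fun y => 𝒮.chartG x₀ y u v := by
    filter_upwards [mem_nhds_target hy] with z hz
    rw [constField_symm hz, constField_symm hz, 𝒮.chartG_apply]
  have kd : DifferentiableAt ℝ (fun y => 𝒮.chartG x₀ y u v) y :=
    ((((𝒮.contDiffOn_chartG x₀).contDiffAt (mem_nhds_target hy)).clm_apply
      contDiffAt_const).clm_apply contDiffAt_const).differentiableAt (by simp)
  have k2 : mvfderiv 𝓘(ℝ, E3) (fun y => 𝒮.g.inner y (constField x₀ u y) (constField x₀ v y))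
      ((extChartAt 𝓘(ℝ, E3) x₀).symm y) (𝒮.T _)
      = fderiv ℝ (fun y => 𝒮.chartG x₀ y u v) y (𝒮.chartT x₀ y) := by
    rw [mvfderiv_eq_fderiv_chart (f := fun y => 𝒮.g.inner y (constField x₀ u y) (constField x₀ v y)) hy
      (kd.congr_of_eventuallyEq key), key.fderiv_eq]
    rfl
  have k3 : ∀ u, VectorField.mlieBracket 𝓘(ℝ, E3) 𝒮.T (constField x₀ u)
      ((extChartAt 𝓘(ℝ, E3) x₀).symm y) = chartDinv x₀ y (-fderiv ℝ (𝒮.chartT x₀) y u) := by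
    intro u
    rw [← 𝒮.chartD_mlieBracket_T hy, chartDinv_chartD hy]
  rw [k2, k3, k3, constField_symm hy, constField_symm hy, ← 𝒮.chartG_apply, ← 𝒮.chartG_apply] at h1
  rw [h1]
  simp

end bracket

end SasakianStructure
end SubRiem

namespace SubRiem

/-! ### Christoffel symbols -/

section christoffel

variable {E : Type*} [NormedAddCommGroup E] [NormedSpace ℝ E]

/-- The Christoffel symbols of the first kind, as a trilinear map. -/
def loweredChristoffel (G : E → E →L[ℝ] E →L[ℝ] ℝ) (y : E) : E →L[ℝ] E →L[ℝ] E →L[ℝ] ℝ :=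
  (1 / 2 : ℝ) • (fderiv ℝ G y + (fderiv ℝ G y).flip
    - (ContinuousLinearMap.flipₗᵢ ℝ E E ℝ).toContinuousLinearEquiv.toContinuousLinearMap ∘L
      (fderiv ℝ G y).flip)

/-- The Christoffel symbols of the second kind, as a bilinear map. -/
def secondChristoffel (G : E → E →L[ℝ] E →L[ℝ] ℝ) (y : E) : E →L[ℝ] E →L[ℝ] E :=
  (ContinuousLinearMap.compL ℝ E (E →L[ℝ] ℝ) E (G y).inverse) ∘L loweredChristoffel G y

theorem loweredChristoffel_apply (G : E → E →L[ℝ] E →L[ℝ] ℝ) (y u v w : E) :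
    loweredChristoffel G y u v w
      = (1 / 2 : ℝ) * (fderiv ℝ G y u v w + fderiv ℝ G y v u w - fderiv ℝ G y w u v) := rfl

variable {G : E → E →L[ℝ] E →L[ℝ] ℝ} {y : E}

theorem isInvertible_of_pos [FiniteDimensional ℝ E] (hpos : ∀ u, u ≠ 0 → 0 < G y u u) :
    (G y).IsInvertible := by
  have hinj : Function.Injective (G y).toLinearMap := by
    rw [← LinearMap.ker_eq_bot, LinearMap.ker_eq_bot']
    intro u hu
    by_contra hne
    have h1 := hpos u hne
    have h2 : G y u = 0 := hu
    rw [h2] at h1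
    exact lt_irrefl _ h1
  have hfr : Module.finrank ℝ E = Module.finrank ℝ (E →L[ℝ] ℝ) := by
    rw [← (LinearMap.toContinuousLinearMap (𝕜 := ℝ) (E := E) (F' := ℝ)).finrank_eq]
    exact (Subspace.dual_finrank_eq (K := ℝ) (V := E)).symm
  refine ⟨(LinearEquiv.ofInjectiveOfFinrankEq (G y).toLinearMap hinj hfr).toContinuousLinearEquiv, ?_⟩
  ext u v
  rfl

theorem inner_secondChristoffel [FiniteDimensional ℝ E] (hpos : ∀ u, u ≠ 0 → 0 < G y u u) (u v w : E) :
    G y (secondChristoffel G y u v) w = loweredChristoffel G y u v w := by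
  have h := (isInvertible_of_pos hpos).self_comp_inverse
  exact congrArg (fun L : (E →L[ℝ] ℝ) →L[ℝ] (E →L[ℝ] ℝ) => L (loweredChristoffel G y u v) w) h

theorem contDiffOn_secondChristoffel [FiniteDimensional ℝ E] [CompleteSpace E] {O : Set E} (hO : IsOpen O)
    (hG : ContDiffOn ℝ ∞ G O) (hpos : ∀ y ∈ O, ∀ u, u ≠ 0 → 0 < G y u u) :
    ContDiffOn ℝ ∞ (secondChristoffel G) O := by
  intro y hy
  have hGy := hG.contDiffAt (hO.mem_nhds hy)
  have h1 : ContDiffAt ℝ ∞ (fderiv ℝ G) y := hGy.fderiv_right (by simp)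
  have h2 : ContDiffAt ℝ ∞ (fun y => (fderiv ℝ G y).flip) y :=
    (ContinuousLinearMap.flipₗᵢ ℝ E E (E →L[ℝ] ℝ)).contDiff.contDiffAt.comp y h1
  have h3 : ContDiffAt ℝ ∞ (loweredChristoffel G) y := by
    unfold loweredChristoffel
    exact ((h1.add h2).sub (contDiffAt_const.clm_comp h2)).const_smul (1 / 2 : ℝ)
  obtain ⟨e, he⟩ := isInvertible_of_pos (hpos y hy)
  have h4 : ContDiffAt ℝ ∞ (fun y => (G y).inverse) y := by
    have h5 := contDiffAt_map_inverse (𝕜 := ℝ) (n := ∞) e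
    rw [he] at h5
    exact h5.comp y hGy
  exact ((((ContinuousLinearMap.compL ℝ E (E →L[ℝ] ℝ) E).contDiff.contDiffAt.comp y h4).clm_comp
    h3)).contDiffWithinAt

theorem eq_of_inner_eq (hpos : ∀ u, u ≠ 0 → 0 < G y u u) {u v : E} (h : ∀ w, G y u w = G y v w) :
    u = v := by
  by_contra hne
  have h1 := hpos (u - v) (sub_ne_zero.2 hne)
  have h2 : G y (u - v) (u - v) = G y u (u - v) - G y v (u - v) := by
    rw [map_sub (G y)]; rfl
  rw [h2, h, sub_self] at h1
  exact lt_irrefl _ h1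

theorem fderiv_apply_apply (hG : DifferentiableAt ℝ G y) (a b u : E) :
    fderiv ℝ (fun y => G y a b) y u = fderiv ℝ G y u a b := by
  have := (fderiv_bilin_apply (F := fun y => y) (A := fun _ => a) (B := fun _ => b) hG
    differentiableAt_id (differentiableAt_const _) (differentiableAt_const _)).2 u
  rw [this]
  simp

theorem fderiv_symm {O : Set E} (hO : IsOpen O) (hG : ContDiffOn ℝ ∞ G O) (hy : y ∈ O)
    (hs : ∀ y ∈ O, ∀ u v, G y u v = G y v u) (u a b : E) : fderiv ℝ G y u a b = fderiv ℝ G y u b a := by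
  have hd := (hG.contDiffAt (hO.mem_nhds hy)).differentiableAt (by simp)
  rw [← fderiv_apply_apply hd, ← fderiv_apply_apply hd]
  have : (fun y => G y a b) =ᶠ[𝓝 y] fun y => G y b a := by
    filter_upwards [hO.mem_nhds hy] with z hz using hs z hz a b
  rw [this.fderiv_eq]

end christoffel

namespace SasakianStructure

variable {M : Type*} [TopologicalSpace M] [ChartedSpace E3 M] [IsManifold 𝓘(ℝ, E3) ∞ M]
variable (𝒮 : SasakianStructure M)

/-- The Christoffel symbols in the preferred chart at `x₀`. -/
def chartΓ (x₀ : M) : E3 → E3 →L[ℝ] E3 →L[ℝ] E3 := secondChristoffel (𝒮.chartG x₀)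

theorem differentiableAt_chartG {x₀ : M} {y : E3} (hy : y ∈ (extChartAt 𝓘(ℝ, E3) x₀).target) :
    DifferentiableAt ℝ (𝒮.chartG x₀) y :=
  ((𝒮.contDiffOn_chartG x₀).contDiffAt (mem_nhds_target hy)).differentiableAt (by simp)

theorem differentiableAt_chartT {x₀ : M} {y : E3} (hy : y ∈ (extChartAt 𝓘(ℝ, E3) x₀).target) :
    DifferentiableAt ℝ (𝒮.chartT x₀) y :=
  ((𝒮.contDiffOn_chartT x₀).contDiffAt (mem_nhds_target hy)).differentiableAt (by simp)

/-- The Christoffel symbols computed with the inverse of the matrix of the metric are the components of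
the symbols determined by the metric as a bilinear form. -/
theorem christoffel_eq {x₀ : M} {y : E3} (hy : y ∈ (extChartAt 𝓘(ℝ, E3) x₀).target) (u v : E3) :
    𝒮.christoffel x₀ y u v = 𝒮.chartΓ x₀ y u v := by
  have hpos : ∀ u, u ≠ 0 → 0 < 𝒮.chartG x₀ y u u := fun u => 𝒮.chartG_pos hy
  have hd := 𝒮.differentiableAt_chartG hy
  refine eq_of_inner_eq hpos fun w => ?_
  rw [chartΓ, inner_secondChristoffel hpos]
  set A := 𝒮.metricMatrix x₀ y with hA
  have hAij : ∀ i j, A i j = 𝒮.chartG x₀ y (b3 i) (b3 j) := fun i j => rfl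
  have hAs : ∀ i j, A i j = A j i := fun i j => 𝒮.chartG_symm _ _
  have expand : ∀ z : E3, z = ∑ i, z i • b3 i := fun z => by
    ext k
    simp [Finset.sum_apply, Pi.single_apply]
  have hdet : IsUnit A.det := by
    rw [isUnit_iff_ne_zero]
    intro h0
    obtain ⟨v, hv, hv0⟩ := Matrix.exists_mulVec_eq_zero_iff.2 h0
    have hz : WithLp.toLp 2 v ≠ (0 : E3) := fun h => hv (by simpa using congrArg (WithLp.ofLp) h)
    have h1 := hpos _ hz
    have h2 : 𝒮.chartG x₀ y (WithLp.toLp 2 v) (WithLp.toLp 2 v) = v ⬝ᵥ A.mulVec v := by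
      conv_lhs => rw [expand (WithLp.toLp 2 v)]
      simp only [map_sum, map_smul, _root_.sum_apply, _root_.smul_apply, smul_eq_mul, dotProduct,
        Matrix.mulVec, Finset.mul_sum, hAij]
      refine Finset.sum_congr rfl fun i _ => Finset.sum_congr rfl fun j _ => ?_
      rw [𝒮.chartG_symm (b3 j)]; ring
    rw [h2, hv0] at h1
    simp at h1
  have hbase : ∀ j, 𝒮.chartG x₀ y (𝒮.christoffel x₀ y u v) (b3 j)
      = loweredChristoffel (𝒮.chartG x₀) y u v (b3 j) := by
    intro j
    set L := fun l => loweredChristoffel (𝒮.chartG x₀) y u v (b3 l)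
    have hk : ∀ k, 𝒮.christoffel x₀ y u v k = ∑ l, A⁻¹ k l * L l := by
      intro k
      simp only [christoffel, L, loweredChristoffel_apply, Finset.mul_sum, metricInChart_eq]
      refine Finset.sum_congr rfl fun l _ => ?_
      rw [fderiv_apply_apply hd, fderiv_apply_apply hd, fderiv_apply_apply hd]
      ring
    rw [expand (𝒮.christoffel x₀ y u v)]
    simp only [map_sum, map_smul, _root_.sum_apply, _root_.smul_apply, smul_eq_mul, hk]
    have h1 : A.mulVec (A⁻¹.mulVec L) j = L j := by
      rw [Matrix.mulVec_mulVec, Matrix.mul_nonsing_inv _ hdet, Matrix.one_mulVec]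
    simp only [Matrix.mulVec, dotProduct] at h1
    refine Eq.trans (Finset.sum_congr rfl fun k _ => ?_) h1
    rw [hAs, hAij]; ring
  rw [expand w]
  simp only [map_sum, map_smul, hbase]

/-- The coordinate expressions of a Sasakian structure in a preferred chart.  The formula for `dη` gives
the skew part, and the Killing equation the symmetric part, of `D_u T = J u`. -/
theorem isSasakianChart (x₀ : M) : IsSasakianChart (𝒮.chartG x₀) (𝒮.chartΓ x₀) (𝒮.chartT x₀)
    (𝒮.chartJ x₀) (extChartAt 𝓘(ℝ, E3) x₀).target := by
  have hO := isOpen_extChartAt_target (I := 𝓘(ℝ, E3)) x₀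
  have hG := 𝒮.contDiffOn_chartG x₀
  have hpos : ∀ y ∈ (extChartAt 𝓘(ℝ, E3) x₀).target, ∀ u, u ≠ 0 → 0 < 𝒮.chartG x₀ y u u :=
    fun y hy u => 𝒮.chartG_pos hy
  have hs : ∀ y ∈ (extChartAt 𝓘(ℝ, E3) x₀).target, ∀ u v, 𝒮.chartG x₀ y u v = 𝒮.chartG x₀ y v u :=
    fun y hy u v => 𝒮.chartG_symm u v
  have hΓ : ∀ y ∈ (extChartAt 𝓘(ℝ, E3) x₀).target, ∀ u v w,
      𝒮.chartG x₀ y (𝒮.chartΓ x₀ y u v) w = (1 / 2 : ℝ) * (fderiv ℝ (𝒮.chartG x₀) y u v w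
        + fderiv ℝ (𝒮.chartG x₀) y v u w - fderiv ℝ (𝒮.chartG x₀) y w u v) :=
    fun y hy u v w => inner_secondChristoffel (hpos y hy) u v w
  have hsymm : ∀ y ∈ (extChartAt 𝓘(ℝ, E3) x₀).target, ∀ u v, 𝒮.chartΓ x₀ y u v = 𝒮.chartΓ x₀ y v u := by
    intro y hy u v
    refine eq_of_inner_eq (hpos y hy) fun w => ?_
    rw [hΓ y hy, hΓ y hy, fderiv_symm hO hG hy hs w u v]
    ring
  have hcompat : ∀ y ∈ (extChartAt 𝓘(ℝ, E3) x₀).target, ∀ a b u,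
      fderiv ℝ (fun y => 𝒮.chartG x₀ y a b) y u = 𝒮.chartG x₀ y (𝒮.chartΓ x₀ y u a) b
        + 𝒮.chartG x₀ y a (𝒮.chartΓ x₀ y u b) := by
    intro y hy a b u
    rw [hs y hy a, hΓ y hy, hΓ y hy, fderiv_apply_apply (𝒮.differentiableAt_chartG hy),
      fderiv_symm hO hG hy hs b u a, fderiv_symm hO hG hy hs a u b, fderiv_symm hO hG hy hs u b a]
    ring
  have dGT : ∀ y ∈ (extChartAt 𝓘(ℝ, E3) x₀).target, ∀ u v,
      fderiv ℝ (fun y => 𝒮.chartG x₀ y (𝒮.chartT x₀ y) v) y u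
        = fderiv ℝ (𝒮.chartG x₀) y u (𝒮.chartT x₀ y) v + 𝒮.chartG x₀ y (fderiv ℝ (𝒮.chartT x₀) y u) v := by
    intro y hy u v
    have := (fderiv_bilin_apply (F := fun y => y) (A := 𝒮.chartT x₀) (B := fun _ => v)
      (𝒮.differentiableAt_chartG hy) differentiableAt_id (𝒮.differentiableAt_chartT hy)
      (differentiableAt_const _)).2 u
    rw [this]
    simp
  refine ⟨hO, hG, contDiffOn_secondChristoffel hO hG hpos, 𝒮.contDiffOn_chartT x₀,
    𝒮.contDiffOn_chartJ x₀, hs, hpos, hsymm, hcompat, fun y hy => 𝒮.chartT_unit hy,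
    fun y hy => 𝒮.chartJ_chartJ hy, ?_, ?_⟩
  · intro y hy u v
    rw [hs y hy u, ← 𝒮.chart_dη hy, ← 𝒮.chart_dη hy]
    ring
  · intro y hy u
    refine eq_of_inner_eq (hpos y hy) fun v => ?_
    have h1 := 𝒮.chart_dη hy u v
    have h2 := 𝒮.chart_killing hy u v
    have h3 := hcompat y hy u v (𝒮.chartT x₀ y)
    have h4 := hcompat y hy (𝒮.chartT x₀ y) v u
    have h5 := hcompat y hy (𝒮.chartT x₀ y) u v
    have hd := 𝒮.differentiableAt_chartG hy
    rw [fderiv_apply_apply hd] at h4 h5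
    rw [dGT y hy, dGT y hy, h4, h5] at h1
    rw [h3, hsymm y hy _ u, hsymm y hy _ v, hs y hy u, hs y hy u] at h2
    rw [hsymm y hy v u] at h1
    simp only [map_add, _root_.add_apply]
    linarith

end SasakianStructure
end SubRiem

namespace SubRiem

/-! ### Changes of coordinates -/

/-- The map `τ` is an isometric change of coordinates near `y`. -/
structure IsTransition {E : Type*} [NormedAddCommGroup E] [NormedSpace ℝ E]
    (G₀ G₁ : E → E →L[ℝ] E →L[ℝ] ℝ) (O₀ O₁ : Set E) (τ : E → E) (y : E) : Prop where
  mem₀ : y ∈ O₀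
  mem₁ : τ y ∈ O₁
  contDiffAt : ContDiffAt ℝ ∞ τ y
  surj : Function.Surjective (fderiv ℝ τ y)
  isometry : ∀ᶠ z in 𝓝 y, ∀ u v, G₁ (τ z) (fderiv ℝ τ z u) (fderiv ℝ τ z v) = G₀ z u v

theorem two_le_infty : (2 : WithTop ℕ∞) ≤ (∞ : WithTop ℕ∞) := WithTop.coe_le_coe.2 le_top

theorem add_two_le_infty : (2 : WithTop ℕ∞) + 1 ≤ (∞ : WithTop ℕ∞) := WithTop.coe_le_coe.2 le_top

namespace IsSasakianChart

variable {E : Type*} [NormedAddCommGroup E] [NormedSpace ℝ E]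
  {G₀ G₁ : E → E →L[ℝ] E →L[ℝ] ℝ} {Γ₀ Γ₁ : E → E →L[ℝ] E →L[ℝ] E} {T₀ T₁ : E → E}
  {J₀ J₁ : E → E →L[ℝ] E} {O₀ O₁ : Set E} {τ : E → E} {y : E}
variable {D : Type*} [NormedAddCommGroup D] [NormedSpace ℝ D]

section
variable (h₀ : IsSasakianChart G₀ Γ₀ T₀ J₀ O₀) (h₁ : IsSasakianChart G₁ Γ₁ T₁ J₁ O₁)
include h₀ h₁

/-- An isometry preserves the Levi-Civita connection, which is the only torsion-free metric
connection. -/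
theorem cov_fderiv_transition (ht : IsTransition G₀ G₁ O₀ O₁ τ y) (u v : E) :
    cov Γ₁ τ (fun z => fderiv ℝ τ z v) u y = fderiv ℝ τ y (Γ₀ y u v) := by
  have hc2 : ContDiffAt ℝ 2 τ y := ht.contDiffAt.of_le two_le_infty
  have hd : DifferentiableAt ℝ τ y := hc2.differentiableAt (by simp)
  have hdv : ∀ v, DifferentiableAt ℝ (fun z => fderiv ℝ τ z v) y := differentiableAt_fderiv_apply hc2
  have hA : ∀ u v, cov Γ₁ τ (fun z => fderiv ℝ τ z v) u y = cov Γ₁ τ (fun z => fderiv ℝ τ z u) v y :=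
    fun u v => h₁.cov_fderiv_comm hc2 ht.mem₁ u v
  have hiso := ht.isometry.self_of_nhds
  have key : ∀ w u v, G₁ (τ y) (cov Γ₁ τ (fun z => fderiv ℝ τ z u) w y) (fderiv ℝ τ y v)
      + G₁ (τ y) (fderiv ℝ τ y u) (cov Γ₁ τ (fun z => fderiv ℝ τ z v) w y)
      = G₀ y (Γ₀ y w u) v + G₀ y u (Γ₀ y w v) := by
    intro w u v
    rw [← h₀.compat y ht.mem₀, ← h₁.fderiv_inner hd ht.mem₁ (hdv u) (hdv v)]
    have : (fun z => G₁ (τ z) (fderiv ℝ τ z u) (fderiv ℝ τ z v)) =ᶠ[𝓝 y] fun z => G₀ z u v := by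
      filter_upwards [ht.isometry] with z hz using hz u v
    rw [this.fderiv_eq]
  -- the Koszul argument: the three cyclic instances of `key` and the symmetry of both connections
  refine eq_of_inner_eq (h₁.G_pos _ ht.mem₁) fun w' => ?_
  obtain ⟨w, rfl⟩ := ht.surj w'
  rw [hiso]
  have k1 := key u v w
  have k2 := key v w u
  have k3 := key w u v
  have s₁ := h₁.G_symm _ ht.mem₁
  have s₀ := h₀.G_symm _ ht.mem₀
  have t := h₀.Γ_symm _ ht.mem₀
  rw [s₁ (fderiv ℝ τ y v), s₀ v] at k1
  rw [s₁ (fderiv ℝ τ y w), s₀ w] at k2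
  rw [s₁ (fderiv ℝ τ y u), s₀ u] at k3
  have a1 := congrArg (fun a => G₁ (τ y) a (fderiv ℝ τ y v)) (hA u w)
  have a2 := congrArg (fun a => G₁ (τ y) a (fderiv ℝ τ y u)) (hA v w)
  have a3 := congrArg (fun a => G₁ (τ y) a (fderiv ℝ τ y w)) (hA u v)
  have b1 := congrArg (fun a => G₀ y a v) (t u w)
  have b2 := congrArg (fun a => G₀ y a u) (t v w)
  have b3 := congrArg (fun a => G₀ y a w) (t u v)
  linarith

theorem cov_transition (ht : IsTransition G₀ G₁ O₀ O₁ τ y) {F A : D → E} {q : D} (hF : DifferentiableAt ℝ F q)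
    (hq : F q = y) (hA : DifferentiableAt ℝ A q) (v : D) :
    cov Γ₁ (fun q => τ (F q)) (fun q => fderiv ℝ τ (F q) (A q)) v q = fderiv ℝ τ y (cov Γ₀ F A v q) := by
  subst hq
  have hc2 : ContDiffAt ℝ 2 τ (F q) := ht.contDiffAt.of_le two_le_infty
  have hd : DifferentiableAt ℝ τ (F q) := hc2.differentiableAt (by simp)
  have hd2 : DifferentiableAt ℝ (fderiv ℝ τ) (F q) :=
    (hc2.fderiv_right (m := 1) (by norm_num)).differentiableAt (by simp)
  have e1 : fderiv ℝ (fun q => fderiv ℝ τ (F q) (A q)) q v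
      = fderiv ℝ (fderiv ℝ τ) (F q) (fderiv ℝ F q v) (A q) + fderiv ℝ τ (F q) (fderiv ℝ A q v) := by
    have := ((hd2.hasFDerivAt.comp q hF.hasFDerivAt).clm_apply hA.hasFDerivAt).fderiv
    have h3 : fderiv ℝ (fun q => fderiv ℝ τ (F q) (A q)) q = _ := this
    rw [h3]
    simp [add_comm]
  have e2 : fderiv ℝ (fun q => τ (F q)) q v = fderiv ℝ τ (F q) (fderiv ℝ F q v) := by
    have h3 : fderiv ℝ (fun q => τ (F q)) q = _ := (hd.hasFDerivAt.comp q hF.hasFDerivAt).fderiv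
    rw [h3]; rfl
  have e3 := h₀.cov_fderiv_transition h₁ ht (fderiv ℝ F q v) (A q)
  have e4 : fderiv ℝ (fun z => fderiv ℝ τ z (A q)) (F q) (fderiv ℝ F q v)
      = fderiv ℝ (fderiv ℝ τ) (F q) (fderiv ℝ F q v) (A q) := by
    rw [(hd2.hasFDerivAt.clm_apply (hasFDerivAt_const (A q) (F q))).fderiv]; simp
  simp only [cov] at e3 ⊢
  rw [e4] at e3
  rw [e1, e2, map_add, ← e3]
  abel

/-- An isometric change of coordinates preserves the curvature, which is a commutator of covariant
derivatives. -/
theorem riem_transition (ht : ∀ᶠ z in 𝓝 y, IsTransition G₀ G₁ O₀ O₁ τ z) (u v w : E) :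
    riem Γ₁ (τ y) (fderiv ℝ τ y u) (fderiv ℝ τ y v) (fderiv ℝ τ y w)
      = fderiv ℝ τ y (riem Γ₀ y u v w) := by
  have h := ht.self_of_nhds
  have hc2 : ContDiffAt ℝ 2 τ y := h.contDiffAt.of_le two_le_infty
  have hw : ContDiffAt ℝ 2 (fun z => fderiv ℝ τ z w) y :=
    ((h.contDiffAt.fderiv_right (m := 2) add_two_le_infty).clm_apply contDiffAt_const)
  rw [← h₁.cov_cov_sub hc2 h.mem₁ hw]
  have e0 : ∀ v, cov Γ₁ τ (fun z => fderiv ℝ τ z w) v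
      =ᶠ[𝓝 y] fun z => fderiv ℝ τ z (Γ₀ z v w) := by
    intro v
    filter_upwards [ht] with z hz using h₀.cov_fderiv_transition h₁ hz v w
  have e1 : ∀ u v, cov Γ₁ τ (cov Γ₁ τ (fun z => fderiv ℝ τ z w) v) u y
      = fderiv ℝ τ y (cov Γ₀ id (fun z => Γ₀ z v w) u y) := by
    intro u v
    have e2 := h₀.cov_transition h₁ h (F := id) (q := y) differentiableAt_id rfl
      (h₀.differentiableAt_Γ_apply h.mem₀ v w) u
    rw [← e2]
    have e3 : cov Γ₁ τ (cov Γ₁ τ (fun z => fderiv ℝ τ z w) v) u y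
        = cov Γ₁ τ (fun z => fderiv ℝ τ z (Γ₀ z v w)) u y := by
      unfold cov
      exact congrArg₂ (· + ·) (by rw [← (e0 v).fderiv_eq]; rfl)
        (congrArg (Γ₁ (τ y) (fderiv ℝ τ y u)) (e0 v).eq_of_nhds)
    exact e3
  rw [e1, e1, ← map_sub]
  have := h₀.cov_cov_sub (F := id) (q := y) (A := fun _ => w) contDiffAt_id h.mem₀ contDiffAt_const u v
  rw [cov_id_const, cov_id_const] at this
  rw [this]
  simp

end

end IsSasakianChart
end SubRiem

namespace SubRiem
section chartD

variable {E : Type*} [NormedAddCommGroup E] [NormedSpace ℝ E]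
  {N : Type*} [TopologicalSpace N] [ChartedSpace E N] [IsManifold 𝓘(ℝ, E) 1 N] {x₀ x : N}

theorem chartD_injective (hx : x ∈ (extChartAt 𝓘(ℝ, E) x₀).source) :
    Function.Injective (chartD (E := E) x₀ x) := by
  obtain ⟨y, hy, rfl⟩ := exists_symm_eq hx
  exact Function.LeftInverse.injective (chartDinv_chartD hy)

theorem chartD_surjective (hx : x ∈ (extChartAt 𝓘(ℝ, E) x₀).source) :
    Function.Surjective (chartD (E := E) x₀ x) := by
  obtain ⟨y, hy, rfl⟩ := exists_symm_eq hx
  exact Function.RightInverse.surjective (chartD_chartDinv hy)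

theorem chartDinv_self (x : N) (u : E) : (chartDinv x (extChartAt 𝓘(ℝ, E) x x) u : E) = u := by
  have h1 := chartD_chartDinv (mem_extChartAt_target (I := 𝓘(ℝ, E)) x) u
  have e3 : ∀ z, z = x → chartD (E := E) x z = (chartD x x : E →L[ℝ] E) := by rintro z rfl; rfl
  have h3 : (chartD x ((extChartAt 𝓘(ℝ, E) x).symm (extChartAt 𝓘(ℝ, E) x x)) : E →L[ℝ] E)
      = ContinuousLinearMap.id ℝ E :=
    (e3 _ ((extChartAt 𝓘(ℝ, E) x).left_inv (mem_extChartAt_source x))).trans (chartD_self x)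
  exact (congrArg (fun L : E →L[ℝ] E => L (chartDinv x (extChartAt 𝓘(ℝ, E) x x) u : E))
    h3).symm.trans h1

end chartD

namespace SasakianStructure

variable {M : Type*} [TopologicalSpace M] [ChartedSpace E3 M] [IsManifold 𝓘(ℝ, E3) ∞ M]
variable (𝒮 : SasakianStructure M)

section pointwise

variable {x₀ x : M}

theorem inner_chartD (hx : x ∈ (extChartAt 𝓘(ℝ, E3) x₀).source) (u v : TangentSpace 𝓘(ℝ, E3) x) :
    𝒮.chartG x₀ (extChartAt 𝓘(ℝ, E3) x₀ x) (chartD x₀ x u) (chartD x₀ x v) = 𝒮.g.inner x u v := by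
  obtain ⟨y, hy, rfl⟩ := exists_symm_eq hx
  rw [(extChartAt 𝓘(ℝ, E3) x₀).right_inv hy, chartG_apply, chartDinv_chartD hy, chartDinv_chartD hy]

theorem chartD_T (hx : x ∈ (extChartAt 𝓘(ℝ, E3) x₀).source) :
    chartD x₀ x (𝒮.T x) = 𝒮.chartT x₀ (extChartAt 𝓘(ℝ, E3) x₀ x) := by
  obtain ⟨y, hy, rfl⟩ := exists_symm_eq hx
  rw [(extChartAt 𝓘(ℝ, E3) x₀).right_inv hy, chartT]

theorem chartD_J (hx : x ∈ (extChartAt 𝓘(ℝ, E3) x₀).source) (u : TangentSpace 𝓘(ℝ, E3) x) :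
    chartD x₀ x (𝒮.J x u) = 𝒮.chartJ x₀ (extChartAt 𝓘(ℝ, E3) x₀ x) (chartD x₀ x u) := by
  obtain ⟨y, hy, rfl⟩ := exists_symm_eq hx
  rw [(extChartAt 𝓘(ℝ, E3) x₀).right_inv hy]
  conv_lhs => rw [← chartDinv_chartD hy u]
  rfl

theorem η_chartD (hx : x ∈ (extChartAt 𝓘(ℝ, E3) x₀).source) (u : TangentSpace 𝓘(ℝ, E3) x) :
    𝒮.chartG x₀ (extChartAt 𝓘(ℝ, E3) x₀ x) (𝒮.chartT x₀ (extChartAt 𝓘(ℝ, E3) x₀ x)) (chartD x₀ x u)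
      = 𝒮.η x u := by
  rw [← 𝒮.chartD_T hx, 𝒮.inner_chartD hx, 𝒮.g_T]

end pointwise

section transition

variable {x₀ x₁ : M} {y : E3}

theorem fderiv_transition (hy : y ∈ (extChartAt 𝓘(ℝ, E3) x₀).target)
    (hy' : (extChartAt 𝓘(ℝ, E3) x₀).symm y ∈ (extChartAt 𝓘(ℝ, E3) x₁).source) (u : E3) :
    fderiv ℝ (fun z => extChartAt 𝓘(ℝ, E3) x₁ ((extChartAt 𝓘(ℝ, E3) x₀).symm z)) y u
      = chartD x₁ _ (chartDinv x₀ y u) :=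
  fderiv_chart_comp (mdifferentiableAt_chart_symm hy) hy' u

theorem eventually_transition (hy : y ∈ (extChartAt 𝓘(ℝ, E3) x₀).target)
    (hy' : (extChartAt 𝓘(ℝ, E3) x₀).symm y ∈ (extChartAt 𝓘(ℝ, E3) x₁).source) :
    ∀ᶠ z in 𝓝 y, z ∈ (extChartAt 𝓘(ℝ, E3) x₀).target ∧
      (extChartAt 𝓘(ℝ, E3) x₀).symm z ∈ (extChartAt 𝓘(ℝ, E3) x₁).source :=
  Eventually.and (mem_nhds_target hy) ((mdifferentiableAt_chart_symm hy).continuousAt.eventually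
    (mem_nhds_source hy'))

theorem isTransition (hy : y ∈ (extChartAt 𝓘(ℝ, E3) x₀).target)
    (hy' : (extChartAt 𝓘(ℝ, E3) x₀).symm y ∈ (extChartAt 𝓘(ℝ, E3) x₁).source) :
    IsTransition (𝒮.chartG x₀) (𝒮.chartG x₁) (extChartAt 𝓘(ℝ, E3) x₀).target
      (extChartAt 𝓘(ℝ, E3) x₁).target
      (fun z => extChartAt 𝓘(ℝ, E3) x₁ ((extChartAt 𝓘(ℝ, E3) x₀).symm z)) y := by
  refine ⟨hy, (extChartAt 𝓘(ℝ, E3) x₁).map_source hy', ?_, ?_, ?_⟩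
  · have h0 : ContMDiffOn 𝓘(ℝ, E3) 𝓘(ℝ, E3) ∞ (extChartAt 𝓘(ℝ, E3) x₁)
      (extChartAt 𝓘(ℝ, E3) x₁).source := by
      rw [extChartAt_source]; exact contMDiffOn_extChartAt
    exact ((h0.contMDiffAt (mem_nhds_source hy')).comp y
      ((contMDiffOn_symm x₀).contMDiffAt (mem_nhds_target hy))).contDiffAt
  · intro w
    obtain ⟨u, rfl⟩ := chartD_surjective hy' w
    exact ⟨chartD x₀ _ u, by rw [fderiv_transition hy hy', chartDinv_chartD hy]⟩
  · filter_upwards [eventually_transition hy hy'] with z hz u v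
    rw [fderiv_transition hz.1 hz.2, fderiv_transition hz.1 hz.2, 𝒮.inner_chartD hz.2, chartG_apply]

end transition

section curvature

theorem curvature_eq (x : M) (u v w : TangentSpace 𝓘(ℝ, E3) x) :
    𝒮.curvature x u v w = (riem (𝒮.chartΓ x) (extChartAt 𝓘(ℝ, E3) x x) u v w : E3) := by
  have hy := mem_extChartAt_target (I := 𝓘(ℝ, E3)) x
  have h := 𝒮.isSasakianChart x
  have e : ∀ u v w : E3, fderiv ℝ (fun y => 𝒮.christoffel x y v w) (extChartAt 𝓘(ℝ, E3) x x) u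
      = fderiv ℝ (𝒮.chartΓ x) (extChartAt 𝓘(ℝ, E3) x x) u v w := by
    intro u v w
    have e1 : (fun y => 𝒮.christoffel x y v w) =ᶠ[𝓝 (extChartAt 𝓘(ℝ, E3) x x)]
        fun y => 𝒮.chartΓ x y v w := by
      filter_upwards [mem_nhds_target hy] with z hz using 𝒮.christoffel_eq hz v w
    rw [e1.fderiv_eq]
    simpa using (fderiv_bilin_apply (F := id) (A := fun _ => v) (B := fun _ => w)
      (h.differentiableAt_Γ hy) differentiableAt_id (differentiableAt_const v)
      (differentiableAt_const w)).2 u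
  have c := 𝒮.christoffel_eq hy
  have key : ∀ u v w : E3, fderiv ℝ (fun y => 𝒮.christoffel x y v w) (extChartAt 𝓘(ℝ, E3) x x) u
      - fderiv ℝ (fun y => 𝒮.christoffel x y u w) (extChartAt 𝓘(ℝ, E3) x x) v
      + 𝒮.christoffel x (extChartAt 𝓘(ℝ, E3) x x) u (𝒮.christoffel x (extChartAt 𝓘(ℝ, E3) x x) v w)
      - 𝒮.christoffel x (extChartAt 𝓘(ℝ, E3) x x) v (𝒮.christoffel x (extChartAt 𝓘(ℝ, E3) x x) u w)
      = riem (𝒮.chartΓ x) (extChartAt 𝓘(ℝ, E3) x x) u v w := by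
    intro u v w
    rw [e, e, c, c, c, c]
    rfl
  exact key u v w

/-- The curvature tensor may be computed in any chart. -/
theorem chartD_curvature {x₀ x : M} (hx : x ∈ (extChartAt 𝓘(ℝ, E3) x₀).source)
    (u v w : TangentSpace 𝓘(ℝ, E3) x) :
    chartD x₀ x (𝒮.curvature x u v w)
      = riem (𝒮.chartΓ x₀) (extChartAt 𝓘(ℝ, E3) x₀ x) (chartD x₀ x u) (chartD x₀ x v) (chartD x₀ x w) := by
  have hx' := mem_extChartAt_source (I := 𝓘(ℝ, E3)) x
  have hy' := mem_extChartAt_target (I := 𝓘(ℝ, E3)) x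
  have l := (extChartAt 𝓘(ℝ, E3) x).left_inv hx'
  have hs : (extChartAt 𝓘(ℝ, E3) x).symm (extChartAt 𝓘(ℝ, E3) x x)
      ∈ (extChartAt 𝓘(ℝ, E3) x₀).source := by rwa [l]
  have ht := (eventually_transition hy' hs).mono fun z hz => 𝒮.isTransition hz.1 hz.2
  have h := (𝒮.isSasakianChart x).riem_transition (𝒮.isSasakianChart x₀) ht
  have e : ∀ u : E3, fderiv ℝ (fun z => extChartAt 𝓘(ℝ, E3) x₀ ((extChartAt 𝓘(ℝ, E3) x).symm z))
      (extChartAt 𝓘(ℝ, E3) x x) u = chartD x₀ x u := by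
    intro u
    have e1 : ∀ z, z = x → chartD (E := E3) x₀ z = (chartD x₀ x : E3 →L[ℝ] E3) := by rintro z rfl; rfl
    have e2 : (chartDinv x (extChartAt 𝓘(ℝ, E3) x x) u : E3) = u := chartDinv_self x u
    rw [fderiv_transition hy' hs]
    exact congrArg₂ (fun (L : E3 →L[ℝ] E3) (a : E3) => L a) (e1 _ l) e2
  have key : ∀ u v w : E3, riem (𝒮.chartΓ x₀) (extChartAt 𝓘(ℝ, E3) x₀ x) (chartD x₀ x u)
      (chartD x₀ x v) (chartD x₀ x w) = (fun z : E3 => chartD x₀ x z) (riem (𝒮.chartΓ x) (extChartAt 𝓘(ℝ, E3) x x) u v w) := by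
    intro u v w
    have h' := h u v w
    rw [e, e, e, e, l] at h'
    exact h'
  rw [𝒮.curvature_eq]
  exact (key u v w).symm

theorem sectionalCurvature_eq {x₀ x : M} (hx : x ∈ (extChartAt 𝓘(ℝ, E3) x₀).source)
    (u v : TangentSpace 𝓘(ℝ, E3) x) (huu : 𝒮.g.inner x u u = 1) (hvv : 𝒮.g.inner x v v = 1)
    (huv : 𝒮.g.inner x u v = 0) :
    𝒮.sectionalCurvature x u v = 𝒮.chartG x₀ (extChartAt 𝓘(ℝ, E3) x₀ x)
      (riem (𝒮.chartΓ x₀) (extChartAt 𝓘(ℝ, E3) x₀ x) (chartD x₀ x u) (chartD x₀ x v) (chartD x₀ x v))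
      (chartD x₀ x u) := by
  rw [← 𝒮.chartD_curvature hx, 𝒮.inner_chartD hx, sectionalCurvature, huu, hvv, huv]
  simp

end curvature

end SasakianStructure
end SubRiem

namespace SubRiem

/-! ### Families of immersions in charts -/

section rep

variable {M : Type*} [TopologicalSpace M] [ChartedSpace E3 M]
  {S : Type*} [TopologicalSpace S] [ChartedSpace E2 S]

/-- The expression of a family of maps from the surface to `M` in the preferred charts at `p₀`
and `x₀`. -/
def rep (Φ : ℝ → S → M) (p₀ : S) (x₀ : M) (q : ℝ × E2) : E3 :=
  extChartAt 𝓘(ℝ, E3) x₀ (Φ q.1 ((extChartAt 𝓘(ℝ, E2) p₀).symm q.2))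

/-- The point `q = (s, y)` is in the domain of the expression of the family `Φ` in the preferred
charts at `p₀` and `x₀`, and the family is of class `C³` there. -/
structure IsRepPoint (Φ : ℝ → S → M) (p₀ : S) (x₀ : M) (q : ℝ × E2) : Prop where
  mem : q.2 ∈ (extChartAt 𝓘(ℝ, E2) p₀).target
  mem' : Φ q.1 ((extChartAt 𝓘(ℝ, E2) p₀).symm q.2) ∈ (extChartAt 𝓘(ℝ, E3) x₀).source
  smooth : ContMDiffAt (𝓘(ℝ, ℝ).prod 𝓘(ℝ, E2)) 𝓘(ℝ, E3) 3 (fun q : ℝ × S => Φ q.1 q.2)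
    (q.1, (extChartAt 𝓘(ℝ, E2) p₀).symm q.2)

namespace IsRepPoint

variable [IsManifold 𝓘(ℝ, E3) ∞ M] [IsManifold 𝓘(ℝ, E2) 3 S]
  {Φ : ℝ → S → M} {p₀ : S} {x₀ : M} {q : ℝ × E2} (r : IsRepPoint Φ p₀ x₀ q)
include r

omit [IsManifold 𝓘(ℝ, E3) ∞ M] [IsManifold 𝓘(ℝ, E2) 3 S] in
theorem rep_mem : rep Φ p₀ x₀ q ∈ (extChartAt 𝓘(ℝ, E3) x₀).target :=
  (extChartAt 𝓘(ℝ, E3) x₀).map_source r.mem'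

omit [IsManifold 𝓘(ℝ, E3) ∞ M] in
theorem contMDiffAt_param : ContMDiffAt 𝓘(ℝ, ℝ × E2) (𝓘(ℝ, ℝ).prod 𝓘(ℝ, E2)) 3
    (fun q : ℝ × E2 => (q.1, (extChartAt 𝓘(ℝ, E2) p₀).symm q.2)) q := by
  have h1 : ContMDiffAt 𝓘(ℝ, ℝ × E2) 𝓘(ℝ, ℝ) 3 (fun q : ℝ × E2 => q.1) q :=
    contDiff_fst.contMDiff.contMDiffAt
  have h2 : ContMDiffAt 𝓘(ℝ, ℝ × E2) 𝓘(ℝ, E2) 3 (fun q : ℝ × E2 => q.2) q :=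
    contDiff_snd.contMDiff.contMDiffAt
  have h3 : ContMDiffAt 𝓘(ℝ, E2) 𝓘(ℝ, E2) 3 (extChartAt 𝓘(ℝ, E2) p₀).symm q.2 :=
    (contMDiffOn_extChartAt_symm p₀).contMDiffAt (mem_nhds_target r.mem)
  exact h1.prodMk (h3.comp q h2)

theorem contDiffAt : ContDiffAt ℝ 3 (rep Φ p₀ x₀) q := by
  have h0 : ContMDiffOn 𝓘(ℝ, E3) 𝓘(ℝ, E3) 3 (extChartAt 𝓘(ℝ, E3) x₀)
    (extChartAt 𝓘(ℝ, E3) x₀).source := by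
    rw [extChartAt_source]; exact contMDiffOn_extChartAt
  have h1 := ContMDiffAt.comp q (g := fun q : ℝ × S => Φ q.1 q.2) r.smooth r.contMDiffAt_param
  exact (ContMDiffAt.comp q (h0.contMDiffAt (mem_nhds_source r.mem')) h1).contDiffAt

theorem differentiableAt : DifferentiableAt ℝ (rep Φ p₀ x₀) q :=
  r.contDiffAt.differentiableAt (by simp)

theorem eventually : ∀ᶠ q' in 𝓝 q, IsRepPoint Φ p₀ x₀ q' := by
  have : IsManifold 𝓘(ℝ, E3) 3 M := IsManifold.of_le (n := ∞) (WithTop.coe_le_coe.2 le_top)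
  have h1 := (contMDiffAt_iff_contMDiffAt_nhds (by simp)).1 r.smooth
  have h2 := r.contMDiffAt_param.continuousAt
  have h3 : ContinuousAt (fun q : ℝ × E2 => Φ q.1 ((extChartAt 𝓘(ℝ, E2) p₀).symm q.2)) q :=
    ContinuousAt.comp (g := fun q : ℝ × S => Φ q.1 q.2)
      (f := fun q : ℝ × E2 => (q.1, (extChartAt 𝓘(ℝ, E2) p₀).symm q.2)) r.smooth.continuousAt h2
  filter_upwards [h2.eventually h1, h3.eventually (mem_nhds_source r.mem'),
    continuous_snd.continuousAt.eventually (mem_nhds_target r.mem)] with q' a b c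
  exact ⟨c, b, a⟩

omit [IsManifold 𝓘(ℝ, E3) ∞ M] [IsManifold 𝓘(ℝ, E2) 3 S] in
theorem mdifferentiableAt_slice : MDifferentiableAt 𝓘(ℝ, E2) 𝓘(ℝ, E3) (Φ q.1)
    ((extChartAt 𝓘(ℝ, E2) p₀).symm q.2) := by
  have h : MDifferentiableAt 𝓘(ℝ, E2) (𝓘(ℝ, ℝ).prod 𝓘(ℝ, E2)) (fun p : S => (q.1, p))
      ((extChartAt 𝓘(ℝ, E2) p₀).symm q.2) :=
    mdifferentiableAt_const.prodMk mdifferentiableAt_id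
  exact MDifferentiableAt.comp (g := fun q : ℝ × S => Φ q.1 q.2) _
    (r.smooth.mdifferentiableAt (by simp)) h

/-- The differential of a slice in charts. -/
theorem fderiv_slice_eq (v : E2) : fderiv ℝ (rep Φ p₀ x₀) q (0, v)
    = chartD x₀ _ (dmap (Φ q.1) ((extChartAt 𝓘(ℝ, E2) p₀).symm q.2) (chartDinv p₀ q.2 v)) := by
  have h1 : HasFDerivAt (fun y : E2 => (q.1, y)) (ContinuousLinearMap.inr ℝ ℝ E2) q.2 :=
    hasFDerivAt_prodMk_right q.1 q.2
  have h2 : HasFDerivAt (fun y => rep Φ p₀ x₀ (q.1, y)) _ q.2 :=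
    HasFDerivAt.comp (g := rep Φ p₀ x₀) q.2 r.differentiableAt.hasFDerivAt h1
  have h3 : fderiv ℝ (fun y => rep Φ p₀ x₀ (q.1, y)) q.2 v = fderiv ℝ (rep Φ p₀ x₀) q (0, v) := by
    rw [h2.fderiv]; simp
  have hs := mdifferentiableAt_chart_symm r.mem
  rw [← h3]
  refine (fderiv_chart_comp (x₀ := x₀) (f := fun y => Φ q.1 ((extChartAt 𝓘(ℝ, E2) p₀).symm y))
    (MDifferentiableAt.comp q.2 r.mdifferentiableAt_slice hs) r.mem' v).trans ?_
  have h4 := mfderiv_comp q.2 r.mdifferentiableAt_slice hs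
  have h5 := congrArg (fun L => L v) h4
  exact congrArg (chartD x₀ (Φ q.1 ((extChartAt 𝓘(ℝ, E2) p₀).symm q.2))) h5

theorem chartD_dmap (v : TangentSpace 𝓘(ℝ, E2) ((extChartAt 𝓘(ℝ, E2) p₀).symm q.2)) :
    chartD x₀ _ (dmap (Φ q.1) ((extChartAt 𝓘(ℝ, E2) p₀).symm q.2) v)
      = fderiv ℝ (rep Φ p₀ x₀) q (0, chartD p₀ _ v) := by
  rw [r.fderiv_slice_eq, chartDinv_chartD r.mem]

/-- The velocity in charts. -/
theorem chartD_velocity : chartD x₀ _ (SasakianStructure.velocity Φ q.1 ((extChartAt 𝓘(ℝ, E2) p₀).symm q.2))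
    = fderiv ℝ (rep Φ p₀ x₀) q (dir 0) := by
  have h1 : HasFDerivAt (fun s : ℝ => (s, q.2)) (ContinuousLinearMap.inl ℝ ℝ E2) q.1 :=
    hasFDerivAt_prodMk_left q.1 q.2
  have h2 : HasFDerivAt (fun s => rep Φ p₀ x₀ (s, q.2)) _ q.1 :=
    HasFDerivAt.comp (g := rep Φ p₀ x₀) q.1 r.differentiableAt.hasFDerivAt h1
  have h3 : fderiv ℝ (fun s => rep Φ p₀ x₀ (s, q.2)) q.1 1 = fderiv ℝ (rep Φ p₀ x₀) q (dir 0) := by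
    rw [h2.fderiv]; simp [dir]
  have h : MDifferentiableAt 𝓘(ℝ, ℝ) (𝓘(ℝ, ℝ).prod 𝓘(ℝ, E2))
      (fun s : ℝ => (s, (extChartAt 𝓘(ℝ, E2) p₀).symm q.2)) q.1 :=
    mdifferentiableAt_id.prodMk mdifferentiableAt_const
  have h4 := MDifferentiableAt.comp (g := fun q : ℝ × S => Φ q.1 q.2)
    (f := fun s : ℝ => (s, (extChartAt 𝓘(ℝ, E2) p₀).symm q.2)) _ (r.smooth.mdifferentiableAt (by simp)) h
  rw [← h3]
  exact (fderiv_chart_comp (x₀ := x₀) (f := fun s => Φ s ((extChartAt 𝓘(ℝ, E2) p₀).symm q.2))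
    h4 r.mem' 1).symm

end IsRepPoint

end rep

section orientation

variable {S : Type*} [TopologicalSpace S] [ChartedSpace E2 S] [IsManifold 𝓘(ℝ, E2) 1 S]

/-- The determinant of the change of coordinates from the preferred chart at `p` to the preferred chart
at `p₀`. -/
def chartDet (p₀ p : S) : ℝ := (chartD p₀ p : E2 →L[ℝ] E2).det

theorem chartDet_pos [OrientedAtlas S] {p₀ p : S} (hp : p ∈ (extChartAt 𝓘(ℝ, E2) p₀).source) :
    0 < chartDet p₀ p := by
  have h := OrientedAtlas.det_pos (S := S) _ (chart_mem_atlas E2 p) _ (chart_mem_atlas E2 p₀)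
    (chartAt E2 p p) (by
      simp only [extChartAt_source] at hp
      simp [hp])
  have hx' := mem_extChartAt_source (I := 𝓘(ℝ, E2)) p
  have hy' := mem_extChartAt_target (I := 𝓘(ℝ, E2)) p
  have l := (extChartAt 𝓘(ℝ, E2) p).left_inv hx'
  have hs : (extChartAt 𝓘(ℝ, E2) p).symm (extChartAt 𝓘(ℝ, E2) p p)
      ∈ (extChartAt 𝓘(ℝ, E2) p₀).source := by rwa [l]
  have key : fderiv ℝ ((chartAt E2 p).symm.trans (chartAt E2 p₀)) (chartAt E2 p p)
      = (chartD p₀ p : E2 →L[ℝ] E2) := by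
    ext1 u
    have e1 : ∀ z, z = p → chartD (E := E2) p₀ z = (chartD p₀ p : E2 →L[ℝ] E2) := by rintro z rfl; rfl
    have e2 := fderiv_chart_comp (mdifferentiableAt_chart_symm hy') hs u
    refine e2.trans ?_
    exact congrArg₂ (fun (L : E2 →L[ℝ] E2) (a : E2) => L a) (e1 _ l) (chartDinv_self p u)
  rw [key] at h
  exact h

end orientation
end SubRiem

namespace SubRiem

/-! ### The Gauss map in charts -/

/-- The value of `|N_h|` for a plane with `-⟨N, T⟩ / |N_h| = m`. -/
def tilt (m : ℝ) : ℝ := (√(1 + m ^ 2))⁻¹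

theorem tilt_pos (m : ℝ) : 0 < tilt m := by unfold tilt; positivity

theorem tilt_sq (m : ℝ) : tilt m ^ 2 * (1 + m ^ 2) = 1 := by
  unfold tilt
  rw [inv_pow, Real.sq_sqrt (by positivity)]
  field_simp

theorem contDiff_tilt {n : WithTop ℕ∞} : ContDiff ℝ n tilt :=
  ((contDiff_const.add (contDiff_id.pow 2)).sqrt fun m => by positivity).inv fun m => by positivity

theorem hasDerivAt_tilt (m : ℝ) : HasDerivAt tilt (-(tilt m ^ 3 * m)) m := by
  have h1 : HasDerivAt (fun m : ℝ => 1 + m ^ 2) (2 * m) m := by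
    simpa using ((hasDerivAt_id m).pow 2).const_add 1
  have h2 := (h1.sqrt (by positivity)).inv (by positivity)
  refine h2.congr_deriv ?_
  have h3 : √(1 + m ^ 2) ≠ 0 := by positivity
  unfold tilt
  field_simp

theorem det_eq (c : E2 →L[ℝ] E2) :
    c.det = c (b2 0) 0 * c (b2 1) 1 - c (b2 1) 0 * c (b2 0) 1 := by
  rw [ContinuousLinearMap.det, ← LinearMap.det_toMatrix (EuclideanSpace.basisFun (Fin 2) ℝ).toBasis,
    Matrix.det_fin_two]
  simp [LinearMap.toMatrix_apply]

theorem eq_sum_b2 (v : E2) : v = v 0 • b2 0 + v 1 • b2 1 := by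
  ext i; fin_cases i <;> simp

theorem zero_prod_eq (v : E2) : ((0 : ℝ), v) = v 0 • dir 1 + v 1 • dir 2 := by
  conv_lhs => rw [eq_sum_b2 v]
  simp [dir]

section cross

variable {E : Type*} [NormedAddCommGroup E] [NormedSpace ℝ E]

/-- The cross product in a chart. -/
def crossField (G : E → E →L[ℝ] E →L[ℝ] ℝ) (T : E → E) (J : E → E →L[ℝ] E) (y a b : E) : E :=
  G y (J y a) b • T y + G y (T y) a • J y b - G y (T y) b • J y a

variable {G : E → E →L[ℝ] E →L[ℝ] ℝ} {Γ : E → E →L[ℝ] E →L[ℝ] E} {T : E → E}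
  {J : E → E →L[ℝ] E} {O : Set E} {F : ℝ × E2 → E} {q : ℝ × E2}

theorem IsSasakianChart.crossField_comb (h : IsSasakianChart G Γ T J O) {y : E} (hy : y ∈ O) (a b : E)
    (c₁ c₂ d₁ d₂ : ℝ) : crossField G T J y (c₁ • a + c₂ • b) (d₁ • a + d₂ • b)
      = (c₁ * d₂ - d₁ * c₂) • crossField G T J y a b := by
  have h0 : ∀ a, G y (J y a) a = 0 := by
    intro a
    have := h.J_skew y hy a a
    rw [h.G_symm y hy a] at this
    linarith
  have h1 : G y (J y b) a = -G y (J y a) b := by rw [h.J_skew y hy, h.G_symm y hy]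
  simp only [crossField, map_add, map_smul, _root_.add_apply, _root_.smul_apply, h0, h1, smul_eq_mul]
  module

/-- The cross product of the tangent vectors of a slice. -/
theorem IsSasakianChart.crossField_slice (h : IsSasakianChart G Γ T J O) (hF : ContDiffAt ℝ 3 F q)
    (hq : F q ∈ O) (hP : density G T F q ≠ 0) :
    crossField G T J (F q) (fderiv ℝ F q (dir 1)) (fderiv ℝ F q (dir 2))
      = density G T F q • (gaussField G T J F q - slope G T J F q • T (F q)) := by
  have a := h.isAdaptedFrame hF hq hP
  have e1 : G (F q) (J (F q) (fderiv ℝ F q (dir 1))) (fderiv ℝ F q (dir 2))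
      = -(density G T F q * slope G T J F q) := by
    rw [slope]; field_simp
  have e2 := congrArg (J (F q)) (charVec_eq hP)
  rw [map_smul, a.J_Z h, charVec, map_sub, map_smul, map_smul] at e2
  have e3 : ∀ i, G (F q) (T (F q)) (fderiv ℝ F q (dir i)) = etaForm G T F i q := fun i => rfl
  rw [crossField, e1, e3, e3, add_sub_assoc, e2]
  module

theorem IsSasakianChart.inner_gaussField_sub (h : IsSasakianChart G Γ T J O) (hF : ContDiffAt ℝ 3 F q)
    (hq : F q ∈ O) (hP : density G T F q ≠ 0) :
    G (F q) (gaussField G T J F q - slope G T J F q • T (F q))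
      (gaussField G T J F q - slope G T J F q • T (F q)) = 1 + slope G T J F q ^ 2 := by
  have a := h.isAdaptedFrame hF hq hP
  have h1 := a.unit.self_of_nhds
  have h2 := a.horizontal.self_of_nhds
  simp only [map_sub, map_smul, _root_.sub_apply, _root_.smul_apply, smul_eq_mul, h1, h2,
    h.T_unit _ hq, h.G_symm _ hq _ (T (F q))]
  ring

end cross

namespace SasakianStructure

variable {M : Type*} [TopologicalSpace M] [ChartedSpace E3 M] [IsManifold 𝓘(ℝ, E3) ∞ M]
variable (𝒮 : SasakianStructure M)
variable {S : Type*} [TopologicalSpace S] [ChartedSpace E2 S] [IsManifold 𝓘(ℝ, E2) 3 S]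

section abbrevs

variable (Φ : ℝ → S → M) (p₀ : S) (x₀ : M)

/-- The sub-Riemannian area density of a family of immersions in charts. -/
abbrev repDensity : ℝ × E2 → ℝ := density (𝒮.chartG x₀) (𝒮.chartT x₀) (rep Φ p₀ x₀)

/-- The function `-⟨N, T⟩ / |N_h|` of a family of immersions in charts. -/
abbrev repSlope : ℝ × E2 → ℝ := slope (𝒮.chartG x₀) (𝒮.chartT x₀) (𝒮.chartJ x₀) (rep Φ p₀ x₀)

/-- The function `⟨∂ₛ, N⟩ / |N_h|` of a family of immersions in charts. -/
abbrev repSpeed : ℝ × E2 → ℝ := speed (𝒮.chartG x₀) (𝒮.chartT x₀) (𝒮.chartJ x₀) (rep Φ p₀ x₀)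

/-- The horizontal Gauss map of a family of immersions in charts. -/
abbrev repNu : ℝ × E2 → E3 := gaussField (𝒮.chartG x₀) (𝒮.chartT x₀) (𝒮.chartJ x₀) (rep Φ p₀ x₀)

/-- The characteristic field of a family of immersions in charts. -/
abbrev repZ : ℝ × E2 → E3 := charField (𝒮.chartG x₀) (𝒮.chartT x₀) (rep Φ p₀ x₀)

/-- The pulled back contact form in charts. -/
abbrev repEta : Fin 3 → ℝ × E2 → ℝ := etaForm (𝒮.chartG x₀) (𝒮.chartT x₀) (rep Φ p₀ x₀)

/-- The form dual to the characteristic field in charts. -/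
abbrev repAl : Fin 3 → ℝ × E2 → ℝ := zForm (𝒮.chartG x₀) (𝒮.chartT x₀) (rep Φ p₀ x₀)

/-- The connection form in charts. -/
abbrev repOm : Fin 3 → ℝ × E2 → ℝ :=
  connForm (𝒮.chartG x₀) (𝒮.chartΓ x₀) (𝒮.chartT x₀) (𝒮.chartJ x₀) (rep Φ p₀ x₀)

end abbrevs

theorem chartD_cross {x₀ x : M} (hx : x ∈ (extChartAt 𝓘(ℝ, E3) x₀).source)
    (u v : TangentSpace 𝓘(ℝ, E3) x) : chartD x₀ x (𝒮.cross x u v)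
      = crossField (𝒮.chartG x₀) (𝒮.chartT x₀) (𝒮.chartJ x₀) (extChartAt 𝓘(ℝ, E3) x₀ x)
        (chartD x₀ x u) (chartD x₀ x v) := by
  rw [cross, crossField, map_sub, map_add, map_smul, map_smul, map_smul, ← 𝒮.chartD_J hx, ← 𝒮.chartD_J hx,
    𝒮.inner_chartD hx, 𝒮.η_chartD hx, 𝒮.η_chartD hx, 𝒮.chartD_T hx]

theorem len_eq {x₀ x : M} (hx : x ∈ (extChartAt 𝓘(ℝ, E3) x₀).source) (u : TangentSpace 𝓘(ℝ, E3) x) :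
    𝒮.len x u = √(𝒮.chartG x₀ (extChartAt 𝓘(ℝ, E3) x₀ x) (chartD x₀ x u) (chartD x₀ x u)) := by
  rw [len, 𝒮.inner_chartD hx]

section regular

variable {𝒮}
variable {Φ : ℝ → S → M} {p₀ : S} {x₀ : M} {q : ℝ × E2} (r : IsRepPoint Φ p₀ x₀ q)
include r

theorem chartD_tangentFrame (i : Fin 2) :
    chartD x₀ _ (tangentFrame (Φ q.1) i ((extChartAt 𝓘(ℝ, E2) p₀).symm q.2))
      = (chartD p₀ ((extChartAt 𝓘(ℝ, E2) p₀).symm q.2) (b2 i) : E2) 0 • fderiv ℝ (rep Φ p₀ x₀) q (dir 1)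
      + (chartD p₀ ((extChartAt 𝓘(ℝ, E2) p₀).symm q.2) (b2 i) : E2) 1 • fderiv ℝ (rep Φ p₀ x₀) q (dir 2) := by
  refine (r.chartD_dmap _).trans ?_
  rw [zero_prod_eq, map_add, map_smul, map_smul]

variable (hP : 𝒮.repDensity Φ p₀ x₀ q ≠ 0)
include hP

theorem chartD_cross_tangentFrame : chartD x₀ _ (𝒮.cross _
      (tangentFrame (Φ q.1) 0 ((extChartAt 𝓘(ℝ, E2) p₀).symm q.2))
      (tangentFrame (Φ q.1) 1 ((extChartAt 𝓘(ℝ, E2) p₀).symm q.2)))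
    = (chartDet p₀ ((extChartAt 𝓘(ℝ, E2) p₀).symm q.2) * 𝒮.repDensity Φ p₀ x₀ q) •
      (𝒮.repNu Φ p₀ x₀ q - 𝒮.repSlope Φ p₀ x₀ q • 𝒮.chartT x₀ (rep Φ p₀ x₀ q)) := by
  have h := 𝒮.isSasakianChart x₀
  have h1 := h.crossField_comb r.rep_mem (fderiv ℝ (rep Φ p₀ x₀) q (dir 1))
    (fderiv ℝ (rep Φ p₀ x₀) q (dir 2))
  have h2 := h.crossField_slice r.contDiffAt r.rep_mem hP
  rw [𝒮.chartD_cross r.mem', chartD_tangentFrame r, chartD_tangentFrame r]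
  refine (h1 _ _ _ _).trans ?_
  rw [h2, smul_smul]
  exact congrArg (fun d : ℝ => (d * density (𝒮.chartG x₀) (𝒮.chartT x₀) (rep Φ p₀ x₀) q) • _)
    (det_eq (chartD p₀ ((extChartAt 𝓘(ℝ, E2) p₀).symm q.2))).symm

variable [OrientedAtlas S]

theorem len_cross_tangentFrame : 𝒮.len _ (𝒮.cross _
      (tangentFrame (Φ q.1) 0 ((extChartAt 𝓘(ℝ, E2) p₀).symm q.2))
      (tangentFrame (Φ q.1) 1 ((extChartAt 𝓘(ℝ, E2) p₀).symm q.2)))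
    = chartDet p₀ ((extChartAt 𝓘(ℝ, E2) p₀).symm q.2) * 𝒮.repDensity Φ p₀ x₀ q
      * (tilt (𝒮.repSlope Φ p₀ x₀ q))⁻¹ := by
  have h := 𝒮.isSasakianChart x₀
  have hpos : 0 < chartDet p₀ ((extChartAt 𝓘(ℝ, E2) p₀).symm q.2) * 𝒮.repDensity Φ p₀ x₀ q :=
    mul_pos (chartDet_pos ((extChartAt 𝓘(ℝ, E2) p₀).map_target r.mem)) (IsSasakianChart.density_pos hP)
  have h1 := h.inner_gaussField_sub r.contDiffAt r.rep_mem hP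
  rw [𝒮.len_eq r.mem', chartD_cross_tangentFrame r hP]
  set c := chartDet p₀ ((extChartAt 𝓘(ℝ, E2) p₀).symm q.2) * 𝒮.repDensity Φ p₀ x₀ q with hc
  have h2 : ∀ v : E3, 𝒮.chartG x₀ (rep Φ p₀ x₀ q) (c • v) (c • v) = c ^ 2 * 𝒮.chartG x₀ (rep Φ p₀ x₀ q) v v := by
    intro v; simp; ring
  refine (congrArg Real.sqrt ((h2 _).trans (congrArg _ h1))).trans ?_
  rw [Real.sqrt_mul (by positivity), Real.sqrt_sq hpos.le, tilt, inv_inv]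

theorem chartD_normal : chartD x₀ _ (𝒮.normal (Φ q.1) ((extChartAt 𝓘(ℝ, E2) p₀).symm q.2))
    = tilt (𝒮.repSlope Φ p₀ x₀ q) •
      (𝒮.repNu Φ p₀ x₀ q - 𝒮.repSlope Φ p₀ x₀ q • 𝒮.chartT x₀ (rep Φ p₀ x₀ q)) := by
  have hc := (chartDet_pos ((extChartAt 𝓘(ℝ, E2) p₀).map_target r.mem)).ne'
  have ht := (tilt_pos (𝒮.repSlope Φ p₀ x₀ q)).ne'
  simp only [normal]
  rw [map_smul, chartD_cross_tangentFrame r hP, len_cross_tangentFrame r hP, smul_smul]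
  congr 1
  field_simp

theorem normalT_eq : 𝒮.normalT (Φ q.1) ((extChartAt 𝓘(ℝ, E2) p₀).symm q.2)
    = -(tilt (𝒮.repSlope Φ p₀ x₀ q) * 𝒮.repSlope Φ p₀ x₀ q) := by
  have h := 𝒮.isSasakianChart x₀
  have a := h.isAdaptedFrame r.contDiffAt r.rep_mem hP
  rw [normalT, ← 𝒮.inner_chartD r.mem', chartD_normal r hP, 𝒮.chartD_T r.mem']
  refine (h.G_symm _ r.rep_mem _ _).trans ?_
  have h1 := h.T_unit _ r.rep_mem
  have h2 := a.horizontal.self_of_nhds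
  rw [map_smul, map_sub, map_smul]
  refine (congrArg _ (congrArg₂ (· - ·) h2 (congrArg _ h1))).trans ?_
  simp

theorem chartD_normalH : chartD x₀ _ (𝒮.normalH (Φ q.1) ((extChartAt 𝓘(ℝ, E2) p₀).symm q.2))
    = tilt (𝒮.repSlope Φ p₀ x₀ q) • 𝒮.repNu Φ p₀ x₀ q := by
  rw [normalH, map_sub, map_smul, chartD_normal r hP, normalT_eq r hP, 𝒮.chartD_T r.mem', smul_sub,
    smul_smul, neg_smul, sub_neg_eq_add]
  exact sub_add_cancel (_ : E3) _

theorem absNormalH_eq : 𝒮.absNormalH (Φ q.1) ((extChartAt 𝓘(ℝ, E2) p₀).symm q.2)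
    = tilt (𝒮.repSlope Φ p₀ x₀ q) := by
  have h := 𝒮.isSasakianChart x₀
  have a := h.isAdaptedFrame r.contDiffAt r.rep_mem hP
  have h1 := a.unit.self_of_nhds
  rw [absNormalH, 𝒮.len_eq r.mem', chartD_normalH r hP]
  have h2 : ∀ (c : ℝ) (v : E3), 𝒮.chartG x₀ (rep Φ p₀ x₀ q) (c • v) (c • v)
      = c ^ 2 * 𝒮.chartG x₀ (rep Φ p₀ x₀ q) v v := by
    intro c v; simp; ring
  refine (congrArg Real.sqrt ((h2 _ _).trans (congrArg _ h1))).trans ?_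
  rw [mul_one, Real.sqrt_sq (tilt_pos _).le]

theorem chartD_nuH : chartD x₀ _ (𝒮.nuH (Φ q.1) ((extChartAt 𝓘(ℝ, E2) p₀).symm q.2))
    = 𝒮.repNu Φ p₀ x₀ q := by
  rw [nuH, map_smul, absNormalH_eq r hP, chartD_normalH r hP, smul_smul,
    inv_mul_cancel₀ (tilt_pos _).ne', one_smul]

theorem chartD_Z : chartD x₀ _ (𝒮.Z (Φ q.1) ((extChartAt 𝓘(ℝ, E2) p₀).symm q.2))
    = 𝒮.repZ Φ p₀ x₀ q := by
  have a := (𝒮.isSasakianChart x₀).isAdaptedFrame r.contDiffAt r.rep_mem hP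
  rw [Z, 𝒮.chartD_J r.mem', chartD_nuH r hP]
  exact a.Z_eq_self.symm

theorem chartD_sField : chartD x₀ _ (𝒮.sField (Φ q.1) ((extChartAt 𝓘(ℝ, E2) p₀).symm q.2))
    = -(tilt (𝒮.repSlope Φ p₀ x₀ q) • (𝒮.repSlope Φ p₀ x₀ q • 𝒮.repNu Φ p₀ x₀ q
      + 𝒮.chartT x₀ (rep Φ p₀ x₀ q))) := by
  rw [sField, map_sub, map_smul, map_smul, chartD_nuH r hP, normalT_eq r hP, absNormalH_eq r hP,
    𝒮.chartD_T r.mem', smul_add, smul_smul, neg_smul, neg_add]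
  rfl

end regular

end SasakianStructure
end SubRiem

namespace SubRiem
namespace SasakianStructure

variable {M : Type*} [TopologicalSpace M] [ChartedSpace E3 M] [IsManifold 𝓘(ℝ, E3) ∞ M]
variable (𝒮 : SasakianStructure M)
variable {S : Type*} [TopologicalSpace S] [ChartedSpace E2 S] [IsManifold 𝓘(ℝ, E2) 3 S]

/-! ### Covariant derivatives in charts -/

theorem fderiv_transition_chartD {x₀ x₁ x : M} (hx₀ : x ∈ (extChartAt 𝓘(ℝ, E3) x₀).source)
    (hx₁ : x ∈ (extChartAt 𝓘(ℝ, E3) x₁).source) (w : TangentSpace 𝓘(ℝ, E3) x) :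
    fderiv ℝ (fun z => extChartAt 𝓘(ℝ, E3) x₁ ((extChartAt 𝓘(ℝ, E3) x₀).symm z))
      (extChartAt 𝓘(ℝ, E3) x₀ x) (chartD x₀ x w) = chartD x₁ x w := by
  obtain ⟨y, hy, rfl⟩ := exists_symm_eq hx₀
  rw [(extChartAt 𝓘(ℝ, E3) x₀).right_inv hy, fderiv_transition hy hx₁, chartDinv_chartD hy]

section covDeriv

variable {Φ : ℝ → S → M} {p₀ : S} {x₀ : M} {q : ℝ × E2}

theorem _root_.SubRiem.IsRepPoint.hasFDerivAt_slice (r : IsRepPoint Φ p₀ x₀ q) :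
    HasFDerivAt (fun y => rep Φ p₀ x₀ (q.1, y))
      ((fderiv ℝ (rep Φ p₀ x₀) q).comp (ContinuousLinearMap.inr ℝ ℝ E2)) q.2 :=
  HasFDerivAt.comp (g := rep Φ p₀ x₀) q.2 r.differentiableAt.hasFDerivAt
    (hasFDerivAt_prodMk_right q.1 q.2)

theorem _root_.SubRiem.IsRepPoint.eventually_slice (r : IsRepPoint Φ p₀ x₀ q) :
    ∀ᶠ y in 𝓝 q.2, IsRepPoint Φ p₀ x₀ (q.1, y) :=
  (Continuous.prodMk_right q.1).continuousAt.eventually r.eventually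

/-- The covariant derivative of a field along a map may be computed in any charts. -/
theorem chartD_covDeriv (r : IsRepPoint Φ p₀ x₀ q) (W : ∀ p : S, TangentSpace 𝓘(ℝ, E3) (Φ q.1 p))
    {W₀ : E2 → E3} (hW : ∀ᶠ y in 𝓝 q.2, chartD x₀ _ (W ((extChartAt 𝓘(ℝ, E2) p₀).symm y)) = W₀ y)
    (hd : DifferentiableAt ℝ W₀ q.2) (v : E2) :
    chartD x₀ _ (𝒮.covDeriv (Φ q.1) W ((extChartAt 𝓘(ℝ, E2) p₀).symm q.2) (chartDinv p₀ q.2 v))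
      = fderiv ℝ W₀ q.2 v
        + 𝒮.chartΓ x₀ (rep Φ p₀ x₀ q) (fderiv ℝ (rep Φ p₀ x₀) q (0, v)) (W₀ q.2) := by
  set p := (extChartAt 𝓘(ℝ, E2) p₀).symm q.2 with hp
  set x₁ := Φ q.1 p with hx₁
  have m₁ := mem_extChartAt_source (I := 𝓘(ℝ, E3)) x₁
  have l := (extChartAt 𝓘(ℝ, E3) x₀).left_inv r.mem'
  set τ := fun z => extChartAt 𝓘(ℝ, E3) x₁ ((extChartAt 𝓘(ℝ, E3) x₀).symm z) with hτ
  have ht : IsTransition (𝒮.chartG x₀) (𝒮.chartG x₁) (extChartAt 𝓘(ℝ, E3) x₀).target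
      (extChartAt 𝓘(ℝ, E3) x₁).target τ (rep Φ p₀ x₀ q) :=
    𝒮.isTransition r.rep_mem (by rw [rep, l]; exact m₁)
  have hf := r.hasFDerivAt_slice
  have hcov := (𝒮.isSasakianChart x₀).cov_transition (𝒮.isSasakianChart x₁) ht
    (F := fun y => rep Φ p₀ x₀ (q.1, y)) (q := q.2) hf.differentiableAt rfl hd v
  have hc : cov (𝒮.chartΓ x₀) (fun y => rep Φ p₀ x₀ (q.1, y)) W₀ v q.2 = fderiv ℝ W₀ q.2 v
        + 𝒮.chartΓ x₀ (rep Φ p₀ x₀ q) (fderiv ℝ (rep Φ p₀ x₀) q (0, v)) (W₀ q.2) := by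
    simp only [cov, hf.fderiv]
    simp
  rw [← hc]
  -- near `q`, the field in the chart at `x₁` is the image of `W₀` under the change of coordinates
  have hev : (fun y => chartD x₁ _ (W ((extChartAt 𝓘(ℝ, E2) p₀).symm y)))
      =ᶠ[𝓝 q.2] fun y => fderiv ℝ τ (rep Φ p₀ x₀ (q.1, y)) (W₀ y) := by
    have hcont : ContinuousAt (fun y => Φ q.1 ((extChartAt 𝓘(ℝ, E2) p₀).symm y)) q.2 :=
      ContinuousAt.comp (g := Φ q.1) r.mdifferentiableAt_slice.continuousAt
        (mdifferentiableAt_chart_symm r.mem).continuousAt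
    filter_upwards [hW, r.eventually_slice, hcont.eventually (mem_nhds_source m₁)] with y h1 h2 h3
    rw [← h1]
    exact (fderiv_transition_chartD h2.mem' h3 _).symm
  have hτ2 : ContDiffAt ℝ 2 τ (rep Φ p₀ x₀ q) := ht.contDiffAt.of_le two_le_infty
  have hd' : DifferentiableAt ℝ (fun y => fderiv ℝ τ (rep Φ p₀ x₀ (q.1, y)) (W₀ y)) q.2 :=
    (DifferentiableAt.comp (g := fderiv ℝ τ) q.2
      ((hτ2.fderiv_right (m := 1) (by norm_num)).differentiableAt (by simp)) hf.differentiableAt).clm_apply hd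
  have h1 : mvfderiv 𝓘(ℝ, E2) (fun p' => chartD x₁ (Φ q.1 p') (W p')) p (chartDinv p₀ q.2 v)
      = fderiv ℝ (fun y => fderiv ℝ τ (rep Φ p₀ x₀ (q.1, y)) (W₀ y)) q.2 v := by
    refine (mvfderiv_eq_fderiv_chart (f := fun p' => chartD x₁ (Φ q.1 p') (W p')) r.mem
      (hd'.congr_of_eventuallyEq hev) _).trans ?_
    rw [hev.fderiv_eq, chartD_chartDinv r.mem]
  have e₁ : ∀ u : TangentSpace 𝓘(ℝ, E3) x₁, (chartD x₁ x₁ u : E3) = u := fun u =>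
    congrArg (fun L : E3 →L[ℝ] E3 => L u) (chartD_self x₁)
  have h2 : fderiv ℝ (fun y => τ (rep Φ p₀ x₀ (q.1, y))) q.2 v
      = chartD x₁ x₁ (dmap (Φ q.1) p (chartDinv p₀ q.2 v)) := by
    have h3 : fderiv ℝ (fun y => τ (rep Φ p₀ x₀ (q.1, y))) q.2 = _ :=
      (HasFDerivAt.comp (g := τ) q.2 (hτ2.differentiableAt (by simp)).hasFDerivAt hf).fderiv
    rw [h3]
    refine Eq.trans ?_ (fderiv_transition_chartD r.mem' m₁ _)
    rw [r.chartD_dmap, chartD_chartDinv r.mem]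
    simp
    rfl
  have h4 : fderiv ℝ τ (rep Φ p₀ x₀ q) (W₀ q.2) = chartD x₁ x₁ (W p) := by
    rw [← hW.self_of_nhds]
    exact fderiv_transition_chartD r.mem' m₁ _
  have h5 : τ (rep Φ p₀ x₀ q) = extChartAt 𝓘(ℝ, E3) x₁ x₁ := by
    simp only [hτ, rep]
    rw [l]
  have h6 : (𝒮.covDeriv (Φ q.1) W p (chartDinv p₀ q.2 v) : E3)
      = fderiv ℝ τ (rep Φ p₀ x₀ q) (cov (𝒮.chartΓ x₀) (fun y => rep Φ p₀ x₀ (q.1, y)) W₀ v q.2) := by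
    rw [← hcov]
    show _ = fderiv ℝ (fun y => fderiv ℝ τ (rep Φ p₀ x₀ (q.1, y)) (W₀ y)) q.2 v
      + 𝒮.chartΓ x₁ (τ (rep Φ p₀ x₀ q)) (fderiv ℝ (fun y => τ (rep Φ p₀ x₀ (q.1, y))) q.2 v)
        (fderiv ℝ τ (rep Φ p₀ x₀ q) (W₀ q.2))
    rw [h2, h4, h5, e₁, e₁]
    exact congrArg₂ (fun a b : E3 => a + b) h1
      (𝒮.christoffel_eq (mem_extChartAt_target (I := 𝓘(ℝ, E3)) x₁) _ _)
  obtain ⟨w, hw⟩ := chartD_surjective r.mem' (cov (𝒮.chartΓ x₀) (fun y => rep Φ p₀ x₀ (q.1, y)) W₀ v q.2)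
  rw [← hw] at h6 ⊢
  have h7 := fderiv_transition_chartD r.mem' m₁ w
  exact congrArg (chartD x₀ x₁) (h6.trans (h7.trans (e₁ w)))

end covDeriv

end SasakianStructure
end SubRiem

namespace SubRiem

/-! ### The shape operator in charts -/

theorem map_zero_prod {V : Type*} [NormedAddCommGroup V] [NormedSpace ℝ V] (L : ℝ × E2 →L[ℝ] V)
    (c a b : ℝ) : L (0, c • (a • b2 0 - b • b2 1)) = c • (a • L (dir 1) - b • L (dir 2)) := by
  rw [← map_smul, ← map_smul, ← map_sub, ← map_smul]
  simp [dir]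

section chart

variable {E : Type*} [NormedAddCommGroup E] [NormedSpace ℝ E]

/-- The coordinates of the tangent vector of the slice that is mapped to the characteristic field. -/
def zDir (G : E → E →L[ℝ] E →L[ℝ] ℝ) (T : E → E) (F : ℝ × E2 → E) (q : ℝ × E2) : E2 :=
  (density G T F q)⁻¹ • (etaForm G T F 2 q • b2 0 - etaForm G T F 1 q • b2 1)

/-- The unit normal of the slices. -/
def normalField (G : E → E →L[ℝ] E →L[ℝ] ℝ) (T : E → E) (J : E → E →L[ℝ] E) (F : ℝ × E2 → E)
    (q : ℝ × E2) : E :=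
  tilt (slope G T J F q) • (gaussField G T J F q - slope G T J F q • T (F q))

namespace IsSasakianChart

variable {G : E → E →L[ℝ] E →L[ℝ] ℝ} {Γ : E → E →L[ℝ] E →L[ℝ] E} {T : E → E}
  {J : E → E →L[ℝ] E} {O : Set E} {F : ℝ × E2 → E} {q : ℝ × E2}

theorem fderiv_zDir : fderiv ℝ F q (0, zDir G T F q) = charField G T F q := by
  rw [zDir, map_zero_prod, charField, charVec, neg_smul, ← smul_neg, neg_sub]

theorem conn_zDir : conn G Γ T F (gaussField G T J F) (charField G T F) (0, zDir G T F q) q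
    = wedge (connForm G Γ T J F) (etaForm G T F) 1 2 q / density G T F q := by
  obtain ⟨L, hL⟩ : ∃ L : ℝ × E2 →L[ℝ] ℝ,
      ∀ v, conn G Γ T F (gaussField G T J F) (charField G T F) v q = L v := by
    refine ⟨((G (F q)).flip (charField G T F q)).comp (fderiv ℝ (gaussField G T J F) q
      + ((Γ (F q)).flip (gaussField G T J F q)).comp (fderiv ℝ F q))
      - (G (F q) (T (F q))).comp (fderiv ℝ F q), fun v => ?_⟩
    simp [conn, cov, form]
  rw [hL, zDir, map_zero_prod, ← hL, ← hL]
  simp only [wedge, connForm, smul_eq_mul]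
  ring

variable (h : IsSasakianChart G Γ T J O) (hF : ContDiffAt ℝ 3 F q) (hq : F q ∈ O)
  (hP : density G T F q ≠ 0)
include h hF hq hP

theorem contDiffAt_normalField : ContDiffAt ℝ 2 (normalField G T J F) q := by
  have a := h.isAdaptedFrame hF hq hP
  have hm := h.contDiffAt_slope hF hq hP
  exact (contDiff_tilt.contDiffAt.comp q hm).smul
    ((h.contDiffAt_gaussField hF hq hP).sub (hm.smul (a.contDiffAt_T_comp h)))

theorem fderiv_tilt_slope (v : ℝ × E2) : fderiv ℝ (fun q => tilt (slope G T J F q)) q v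
    = -(tilt (slope G T J F q) ^ 3 * slope G T J F q) * fderiv ℝ (slope G T J F) q v := by
  have hm := (h.contDiffAt_slope hF hq hP).differentiableAt (by simp)
  have h1 : fderiv ℝ (fun q => tilt (slope G T J F q)) q = _ :=
    (HasDerivAt.comp_hasFDerivAt q (hasDerivAt_tilt (slope G T J F q)) hm.hasFDerivAt).fderiv
  rw [h1]; simp

theorem cov_normalField (v : ℝ × E2) : cov Γ F (normalField G T J F) v q
    = -(tilt (slope G T J F q) ^ 3 * slope G T J F q * fderiv ℝ (slope G T J F) q v) •
        (gaussField G T J F q - slope G T J F q • T (F q))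
      + tilt (slope G T J F q) • (cov Γ F (gaussField G T J F) v q
        - fderiv ℝ (slope G T J F) q v • T (F q) - slope G T J F q • J (F q) (fderiv ℝ F q v)) := by
  have a := h.isAdaptedFrame hF hq hP
  have hm := (h.contDiffAt_slope hF hq hP).differentiableAt (by simp)
  have hν := a.differentiableAt_ν
  have hT := (a.contDiffAt_T_comp h).differentiableAt (by simp)
  have ht : DifferentiableAt ℝ (fun q => tilt (slope G T J F q)) q :=
    DifferentiableAt.comp (g := tilt) q (hasDerivAt_tilt _).differentiableAt hm
  have e1 := h.cov_reeb a.differentiableAt_F a.mem v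
  have e2 := h.fderiv_tilt_slope hF hq hP v
  have e3 : fderiv ℝ (normalField G T J F) q = _ := fderiv_fun_smul ht (hν.fun_sub (hm.fun_smul hT))
  rw [cov, e3, fderiv_fun_sub hν (hm.fun_smul hT), fderiv_fun_smul hm hT, ← e1]
  simp only [_root_.add_apply, _root_.smul_apply, _root_.sub_apply,
    ContinuousLinearMap.smulRight_apply, e2, normalField, map_smul, map_sub, cov]
  module

/-- The derivative of the unit normal along the characteristic field. -/
theorem cov_normalField_zDir (hE : Module.finrank ℝ E = 3) :
    cov Γ F (normalField G T J F) (0, zDir G T F q) q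
    = (tilt (slope G T J F q) * slope G T J F q - tilt (slope G T J F q) ^ 3 * slope G T J F q
        * fderiv ℝ (slope G T J F) q (0, zDir G T F q)) • gaussField G T J F q
      + (tilt (slope G T J F q) * (wedge (connForm G Γ T J F) (etaForm G T F) 1 2 q / density G T F q)) •
        charField G T F q
      + (tilt (slope G T J F q) ^ 3 * slope G T J F q ^ 2
        * fderiv ℝ (slope G T J F) q (0, zDir G T F q) + tilt (slope G T J F q)
        - tilt (slope G T J F q) * fderiv ℝ (slope G T J F) q (0, zDir G T F q)) • T (F q) := by
  have a := h.isAdaptedFrame hF hq hP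
  have e1 : cov Γ F (gaussField G T J F) (0, zDir G T F q) q
      = (wedge (connForm G Γ T J F) (etaForm G T F) 1 2 q / density G T F q) • charField G T F q
        + T (F q) := by
    have e2 := a.expand h hE (cov Γ F (gaussField G T J F) (0, zDir G T F q) q)
    have e3 := h.G_symm _ hq (gaussField G T J F q) (cov Γ F (gaussField G T J F) (0, zDir G T F q) q)
    have e4 := h.G_symm _ hq (charField G T F q) (cov Γ F (gaussField G T J F) (0, zDir G T F q) q)
    have e5 := h.G_symm _ hq (T (F q)) (cov Γ F (gaussField G T J F) (0, zDir G T F q) q)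
    rw [e3, e4, e5, a.inner_cov_ν_ν h, a.inner_cov_ν_T h, form, fderiv_zDir, a.inner_Z_Z h] at e2
    have e6 := conn_zDir (G := G) (Γ := Γ) (T := T) (J := J) (F := F) (q := q)
    rw [conn, form, fderiv_zDir, a.inner_T_Z h, sub_zero] at e6
    rw [e6] at e2
    simpa using e2
  rw [h.cov_normalField hF hq hP, e1, fderiv_zDir, a.J_Z h]
  module

/-- The characteristic field and the field `m ν + T` span the tangent planes of the slices. -/
theorem fderiv_sDir (hE : Module.finrank ℝ E = 3) :
    fderiv ℝ F q (0, (tilt (slope G T J F q) / density G T F q) •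
      (zForm G T F 2 q • b2 0 - zForm G T F 1 q • b2 1))
    = -(tilt (slope G T J F q) • (slope G T J F q • gaussField G T J F q + T (F q))) := by
  have a := h.isAdaptedFrame hF hq hP
  have e1 := h.wedge_zForm_etaForm hF hq hP
  obtain ⟨n1, n2⟩ := h.nuForm_eq hF hq hP hE
  have e : ∀ i, fderiv ℝ F q (dir i) = nuForm G T J F i q • gaussField G T J F q
    + zForm G T F i q • charField G T F q + etaForm G T F i q • T (F q) := fun i => a.expand h hE _
  rw [map_zero_prod, e 1, e 2, n1, n2]
  simp only [wedge] at e1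
  have e2 : zForm G T F 2 q * etaForm G T F 1 q = zForm G T F 1 q * etaForm G T F 2 q
    - density G T F q := by linarith
  have e3 : zForm G T F 2 q • ((slope G T J F q * etaForm G T F 1 q) • gaussField G T J F q
      + zForm G T F 1 q • charField G T F q + etaForm G T F 1 q • T (F q))
      - zForm G T F 1 q • ((slope G T J F q * etaForm G T F 2 q) • gaussField G T J F q
      + zForm G T F 2 q • charField G T F q + etaForm G T F 2 q • T (F q))
      = (zForm G T F 2 q * etaForm G T F 1 q - zForm G T F 1 q * etaForm G T F 2 q) •
        (slope G T J F q • gaussField G T J F q + T (F q)) := by module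
  rw [e3, e2, smul_smul, ← neg_smul]
  congr 1
  field_simp
  ring

/-- A vector is tangent to the slice if and only if it is orthogonal to `ν - m T`. -/
theorem exists_fderiv_eq_iff (hE : Module.finrank ℝ E = 3) (u : E) :
    (∃ v : E2, fderiv ℝ F q (0, v) = u) ↔
      G (F q) (gaussField G T J F q) u - slope G T J F q * G (F q) (T (F q)) u = 0 := by
  have a := h.isAdaptedFrame hF hq hP
  constructor
  · rintro ⟨v, rfl⟩
    obtain ⟨n1, n2⟩ := h.nuForm_eq hF hq hP hE
    simp only [nuForm, etaForm, form] at n1 n2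
    rw [zero_prod_eq]
    simp only [map_add, map_smul, smul_eq_mul]
    linear_combination v 0 * n1 + v 1 * n2
  · intro hu
    have e1 := fderiv_zDir (G := G) (T := T) (F := F) (q := q)
    have e2 := h.fderiv_sDir hF hq hP hE
    set w := (tilt (slope G T J F q) / density G T F q) •
      (zForm G T F 2 q • b2 0 - zForm G T F 1 q • b2 1) with hw
    -- the coefficients of `u` in the basis of the tangent plane given by `Z` and `-tilt • (m ν + T)`
    refine ⟨G (F q) (charField G T F q) u • zDir G T F q
      - ((tilt (slope G T J F q))⁻¹ * G (F q) (T (F q)) u) • w, ?_⟩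
    have e3 : ∀ (c d : ℝ) (v w : E2), fderiv ℝ F q (0, c • v - d • w)
        = c • fderiv ℝ F q (0, v) - d • fderiv ℝ F q (0, w) := by
      intro c d v w
      rw [← map_smul, ← map_smul, ← map_sub]; simp
    have ht := (tilt_pos (slope G T J F q)).ne'
    have e4 : G (F q) (gaussField G T J F q) u = slope G T J F q * G (F q) (T (F q)) u := by linarith
    rw [e3, e1, e2]
    conv_rhs => rw [a.expand h hE u, e4]
    rw [smul_neg, sub_neg_eq_add, smul_smul]
    have e5 : (tilt (slope G T J F q))⁻¹ * (G (F q)) (T (F q)) u * tilt (slope G T J F q)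
      = G (F q) (T (F q)) u := by field_simp
    rw [e5]
    module

end IsSasakianChart

end chart
end SubRiem

namespace SubRiem
namespace SasakianStructure

variable {M : Type*} [TopologicalSpace M] [ChartedSpace E3 M] [IsManifold 𝓘(ℝ, E3) ∞ M]
variable {𝒮 : SasakianStructure M}
variable {S : Type*} [TopologicalSpace S] [ChartedSpace E2 S] [IsManifold 𝓘(ℝ, E2) 3 S]
  {Φ : ℝ → S → M} {p₀ : S} {x₀ : M} {q : ℝ × E2}

/-! ### The invariants of the surface in charts -/

theorem finrank_E3 : Module.finrank ℝ E3 = 3 := by simp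

/-- A tangent vector of the surface is determined by its image. -/
theorem lift_eq (r : IsRepPoint Φ p₀ x₀ q)
    (hi : Function.Injective (dmap (Φ q.1) ((extChartAt 𝓘(ℝ, E2) p₀).symm q.2))) {v : E2}
    {w : TangentSpace 𝓘(ℝ, E3) (Φ q.1 ((extChartAt 𝓘(ℝ, E2) p₀).symm q.2))}
    (h : fderiv ℝ (rep Φ p₀ x₀) q (0, v) = chartD x₀ _ w) :
    lift (Φ q.1) ((extChartAt 𝓘(ℝ, E2) p₀).symm q.2) w = chartDinv p₀ q.2 v := by
  have h1 : dmap (Φ q.1) ((extChartAt 𝓘(ℝ, E2) p₀).symm q.2) (chartDinv p₀ q.2 v) = w := by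
    apply chartD_injective r.mem'
    rw [r.chartD_dmap, chartD_chartDinv r.mem, h]
  rw [← h1]
  have : Nonempty (TangentSpace 𝓘(ℝ, E2) ((extChartAt 𝓘(ℝ, E2) p₀).symm q.2)) := ⟨0⟩
  exact Function.leftInverse_invFun hi _

/-- The covariant derivative of the restriction to a slice of a field along the family. -/
theorem chartD_covDeriv_slice (r : IsRepPoint Φ p₀ x₀ q) (W : ∀ p : S, TangentSpace 𝓘(ℝ, E3) (Φ q.1 p))
    {A : ℝ × E2 → E3}
    (hW : ∀ᶠ y in 𝓝 q.2, chartD x₀ _ (W ((extChartAt 𝓘(ℝ, E2) p₀).symm y)) = A (q.1, y))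
    (hd : DifferentiableAt ℝ A q) (v : E2) :
    chartD x₀ _ (𝒮.covDeriv (Φ q.1) W ((extChartAt 𝓘(ℝ, E2) p₀).symm q.2) (chartDinv p₀ q.2 v))
      = cov (𝒮.chartΓ x₀) (rep Φ p₀ x₀) A (0, v) q := by
  have h1 : HasFDerivAt (fun y => A (q.1, y)) _ q.2 :=
    HasFDerivAt.comp (g := A) q.2 hd.hasFDerivAt (hasFDerivAt_prodMk_right q.1 q.2)
  rw [𝒮.chartD_covDeriv r W hW h1.differentiableAt, h1.fderiv]
  simp [cov]

/-- The nonsingular points in the domain of the expression of the family in charts. -/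
structure IsRegPoint (𝒮 : SasakianStructure M) (Φ : ℝ → S → M) (p₀ : S) (x₀ : M) (q : ℝ × E2) :
    Prop where
  rep : IsRepPoint Φ p₀ x₀ q
  density_ne : 𝒮.repDensity Φ p₀ x₀ q ≠ 0

namespace IsRegPoint

variable (r : 𝒮.IsRegPoint Φ p₀ x₀ q)
include r

theorem eventually : ∀ᶠ q' in 𝓝 q, 𝒮.IsRegPoint Φ p₀ x₀ q' := by
  filter_upwards [r.rep.eventually, ((𝒮.isSasakianChart x₀).continuousAt_density
    r.rep.contDiffAt r.rep.rep_mem).eventually_ne r.density_ne] with q' h1 h2 using ⟨h1, h2⟩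

theorem eventually_slice : ∀ᶠ y in 𝓝 q.2, 𝒮.IsRegPoint Φ p₀ x₀ (q.1, y) :=
  (Continuous.prodMk_right q.1).continuousAt.eventually r.eventually

theorem frame : IsAdaptedFrame (𝒮.chartG x₀) (𝒮.chartT x₀) (𝒮.chartJ x₀)
    (extChartAt 𝓘(ℝ, E3) x₀).target (SubRiem.rep Φ p₀ x₀) (𝒮.repNu Φ p₀ x₀) (𝒮.repZ Φ p₀ x₀) q :=
  (𝒮.isSasakianChart x₀).isAdaptedFrame r.rep.contDiffAt r.rep.rep_mem r.density_ne

omit [IsManifold 𝓘(ℝ, E2) 3 S] in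
theorem density_pos : 0 < 𝒮.repDensity Φ p₀ x₀ q := IsSasakianChart.density_pos r.density_ne

variable [OrientedAtlas S]
  (hi : Function.Injective (dmap (Φ q.1) ((extChartAt 𝓘(ℝ, E2) p₀).symm q.2)))
include hi

theorem lift_Z : lift (Φ q.1) ((extChartAt 𝓘(ℝ, E2) p₀).symm q.2)
      (𝒮.Z (Φ q.1) ((extChartAt 𝓘(ℝ, E2) p₀).symm q.2))
    = chartDinv p₀ q.2 (zDir (𝒮.chartG x₀) (𝒮.chartT x₀) (SubRiem.rep Φ p₀ x₀) q) :=
  lift_eq r.rep hi (by rw [chartD_Z r.rep r.density_ne, IsSasakianChart.fderiv_zDir])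

theorem lift_sField : lift (Φ q.1) ((extChartAt 𝓘(ℝ, E2) p₀).symm q.2)
      (𝒮.sField (Φ q.1) ((extChartAt 𝓘(ℝ, E2) p₀).symm q.2))
    = chartDinv p₀ q.2 ((tilt (𝒮.repSlope Φ p₀ x₀ q) / 𝒮.repDensity Φ p₀ x₀ q) •
      (𝒮.repAl Φ p₀ x₀ 2 q • b2 0 - 𝒮.repAl Φ p₀ x₀ 1 q • b2 1)) :=
  lift_eq r.rep hi (by
    rw [chartD_sField r.rep r.density_ne]
    exact (𝒮.isSasakianChart x₀).fderiv_sDir r.rep.contDiffAt r.rep.rep_mem r.density_ne finrank_E3)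

/-- The mean curvature as the component of the connection form along `Z`: the term `⟨D_S ν_h, S⟩`
vanishes. -/
theorem meanCurvature_eq : -2 * 𝒮.meanCurvature (Φ q.1) ((extChartAt 𝓘(ℝ, E2) p₀).symm q.2)
      * 𝒮.repDensity Φ p₀ x₀ q
    = wedge (𝒮.repOm Φ p₀ x₀) (𝒮.repEta Φ p₀ x₀) 1 2 q := by
  have h := 𝒮.isSasakianChart x₀
  have a := r.frame
  have hP := r.density_ne
  have hν : ∀ᶠ y in 𝓝 q.2, chartD x₀ _ (𝒮.nuH (Φ q.1) ((extChartAt 𝓘(ℝ, E2) p₀).symm y))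
      = 𝒮.repNu Φ p₀ x₀ (q.1, y) := by
    filter_upwards [r.eventually_slice] with y hy using chartD_nuH hy.rep hy.density_ne
  have hd := a.differentiableAt_ν
  have e1 : 𝒮.g.inner _ (𝒮.covDeriv (Φ q.1) (𝒮.nuH (Φ q.1)) ((extChartAt 𝓘(ℝ, E2) p₀).symm q.2)
      (lift (Φ q.1) ((extChartAt 𝓘(ℝ, E2) p₀).symm q.2)
        (𝒮.Z (Φ q.1) ((extChartAt 𝓘(ℝ, E2) p₀).symm q.2))))
      (𝒮.Z (Φ q.1) ((extChartAt 𝓘(ℝ, E2) p₀).symm q.2))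
      = wedge (𝒮.repOm Φ p₀ x₀) (𝒮.repEta Φ p₀ x₀) 1 2 q / 𝒮.repDensity Φ p₀ x₀ q := by
    rw [r.lift_Z hi, ← 𝒮.inner_chartD r.rep.mem', chartD_covDeriv_slice r.rep _ hν hd,
      chartD_Z r.rep hP]
    refine Eq.trans ?_ IsSasakianChart.conn_zDir
    rw [conn, form, IsSasakianChart.fderiv_zDir]
    refine (sub_eq_self.2 (a.inner_T_Z h)).symm
  have e2 : 𝒮.g.inner _ (𝒮.covDeriv (Φ q.1) (𝒮.nuH (Φ q.1)) ((extChartAt 𝓘(ℝ, E2) p₀).symm q.2)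
      (lift (Φ q.1) ((extChartAt 𝓘(ℝ, E2) p₀).symm q.2)
        (𝒮.sField (Φ q.1) ((extChartAt 𝓘(ℝ, E2) p₀).symm q.2))))
      (𝒮.sField (Φ q.1) ((extChartAt 𝓘(ℝ, E2) p₀).symm q.2)) = 0 := by
    rw [r.lift_sField hi, ← 𝒮.inner_chartD r.rep.mem', chartD_covDeriv_slice r.rep _ hν hd,
      chartD_sField r.rep hP]
    set v := (tilt (𝒮.repSlope Φ p₀ x₀ q) / 𝒮.repDensity Φ p₀ x₀ q) •
      (𝒮.repAl Φ p₀ x₀ 2 q • b2 0 - 𝒮.repAl Φ p₀ x₀ 1 q • b2 1) with hv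
    have k1 := a.inner_cov_ν_ν h (0, v)
    have k2 := a.inner_cov_ν_T h (0, v)
    have k3 : form (𝒮.chartG x₀) (SubRiem.rep Φ p₀ x₀) (𝒮.repZ Φ p₀ x₀) (0, v) q = 0 := by
      have k4 := h.fderiv_sDir r.rep.contDiffAt r.rep.rep_mem hP finrank_E3
      have k5 := h.G_symm _ r.rep.rep_mem (𝒮.repZ Φ p₀ x₀ q) (𝒮.repNu Φ p₀ x₀ q)
      have k6 := h.G_symm _ r.rep.rep_mem (𝒮.repZ Φ p₀ x₀ q) (𝒮.chartT x₀ (SubRiem.rep Φ p₀ x₀ q))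
      rw [a.inner_ν_Z h] at k5
      rw [a.inner_T_Z h] at k6
      rw [form]
      refine (congrArg _ k4).trans ?_
      rw [map_neg, map_smul, map_add, map_smul, k5, k6]
      simp
    have key : ∀ (X n t : E3) (c m : ℝ), 𝒮.chartG x₀ (SubRiem.rep Φ p₀ x₀ q) X n = 0 →
        𝒮.chartG x₀ (SubRiem.rep Φ p₀ x₀ q) X t = 0 →
        𝒮.chartG x₀ (SubRiem.rep Φ p₀ x₀ q) X (-(c • (m • n + t))) = 0 := by
      intro X n t c m h1 h2
      simp [h1, h2]
    exact key _ _ _ _ _ k1 (k2.trans k3)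
  rw [meanCurvature, e1, e2]
  field_simp
  ring

/-- `B(Z)` in charts. -/
theorem chartD_shapeZ : chartD x₀ _ (𝒮.shapeZ (Φ q.1) ((extChartAt 𝓘(ℝ, E2) p₀).symm q.2))
    = -cov (𝒮.chartΓ x₀) (SubRiem.rep Φ p₀ x₀) (normalField (𝒮.chartG x₀) (𝒮.chartT x₀) (𝒮.chartJ x₀)
      (SubRiem.rep Φ p₀ x₀)) (0, zDir (𝒮.chartG x₀) (𝒮.chartT x₀) (SubRiem.rep Φ p₀ x₀) q) q := by
  have h := 𝒮.isSasakianChart x₀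
  have hN : ∀ᶠ y in 𝓝 q.2, chartD x₀ _ (𝒮.normal (Φ q.1) ((extChartAt 𝓘(ℝ, E2) p₀).symm y))
      = normalField (𝒮.chartG x₀) (𝒮.chartT x₀) (𝒮.chartJ x₀) (SubRiem.rep Φ p₀ x₀) (q.1, y) := by
    filter_upwards [r.eventually_slice] with y hy using chartD_normal hy.rep hy.density_ne
  have hd := (h.contDiffAt_normalField r.rep.contDiffAt r.rep.rep_mem r.density_ne).differentiableAt
    (by simp)
  rw [shapeZ, map_neg, r.lift_Z hi, chartD_covDeriv_slice r.rep _ hN hd]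

/-- The two invariants of the shape operator that enter the Jacobi operator. -/
theorem shapeZ_eq : 𝒮.g.inner _ (𝒮.shapeZ (Φ q.1) ((extChartAt 𝓘(ℝ, E2) p₀).symm q.2))
      (𝒮.sField (Φ q.1) ((extChartAt 𝓘(ℝ, E2) p₀).symm q.2))
      = 1 - tilt (𝒮.repSlope Φ p₀ x₀ q) ^ 2 * fderiv ℝ (𝒮.repSlope Φ p₀ x₀) q
        (0, zDir (𝒮.chartG x₀) (𝒮.chartT x₀) (SubRiem.rep Φ p₀ x₀) q) ∧
    𝒮.len _ (𝒮.shapeZ (Φ q.1) ((extChartAt 𝓘(ℝ, E2) p₀).symm q.2)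
      + 𝒮.sField (Φ q.1) ((extChartAt 𝓘(ℝ, E2) p₀).symm q.2)) ^ 2
      = (2 - tilt (𝒮.repSlope Φ p₀ x₀ q) ^ 2 * fderiv ℝ (𝒮.repSlope Φ p₀ x₀) q
        (0, zDir (𝒮.chartG x₀) (𝒮.chartT x₀) (SubRiem.rep Φ p₀ x₀) q)) ^ 2
        + 4 * 𝒮.meanCurvature (Φ q.1) ((extChartAt 𝓘(ℝ, E2) p₀).symm q.2) ^ 2
          * tilt (𝒮.repSlope Φ p₀ x₀ q) ^ 2 := by
  have h := 𝒮.isSasakianChart x₀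
  have a := r.frame
  have hP := r.density_ne
  have hH : wedge (𝒮.repOm Φ p₀ x₀) (𝒮.repEta Φ p₀ x₀) 1 2 q / 𝒮.repDensity Φ p₀ x₀ q
      = -2 * 𝒮.meanCurvature (Φ q.1) ((extChartAt 𝓘(ℝ, E2) p₀).symm q.2) := by
    rw [← r.meanCurvature_eq hi]; field_simp
  have hB : chartD x₀ _ (𝒮.shapeZ (Φ q.1) ((extChartAt 𝓘(ℝ, E2) p₀).symm q.2)) = _ :=
    (r.chartD_shapeZ hi).trans (congrArg Neg.neg
      (h.cov_normalField_zDir r.rep.contDiffAt r.rep.rep_mem hP finrank_E3))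
  have hS := chartD_sField r.rep hP
  have hρ := tilt_sq (𝒮.repSlope Φ p₀ x₀ q)
  set m := 𝒮.repSlope Φ p₀ x₀ q
  set ρ := tilt m
  set m' := fderiv ℝ (𝒮.repSlope Φ p₀ x₀) q
        (0, zDir (𝒮.chartG x₀) (𝒮.chartT x₀) (SubRiem.rep Φ p₀ x₀) q)
  set H := 𝒮.meanCurvature (Φ q.1) ((extChartAt 𝓘(ℝ, E2) p₀).symm q.2)
  rw [hH] at hB
  -- the inner product in an orthonormal frame
  have key : ∀ a₁ a₂ a₃ c₁ c₂ c₃ : ℝ, 𝒮.chartG x₀ (SubRiem.rep Φ p₀ x₀ q)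
      (a₁ • 𝒮.repNu Φ p₀ x₀ q + a₂ • 𝒮.repZ Φ p₀ x₀ q + a₃ • 𝒮.chartT x₀ (SubRiem.rep Φ p₀ x₀ q))
      (c₁ • 𝒮.repNu Φ p₀ x₀ q + c₂ • 𝒮.repZ Φ p₀ x₀ q + c₃ • 𝒮.chartT x₀ (SubRiem.rep Φ p₀ x₀ q))
      = a₁ * c₁ + a₂ * c₂ + a₃ * c₃ := by
    intro a₁ a₂ a₃ c₁ c₂ c₃
    have g1 := a.unit.self_of_nhds
    have g2 := a.inner_Z_Z h
    have g3 := h.T_unit _ r.rep.rep_mem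
    have g4 := a.inner_ν_Z h
    have g5 := a.inner_T_Z h
    have g6 := a.horizontal.self_of_nhds
    have s4 := h.G_symm _ r.rep.rep_mem (𝒮.repZ Φ p₀ x₀ q) (𝒮.repNu Φ p₀ x₀ q)
    have s5 := h.G_symm _ r.rep.rep_mem (𝒮.repZ Φ p₀ x₀ q) (𝒮.chartT x₀ (SubRiem.rep Φ p₀ x₀ q))
    have s6 := h.G_symm _ r.rep.rep_mem (𝒮.repNu Φ p₀ x₀ q) (𝒮.chartT x₀ (SubRiem.rep Φ p₀ x₀ q))
    simp only [map_add, map_smul, _root_.add_apply, _root_.smul_apply, smul_eq_mul, g1, g2, g3,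
      s4, s5, s6, g4, g5, g6]
    ring
  have hB' : chartD x₀ _ (𝒮.shapeZ (Φ q.1) ((extChartAt 𝓘(ℝ, E2) p₀).symm q.2))
      = (ρ ^ 3 * m * m' - ρ * m) • 𝒮.repNu Φ p₀ x₀ q + (2 * H * ρ) • 𝒮.repZ Φ p₀ x₀ q
        + (ρ * m' - ρ - ρ ^ 3 * m ^ 2 * m') • 𝒮.chartT x₀ (SubRiem.rep Φ p₀ x₀ q) := by
    rw [hB]
    change -(_ + _ + _ : E3) = _
    module
  have hS' : chartD x₀ _ (𝒮.sField (Φ q.1) ((extChartAt 𝓘(ℝ, E2) p₀).symm q.2))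
      = (-(ρ * m)) • 𝒮.repNu Φ p₀ x₀ q + (0 : ℝ) • 𝒮.repZ Φ p₀ x₀ q
        + (-ρ) • 𝒮.chartT x₀ (SubRiem.rep Φ p₀ x₀ q) := by
    rw [hS]
    module
  have hBS : chartD x₀ _ (𝒮.shapeZ (Φ q.1) ((extChartAt 𝓘(ℝ, E2) p₀).symm q.2)
      + 𝒮.sField (Φ q.1) ((extChartAt 𝓘(ℝ, E2) p₀).symm q.2))
      = (ρ ^ 3 * m * m' - 2 * ρ * m) • 𝒮.repNu Φ p₀ x₀ q + (2 * H * ρ) • 𝒮.repZ Φ p₀ x₀ q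
        + (ρ * m' - 2 * ρ - ρ ^ 3 * m ^ 2 * m') • 𝒮.chartT x₀ (SubRiem.rep Φ p₀ x₀ q) := by
    rw [map_add, hB', hS']
    module
  constructor
  · rw [← 𝒮.inner_chartD r.rep.mem', hB', hS']
    refine (key _ _ _ _ _ _).trans ?_
    linear_combination hρ
  · rw [len, Real.sq_sqrt, ← 𝒮.inner_chartD r.rep.mem', hBS]
    · refine (key _ _ _ _ _ _).trans ?_
      have e : ρ * m' - 2 * ρ - ρ ^ 3 * m ^ 2 * m' = ρ ^ 3 * m' - 2 * ρ := by
        linear_combination -(ρ * m') * hρ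
      rw [e]
      linear_combination (ρ ^ 2 * m' - 2) ^ 2 * hρ
    · rw [← 𝒮.inner_chartD r.rep.mem', hBS]
      refine le_of_le_of_eq ?_ (key _ _ _ _ _ _).symm
      exact add_nonneg (add_nonneg (mul_self_nonneg _) (mul_self_nonneg _)) (mul_self_nonneg _)

end IsRegPoint

end SasakianStructure
end SubRiem

namespace SubRiem

/-! ### Pointwise identities for the second variation and for positivity -/

namespace IsVariationCoframe

variable {al be ga om : Fin 3 → ℝ × E2 → ℝ} {m f : ℝ × E2 → ℝ} {κ H : ℝ} {y : E2}

/-- The potential `|B(Z) + S|² + 4 (K - 1) |N_h|²` in terms of the function `m`, where `κ = -4K`. -/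
def pot (al ga : Fin 3 → ℝ × E2 → ℝ) (m : ℝ × E2 → ℝ) (κ H : ℝ) (y : E2) : ℝ :=
  (2 - tilt (m (0, y)) ^ 2 * zd al ga (fun y => m (0, y)) y) ^ 2 + 4 * H ^ 2 * tilt (m (0, y)) ^ 2
    - (κ + 4) * tilt (m (0, y)) ^ 2

theorem zd_congr {h k : E2 → ℝ} (e : h =ᶠ[𝓝 y] k) : zd al ga h y = zd al ga k y := by
  rw [zd, zd, e.fderiv_eq]

theorem zd_comp {h : E2 → ℝ} {k : ℝ → ℝ} {k' : ℝ} (hk : HasDerivAt k k' (h y))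
    (hh : DifferentiableAt ℝ h y) : zd al ga (fun y => k (h y)) y = k' * zd al ga h y := by
  have e : fderiv ℝ (fun y => k (h y)) y = _ := (hk.comp_hasFDerivAt y hh.hasFDerivAt).fderiv
  simp only [zd, e, _root_.smul_apply, smul_eq_mul]
  ring

variable (c : IsVariationCoframe al be ga om m f κ H y)
include c

/-- The curl of `g η` on the slice `s = 0`. -/
theorem curl_mul_ga {g : E2 → ℝ} (hg : DifferentiableAt ℝ g y) :
    fderiv ℝ (fun y => g y * ga 2 (0, y)) y (b2 0) - fderiv ℝ (fun y => g y * ga 1 (0, y)) y (b2 1)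
      = wedge al ga 1 2 (0, y) * (zd al ga g y - 2 * m (0, y) * g y) := by
  have h2 := c.diff_ga.self_of_nhds
  have s : ∀ i, DifferentiableAt ℝ (fun y => ga i (0, y)) y := fun i =>
    (contDiffAt_slice (c.cd_ga i)).differentiableAt (by simp)
  have d := c.d_ga.self_of_nhds 1 2
  have z := c.zd_mul_density g
  rw [fderiv_fun_mul hg (s 2), fderiv_fun_mul hg (s 1)]
  simp only [_root_.add_apply, _root_.smul_apply, smul_eq_mul, fderiv_slice (h2 _)]
  simp only [dd, dir_one, dir_two, wedge, c.be_one.self_of_nhds, c.be_two.self_of_nhds] at d z ⊢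
  linear_combination g y * d - z

/-- The second variation in terms of `u = |N_h| f`: up to the curl of `G η`, the integrand is that
of the index form. -/
theorem variation_eq {u G : E2 → ℝ} (hu : ∀ y, u y = tilt (m (0, y)) * f (0, y))
    (hG : ∀ y, G y = -(u y * zd al ga u y / tilt (m (0, y)) ^ 2)) :
    f (0, y) * (dd 0 (wedge om ga 1 2) (0, y) + 2 * H * dd 0 (wedge al ga 1 2) (0, y))
      = wedge al ga 1 2 (0, y) * ((zd al ga u y ^ 2 - pot al ga m κ H y * u y ^ 2)
        / tilt (m (0, y)) ^ 2 + (zd al ga G y - 2 * m (0, y) * G y)) := by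
  have hm := contDiffAt_slice c.cd_m
  have hf := contDiffAt_slice c.cd_f
  have hm1 : ∀ᶠ y in 𝓝 y, DifferentiableAt ℝ (fun y => m (0, y)) y :=
    (hm.eventually (by simp)).mono fun _ h => h.differentiableAt (by simp)
  have hf1 : ∀ᶠ y in 𝓝 y, DifferentiableAt ℝ (fun y => f (0, y)) y :=
    (hf.eventually (by simp)).mono fun _ h => h.differentiableAt (by simp)
  have hzm : DifferentiableAt ℝ (zd al ga fun y => m (0, y)) y :=
    (c.contDiffAt_zd hm).differentiableAt (by simp)
  have hzf : DifferentiableAt ℝ (zd al ga fun y => f (0, y)) y :=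
    (c.contDiffAt_zd hf).differentiableAt (by simp)
  have hu' : u = fun y => tilt (m (0, y)) * f (0, y) := funext hu
  have ht : ∀ y, DifferentiableAt ℝ (fun y => m (0, y)) y →
      DifferentiableAt ℝ (fun y => tilt (m (0, y))) y := fun y h =>
    DifferentiableAt.comp (g := tilt) y (hasDerivAt_tilt _).differentiableAt h
  have hzu : ∀ᶠ y in 𝓝 y, zd al ga u y
      = -(tilt (m (0, y)) ^ 3 * m (0, y)) * zd al ga (fun y => m (0, y)) y * f (0, y)
        + tilt (m (0, y)) * zd al ga (fun y => f (0, y)) y := by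
    filter_upwards [hm1, hf1] with y h1 h2
    rw [hu', zd_mul (ht y h1) h2, zd_comp (hasDerivAt_tilt _) h1]
  -- `G = ρ² m m' f² - f Z(f)`
  have hG' : G =ᶠ[𝓝 y] fun y => (tilt (m (0, y)) * tilt (m (0, y))) * (m (0, y) *
      zd al ga (fun y => m (0, y)) y * (f (0, y) * f (0, y)))
      - f (0, y) * zd al ga (fun y => f (0, y)) y := by
    filter_upwards [hzu] with y h1
    have := (tilt_pos (m (0, y))).ne'
    rw [hG, h1, hu]
    field_simp
    ring
  obtain ⟨hcod, hvar⟩ := c.codazzi_and_variation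
  have hm1 := hm1.self_of_nhds
  have hf1 := hf1.self_of_nhds
  have ht1 := ht y hm1
  have hzG : zd al ga G y = _ := (zd_congr hG').trans
    (zd_sub ((ht1.fun_mul ht1).fun_mul ((hm1.fun_mul hzm).fun_mul (hf1.fun_mul hf1))) (hf1.fun_mul hzf))
  rw [zd_mul (ht1.fun_mul ht1) ((hm1.fun_mul hzm).fun_mul (hf1.fun_mul hf1)), zd_mul ht1 ht1,
    zd_mul (hm1.fun_mul hzm) (hf1.fun_mul hf1), zd_mul hm1 hzm, zd_mul hf1 hf1, zd_mul hf1 hzf,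
    zd_comp (hasDerivAt_tilt _) hm1, hcod] at hzG
  have hGy := hG'.self_of_nhds
  have hρ := tilt_sq (m (0, y))
  have hρ0 := (tilt_pos (m (0, y))).ne'
  rw [hvar, hzG, hGy, hzu.self_of_nhds, hu, pot]
  set ρ := tilt (m (0, y))
  have e : ∀ a b d e g : ℝ, ((-(ρ ^ 3 * a) * b * d + ρ * e) ^ 2 - g * (ρ * d) ^ 2) / ρ ^ 2
      = (-(ρ ^ 2 * a) * b * d + e) ^ 2 - g * d ^ 2 := by
    intro a b d e g; field_simp
  rw [e]
  linear_combination -(wedge al ga 1 2 (0, y) * f (0, y) ^ 2 * (4 * zd al ga (fun y => m (0, y)) y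
    + κ - 4 * H ^ 2 + 4 * (1 - m (0, y) ^ 2) - zd al ga (fun y => m (0, y)) y ^ 2 * ρ ^ 2)) * hρ

omit c in
/-- The identity behind the positivity of the index form, for a function `ψ` with `ψ L(ψ) ≤ 0`. -/
theorem positivity_eq {w ψ g : E2 → ℝ} (hw : DifferentiableAt ℝ w y) (hψ : DifferentiableAt ℝ ψ y)
    (hzψ : DifferentiableAt ℝ (zd al ga ψ) y) (hm : DifferentiableAt ℝ (fun y => m (0, y)) y)
    (hψ0 : ψ y ≠ 0) (hg : g =ᶠ[𝓝 y] fun y => w y ^ 2 * zd al ga ψ y / (tilt (m (0, y)) ^ 2 * ψ y)) :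
    (zd al ga w y ^ 2 - pot al ga m κ H y * w y ^ 2) / tilt (m (0, y)) ^ 2
      - (zd al ga g y - 2 * m (0, y) * g y)
      = (zd al ga w y - w y * zd al ga ψ y / ψ y) ^ 2 / tilt (m (0, y)) ^ 2
        - w y ^ 2 / ψ y ^ 2 * (ψ y * (zd al ga (zd al ga ψ) y
          - 2 * m (0, y) * (1 - tilt (m (0, y)) ^ 2 * zd al ga (fun y => m (0, y)) y) * zd al ga ψ y
          + pot al ga m κ H y * ψ y)) / tilt (m (0, y)) ^ 2 := by
  have hg' : g =ᶠ[𝓝 y] fun y => (w y * w y) * zd al ga ψ y *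
      ((1 + m (0, y) * m (0, y)) * (ψ y)⁻¹) := by
    filter_upwards [hg] with y h1
    have h2 := tilt_sq (m (0, y))
    have h3 := (tilt_pos (m (0, y))).ne'
    have h4 : 1 + m (0, y) * m (0, y) = (tilt (m (0, y)) ^ 2)⁻¹ := by
      field_simp; linarith
    rw [h1, h4]
    field_simp
  have hi : DifferentiableAt ℝ (fun y => (ψ y)⁻¹) y := hψ.fun_inv hψ0
  have h1 : DifferentiableAt ℝ (fun y => 1 + m (0, y) * m (0, y)) y := (hm.fun_mul hm).const_add 1
  have z1 : zd al ga (fun y => 1 + m (0, y) * m (0, y)) y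
      = 2 * m (0, y) * zd al ga (fun y => m (0, y)) y := by
    have : zd al ga (fun y => 1 + m (0, y) * m (0, y)) y = zd al ga (fun y => m (0, y) * m (0, y)) y := by
      simp only [zd, fderiv_const_add]
    rw [this, zd_mul hm hm]; ring
  have z2 : zd al ga (fun y => (ψ y)⁻¹) y = -(ψ y ^ 2)⁻¹ * zd al ga ψ y :=
    zd_comp (hasDerivAt_inv hψ0) hψ
  have hzg : zd al ga g y = _ := (zd_congr hg').trans
    (zd_mul ((hw.fun_mul hw).fun_mul hzψ) (h1.fun_mul hi))
  rw [zd_mul (hw.fun_mul hw) hzψ, zd_mul hw hw, zd_mul h1 hi, z1, z2] at hzg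
  rw [hzg, hg'.self_of_nhds]
  have h3 := (tilt_pos (m (0, y))).ne'
  have h4 : (tilt (m (0, y)) ^ 2)⁻¹ = 1 + m (0, y) * m (0, y) := by
    have := tilt_sq (m (0, y))
    field_simp; linarith
  have h5 : tilt (m (0, y)) ^ 2 = (1 + m (0, y) * m (0, y))⁻¹ := by rw [← h4, inv_inv]
  have h6 : 1 + m (0, y) * m (0, y) ≠ 0 := by nlinarith [mul_self_nonneg (m (0, y))]
  rw [h5]
  field_simp
  ring

end IsVariationCoframe
end SubRiem

namespace SubRiem
namespace SasakianStructure

variable {M : Type*} [TopologicalSpace M] [ChartedSpace E3 M] [IsManifold 𝓘(ℝ, E3) ∞ M]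
variable {𝒮 : SasakianStructure M}
variable {S : Type*} [TopologicalSpace S] [ChartedSpace E2 S] [IsManifold 𝓘(ℝ, E2) 3 S]
  {Φ : ℝ → S → M} {p₀ : S} {x₀ : M} {q : ℝ × E2} {y : E2}

/-! ### Regular points -/

theorem repEta_eq (r : IsRepPoint Φ p₀ x₀ q) (v : E2) :
    𝒮.chartG x₀ (rep Φ p₀ x₀ q) (𝒮.chartT x₀ (rep Φ p₀ x₀ q)) (fderiv ℝ (rep Φ p₀ x₀) q (0, v))
      = 𝒮.η _ (dmap (Φ q.1) ((extChartAt 𝓘(ℝ, E2) p₀).symm q.2) (chartDinv p₀ q.2 v)) := by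
  rw [r.fderiv_slice_eq]
  exact 𝒮.η_chartD r.mem' _

omit [IsManifold 𝓘(ℝ, E2) 3 S] in
/-- The tangent plane is horizontal if and only if the contact form vanishes on it. -/
theorem mem_regularSet_iff {φ : S → M} {p : S} (hi : Function.Injective (dmap φ p)) :
    p ∈ 𝒮.regularSet φ ↔ ∃ v, 𝒮.η (φ p) (dmap φ p v) ≠ 0 := by
  rw [regularSet, Set.mem_compl_iff, ← not_iff_not, not_not]
  push Not
  have : FiniteDimensional ℝ (TangentSpace 𝓘(ℝ, E3) (φ p)) :=
    inferInstanceAs (FiniteDimensional ℝ E3)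
  have h1 : Module.finrank ℝ (LinearMap.range (dmap φ p).toLinearMap) = 2 := by
    rw [LinearMap.finrank_range_of_inj hi]
    exact finrank_euclideanSpace_fin (𝕜 := ℝ) (n := 2)
  have h2 : Module.finrank ℝ (LinearMap.ker (𝒮.η (φ p)).toLinearMap) = 2 := by
    have h3 := LinearMap.finrank_range_add_finrank_ker (𝒮.η (φ p)).toLinearMap
    have h4 : LinearMap.range (𝒮.η (φ p)).toLinearMap = ⊤ := by
      rw [LinearMap.range_eq_top]
      intro c
      exact ⟨c • 𝒮.T (φ p), by simp [𝒮.η_T]⟩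
    have h5 : Module.finrank ℝ (TangentSpace 𝓘(ℝ, E3) (φ p)) = 3 :=
      finrank_euclideanSpace_fin (𝕜 := ℝ) (n := 3)
    rw [h4, finrank_top, h5] at h3
    simp at h3
    omega
  constructor
  · intro h v
    have : dmap φ p v ∈ LinearMap.ker (𝒮.η (φ p)).toLinearMap := by
      rw [← show _ = _ from h]; exact ⟨v, rfl⟩
    exact this
  · intro h
    refine Submodule.eq_of_le_of_finrank_eq ?_ (h1.trans h2.symm)
    rintro _ ⟨v, rfl⟩
    exact h v

theorem isRegPoint_iff (r : IsRepPoint Φ p₀ x₀ q)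
    (hi : Function.Injective (dmap (Φ q.1) ((extChartAt 𝓘(ℝ, E2) p₀).symm q.2))) :
    𝒮.IsRegPoint Φ p₀ x₀ q ↔ (extChartAt 𝓘(ℝ, E2) p₀).symm q.2 ∈ 𝒮.regularSet (Φ q.1) := by
  rw [mem_regularSet_iff hi]
  have e1 := repEta_eq (𝒮 := 𝒮) r (b2 0)
  have e2 := repEta_eq (𝒮 := 𝒮) r (b2 1)
  constructor
  · intro h
    by_contra! hv
    rw [hv] at e1 e2
    apply h.density_ne
    have : charVec (𝒮.chartG x₀) (𝒮.chartT x₀) (rep Φ p₀ x₀) q = 0 := by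
      simp only [charVec, etaForm, form, dir_one, dir_two, e1, e2, zero_smul, sub_zero]
    simp [density, this]
  · rintro ⟨v, hv⟩
    refine ⟨r, fun hP => hv ?_⟩
    have h0 : charVec (𝒮.chartG x₀) (𝒮.chartT x₀) (rep Φ p₀ x₀) q = 0 := by
      by_contra hne
      have := (𝒮.isSasakianChart x₀).G_pos _ r.rep_mem _ hne
      exact this.ne' ((Real.sqrt_eq_zero this.le).1 hP)
    -- the differential is injective, so that `η(∂₁) ∂₂ = η(∂₂) ∂₁` forces `η(∂₁) = η(∂₂) = 0`
    have h1 : fderiv ℝ (rep Φ p₀ x₀) q (0, (1 : ℝ) • (-𝒮.repEta Φ p₀ x₀ 2 q • b2 0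
        - -𝒮.repEta Φ p₀ x₀ 1 q • b2 1)) = 0 := by
      rw [map_zero_prod, one_smul, ← h0, charVec]
      module
    rw [r.fderiv_slice_eq] at h1
    have h2 := chartD_injective r.mem' (h1.trans (map_zero _).symm)
    have h3 := hi (h2.trans (map_zero _).symm)
    have h4 := congrArg (chartD p₀ ((extChartAt 𝓘(ℝ, E2) p₀).symm q.2)) h3
    rw [chartD_chartDinv r.mem, map_zero] at h4
    have h5 := congrArg (fun v : E2 => v 0) h4
    have h6 := congrArg (fun v : E2 => v 1) h4
    simp at h5 h6
    obtain ⟨w, rfl⟩ : ∃ w : E2, chartDinv p₀ q.2 w = v := ⟨_, chartDinv_chartD r.mem v⟩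
    rw [← repEta_eq r, zero_prod_eq, map_add, map_smul, map_smul, map_add, map_smul, map_smul]
    have h7 : 𝒮.chartG x₀ (rep Φ p₀ x₀ q) (𝒮.chartT x₀ (rep Φ p₀ x₀ q))
      (fderiv ℝ (rep Φ p₀ x₀) q (dir 1)) = 0 := h6
    have h8 : 𝒮.chartG x₀ (rep Φ p₀ x₀ q) (𝒮.chartT x₀ (rep Φ p₀ x₀ q))
      (fderiv ℝ (rep Φ p₀ x₀) q (dir 2)) = 0 := h5
    rw [h7, h8]
    simp

/-! ### The index form and the Jacobi operator in charts -/

/-- `-4K` along the slice `s = 0`, in charts. -/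
def repKappa (𝒮 : SasakianStructure M) (Φ : ℝ → S → M) (p₀ : S) (x₀ : M) (y : E2) : ℝ :=
  𝒮.chartG x₀ (rep Φ p₀ x₀ (0, y)) (riem (𝒮.chartΓ x₀) (rep Φ p₀ x₀ (0, y)) (𝒮.repNu Φ p₀ x₀ (0, y))
    (𝒮.repZ Φ p₀ x₀ (0, y)) (𝒮.repNu Φ p₀ x₀ (0, y))) (𝒮.repZ Φ p₀ x₀ (0, y)) - 3

/-- The derivative along `Z` in charts. -/
abbrev repZd (𝒮 : SasakianStructure M) (Φ : ℝ → S → M) (p₀ : S) (x₀ : M) (h : E2 → ℝ) (y : E2) : ℝ :=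
  IsVariationCoframe.zd (𝒮.repAl Φ p₀ x₀) (𝒮.repEta Φ p₀ x₀) h y

/-- The potential of the index form in charts. -/
abbrev repPot (𝒮 : SasakianStructure M) (Φ : ℝ → S → M) (p₀ : S) (x₀ : M) (H : ℝ) (y : E2) : ℝ :=
  IsVariationCoframe.pot (𝒮.repAl Φ p₀ x₀) (𝒮.repEta Φ p₀ x₀) (𝒮.repSlope Φ p₀ x₀)
    (𝒮.repKappa Φ p₀ x₀ y) H y

namespace IsRegPoint

section

variable (r : 𝒮.IsRegPoint Φ p₀ x₀ q)
include r

theorem wedge_eq : wedge (𝒮.repAl Φ p₀ x₀) (𝒮.repEta Φ p₀ x₀) 1 2 q = 𝒮.repDensity Φ p₀ x₀ q :=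
  (𝒮.isSasakianChart x₀).wedge_zForm_etaForm r.rep.contDiffAt r.rep.rep_mem r.density_ne

theorem contDiffAt_slope : ContDiffAt ℝ 2 (𝒮.repSlope Φ p₀ x₀) q :=
  (𝒮.isSasakianChart x₀).contDiffAt_slope r.rep.contDiffAt r.rep.rep_mem r.density_ne

theorem contDiffAt_density : ContDiffAt ℝ 2 (𝒮.repDensity Φ p₀ x₀) q :=
  (𝒮.isSasakianChart x₀).contDiffAt_density r.rep.contDiffAt r.rep.rep_mem r.density_ne

theorem contDiffAt_speed : ContDiffAt ℝ 2 (𝒮.repSpeed Φ p₀ x₀) q :=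
  (𝒮.isSasakianChart x₀).contDiffAt_speed r.rep.contDiffAt r.rep.rep_mem r.density_ne

theorem contDiffAt_eta (i : Fin 3) : ContDiffAt ℝ 2 (𝒮.repEta Φ p₀ x₀ i) q :=
  (𝒮.isSasakianChart x₀).contDiffAt_etaForm r.rep.contDiffAt r.rep.rep_mem i

theorem contDiffAt_al (i : Fin 3) : ContDiffAt ℝ 2 (𝒮.repAl Φ p₀ x₀ i) q :=
  r.frame.contDiffAt_form (𝒮.isSasakianChart x₀) r.frame.contDiffAt_Z _

variable [OrientedAtlas S]

/-- The transversal component of the velocity. -/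
theorem inner_normal_velocity : 𝒮.g.inner _ (𝒮.normal (Φ q.1) ((extChartAt 𝓘(ℝ, E2) p₀).symm q.2))
      (velocity Φ q.1 ((extChartAt 𝓘(ℝ, E2) p₀).symm q.2))
    = tilt (𝒮.repSlope Φ p₀ x₀ q) * 𝒮.repSpeed Φ p₀ x₀ q := by
  rw [← 𝒮.inner_chartD r.rep.mem', chartD_normal r.rep r.density_ne]
  refine (congrArg _ r.rep.chartD_velocity).trans ?_
  have key : ∀ (n t X : E3) (c m : ℝ), 𝒮.chartG x₀ (SubRiem.rep Φ p₀ x₀ q) (c • (n - m • t)) X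
      = c * (𝒮.chartG x₀ (SubRiem.rep Φ p₀ x₀ q) n X - m * 𝒮.chartG x₀ (SubRiem.rep Φ p₀ x₀ q) t X) := by
    intro n t X c m; simp
  exact key _ _ _ _ _

omit [OrientedAtlas S] in
/-- The velocity is tangent to the slice if and only if its transversal component vanishes. -/
theorem exists_dmap_eq_velocity_iff :
    (∃ v, dmap (Φ q.1) ((extChartAt 𝓘(ℝ, E2) p₀).symm q.2) v
      = velocity Φ q.1 ((extChartAt 𝓘(ℝ, E2) p₀).symm q.2)) ↔ 𝒮.repSpeed Φ p₀ x₀ q = 0 := by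
  have e := (𝒮.isSasakianChart x₀).exists_fderiv_eq_iff r.rep.contDiffAt r.rep.rep_mem r.density_ne
    finrank_E3 (fderiv ℝ (SubRiem.rep Φ p₀ x₀) q (dir 0))
  refine Iff.trans ?_ e
  rw [← r.rep.chartD_velocity]
  constructor
  · rintro ⟨v, hv⟩
    refine ⟨chartD p₀ _ v, ?_⟩
    rw [← r.rep.chartD_dmap, hv]
  · rintro ⟨v, hv⟩
    refine ⟨chartDinv p₀ q.2 v, chartD_injective r.rep.mem' ?_⟩
    rw [r.rep.chartD_dmap, chartD_chartDinv r.rep.mem, hv]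

end

variable [OrientedAtlas S] (r : 𝒮.IsRegPoint Φ p₀ x₀ (0, y))
  (hi : Function.Injective (dmap (Φ 0) ((extChartAt 𝓘(ℝ, E2) p₀).symm y)))
include r

omit [OrientedAtlas S] in
theorem zd_eq (h : E2 → ℝ) : 𝒮.repZd Φ p₀ x₀ h y
    = fderiv ℝ h y (zDir (𝒮.chartG x₀) (𝒮.chartT x₀) (SubRiem.rep Φ p₀ x₀) (0, y)) := by
  rw [repZd, IsVariationCoframe.zd, r.wedge_eq, zDir]
  simp only [map_smul, map_sub, smul_eq_mul]
  field_simp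

omit [OrientedAtlas S] in
theorem zd_slope : 𝒮.repZd Φ p₀ x₀ (fun y => 𝒮.repSlope Φ p₀ x₀ (0, y)) y
    = fderiv ℝ (𝒮.repSlope Φ p₀ x₀) (0, y)
      (0, zDir (𝒮.chartG x₀) (𝒮.chartT x₀) (SubRiem.rep Φ p₀ x₀) (0, y)) := by
  rw [r.zd_eq, fderiv_slice (r.contDiffAt_slope.differentiableAt (by simp))]

theorem webster_eq : 𝒮.webster _ (𝒮.Z (Φ 0) ((extChartAt 𝓘(ℝ, E2) p₀).symm y))
    = -(𝒮.repKappa Φ p₀ x₀ y) / 4 := by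
  have h := 𝒮.isSasakianChart x₀
  have a := r.frame
  have hz : chartD x₀ _ (𝒮.Z (Φ 0) ((extChartAt 𝓘(ℝ, E2) p₀).symm y)) = 𝒮.repZ Φ p₀ x₀ (0, y) :=
    chartD_Z r.rep r.density_ne
  have hj : chartD x₀ _ (𝒮.J _ (𝒮.Z (Φ 0) ((extChartAt 𝓘(ℝ, E2) p₀).symm y)))
      = -𝒮.repNu Φ p₀ x₀ (0, y) := by
    rw [𝒮.chartD_J r.rep.mem', hz]
    exact a.J_Z h
  rw [webster, 𝒮.sectionalCurvature_eq r.rep.mem', hz, hj]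
  · have h1 : ∀ y n z : E3, riem (𝒮.chartΓ x₀) y z (-n) (-n) = -riem (𝒮.chartΓ x₀) y n z n := by
      intro y n z
      rw [IsSasakianChart.riem_swap]
      simp only [riem, map_neg, _root_.neg_apply, neg_neg]
    rw [h1, map_neg, _root_.neg_apply, repKappa]
    change 1 / 4 * (-(𝒮.chartG x₀ (SubRiem.rep Φ p₀ x₀ (0, y)) (riem (𝒮.chartΓ x₀)
      (SubRiem.rep Φ p₀ x₀ (0, y)) _ _ _) _) + 3) = _
    ring
  · rw [← 𝒮.inner_chartD r.rep.mem', hz]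
    exact a.inner_Z_Z h
  · rw [← 𝒮.inner_chartD r.rep.mem', hj]
    refine Eq.trans ?_ a.unit.self_of_nhds
    have : ∀ y n : E3, 𝒮.chartG x₀ y (-n) (-n) = 𝒮.chartG x₀ y n n := by intro y n; simp
    exact this _ _
  · rw [← 𝒮.inner_chartD r.rep.mem', hj, hz, map_neg]
    exact neg_eq_zero.2 ((h.G_symm _ a.mem _ _).trans (a.inner_ν_Z h))

include hi

theorem Zderiv_eq {u : S → ℝ} {w : E2 → ℝ}
    (hu : ∀ᶠ y' in 𝓝 y, u ((extChartAt 𝓘(ℝ, E2) p₀).symm y') = w y') (hd : DifferentiableAt ℝ w y) :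
    𝒮.Zderiv (Φ 0) u ((extChartAt 𝓘(ℝ, E2) p₀).symm y) = 𝒮.repZd Φ p₀ x₀ w y := by
  have hu' : (fun y => u ((extChartAt 𝓘(ℝ, E2) p₀).symm y)) =ᶠ[𝓝 y] w := hu
  have hl : lift (Φ 0) ((extChartAt 𝓘(ℝ, E2) p₀).symm y) (𝒮.Z (Φ 0) ((extChartAt 𝓘(ℝ, E2) p₀).symm y))
    = chartDinv p₀ y (zDir (𝒮.chartG x₀) (𝒮.chartT x₀) (SubRiem.rep Φ p₀ x₀) (0, y)) := r.lift_Z hi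
  rw [Zderiv, mvfderiv_eq_fderiv_chart r.rep.mem (hd.congr_of_eventuallyEq hu'), hl,
    chartD_chartDinv r.rep.mem, r.zd_eq, hu'.fderiv_eq]

variable {H : ℝ} (hH : 𝒮.meanCurvature (Φ 0) ((extChartAt 𝓘(ℝ, E2) p₀).symm y) = H)
include hH

theorem potential_eq : 𝒮.potential (Φ 0) ((extChartAt 𝓘(ℝ, E2) p₀).symm y) = 𝒮.repPot Φ p₀ x₀ H y := by
  have e := (r.shapeZ_eq hi).2
  simp only [← r.zd_slope, hH] at e
  have e2 : 𝒮.absNormalH (Φ 0) ((extChartAt 𝓘(ℝ, E2) p₀).symm y) = _ := absNormalH_eq r.rep r.density_ne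
  rw [potential, e, r.webster_eq, e2, repPot, IsVariationCoframe.pot]
  ring

/-- The Jacobi operator in charts. -/
theorem jacobi_eq {u : S → ℝ} {w : E2 → ℝ}
    (hu : ∀ᶠ y' in 𝓝 y, u ((extChartAt 𝓘(ℝ, E2) p₀).symm y') = w y')
    (hu' : ∀ᶠ y' in 𝓝 y, 𝒮.Zderiv (Φ 0) u ((extChartAt 𝓘(ℝ, E2) p₀).symm y') = 𝒮.repZd Φ p₀ x₀ w y')
    (hd : DifferentiableAt ℝ (𝒮.repZd Φ p₀ x₀ w) y) :
    𝒮.jacobi (Φ 0) u ((extChartAt 𝓘(ℝ, E2) p₀).symm y)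
      = (tilt (𝒮.repSlope Φ p₀ x₀ (0, y)))⁻¹ * (𝒮.repZd Φ p₀ x₀ (𝒮.repZd Φ p₀ x₀ w) y
        - 2 * 𝒮.repSlope Φ p₀ x₀ (0, y) * (1 - tilt (𝒮.repSlope Φ p₀ x₀ (0, y)) ^ 2
          * 𝒮.repZd Φ p₀ x₀ (fun y => 𝒮.repSlope Φ p₀ x₀ (0, y)) y) * 𝒮.repZd Φ p₀ x₀ w y
        + 𝒮.repPot Φ p₀ x₀ H y * w y) := by
  have e := (r.shapeZ_eq hi).1
  simp only [← r.zd_slope] at e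
  have e2 : 𝒮.absNormalH (Φ 0) ((extChartAt 𝓘(ℝ, E2) p₀).symm y) = _ := absNormalH_eq r.rep r.density_ne
  have e3 : 𝒮.normalT (Φ 0) ((extChartAt 𝓘(ℝ, E2) p₀).symm y) = _ := normalT_eq r.rep r.density_ne
  have ht := (tilt_pos (𝒮.repSlope Φ p₀ x₀ (0, y))).ne'
  rw [jacobi, e, e2, e3, r.potential_eq hi hH, r.Zderiv_eq hi hu' hd, hu'.self_of_nhds, hu.self_of_nhds]
  field_simp
  ring

omit hi hH in
/-- The coframe of a family whose slice `s = 0` is an immersion of constant mean curvature. -/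
theorem isVariationCoframe
    (hi : ∀ᶠ y' in 𝓝 y, Function.Injective (dmap (Φ 0) ((extChartAt 𝓘(ℝ, E2) p₀).symm y')))
    (hH : ∀ᶠ y' in 𝓝 y, 𝒮.meanCurvature (Φ 0) ((extChartAt 𝓘(ℝ, E2) p₀).symm y') = H) :
    IsVariationCoframe (𝒮.repAl Φ p₀ x₀) (nuForm (𝒮.chartG x₀) (𝒮.chartT x₀) (𝒮.chartJ x₀)
      (SubRiem.rep Φ p₀ x₀)) (𝒮.repEta Φ p₀ x₀) (𝒮.repOm Φ p₀ x₀) (𝒮.repSlope Φ p₀ x₀)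
      (𝒮.repSpeed Φ p₀ x₀) (𝒮.repKappa Φ p₀ x₀ y) H y := by
  refine IsSasakianChart.isVariationCoframe (𝒮.isSasakianChart x₀) finrank_E3 r.rep.contDiffAt
    r.rep.rep_mem r.density_ne ?_
  filter_upwards [hi, hH, r.eventually_slice] with y' h1 h2 h3
  rw [← IsRegPoint.meanCurvature_eq (q := (0, y')) h3 h1, h2]

end IsRegPoint
end SasakianStructure
end SubRiem

namespace SubRiem

/-! ### The area measure -/

theorem det_comp_E2 (A B : E2 →L[ℝ] E2) : (A ∘L B).det = A.det * B.det :=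
  LinearMap.det_comp (A : E2 →ₗ[ℝ] E2) (B : E2 →ₗ[ℝ] E2)

/-- The Gram determinant of a bilinear form on `ℝ²`. -/
def gram (B : E2 →L[ℝ] E2 →L[ℝ] ℝ) (u v : E2) : ℝ := B u u * B v v - B u v * B v u

theorem gram_comp (B : E2 →L[ℝ] E2 →L[ℝ] ℝ) (L : E2 →L[ℝ] E2) :
    gram B (L (b2 0)) (L (b2 1)) = L.det ^ 2 * gram B (b2 0) (b2 1) := by
  rw [det_eq, gram, gram, eq_sum_b2 (L (b2 0)), eq_sum_b2 (L (b2 1))]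
  simp only [map_add, map_smul, _root_.add_apply, _root_.smul_apply, smul_eq_mul]
  simp
  ring

section chartDet

variable {S : Type*} [TopologicalSpace S] [ChartedSpace E2 S] [IsManifold 𝓘(ℝ, E2) 3 S]
  {p p₀ : S} {y : E2}

theorem chartDet_mul_det_chartDinv (hy : y ∈ (extChartAt 𝓘(ℝ, E2) p).target) :
    chartDet p ((extChartAt 𝓘(ℝ, E2) p).symm y) * (chartDinv p y : E2 →L[ℝ] E2).det = 1 := by
  have h := congrArg ContinuousLinearMap.det (chartD_comp_chartDinv hy)
  exact (det_comp_E2 _ _).symm.trans (h.trans LinearMap.det_id)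

theorem hasFDerivAt_transition (hy : y ∈ (extChartAt 𝓘(ℝ, E2) p).target)
    (hy' : (extChartAt 𝓘(ℝ, E2) p).symm y ∈ (extChartAt 𝓘(ℝ, E2) p₀).source) :
    HasFDerivAt (fun y => extChartAt 𝓘(ℝ, E2) p₀ ((extChartAt 𝓘(ℝ, E2) p).symm y))
      ((chartD p₀ ((extChartAt 𝓘(ℝ, E2) p).symm y) : E2 →L[ℝ] E2) ∘L chartDinv p y) y := by
  have h1 : MDifferentiableAt 𝓘(ℝ, E2) 𝓘(ℝ, E2)
      (fun y => extChartAt 𝓘(ℝ, E2) p₀ ((extChartAt 𝓘(ℝ, E2) p).symm y)) y :=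
    MDifferentiableAt.comp (g := extChartAt 𝓘(ℝ, E2) p₀) y (mdifferentiableAt_chart hy')
      (mdifferentiableAt_chart_symm hy)
  have h2 : fderiv ℝ (fun y => extChartAt 𝓘(ℝ, E2) p₀ ((extChartAt 𝓘(ℝ, E2) p).symm y)) y
      = (chartD p₀ ((extChartAt 𝓘(ℝ, E2) p).symm y) : E2 →L[ℝ] E2) ∘L chartDinv p y := by
    ext1 u
    exact fderiv_chart_comp (mdifferentiableAt_chart_symm hy) hy' u
  rw [← h2]
  exact (mdifferentiableAt_iff_differentiableAt.1 h1).hasFDerivAt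

end chartDet

namespace SasakianStructure

variable {M : Type*} [TopologicalSpace M] [ChartedSpace E3 M] [IsManifold 𝓘(ℝ, E3) ∞ M]
variable (𝒮 : SasakianStructure M)
variable {S : Type*} [TopologicalSpace S] [ChartedSpace E2 S]

/-- The metric induced on the surface. -/
def pullMetric (φ : S → M) (p : S) : E2 →L[ℝ] E2 →L[ℝ] ℝ :=
  let L : E2 →L[ℝ] E3 := dmap φ p
  let g : E3 →L[ℝ] E3 →L[ℝ] ℝ := 𝒮.g.inner (φ p)
  g.bilinearComp L L

theorem pullMetric_apply (φ : S → M) (p : S) (u v : E2) :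
    𝒮.pullMetric φ p u v = 𝒮.g.inner (φ p) (dmap φ p u) (dmap φ p v) := rfl

/-- The area density at `p` in the preferred chart at `p`. -/
def areaElement (φ : S → M) (p : S) : ℝ := √(gram (𝒮.pullMetric φ p) (b2 0) (b2 1))

variable [IsManifold 𝓘(ℝ, E2) 3 S] {φ : S → M} {p₀ p : S} {y : E2}

theorem areaDensity_eq (hφ : MDifferentiable 𝓘(ℝ, E2) 𝓘(ℝ, E3) φ)
    (hy : y ∈ (extChartAt 𝓘(ℝ, E2) p₀).target) : 𝒮.areaDensity φ p₀ y
      = √(gram (𝒮.pullMetric φ ((extChartAt 𝓘(ℝ, E2) p₀).symm y)) (chartDinv p₀ y (b2 0))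
        (chartDinv p₀ y (b2 1))) := by
  have h := mfderiv_comp y (hφ _) (mdifferentiableAt_chart_symm hy)
  have h' : ∀ u : E2, mfderiv 𝓘(ℝ, E2) 𝓘(ℝ, E3) (φ ∘ (extChartAt 𝓘(ℝ, E2) p₀).symm) y u
      = dmap φ _ (chartDinv p₀ y u) := fun u => congrArg (fun L => L u) h
  simp only [areaDensity, Matrix.det_fin_two, Matrix.of_apply]
  rw [h', h']
  rfl

theorem areaDensity_mul_abs_chartDet (hφ : MDifferentiable 𝓘(ℝ, E2) 𝓘(ℝ, E3) φ)
    (hy : y ∈ (extChartAt 𝓘(ℝ, E2) p₀).target) :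
    𝒮.areaDensity φ p₀ y * |chartDet p₀ ((extChartAt 𝓘(ℝ, E2) p₀).symm y)|
      = 𝒮.areaElement φ ((extChartAt 𝓘(ℝ, E2) p₀).symm y) := by
  have h1 := gram_comp (𝒮.pullMetric φ ((extChartAt 𝓘(ℝ, E2) p₀).symm y)) (chartDinv p₀ y)
  have h2 := chartDet_mul_det_chartDinv hy
  rw [𝒮.areaDensity_eq hφ hy, areaElement]
  refine (congrArg (fun t => √t * _) h1).trans ?_
  rw [Real.sqrt_mul (sq_nonneg _), Real.sqrt_sq_eq_abs]
  have h3 := congrArg abs h2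
  rw [abs_mul, abs_one] at h3
  linear_combination √(gram (𝒮.pullMetric φ ((extChartAt 𝓘(ℝ, E2) p₀).symm y)) (b2 0) (b2 1)) * h3

/-- The area density under a change of coordinates. -/
theorem areaDensity_transition (hφ : MDifferentiable 𝓘(ℝ, E2) 𝓘(ℝ, E3) φ)
    (hy : y ∈ (extChartAt 𝓘(ℝ, E2) p).target)
    (hy' : (extChartAt 𝓘(ℝ, E2) p).symm y ∈ (extChartAt 𝓘(ℝ, E2) p₀).source) :
    𝒮.areaDensity φ p y
      = |((chartD p₀ ((extChartAt 𝓘(ℝ, E2) p).symm y) : E2 →L[ℝ] E2) ∘L chartDinv p y).det|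
        * 𝒮.areaDensity φ p₀ (extChartAt 𝓘(ℝ, E2) p₀ ((extChartAt 𝓘(ℝ, E2) p).symm y)) := by
  have h1 := 𝒮.areaDensity_mul_abs_chartDet hφ hy
  have h2 := 𝒮.areaDensity_mul_abs_chartDet hφ ((extChartAt 𝓘(ℝ, E2) p₀).map_source hy')
  rw [(extChartAt 𝓘(ℝ, E2) p₀).left_inv hy', ← h1] at h2
  have h3 := congrArg abs (chartDet_mul_det_chartDinv hy)
  rw [abs_mul, abs_one] at h3
  have h4 : |((chartD p₀ ((extChartAt 𝓘(ℝ, E2) p).symm y) : E2 →L[ℝ] E2) ∘L chartDinv p y).det|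
      = |chartDet p₀ ((extChartAt 𝓘(ℝ, E2) p).symm y)| * |(chartDinv p y : E2 →L[ℝ] E2).det| := by
    refine (congrArg abs (det_comp_E2 _ _)).trans ?_
    rw [abs_mul]; rfl
  rw [h4]
  linear_combination -𝒮.areaDensity φ p y * h3 - |(chartDinv p y : E2 →L[ℝ] E2).det| * h2

/-- The area density in charts. -/
theorem areaDensity_eq_chart {x₀ : M} (hφ : MDifferentiable 𝓘(ℝ, E2) 𝓘(ℝ, E3) φ)
    (hy : y ∈ (extChartAt 𝓘(ℝ, E2) p₀).target)
    (hx : φ ((extChartAt 𝓘(ℝ, E2) p₀).symm y) ∈ (extChartAt 𝓘(ℝ, E3) x₀).source) {F : E2 → E3}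
    (hF : F = fun y => extChartAt 𝓘(ℝ, E3) x₀ (φ ((extChartAt 𝓘(ℝ, E2) p₀).symm y))) :
    𝒮.areaDensity φ p₀ y = √(gram (ContinuousLinearMap.bilinearComp (𝒮.chartG x₀ (F y))
      (fderiv ℝ F y) (fderiv ℝ F y)) (b2 0) (b2 1)) := by
  have h1 : ∀ u, fderiv ℝ F y u = chartD x₀ _ (dmap φ _ (chartDinv p₀ y u)) := by
    intro u
    have h := mfderiv_comp y (hφ _) (mdifferentiableAt_chart_symm hy)
    rw [hF]
    refine (fderiv_chart_comp (f := fun y => φ ((extChartAt 𝓘(ℝ, E2) p₀).symm y))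
      (MDifferentiableAt.comp y (hφ _) (mdifferentiableAt_chart_symm hy)) hx u).trans ?_
    exact congrArg (fun L : E2 →L[ℝ] E3 => (chartD x₀ (φ ((extChartAt 𝓘(ℝ, E2) p₀).symm y)) :
      E3 →L[ℝ] E3) (L u)) h
  rw [𝒮.areaDensity_eq hφ hy]
  have h2 : ∀ u v, 𝒮.chartG x₀ (F y) (fderiv ℝ F y u) (fderiv ℝ F y v)
      = 𝒮.pullMetric φ ((extChartAt 𝓘(ℝ, E2) p₀).symm y) (chartDinv p₀ y u) (chartDinv p₀ y v) := by
    intro u v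
    rw [h1, h1, hF]
    exact 𝒮.inner_chartD hx _ _
  simp only [gram, ContinuousLinearMap.bilinearComp_apply, h2]

theorem continuousAt_areaDensity (hφ : ContMDiff 𝓘(ℝ, E2) 𝓘(ℝ, E3) 1 φ)
    (hy : y ∈ (extChartAt 𝓘(ℝ, E2) p₀).target) : ContinuousAt (𝒮.areaDensity φ p₀) y := by
  have hφ' : MDifferentiable 𝓘(ℝ, E2) 𝓘(ℝ, E3) φ := hφ.mdifferentiable (by simp)
  have : IsManifold 𝓘(ℝ, E2) 1 S := IsManifold.of_le (n := 3) (by norm_num)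
  have : IsManifold 𝓘(ℝ, E3) 1 M := IsManifold.of_le (n := ∞) (WithTop.coe_le_coe.2 le_top)
  set x₀ := φ ((extChartAt 𝓘(ℝ, E2) p₀).symm y) with hx₀
  have hx := mem_extChartAt_source (I := 𝓘(ℝ, E3)) x₀
  obtain ⟨F, hF⟩ : ∃ F : E2 → E3, F = fun y => extChartAt 𝓘(ℝ, E3) x₀
    (φ ((extChartAt 𝓘(ℝ, E2) p₀).symm y)) := ⟨_, rfl⟩
  have h3 : ContMDiffAt 𝓘(ℝ, E2) 𝓘(ℝ, E2) 1 (extChartAt 𝓘(ℝ, E2) p₀).symm y :=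
    (contMDiffOn_extChartAt_symm p₀).contMDiffAt (mem_nhds_target hy)
  have h4 : ContMDiffAt 𝓘(ℝ, E2) 𝓘(ℝ, E3) 1 (fun y => φ ((extChartAt 𝓘(ℝ, E2) p₀).symm y)) y :=
    ContMDiffAt.comp (g := φ) y (hφ _) h3
  have h0 : ContMDiffOn 𝓘(ℝ, E3) 𝓘(ℝ, E3) 1 (extChartAt 𝓘(ℝ, E3) x₀)
    (extChartAt 𝓘(ℝ, E3) x₀).source := by
    rw [extChartAt_source]; exact contMDiffOn_extChartAt
  have h5 : ContDiffAt ℝ 1 F y := by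
    rw [hF]
    exact (ContMDiffAt.comp (g := extChartAt 𝓘(ℝ, E3) x₀) y (h0.contMDiffAt (mem_nhds_source hx))
      h4).contDiffAt
  have h6 : 𝒮.areaDensity φ p₀ =ᶠ[𝓝 y] fun y =>
      √(gram (ContinuousLinearMap.bilinearComp (𝒮.chartG x₀ (F y))
      (fderiv ℝ F y) (fderiv ℝ F y)) (b2 0) (b2 1)) := by
    filter_upwards [mem_nhds_target hy, h4.continuousAt.eventually (mem_nhds_source hx)] with y' h1 h2
    exact 𝒮.areaDensity_eq_chart hφ' h1 h2 hF
  refine ContinuousAt.congr ?_ h6.symm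
  have h7 : ContinuousAt (fun y => 𝒮.chartG x₀ (F y)) y := by
    refine ContinuousAt.comp (g := 𝒮.chartG x₀) ?_ h5.continuousAt
    refine ((𝒮.isSasakianChart x₀).contDiffAt_G ?_).continuousAt
    rw [hF]
    exact (extChartAt 𝓘(ℝ, E3) x₀).map_source hx
  have h8 : ∀ i, ContinuousAt (fun y => fderiv ℝ F y (b2 i)) y := fun i =>
    ((h5.fderiv_right (m := 0) (by norm_num)).continuousAt).clm_apply continuousAt_const
  have h9 : ∀ i j, ContinuousAt (fun y => 𝒮.chartG x₀ (F y) (fderiv ℝ F y (b2 i))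
    (fderiv ℝ F y (b2 j))) y := fun i j => (h7.clm_apply (h8 i)).clm_apply (h8 j)
  simp only [gram, ContinuousLinearMap.bilinearComp_apply]
  exact (((h9 0 0).mul (h9 1 1)).sub ((h9 0 1).mul (h9 1 0))).sqrt

omit [IsManifold 𝓘(ℝ, E2) 3 S] in
theorem areaElement_pos (hi : Function.Injective (dmap φ p)) : 0 < 𝒮.areaElement φ p := by
  refine Real.sqrt_pos.2 ?_
  set B := 𝒮.pullMetric φ p with hB
  have hpos : ∀ u : E2, u ≠ 0 → 0 < B u u := by
    intro u hu
    refine 𝒮.g.pos _ _ fun h0 => hu ?_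
    exact hi (h0.trans (map_zero _).symm)
  have hsymm : B (b2 1) (b2 0) = B (b2 0) (b2 1) := 𝒮.g.symm _ _ _
  have hb : b2 0 ≠ 0 := fun h => by simpa using congrArg (fun v : E2 => v 0) h
  have h0 := hpos _ hb
  have h1 := hpos (B (b2 0) (b2 0) • b2 1 - B (b2 0) (b2 1) • b2 0) (fun h => by
    have := congrArg (fun v : E2 => v 1) h
    simp at this
    exact h0.ne' this)
  simp only [map_sub, map_smul, _root_.sub_apply, _root_.smul_apply, smul_eq_mul, hsymm] at h1
  rw [gram, hsymm]
  refine pos_of_mul_pos_right (a := B (b2 0) (b2 0)) ?_ h0.le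
  linarith

section measure

variable [MeasurableSpace S] [BorelSpace S]

/-- The area measure of the image of a chart. -/
def chartMeasure (φ : S → M) (p₀ : S) : Measure S :=
  Measure.map (extChartAt 𝓘(ℝ, E2) p₀).symm
    ((volume.restrict (extChartAt 𝓘(ℝ, E2) p₀).target).withDensity
      fun y => ENNReal.ofReal (𝒮.areaDensity φ p₀ y))

omit [IsManifold 𝓘(ℝ, E2) 3 S] in
theorem aemeasurable_symm (φ : S → M) (p₀ : S) : AEMeasurable (extChartAt 𝓘(ℝ, E2) p₀).symm
    ((volume.restrict (extChartAt 𝓘(ℝ, E2) p₀).target).withDensity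
      fun y => ENNReal.ofReal (𝒮.areaDensity φ p₀ y)) :=
  ((continuousOn_extChartAt_symm p₀).aemeasurable
    (isOpen_extChartAt_target p₀).measurableSet).mono_ac (withDensity_absolutelyContinuous _ _)

omit [IsManifold 𝓘(ℝ, E2) 3 S] in
theorem chartMeasure_apply (φ : S → M) (p₀ : S) {B : Set S} (hB : MeasurableSet B) :
    𝒮.chartMeasure φ p₀ B = ∫⁻ y in (extChartAt 𝓘(ℝ, E2) p₀).symm ⁻¹' B ∩
      (extChartAt 𝓘(ℝ, E2) p₀).target, ENNReal.ofReal (𝒮.areaDensity φ p₀ y) := by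
  rw [chartMeasure, Measure.map_apply_of_aemeasurable (𝒮.aemeasurable_symm φ p₀) hB,
    withDensity_apply', Measure.restrict_restrict' (isOpen_extChartAt_target p₀).measurableSet]

omit [IsManifold 𝓘(ℝ, E2) 3 S] in
theorem measurableSet_symm_preimage (p₀ : S) {B : Set S} (hB : MeasurableSet B) :
    MeasurableSet ((extChartAt 𝓘(ℝ, E2) p₀).symm ⁻¹' B ∩ (extChartAt 𝓘(ℝ, E2) p₀).target) := by
  have h1 := (continuousOn_iff_continuous_domRestrict.1
    (continuousOn_extChartAt_symm (I := 𝓘(ℝ, E2)) p₀)).measurable hB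
  have h2 := (isOpen_extChartAt_target (I := 𝓘(ℝ, E2)) p₀).measurableSet.subtype_image h1
  convert h2 using 1
  ext y
  simp [and_comm]

/-- The chart measures agree on overlaps. -/
theorem chartMeasure_eq (hφ : MDifferentiable 𝓘(ℝ, E2) 𝓘(ℝ, E3) φ) {B : Set S} (hB : MeasurableSet B)
    (h : B ⊆ (extChartAt 𝓘(ℝ, E2) p).source) (h₀ : B ⊆ (extChartAt 𝓘(ℝ, E2) p₀).source) :
    𝒮.chartMeasure φ p B = 𝒮.chartMeasure φ p₀ B := by
  rw [chartMeasure_apply _ _ _ hB, chartMeasure_apply _ _ _ hB]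
  set e := extChartAt 𝓘(ℝ, E2) p
  set e₀ := extChartAt 𝓘(ℝ, E2) p₀
  have h1 : (fun y => e₀ (e.symm y)) '' (e.symm ⁻¹' B ∩ e.target) = e₀.symm ⁻¹' B ∩ e₀.target := by
    ext z
    constructor
    · rintro ⟨y, ⟨hy, -⟩, rfl⟩
      have := h₀ hy
      exact ⟨by rwa [Set.mem_preimage, e₀.left_inv this], e₀.map_source this⟩
    · rintro ⟨hz, hz'⟩
      have := h hz
      refine ⟨e (e₀.symm z), ⟨?_, e.map_source this⟩, ?_⟩
      · rwa [Set.mem_preimage, e.left_inv this]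
      · simp only [e.left_inv this, e₀.right_inv hz']
  rw [← h1, lintegral_image_eq_lintegral_abs_det_fderiv_mul volume (measurableSet_symm_preimage p hB)
    (fun y hy => (hasFDerivAt_transition (p₀ := p₀) hy.2 (h₀ hy.1)).hasFDerivWithinAt)]
  · refine setLIntegral_congr_fun (measurableSet_symm_preimage p hB) fun y hy => ?_
    simp only
    rw [𝒮.areaDensity_transition hφ hy.2 (h₀ hy.1), ENNReal.ofReal_mul (abs_nonneg _)]
  · intro y hy y' hy' heq
    have h2 := e₀.injOn (h₀ hy.1) (h₀ hy'.1) heq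
    exact e.symm.injOn hy.2 hy'.2 h2

/-- On the domain of a chart, the area measure is the measure of the coordinates weighted by the area
density. -/
theorem areaMeasure_restrict (hφ : MDifferentiable 𝓘(ℝ, E2) 𝓘(ℝ, E3) φ) (p₀ : S) :
    (𝒮.areaMeasure φ).restrict (extChartAt 𝓘(ℝ, E2) p₀).source = 𝒮.chartMeasure φ p₀ := by
  have hs : ∀ p : S, MeasurableSet (extChartAt 𝓘(ℝ, E2) p).source := fun p =>
    (isOpen_extChartAt_source p).measurableSet
  have h0 : ∀ p, 𝒮.chartMeasure φ p ≤ 𝒮.areaMeasure φ := fun p => le_iSup (𝒮.chartMeasure φ) p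
  have h1 : ∀ p, 𝒮.chartMeasure φ p (extChartAt 𝓘(ℝ, E2) p).sourceᶜ = 0 := by
    intro p
    rw [chartMeasure_apply _ _ _ (hs p).compl]
    have : (extChartAt 𝓘(ℝ, E2) p).symm ⁻¹' (extChartAt 𝓘(ℝ, E2) p).sourceᶜ ∩
        (extChartAt 𝓘(ℝ, E2) p).target = ∅ := by
      ext y
      simp only [Set.mem_inter_iff, Set.mem_preimage, Set.mem_compl_iff, Set.mem_empty_iff_false,
        iff_false, not_and]
      exact fun h1 h2 => h1 ((extChartAt 𝓘(ℝ, E2) p).map_target h2)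
    rw [this]; simp
  -- the area measure is at most the measure that is the chart measure on the domain of the chart
  have h2 : 𝒮.areaMeasure φ ≤ 𝒮.chartMeasure φ p₀
      + (𝒮.areaMeasure φ).restrict (extChartAt 𝓘(ℝ, E2) p₀).sourceᶜ := by
    refine iSup_le fun p => Measure.le_iff.2 fun B hB => ?_
    change 𝒮.chartMeasure φ p B ≤ _
    rw [← measure_inter_add_sdiff B (hs p₀), Measure.add_apply]
    refine add_le_add ?_ ?_
    · have e1 : 𝒮.chartMeasure φ p (B ∩ (extChartAt 𝓘(ℝ, E2) p₀).source)
          = 𝒮.chartMeasure φ p (B ∩ (extChartAt 𝓘(ℝ, E2) p₀).source ∩ (extChartAt 𝓘(ℝ, E2) p).source) := by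
        have e2 : 𝒮.chartMeasure φ p ((B ∩ (extChartAt 𝓘(ℝ, E2) p₀).source) \
          (extChartAt 𝓘(ℝ, E2) p).source) = 0 := measure_mono_null (fun x hx => hx.2) (h1 p)
        rw [← measure_inter_add_sdiff (B ∩ (extChartAt 𝓘(ℝ, E2) p₀).source) (hs p), e2, add_zero]
      rw [e1, 𝒮.chartMeasure_eq (p₀ := p₀) hφ ((hB.inter (hs p₀)).inter (hs p)) (fun x hx => hx.2)
        (fun x hx => hx.1.2)]
      exact measure_mono fun x hx => hx.1.1
    · rw [Measure.restrict_apply hB]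
      exact (h0 p) _
  refine le_antisymm ?_ ?_
  · refine Measure.le_iff.2 fun B hB => ?_
    rw [Measure.restrict_apply hB]
    refine (h2 _).trans ?_
    rw [Measure.add_apply, Measure.restrict_apply (hB.inter (hs p₀))]
    have : B ∩ (extChartAt 𝓘(ℝ, E2) p₀).source ∩ (extChartAt 𝓘(ℝ, E2) p₀).sourceᶜ = ∅ := by
      rw [Set.inter_assoc, Set.inter_compl_self, Set.inter_empty]
    rw [this, measure_empty, add_zero]
    exact measure_mono Set.inter_subset_left
  · refine Measure.le_iff.2 fun B hB => ?_
    have e2 : 𝒮.chartMeasure φ p₀ (B \ (extChartAt 𝓘(ℝ, E2) p₀).source) = 0 :=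
      measure_mono_null (fun x hx => hx.2) (h1 p₀)
    rw [← measure_inter_add_sdiff B (hs p₀), e2, add_zero, Measure.restrict_apply hB]
    exact h0 p₀ _

/-- Integration over the domain of a chart. -/
theorem setIntegral_chart (hφ : ContMDiff 𝓘(ℝ, E2) 𝓘(ℝ, E3) 1 φ) (p₀ : S) {k : S → ℝ}
    (hk : AEStronglyMeasurable k (𝒮.areaMeasure φ)) :
    ∫ p in (extChartAt 𝓘(ℝ, E2) p₀).source, k p ∂(𝒮.areaMeasure φ)
      = ∫ y in (extChartAt 𝓘(ℝ, E2) p₀).target, 𝒮.areaDensity φ p₀ y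
        * k ((extChartAt 𝓘(ℝ, E2) p₀).symm y) := by
  have h1 := 𝒮.areaMeasure_restrict (hφ.mdifferentiable (by simp)) p₀
  have hk' : AEStronglyMeasurable k (𝒮.chartMeasure φ p₀) := h1 ▸ hk.restrict
  rw [h1, chartMeasure, integral_map (𝒮.aemeasurable_symm φ p₀) hk']
  have hc : ContinuousOn (𝒮.areaDensity φ p₀) (extChartAt 𝓘(ℝ, E2) p₀).target := fun y hy =>
    (𝒮.continuousAt_areaDensity hφ hy).continuousWithinAt
  rw [integral_withDensity_eq_integral_toReal_smul₀
    (hc.aemeasurable (isOpen_extChartAt_target p₀).measurableSet).ennreal_ofReal (by simp)]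
  refine integral_congr_ae (Eventually.of_forall fun y => ?_)
  simp only [smul_eq_mul]
  rw [ENNReal.toReal_ofReal (by exact Real.sqrt_nonneg _)]

theorem isLocallyFiniteMeasure_areaMeasure (hφ : ContMDiff 𝓘(ℝ, E2) 𝓘(ℝ, E3) 1 φ) :
    IsLocallyFiniteMeasure (𝒮.areaMeasure φ) := by
  refine ⟨fun p => ?_⟩
  set e := extChartAt 𝓘(ℝ, E2) p
  have hp := mem_extChartAt_source (I := 𝓘(ℝ, E2)) p
  have hy := mem_extChartAt_target (I := 𝓘(ℝ, E2)) p
  have hc := 𝒮.continuousAt_areaDensity hφ hy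
  have h1 : ∀ᶠ y in 𝓝 (e p), 𝒮.areaDensity φ p y < 𝒮.areaDensity φ p (e p) + 1 :=
    hc.eventually_lt continuousAt_const (by linarith)
  obtain ⟨ε, hε, hb⟩ := Metric.eventually_nhds_iff_ball.1 h1
  have hce : ContinuousAt e p := continuousAt_extChartAt p
  obtain ⟨U, hU, hUo, hpU⟩ : ∃ U ⊆ e ⁻¹' Metric.ball (e p) ε ∩ e.source, IsOpen U ∧ p ∈ U :=
    mem_nhds_iff.1 (Filter.inter_mem (hce.preimage_mem_nhds (Metric.ball_mem_nhds _ hε))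
      (mem_nhds_source hp))
  refine ⟨U, hUo.mem_nhds hpU, ?_⟩
  have h2 : 𝒮.areaMeasure φ U = 𝒮.chartMeasure φ p U := by
    rw [← 𝒮.areaMeasure_restrict (hφ.mdifferentiable (by simp)) p,
      Measure.restrict_apply hUo.measurableSet, Set.inter_eq_left.2 fun x hx => (hU hx).2]
  rw [h2, chartMeasure_apply _ _ _ hUo.measurableSet]
  have hsub : e.symm ⁻¹' U ∩ e.target ⊆ Metric.ball (e p) ε := fun y hy => by
    have := (hU hy.1).1
    rwa [Set.mem_preimage, e.right_inv hy.2] at this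
  calc ∫⁻ y in e.symm ⁻¹' U ∩ e.target, ENNReal.ofReal (𝒮.areaDensity φ p y)
      ≤ ∫⁻ y in e.symm ⁻¹' U ∩ e.target, ENNReal.ofReal (𝒮.areaDensity φ p (e p) + 1) :=
        setLIntegral_mono' (measurableSet_symm_preimage p hUo.measurableSet) fun y hy =>
          ENNReal.ofReal_le_ofReal (hb y (hsub hy)).le
    _ = ENNReal.ofReal (𝒮.areaDensity φ p (e p) + 1) * volume (e.symm ⁻¹' U ∩ e.target) := by simp
    _ < ⊤ := ENNReal.mul_lt_top (by simp) ((measure_mono hsub).trans_lt measure_ball_lt_top)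

end measure

end SasakianStructure
end SubRiem

namespace SubRiem
namespace SasakianStructure

variable {M : Type*} [TopologicalSpace M] [ChartedSpace E3 M] [IsManifold 𝓘(ℝ, E3) ∞ M]
  (𝒮 : SasakianStructure M)
  {S : Type*} [TopologicalSpace S] [ChartedSpace E2 S] [IsManifold 𝓘(ℝ, E2) 3 S] {φ : S → M}

theorem isOpen_regularSet (hφ : ContMDiff 𝓘(ℝ, E2) 𝓘(ℝ, E3) 1 φ)
    (hi : ∀ p, Function.Injective (dmap φ p)) : IsOpen (𝒮.regularSet φ) := by
  have : IsManifold 𝓘(ℝ, E2) 1 S := IsManifold.of_le (n := 3) (by norm_num)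
  have : IsManifold 𝓘(ℝ, E3) 1 M := IsManifold.of_le (n := ∞) (WithTop.coe_le_coe.2 le_top)
  have hφ' : MDifferentiable 𝓘(ℝ, E2) 𝓘(ℝ, E3) φ := hφ.mdifferentiable (by simp)
  refine isOpen_iff_mem_nhds.2 fun p hp => ?_
  obtain ⟨v₀, hv₀⟩ := (mem_regularSet_iff (𝒮 := 𝒮) (hi p)).1 hp
  obtain ⟨p₁, y, hy, rfl⟩ : ∃ p₁ : S, ∃ y ∈ (extChartAt 𝓘(ℝ, E2) p₁).target,
      (extChartAt 𝓘(ℝ, E2) p₁).symm y = p :=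
    ⟨p, _, mem_extChartAt_target p, (extChartAt 𝓘(ℝ, E2) p).left_inv (mem_extChartAt_source p)⟩
  set x₀ := φ ((extChartAt 𝓘(ℝ, E2) p₁).symm y) with hx₀
  have hx := mem_extChartAt_source (I := 𝓘(ℝ, E3)) x₀
  obtain ⟨v, hv⟩ : ∃ v : E2, v = chartD p₁ _ v₀ := ⟨_, rfl⟩
  obtain ⟨F, hF⟩ : ∃ F : E2 → E3, F = fun y => extChartAt 𝓘(ℝ, E3) x₀
    (φ ((extChartAt 𝓘(ℝ, E2) p₁).symm y)) := ⟨_, rfl⟩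
  have h3 : ContMDiffAt 𝓘(ℝ, E2) 𝓘(ℝ, E2) 1 (extChartAt 𝓘(ℝ, E2) p₁).symm y :=
    (contMDiffOn_extChartAt_symm p₁).contMDiffAt (mem_nhds_target hy)
  have h4 : ContMDiffAt 𝓘(ℝ, E2) 𝓘(ℝ, E3) 1 (fun y => φ ((extChartAt 𝓘(ℝ, E2) p₁).symm y)) y :=
    ContMDiffAt.comp (g := φ) y (hφ _) h3
  have h0 : ContMDiffOn 𝓘(ℝ, E3) 𝓘(ℝ, E3) 1 (extChartAt 𝓘(ℝ, E3) x₀)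
    (extChartAt 𝓘(ℝ, E3) x₀).source := by
    rw [extChartAt_source]; exact contMDiffOn_extChartAt
  have h5 : ContDiffAt ℝ 1 F y := by
    rw [hF]
    exact (ContMDiffAt.comp (g := extChartAt 𝓘(ℝ, E3) x₀) y (h0.contMDiffAt (mem_nhds_source hx))
      h4).contDiffAt
  have hmem : F y ∈ (extChartAt 𝓘(ℝ, E3) x₀).target := by
    rw [hF]
    exact (extChartAt 𝓘(ℝ, E3) x₀).map_source hx
  -- the contact form on the image of `v`, read in the charts
  have h6 : ∀ y' ∈ (extChartAt 𝓘(ℝ, E2) p₁).target,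
      φ ((extChartAt 𝓘(ℝ, E2) p₁).symm y') ∈ (extChartAt 𝓘(ℝ, E3) x₀).source →
      𝒮.chartG x₀ (F y') (𝒮.chartT x₀ (F y')) (fderiv ℝ F y' v)
        = 𝒮.η _ (dmap φ _ (chartDinv p₁ y' v)) := by
    intro y' hy' hx'
    have h := mfderiv_comp y' (hφ' _) (mdifferentiableAt_chart_symm hy')
    have h1 : fderiv ℝ F y' v = chartD x₀ _ (dmap φ _ (chartDinv p₁ y' v)) := by
      rw [hF]
      refine (fderiv_chart_comp (f := fun y => φ ((extChartAt 𝓘(ℝ, E2) p₁).symm y))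
        (MDifferentiableAt.comp y' (hφ' _) (mdifferentiableAt_chart_symm hy')) hx' v).trans ?_
      exact congrArg (fun L : E2 →L[ℝ] E3 => (chartD x₀ (φ ((extChartAt 𝓘(ℝ, E2) p₁).symm y')) :
        E3 →L[ℝ] E3) (L v)) h
    rw [h1, hF]
    exact 𝒮.η_chartD hx' _
  have h7 : ContinuousAt (fun y => 𝒮.chartG x₀ (F y)) y :=
    ContinuousAt.comp (g := 𝒮.chartG x₀) ((𝒮.isSasakianChart x₀).contDiffAt_G hmem).continuousAt
      h5.continuousAt
  have h8 : ContinuousAt (fun y => 𝒮.chartT x₀ (F y)) y :=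
    ContinuousAt.comp (g := 𝒮.chartT x₀) ((𝒮.isSasakianChart x₀).contDiffAt_T hmem).continuousAt
      h5.continuousAt
  have h9 : ContinuousAt (fun y => fderiv ℝ F y v) y :=
    ((h5.fderiv_right (m := 0) (by norm_num)).continuousAt).clm_apply continuousAt_const
  have hne : 𝒮.chartG x₀ (F y) (𝒮.chartT x₀ (F y)) (fderiv ℝ F y v) ≠ 0 := by
    rw [h6 y hy hx, hv]
    refine fun h => hv₀ (Eq.trans ?_ h)
    exact congrArg (fun w : E2 => 𝒮.η _ (dmap φ _ w)) (chartDinv_chartD hy v₀).symm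
  have h10 := ((h7.clm_apply h8).clm_apply h9).eventually_ne hne
  have hs := (extChartAt 𝓘(ℝ, E2) p₁).map_target hy
  rw [← (extChartAt 𝓘(ℝ, E2) p₁).right_inv hy] at h10
  have h11 := (continuousAt_extChartAt' hs).eventually h10
  filter_upwards [h11, mem_nhds_source hs,
    hφ.continuous.continuousAt.eventually (mem_nhds_source hx)] with p' h1 h2 h3
  have e := (extChartAt 𝓘(ℝ, E2) p₁).left_inv h2
  rw [h6 _ ((extChartAt 𝓘(ℝ, E2) p₁).map_source h2) (by rwa [e])] at h1
  have h12 := (mem_regularSet_iff (𝒮 := 𝒮) (hi _)).2 ⟨_, h1⟩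
  rwa [e] at h12

end SasakianStructure
end SubRiem

namespace SubRiem

theorem continuousAt_of_chart {S V : Type*} [TopologicalSpace S] [ChartedSpace E2 S]
    [TopologicalSpace V] {k : S → V} {p₀ p : S}
    (hp : p ∈ (extChartAt 𝓘(ℝ, E2) p₀).source)
    (h : ContinuousAt (fun y => k ((extChartAt 𝓘(ℝ, E2) p₀).symm y)) (extChartAt 𝓘(ℝ, E2) p₀ p)) :
    ContinuousAt k p := by
  have h1 : ContinuousAt (extChartAt 𝓘(ℝ, E2) p₀) p := continuousAt_extChartAt' hp
  refine (ContinuousAt.comp (g := fun y => k ((extChartAt 𝓘(ℝ, E2) p₀).symm y)) h h1).congr ?_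
  filter_upwards [mem_nhds_source hp] with p' hp'
  exact congrArg k ((extChartAt 𝓘(ℝ, E2) p₀).left_inv hp')

namespace SasakianStructure

variable {M : Type*} [TopologicalSpace M] [ChartedSpace E3 M] [IsManifold 𝓘(ℝ, E3) ∞ M]
variable (𝒮 : SasakianStructure M)
variable {S : Type*} [TopologicalSpace S] [ChartedSpace E2 S] [IsManifold 𝓘(ℝ, E2) 3 S]

/-- The area density at a regular point. -/
theorem IsRegPoint.areaDensity_eq {𝒮 : SasakianStructure M} {Φ : ℝ → S → M} {p₀ : S} {x₀ : M}
    {q : ℝ × E2} (r : 𝒮.IsRegPoint Φ p₀ x₀ q) (hφ : MDifferentiable 𝓘(ℝ, E2) 𝓘(ℝ, E3) (Φ q.1)) :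
    𝒮.areaDensity (Φ q.1) p₀ q.2
      = 𝒮.repDensity Φ p₀ x₀ q / tilt (𝒮.repSlope Φ p₀ x₀ q) := by
  have h := 𝒮.isSasakianChart x₀
  have a := r.frame
  rw [𝒮.areaDensity_eq_chart hφ r.rep.mem r.rep.mem' (F := fun y => SubRiem.rep Φ p₀ x₀ (q.1, y)) rfl,
    r.rep.hasFDerivAt_slice.fderiv]
  obtain ⟨n1, n2⟩ := h.nuForm_eq r.rep.contDiffAt r.rep.rep_mem r.density_ne finrank_E3
  have hw := r.wedge_eq
  have e : ∀ i j, 𝒮.chartG x₀ (SubRiem.rep Φ p₀ x₀ q) (fderiv ℝ (SubRiem.rep Φ p₀ x₀) q (dir i))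
      (fderiv ℝ (SubRiem.rep Φ p₀ x₀) q (dir j)) = _ := fun i j => a.inner_expand h finrank_E3 _ _
  have e' : ∀ (i j : Fin 3), _ = (nuForm (𝒮.chartG x₀) (𝒮.chartT x₀) (𝒮.chartJ x₀)
      (SubRiem.rep Φ p₀ x₀) i q * nuForm (𝒮.chartG x₀) (𝒮.chartT x₀) (𝒮.chartJ x₀)
      (SubRiem.rep Φ p₀ x₀) j q + 𝒮.repAl Φ p₀ x₀ i q * 𝒮.repAl Φ p₀ x₀ j q
      + 𝒮.repEta Φ p₀ x₀ i q * 𝒮.repEta Φ p₀ x₀ j q) := fun i j => e i j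
  have hg : gram (ContinuousLinearMap.bilinearComp (𝒮.chartG x₀ (SubRiem.rep Φ p₀ x₀ q))
      ((fderiv ℝ (SubRiem.rep Φ p₀ x₀) q).comp (ContinuousLinearMap.inr ℝ ℝ E2))
      ((fderiv ℝ (SubRiem.rep Φ p₀ x₀) q).comp (ContinuousLinearMap.inr ℝ ℝ E2))) (b2 0) (b2 1)
      = (1 + 𝒮.repSlope Φ p₀ x₀ q ^ 2) * 𝒮.repDensity Φ p₀ x₀ q ^ 2 := by
    rw [← hw]
    have e11 := e' 1 1
    have e12 := e' 1 2
    have e21 := e' 2 1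
    have e22 := e' 2 2
    rw [n1] at e11 e12 e21
    rw [n2] at e12 e21 e22
    simp only [dir_one, dir_two] at e11 e12 e21 e22
    simp only [gram, ContinuousLinearMap.bilinearComp_apply, ContinuousLinearMap.comp_apply,
      ContinuousLinearMap.inr_apply, e11, e12, e21, e22, wedge]
    ring
  refine (congrArg Real.sqrt hg).trans ?_
  rw [Real.sqrt_mul (by positivity), Real.sqrt_sq r.density_pos.le, tilt, div_inv_eq_mul, mul_comm]

variable [OrientedAtlas S]

theorem areaDensity_mul_chartDet {φ : S → M} {p₀ : S} {y : E2}
    (hφ : MDifferentiable 𝓘(ℝ, E2) 𝓘(ℝ, E3) φ)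
    (hy : y ∈ (extChartAt 𝓘(ℝ, E2) p₀).target) :
    𝒮.areaDensity φ p₀ y * chartDet p₀ ((extChartAt 𝓘(ℝ, E2) p₀).symm y)
      = 𝒮.areaElement φ ((extChartAt 𝓘(ℝ, E2) p₀).symm y) := by
  rw [← 𝒮.areaDensity_mul_abs_chartDet hφ hy,
    abs_of_pos (chartDet_pos ((extChartAt 𝓘(ℝ, E2) p₀).map_target hy))]

/-- The quotient of the area elements of two immersions. -/
def areaQuotient (φ φ' : S → M) (p : S) : ℝ := 𝒮.areaElement φ' p / 𝒮.areaElement φ p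

variable {φ φ' : S → M}

omit [OrientedAtlas S] [IsManifold 𝓘(ℝ, E2) 3 S] in
theorem areaQuotient_nonneg (p : S) : 0 ≤ 𝒮.areaQuotient φ φ' p :=
  div_nonneg (Real.sqrt_nonneg _) (Real.sqrt_nonneg _)

section

variable (hφ : ContMDiff 𝓘(ℝ, E2) 𝓘(ℝ, E3) 1 φ) (hi : ∀ p, Function.Injective (dmap φ p))
  (hφ' : ContMDiff 𝓘(ℝ, E2) 𝓘(ℝ, E3) 1 φ')
include hφ hi

theorem areaDensity_pos {p₀ : S} {y : E2} (hy : y ∈ (extChartAt 𝓘(ℝ, E2) p₀).target) :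
    0 < 𝒮.areaDensity φ p₀ y :=
  pos_of_mul_pos_left (b := chartDet p₀ ((extChartAt 𝓘(ℝ, E2) p₀).symm y))
    (by rw [𝒮.areaDensity_mul_chartDet (hφ.mdifferentiable (by simp)) hy]; exact 𝒮.areaElement_pos (hi _))
    (chartDet_pos ((extChartAt 𝓘(ℝ, E2) p₀).map_target hy)).le

include hφ'

omit hi in
theorem areaQuotient_eq {p₀ : S} {y : E2} (hy : y ∈ (extChartAt 𝓘(ℝ, E2) p₀).target) :
    𝒮.areaQuotient φ φ' ((extChartAt 𝓘(ℝ, E2) p₀).symm y)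
      = 𝒮.areaDensity φ' p₀ y / 𝒮.areaDensity φ p₀ y := by
  have h := chartDet_pos ((extChartAt 𝓘(ℝ, E2) p₀).map_target hy)
  rw [areaQuotient, ← 𝒮.areaDensity_mul_chartDet (hφ.mdifferentiable (by simp)) hy,
    ← 𝒮.areaDensity_mul_chartDet (hφ'.mdifferentiable (by simp)) hy, mul_div_mul_right _ _ h.ne']

theorem continuous_areaQuotient : Continuous (𝒮.areaQuotient φ φ') := by
  refine continuous_iff_continuousAt.2 fun p => ?_
  have hp := mem_extChartAt_target (I := 𝓘(ℝ, E2)) p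
  refine continuousAt_of_chart (mem_extChartAt_source (I := 𝓘(ℝ, E2)) p) ?_
  refine ((𝒮.continuousAt_areaDensity hφ' hp).div₀ (𝒮.continuousAt_areaDensity hφ hp)
    (𝒮.areaDensity_pos hφ hi hp).ne').congr ?_
  filter_upwards [mem_nhds_target hp] with y hy
  exact (𝒮.areaQuotient_eq hφ hφ' hy).symm

variable [MeasurableSpace S] [BorelSpace S]

omit hi hφ' [OrientedAtlas S] in
theorem lintegral_chartMeasure (p₀ : S) {k : S → ℝ≥0∞} (hk : Measurable k) :
    ∫⁻ p, k p ∂(𝒮.chartMeasure φ p₀) = ∫⁻ y in (extChartAt 𝓘(ℝ, E2) p₀).target,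
      ENNReal.ofReal (𝒮.areaDensity φ p₀ y) * k ((extChartAt 𝓘(ℝ, E2) p₀).symm y) := by
  have hc : ContinuousOn (𝒮.areaDensity φ p₀) (extChartAt 𝓘(ℝ, E2) p₀).target := fun y hy =>
    (𝒮.continuousAt_areaDensity hφ hy).continuousWithinAt
  rw [chartMeasure, lintegral_map' hk.aemeasurable (𝒮.aemeasurable_symm φ p₀),
    lintegral_withDensity_eq_lintegral_mul₀]
  · rfl
  · exact (hc.aemeasurable (isOpen_extChartAt_target p₀).measurableSet).ennreal_ofReal
  · exact hk.comp_aemeasurable ((continuousOn_extChartAt_symm p₀).aemeasurable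
      (isOpen_extChartAt_target p₀).measurableSet)

/-- The area measures of two immersions differ by the quotient of their area elements. -/
theorem areaMeasure_eq_withDensity [SecondCountableTopology S] : 𝒮.areaMeasure φ'
    = (𝒮.areaMeasure φ).withDensity fun p => ENNReal.ofReal (𝒮.areaQuotient φ φ' p) := by
  obtain ⟨t, ht, hcov⟩ := TopologicalSpace.countable_cover_nhds (α := S)
    (f := fun p => (extChartAt 𝓘(ℝ, E2) p).source) fun p =>
      mem_nhds_source (mem_extChartAt_source (I := 𝓘(ℝ, E2)) p)
  rw [← Measure.restrict_univ (μ := 𝒮.areaMeasure φ'), ← Measure.restrict_univ (μ := Measure.withDensity _ _),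
    ← hcov, Measure.restrict_biUnion_congr ht]
  intro p _
  have hm := (𝒮.continuous_areaQuotient hφ hi hφ').measurable.ennreal_ofReal
  rw [restrict_withDensity (isOpen_extChartAt_source p).measurableSet,
    𝒮.areaMeasure_restrict (hφ.mdifferentiable (by simp)),
    𝒮.areaMeasure_restrict (hφ'.mdifferentiable (by simp))]
  ext B hB
  rw [withDensity_apply _ hB, ← lintegral_indicator hB, ← lintegral_indicator_one hB,
    𝒮.lintegral_chartMeasure hφ' p (measurable_one.indicator hB),
    𝒮.lintegral_chartMeasure hφ p (hm.indicator hB)]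
  refine setLIntegral_congr_fun (isOpen_extChartAt_target p).measurableSet fun y hy => ?_
  by_cases h : (extChartAt 𝓘(ℝ, E2) p).symm y ∈ B
  · have h0 := 𝒮.areaDensity_pos hφ hi hy
    rw [Set.indicator_of_mem h, Set.indicator_of_mem h, 𝒮.areaQuotient_eq hφ hφ' hy,
      ← ENNReal.ofReal_mul h0.le, mul_div_cancel₀ _ h0.ne']
    simp
  · rw [Set.indicator_of_notMem h, Set.indicator_of_notMem h]
    simp

theorem setIntegral_areaMeasure [SecondCountableTopology S] {A : Set S} (hA : MeasurableSet A)
    (k : S → ℝ) : ∫ p in A, k p ∂(𝒮.areaMeasure φ')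
      = ∫ p in A, 𝒮.areaQuotient φ φ' p * k p ∂(𝒮.areaMeasure φ) := by
  rw [𝒮.areaMeasure_eq_withDensity hφ hi hφ', restrict_withDensity hA,
    integral_withDensity_eq_integral_toReal_smul₀
      (𝒮.continuous_areaQuotient hφ hi hφ').measurable.ennreal_ofReal.aemeasurable (by simp)]
  refine integral_congr_ae (Eventually.of_forall fun p => ?_)
  simp only [smul_eq_mul]
  rw [ENNReal.toReal_ofReal (𝒮.areaQuotient_nonneg p)]

end

end SasakianStructure
end SubRiem

namespace SubRiem

/-! ### The divergence theorem on the surface -/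

section plane

theorem integral_fderiv_eq_zero {g : E2 → ℝ} (hg : ContDiff ℝ 1 g) (hs : HasCompactSupport g) (v : E2) :
    Integrable (fun y => fderiv ℝ g y v) ∧ ∫ y, fderiv ℝ g y v = 0 := by
  have h1 : Continuous fun y => fderiv ℝ g y v :=
    (hg.continuous_fderiv (by simp)).clm_apply continuous_const
  have h2 : HasCompactSupport fun y => fderiv ℝ g y v := hs.fderiv_apply (𝕜 := ℝ) v
  have h3 := h1.integrable_of_hasCompactSupport (μ := volume) h2
  refine ⟨h3, ?_⟩
  have h4 := integral_mul_fderiv_eq_neg_fderiv_mul_of_integrable (f := fun _ : E2 => (1 : ℝ)) (g := g)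
    (v := v) (μ := volume) (by simp) (by simpa using h3)
    (by simpa using hg.continuous.integrable_of_hasCompactSupport hs)
    (fun _ _ => differentiableAt_const _) (fun y _ => hg.differentiable (by simp) y)
  simpa using h4

end plane

variable {S : Type*} [TopologicalSpace S] [ChartedSpace E2 S]

theorem contDiffAt_chart [IsManifold 𝓘(ℝ, E2) 3 S] {F : S → ℝ} {p₀ : S} {y : E2} {n : WithTop ℕ∞}
    (hn : n ≤ 3) (hy : y ∈ (extChartAt 𝓘(ℝ, E2) p₀).target)
    (hF : ContMDiffAt 𝓘(ℝ, E2) 𝓘(ℝ, ℝ) n F ((extChartAt 𝓘(ℝ, E2) p₀).symm y)) :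
    ContDiffAt ℝ n (fun y => F ((extChartAt 𝓘(ℝ, E2) p₀).symm y)) y := by
  have : IsManifold 𝓘(ℝ, E2) n S := IsManifold.of_le hn
  have h3 : ContMDiffAt 𝓘(ℝ, E2) 𝓘(ℝ, E2) n (extChartAt 𝓘(ℝ, E2) p₀).symm y :=
    (contMDiffOn_extChartAt_symm p₀).contMDiffAt (mem_nhds_target hy)
  exact (ContMDiffAt.comp (g := F) y hF h3).contDiffAt

/-- The component in the coordinate direction `i` of a `1`-form on the surface. -/
def formChart (ξ : S → E2 →L[ℝ] ℝ) (p₀ : S) (i : Fin 2) (y : E2) : ℝ :=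
  ξ ((extChartAt 𝓘(ℝ, E2) p₀).symm y) (chartDinv p₀ y (b2 i) : E2)

/-- The wedge product of two covectors, on the standard basis. -/
def covectorWedge (a b : E2 →L[ℝ] ℝ) : ℝ := a (b2 0) * b (b2 1) - a (b2 1) * b (b2 0)

theorem covectorWedge_comp (a b : E2 →L[ℝ] ℝ) (L : E2 →L[ℝ] E2) :
    a (L (b2 0)) * b (L (b2 1)) - a (L (b2 1)) * b (L (b2 0)) = L.det * covectorWedge a b := by
  rw [det_eq, covectorWedge, eq_sum_b2 (L (b2 0)), eq_sum_b2 (L (b2 1))]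
  simp only [map_add, map_smul, smul_eq_mul]
  simp
  ring

namespace SasakianStructure

variable {M : Type*} [TopologicalSpace M] [ChartedSpace E3 M] [IsManifold 𝓘(ℝ, E3) ∞ M]
variable {𝒮 : SasakianStructure M}

/-- The function `h` is the curl of the `1`-form `ξ` with compact support in `K`: the exterior
derivative of `ξ` is `h` times the area form of the immersion. -/
structure IsCurl (𝒮 : SasakianStructure M) (φ : S → M) (K : Set S) (ξ : S → E2 →L[ℝ] ℝ) (h : S → ℝ) :
    Prop where
  isCompact : IsCompact K
  form_eq_zero : ∀ p ∉ K, ξ p = 0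
  eq_zero : ∀ p ∉ K, h p = 0
  contDiffAt : ∀ (p₀ : S), ∀ y ∈ (extChartAt 𝓘(ℝ, E2) p₀).target,
    (extChartAt 𝓘(ℝ, E2) p₀).symm y ∈ K → ∀ i, ContDiffAt ℝ 1 (formChart ξ p₀ i) y
  curl_eq : ∀ (p₀ : S), ∀ y ∈ (extChartAt 𝓘(ℝ, E2) p₀).target,
    (extChartAt 𝓘(ℝ, E2) p₀).symm y ∈ K → 𝒮.areaDensity φ p₀ y * h ((extChartAt 𝓘(ℝ, E2) p₀).symm y)
      = fderiv ℝ (formChart ξ p₀ 1) y (b2 0) - fderiv ℝ (formChart ξ p₀ 0) y (b2 1)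

/-- The curl of `F ξ`. -/
def curlMul (𝒮 : SasakianStructure M) (φ : S → M) (ξ : S → E2 →L[ℝ] ℝ) (h F : S → ℝ) (p : S) : ℝ :=
  F p * h p + covectorWedge (mvfderiv 𝓘(ℝ, E2) F p : E2 →L[ℝ] ℝ) (ξ p) / 𝒮.areaElement φ p

theorem curlMul_eq_zero_of_eventuallyEq {φ : S → M} {ξ : S → E2 →L[ℝ] ℝ} {h F : S → ℝ} {p : S}
    (hF : F =ᶠ[𝓝 p] fun _ => 0) : 𝒮.curlMul φ ξ h F p = 0 := by
  have key : ∀ (a ζ : E2 →L[ℝ] ℝ) (x z t : ℝ), a = 0 → x = 0 → x * z + covectorWedge a ζ / t = 0 := by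
    rintro a ζ x z t rfl rfl
    simp [covectorWedge]
  refine key _ _ _ _ _ ?_ hF.self_of_nhds
  ext1 v
  refine (mvfderiv_congr hF v).trans ?_
  rw [mvfderiv_const]; rfl

namespace IsCurl

variable [T2Space S] {φ : S → M} {K : Set S} {ξ : S → E2 →L[ℝ] ℝ} {h : S → ℝ} {p₀ : S} {y : E2}
  (c : 𝒮.IsCurl φ K ξ h)
include c

theorem eventually_notMem (hy : y ∈ (extChartAt 𝓘(ℝ, E2) p₀).target)
    (hK : (extChartAt 𝓘(ℝ, E2) p₀).symm y ∉ K) :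
    ∀ᶠ y' in 𝓝 y, (extChartAt 𝓘(ℝ, E2) p₀).symm y' ∉ K :=
  (continuousAt_extChartAt_symm'' hy).eventually (c.isCompact.isClosed.isOpen_compl.mem_nhds hK)

theorem formChart_eventuallyEq (hy : y ∈ (extChartAt 𝓘(ℝ, E2) p₀).target)
    (hK : (extChartAt 𝓘(ℝ, E2) p₀).symm y ∉ K) (i : Fin 2) : formChart ξ p₀ i =ᶠ[𝓝 y] fun _ => 0 := by
  filter_upwards [c.eventually_notMem hy hK] with y' hy'
  rw [formChart, c.form_eq_zero _ hy']; rfl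

theorem contDiffAt_formChart (hy : y ∈ (extChartAt 𝓘(ℝ, E2) p₀).target) (i : Fin 2) :
    ContDiffAt ℝ 1 (formChart ξ p₀ i) y := by
  by_cases hK : (extChartAt 𝓘(ℝ, E2) p₀).symm y ∈ K
  · exact c.contDiffAt p₀ y hy hK i
  · exact contDiffAt_const.congr_of_eventuallyEq (c.formChart_eventuallyEq hy hK i)

theorem curl_formChart (hy : y ∈ (extChartAt 𝓘(ℝ, E2) p₀).target) :
    𝒮.areaDensity φ p₀ y * h ((extChartAt 𝓘(ℝ, E2) p₀).symm y)
      = fderiv ℝ (formChart ξ p₀ 1) y (b2 0) - fderiv ℝ (formChart ξ p₀ 0) y (b2 1) := by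
  by_cases hK : (extChartAt 𝓘(ℝ, E2) p₀).symm y ∈ K
  · exact c.curl_eq p₀ y hy hK
  · rw [(c.formChart_eventuallyEq hy hK _).fderiv_eq, (c.formChart_eventuallyEq hy hK _).fderiv_eq,
      c.eq_zero _ hK]
    simp

omit [T2Space S] in
theorem curlMul_eq_zero {F : S → ℝ} {p : S} (hp : p ∉ K) : 𝒮.curlMul φ ξ h F p = 0 := by
  rw [curlMul, c.eq_zero p hp, c.form_eq_zero p hp]; simp [covectorWedge]

variable [IsManifold 𝓘(ℝ, E2) 3 S] [OrientedAtlas S] (hφ : ContMDiff 𝓘(ℝ, E2) 𝓘(ℝ, E3) 1 φ)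
  (hi : ∀ p, Function.Injective (dmap φ p)) {F G : S → ℝ}
  (hF : ContMDiff 𝓘(ℝ, E2) 𝓘(ℝ, ℝ) 1 F) (hG : ContMDiff 𝓘(ℝ, E2) 𝓘(ℝ, ℝ) 1 G)
include hφ hi hF

/-- The curl of `F ξ` in a chart. -/
theorem curlMul_chart (hy : y ∈ (extChartAt 𝓘(ℝ, E2) p₀).target) :
    𝒮.areaDensity φ p₀ y * 𝒮.curlMul φ ξ h F ((extChartAt 𝓘(ℝ, E2) p₀).symm y)
      = fderiv ℝ (fun y => F ((extChartAt 𝓘(ℝ, E2) p₀).symm y) * formChart ξ p₀ 1 y) y (b2 0)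
        - fderiv ℝ (fun y => F ((extChartAt 𝓘(ℝ, E2) p₀).symm y) * formChart ξ p₀ 0 y) y (b2 1) := by
  have hd := (contDiffAt_chart (by norm_num) hy (hF _)).differentiableAt (by simp)
  have hξ := fun i => (c.contDiffAt_formChart hy i).differentiableAt (by simp)
  have h1 : ∀ v : E2, fderiv ℝ (fun y => F ((extChartAt 𝓘(ℝ, E2) p₀).symm y)) y v
      = (mvfderiv 𝓘(ℝ, E2) F ((extChartAt 𝓘(ℝ, E2) p₀).symm y) : E2 →L[ℝ] ℝ) (chartDinv p₀ y v) := by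
    intro v
    refine Eq.trans ?_ (mvfderiv_eq_fderiv_chart hy hd (chartDinv p₀ y v)).symm
    rw [chartD_chartDinv hy]
  have h2 := covectorWedge_comp (mvfderiv 𝓘(ℝ, E2) F ((extChartAt 𝓘(ℝ, E2) p₀).symm y) : E2 →L[ℝ] ℝ)
    (ξ ((extChartAt 𝓘(ℝ, E2) p₀).symm y)) (chartDinv p₀ y : E2 →L[ℝ] E2)
  have h3 := 𝒮.areaDensity_mul_chartDet (hφ.mdifferentiable (by simp)) hy
  have h4 := chartDet_mul_det_chartDinv hy
  have h5 := 𝒮.areaDensity_pos hφ hi hy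
  have h6 := chartDet_pos ((extChartAt 𝓘(ℝ, E2) p₀).map_target hy)
  have h7 := c.curl_formChart hy
  rw [fderiv_fun_mul hd (hξ 1), fderiv_fun_mul hd (hξ 0)]
  simp only [_root_.add_apply, _root_.smul_apply, smul_eq_mul, h1]
  rw [curlMul, ← h3]
  have h8 : 𝒮.areaDensity φ p₀ y * (covectorWedge (mvfderiv 𝓘(ℝ, E2) F
      ((extChartAt 𝓘(ℝ, E2) p₀).symm y) : E2 →L[ℝ] ℝ) (ξ ((extChartAt 𝓘(ℝ, E2) p₀).symm y))
      / (𝒮.areaDensity φ p₀ y * chartDet p₀ ((extChartAt 𝓘(ℝ, E2) p₀).symm y)))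
      = (chartDinv p₀ y : E2 →L[ℝ] E2).det * covectorWedge (mvfderiv 𝓘(ℝ, E2) F
      ((extChartAt 𝓘(ℝ, E2) p₀).symm y) : E2 →L[ℝ] ℝ) (ξ ((extChartAt 𝓘(ℝ, E2) p₀).symm y)) := by
    rw [eq_comm, ← mul_div_assoc, eq_div_iff (mul_pos h5 h6).ne']
    linear_combination 𝒮.areaDensity φ p₀ y * covectorWedge (mvfderiv 𝓘(ℝ, E2) F
      ((extChartAt 𝓘(ℝ, E2) p₀).symm y) : E2 →L[ℝ] ℝ) (ξ ((extChartAt 𝓘(ℝ, E2) p₀).symm y)) * h4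
  rw [mul_add, h8, ← h2]
  simp only [formChart] at h7 ⊢
  linear_combination F ((extChartAt 𝓘(ℝ, E2) p₀).symm y) * h7

theorem continuous_curlMul : Continuous (𝒮.curlMul φ ξ h F) := by
  refine continuous_iff_continuousAt.2 fun p => ?_
  have hp := mem_extChartAt_target (I := 𝓘(ℝ, E2)) p
  refine continuousAt_of_chart (mem_extChartAt_source (I := 𝓘(ℝ, E2)) p) ?_
  have h1 : ∀ i, ContinuousAt (fun y => fderiv ℝ (fun y => F ((extChartAt 𝓘(ℝ, E2) p).symm y)
      * formChart ξ p i y) y) (extChartAt 𝓘(ℝ, E2) p p) := fun i =>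
    (((contDiffAt_chart (by norm_num) hp (hF _)).mul (c.contDiffAt_formChart hp i)).fderiv_right (m := 0)
      (by norm_num)).continuousAt
  refine ((((h1 1).clm_apply (continuousAt_const (y := b2 0))).fun_sub
    ((h1 0).clm_apply (continuousAt_const (y := b2 1)))).div₀
    (𝒮.continuousAt_areaDensity hφ hp) (𝒮.areaDensity_pos hφ hi hp).ne').congr ?_
  filter_upwards [mem_nhds_target hp] with y hy
  rw [← c.curlMul_chart hφ hi hF hy, mul_div_cancel_left₀ _ (𝒮.areaDensity_pos hφ hi hy).ne']

omit [OrientedAtlas S] [T2Space S] c hi hφ in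
include hG in
omit [IsManifold 𝓘(ℝ, E2) 3 S] in
theorem _root_.SubRiem.SasakianStructure.curlMul_sub (p : S) :
    𝒮.curlMul φ ξ h (fun p => F p - G p) p = 𝒮.curlMul φ ξ h F p - 𝒮.curlMul φ ξ h G p := by
  have key : ∀ (a b d ζ : E2 →L[ℝ] ℝ) (x y z t : ℝ), d = a - b → (x - y) * z + covectorWedge d ζ / t
      = x * z + covectorWedge a ζ / t - (y * z + covectorWedge b ζ / t) := by
    rintro a b d ζ x y z t rfl
    simp only [covectorWedge, _root_.sub_apply]; ring
  exact key _ _ _ _ _ _ _ _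
    (mvfderiv_fun_sub (hF.mdifferentiable (by simp) p) (hG.mdifferentiable (by simp) p))

variable [MeasurableSpace S] [BorelSpace S]

theorem integrable_curlMul : Integrable (𝒮.curlMul φ ξ h F) (𝒮.areaMeasure φ) := by
  have := 𝒮.isLocallyFiniteMeasure_areaMeasure hφ
  refine (c.continuous_curlMul hφ hi hF).integrable_of_hasCompactSupport ?_
  exact HasCompactSupport.intro c.isCompact fun p hp => c.curlMul_eq_zero hp

omit hF in
theorem integrable : Integrable h (𝒮.areaMeasure φ) := by
  refine (c.integrable_curlMul (F := fun _ => 1) hφ hi contMDiff_const).congr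
    (Eventually.of_forall fun p => ?_)
  have key : ∀ (a ζ : E2 →L[ℝ] ℝ) (x t : ℝ), a = 0 → 1 * x + covectorWedge a ζ / t = x := by
    rintro a ζ x t rfl
    simp [covectorWedge]
  exact key _ _ _ _ (mvfderiv_const _)

/-- The divergence theorem for a form with support in the domain of a chart. -/
theorem integral_curlMul_of_tsupport (hs : HasCompactSupport F)
    (ht : tsupport F ⊆ (extChartAt 𝓘(ℝ, E2) p₀).source) :
    ∫ p, 𝒮.curlMul φ ξ h F p ∂(𝒮.areaMeasure φ) = 0 := by
  have h0 : ∀ p ∉ tsupport F, 𝒮.curlMul φ ξ h F p = 0 := by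
    intro p hp
    exact curlMul_eq_zero_of_eventuallyEq (notMem_tsupport_iff_eventuallyEq.1 hp)
  rw [← setIntegral_eq_integral_of_forall_compl_eq_zero (s := (extChartAt 𝓘(ℝ, E2) p₀).source)
    fun p hp => h0 p fun hp' => hp (ht hp'),
    𝒮.setIntegral_chart hφ p₀ (c.integrable_curlMul hφ hi hF).aestronglyMeasurable]
  set e := extChartAt 𝓘(ℝ, E2) p₀ with he
  have hK : IsCompact (e '' tsupport F) :=
    hs.isCompact.image_of_continuousOn ((continuousOn_extChartAt p₀).mono ht)
  -- the components of `F ξ` in the chart, extended by zero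
  obtain ⟨g, hg⟩ : ∃ g : Fin 2 → E2 → ℝ, g = fun i => e.target.indicator
    fun y => F (e.symm y) * formChart ξ p₀ i y := ⟨_, rfl⟩
  have hg1 : ∀ i, ∀ y ∈ e.target, g i =ᶠ[𝓝 y] fun y => F (e.symm y) * formChart ξ p₀ i y := by
    intro i y hy
    filter_upwards [mem_nhds_target hy] with y' hy'
    rw [hg]; exact Set.indicator_of_mem hy' _
  have hg2 : ∀ i, ∀ y ∉ e '' tsupport F, g i y = 0 := by
    intro i y hy
    rw [hg]
    by_cases hy' : y ∈ e.target
    · simp only [Set.indicator_of_mem hy']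
      have : e.symm y ∉ tsupport F := fun h1 => hy ⟨_, h1, e.right_inv hy'⟩
      rw [image_eq_zero_of_notMem_tsupport this, zero_mul]
    · exact Set.indicator_of_notMem hy' _
  have hgs : ∀ i, HasCompactSupport (g i) := fun i => HasCompactSupport.intro hK (hg2 i)
  have hgc : ∀ i, ContDiff ℝ 1 (g i) := by
    intro i
    refine contDiff_iff_contDiffAt.2 fun y => ?_
    by_cases hy : y ∈ e '' tsupport F
    · obtain ⟨p, hp, rfl⟩ := hy
      have hy' := e.map_source (ht hp)
      exact ((contDiffAt_chart (by norm_num) hy' (hF _)).mul (c.contDiffAt_formChart hy' i)).congr_of_eventuallyEq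
        (hg1 i _ hy')
    · have : g i =ᶠ[𝓝 y] fun _ => 0 := by
        filter_upwards [hK.isClosed.isOpen_compl.mem_nhds hy] with y' hy' using hg2 i y' hy'
      exact contDiffAt_const.congr_of_eventuallyEq this
  have h1 : ∀ y ∈ e.target, 𝒮.areaDensity φ p₀ y * 𝒮.curlMul φ ξ h F (e.symm y)
      = fderiv ℝ (g 1) y (b2 0) - fderiv ℝ (g 0) y (b2 1) := by
    intro y hy
    rw [c.curlMul_chart hφ hi hF hy, (hg1 1 y hy).fderiv_eq, (hg1 0 y hy).fderiv_eq]
  rw [setIntegral_congr_fun (isOpen_extChartAt_target p₀).measurableSet h1,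
    setIntegral_eq_integral_of_forall_compl_eq_zero]
  · have i1 := integral_fderiv_eq_zero (hgc 1) (hgs 1) (b2 0)
    have i2 := integral_fderiv_eq_zero (hgc 0) (hgs 0) (b2 1)
    rw [integral_sub i1.1 i2.1, i1.2, i2.2, sub_zero]
  · intro y hy
    have : ∀ i, g i =ᶠ[𝓝 y] fun _ => 0 := fun i => by
      filter_upwards [hK.isClosed.isOpen_compl.mem_nhds (x := y) (by
        rintro ⟨p, hp, rfl⟩; exact hy (e.map_source (ht hp)))] with y' hy' using hg2 i y' hy'
    rw [(this 1).fderiv_eq, (this 0).fderiv_eq]; simp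

omit [OrientedAtlas S] c hi hφ hF [MeasurableSpace S] [BorelSpace S] in
theorem _root_.SubRiem.contMDiff_bump {p : S} (f : SmoothBumpFunction 𝓘(ℝ, E2) p) :
    ContMDiff 𝓘(ℝ, E2) 𝓘(ℝ, ℝ) 1 f := by
  have : IsManifold 𝓘(ℝ, E2) 1 S := IsManifold.of_le (n := 3) (by norm_num)
  refine contMDiff_of_tsupport fun x hx => ?_
  have hx' : x ∈ (chartAt E2 p).source := f.tsupport_subset_chartAt_source hx
  refine ContMDiffAt.congr_of_eventuallyEq ?_ <| f.eqOn_source.eventuallyEq_of_mem <|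
    (chartAt E2 p).open_source.mem_nhds hx'
  exact (f.contDiffAt (n := 1)).contMDiffAt.comp _ (contMDiffAt_extChartAt' hx')

omit hF in
/-- The divergence theorem: a curl has integral zero. Cut-off functions `χ` of chart neighbourhoods are
removed one at a time, replacing `F ξ` by `F (1 - χ) ξ`, until the product of the functions `1 - χ`
vanishes on the support of `ξ`. -/
theorem integral_eq_zero : ∫ p, h p ∂(𝒮.areaMeasure φ) = 0 := by
  obtain ⟨f⟩ : Nonempty (∀ p : S, SmoothBumpFunction 𝓘(ℝ, E2) p) := ⟨fun p => Classical.arbitrary _⟩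
  have hc : ∀ t : Finset S, ContMDiff 𝓘(ℝ, E2) 𝓘(ℝ, ℝ) 1 fun p => ∏ x ∈ t, (1 - f x p) := by
    intro t
    exact contMDiff_finsetProd fun x _ => contMDiff_const.sub (contMDiff_bump (f x))
  have h1 : ∀ t : Finset S, ∫ p, h p ∂(𝒮.areaMeasure φ)
      = ∫ p, 𝒮.curlMul φ ξ h (fun p => ∏ x ∈ t, (1 - f x p)) p ∂(𝒮.areaMeasure φ) := by
    classical
    intro t
    induction t using Finset.induction_on with
    | empty =>
      refine integral_congr_ae (Eventually.of_forall fun p => ?_)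
      simp only [Finset.prod_empty, curlMul, one_mul]
      rw [mvfderiv_const]
      have : covectorWedge (0 : E2 →L[ℝ] ℝ) (ξ p) = 0 := by simp [covectorWedge]
      exact (by rw [this]; simp : h p = h p + covectorWedge (0 : E2 →L[ℝ] ℝ) (ξ p) / _)
    | insert x t hx ih =>
      have e1 : (fun p => ∏ x ∈ insert x t, (1 - f x p))
          = fun p => ∏ x ∈ t, (1 - f x p) - f x p * ∏ x ∈ t, (1 - f x p) := by
        funext p
        rw [Finset.prod_insert hx]; ring
      have h2 : ContMDiff 𝓘(ℝ, E2) 𝓘(ℝ, ℝ) 1 fun p => f x p * ∏ x ∈ t, (1 - f x p) :=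
        (contMDiff_bump (f x)).mul (hc t)
      have h3 : ∫ p, 𝒮.curlMul φ ξ h (fun p => f x p * ∏ x ∈ t, (1 - f x p)) p ∂(𝒮.areaMeasure φ) = 0 :=
        c.integral_curlMul_of_tsupport (p₀ := x) hφ hi h2 (f x).hasCompactSupport.mul_right
          ((tsupport_mul_subset_left).trans (f x).tsupport_subset_extChartAt_source)
      rw [e1, ih]
      simp only [curlMul_sub (hc t) h2]
      rw [integral_sub (c.integrable_curlMul hφ hi (hc t)) (c.integrable_curlMul hφ hi h2), h3, sub_zero]
  obtain ⟨t, -, ht⟩ := c.isCompact.elim_nhds_subcover (fun p => interior {x | f p x = 1}) fun p _ =>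
    interior_mem_nhds.2 (f p).eventuallyEq_one
  rw [h1 t]
  refine integral_eq_zero_of_ae (Eventually.of_forall fun p => ?_)
  by_cases hp : p ∈ K
  · obtain ⟨x, hx, hpx⟩ := Set.mem_iUnion₂.1 (ht hp)
    have h2 : (fun p => ∏ x ∈ t, (1 - f x p)) =ᶠ[𝓝 p] fun _ => 0 := by
      filter_upwards [mem_interior_iff_mem_nhds.1 hpx] with p' hp'
      exact Finset.prod_eq_zero hx (by rw [show f x p' = 1 from hp', sub_self])
    exact curlMul_eq_zero_of_eventuallyEq h2
  · exact c.curlMul_eq_zero hp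

end IsCurl

end SasakianStructure
end SubRiem

namespace SubRiem
namespace SasakianStructure

/-! ### Surfaces of constant mean curvature -/

variable {M : Type*} [TopologicalSpace M] [ChartedSpace E3 M] [IsManifold 𝓘(ℝ, E3) ∞ M]
variable {𝒮 : SasakianStructure M}
variable {S : Type*} [TopologicalSpace S] [ChartedSpace E2 S] [IsManifold 𝓘(ℝ, E2) 3 S]
  {Φ : ℝ → S → M} {H : ℝ} {p₀ p : S} {y : E2}

/-- The contact form pulled back to the surface. -/
def pullEta (𝒮 : SasakianStructure M) (φ : S → M) (p : S) : E2 →L[ℝ] ℝ := (𝒮.η (φ p)).comp (dmap φ p)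

theorem formChart_pullEta {q : ℝ × E2} {x₀ : M} (r : IsRepPoint Φ p₀ x₀ q) (i : Fin 2) :
    formChart (𝒮.pullEta (Φ q.1)) p₀ i q.2 = 𝒮.repEta Φ p₀ x₀ i.succ q := by
  refine (repEta_eq (𝒮 := 𝒮) r (b2 i)).symm.trans ?_
  fin_cases i <;> rfl

/-- The slice `s = 0` of the family `Φ` is an immersion whose regular set has constant mean
curvature `H`, and the family is of class `C³` near the regular set. -/
structure IsCMCSlice (𝒮 : SasakianStructure M) (Φ : ℝ → S → M) (H : ℝ) : Prop where
  contMDiff : ContMDiff 𝓘(ℝ, E2) 𝓘(ℝ, E3) 2 (Φ 0)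
  injective : ∀ p, Function.Injective (dmap (Φ 0) p)
  smooth : ∀ p ∈ 𝒮.regularSet (Φ 0),
    ContMDiffAt (𝓘(ℝ, ℝ).prod 𝓘(ℝ, E2)) 𝓘(ℝ, E3) 3 (fun q : ℝ × S => Φ q.1 q.2) (0, p)
  mean : ∀ p ∈ 𝒮.regularSet (Φ 0), 𝒮.meanCurvature (Φ 0) p = H

namespace IsCMCSlice

variable (c : 𝒮.IsCMCSlice Φ H)
include c

omit [IsManifold 𝓘(ℝ, E2) 3 S] in
theorem contMDiff_one : ContMDiff 𝓘(ℝ, E2) 𝓘(ℝ, E3) 1 (Φ 0) := c.contMDiff.of_le (by norm_num)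

theorem isRegPoint {x₀ : M} (hy : y ∈ (extChartAt 𝓘(ℝ, E2) p₀).target)
    (hr : (extChartAt 𝓘(ℝ, E2) p₀).symm y ∈ 𝒮.regularSet (Φ 0))
    (hx : Φ 0 ((extChartAt 𝓘(ℝ, E2) p₀).symm y) ∈ (extChartAt 𝓘(ℝ, E3) x₀).source) :
    𝒮.IsRegPoint Φ p₀ x₀ (0, y) :=
  (isRegPoint_iff (q := (0, y)) ⟨hy, hx, c.smooth _ hr⟩ (c.injective _)).2 hr

/-- A chart of `M` in which a regular point is seen. -/
theorem exists_isRegPoint (hy : y ∈ (extChartAt 𝓘(ℝ, E2) p₀).target)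
    (hr : (extChartAt 𝓘(ℝ, E2) p₀).symm y ∈ 𝒮.regularSet (Φ 0)) : ∃ x₀, 𝒮.IsRegPoint Φ p₀ x₀ (0, y) :=
  ⟨_, c.isRegPoint hy hr (mem_extChartAt_source _)⟩

theorem mem_regularSet {x₀ : M} (r : 𝒮.IsRegPoint Φ p₀ x₀ (0, y)) :
    (extChartAt 𝓘(ℝ, E2) p₀).symm y ∈ 𝒮.regularSet (Φ 0) :=
  (isRegPoint_iff (q := (0, y)) r.rep (c.injective _)).1 r

theorem isOpen_regularSet : IsOpen (𝒮.regularSet (Φ 0)) :=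
  𝒮.isOpen_regularSet c.contMDiff_one c.injective

variable [OrientedAtlas S]

theorem coframe {x₀ : M} (r : 𝒮.IsRegPoint Φ p₀ x₀ (0, y)) :
    IsVariationCoframe (𝒮.repAl Φ p₀ x₀) (nuForm (𝒮.chartG x₀) (𝒮.chartT x₀) (𝒮.chartJ x₀)
      (rep Φ p₀ x₀)) (𝒮.repEta Φ p₀ x₀) (𝒮.repOm Φ p₀ x₀) (𝒮.repSlope Φ p₀ x₀)
      (𝒮.repSpeed Φ p₀ x₀) (𝒮.repKappa Φ p₀ x₀ y) H y := by
  refine r.isVariationCoframe (Eventually.of_forall fun _ => c.injective _) ?_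
  filter_upwards [r.eventually_slice] with y' r' using c.mean _ (c.mem_regularSet r')

omit c [IsManifold 𝓘(ℝ, E2) 3 S] in
omit [OrientedAtlas S] in
theorem _root_.SubRiem.SasakianStructure.Zderiv_eq_zero {φ : S → M} {u : S → ℝ} {p : S}
    (hu : u =ᶠ[𝓝 p] fun _ => 0) : 𝒮.Zderiv φ u p = 0 := by
  rw [Zderiv]
  refine (mvfderiv_congr hu _).trans ?_
  rw [mvfderiv_const]; rfl

/-- The curl of `g η` is `|N_h| Z(g) + 2 ⟨N, T⟩ g`. -/
theorem isCurl [T2Space S] {g : S → ℝ} {K : Set S} (hK : IsCompact K)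
    (hr : K ⊆ 𝒮.regularSet (Φ 0)) (h0 : ∀ p ∉ K, g p = 0)
    (hg : ∀ (p₀ : S), ∀ y ∈ (extChartAt 𝓘(ℝ, E2) p₀).target, (extChartAt 𝓘(ℝ, E2) p₀).symm y ∈ K →
      ContDiffAt ℝ 1 (fun y => g ((extChartAt 𝓘(ℝ, E2) p₀).symm y)) y) :
    𝒮.IsCurl (Φ 0) K (fun p => g p • 𝒮.pullEta (Φ 0) p)
      fun p => 𝒮.absNormalH (Φ 0) p * 𝒮.Zderiv (Φ 0) g p + 2 * 𝒮.normalT (Φ 0) p * g p where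
  isCompact := hK
  form_eq_zero p hp := by rw [h0 p hp, zero_smul]
  eq_zero p hp := by
    rw [Zderiv_eq_zero, h0 p hp]
    · ring
    · filter_upwards [hK.isClosed.isOpen_compl.mem_nhds hp] with p' hp' using h0 p' hp'
  contDiffAt p₀ y hy hyK i := by
    obtain ⟨x₀, r⟩ := c.exists_isRegPoint hy (hr hyK)
    have h1 := ((hg p₀ y hy hyK).mul ((IsVariationCoframe.contDiffAt_slice
      (r.contDiffAt_eta i.succ)).of_le (by norm_num)))
    refine h1.congr_of_eventuallyEq ?_
    filter_upwards [r.eventually_slice] with y' r'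
    rw [← formChart_pullEta r'.rep i]
    rfl
  curl_eq p₀ y hy hyK := by
    obtain ⟨x₀, r⟩ := c.exists_isRegPoint hy (hr hyK)
    have hd := (hg p₀ y hy hyK).differentiableAt (by simp)
    have e : ∀ i : Fin 2, formChart (fun p => g p • 𝒮.pullEta (Φ 0) p)
        p₀ i =ᶠ[𝓝 y] fun y => g ((extChartAt 𝓘(ℝ, E2) p₀).symm y) * 𝒮.repEta Φ p₀ x₀ i.succ (0, y) := by
      intro i
      filter_upwards [r.eventually_slice] with y' r'
      rw [← formChart_pullEta r'.rep i]
      rfl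
    have h1 := (c.coframe r).curl_mul_ga hd
    have h2 := r.areaDensity_eq (c.contMDiff.mdifferentiable (by simp))
    have h3 := r.Zderiv_eq (c.injective _) (u := g) (Eventually.of_forall fun _ => rfl) hd
    have h4 : 𝒮.absNormalH (Φ 0) ((extChartAt 𝓘(ℝ, E2) p₀).symm y) = _ :=
      absNormalH_eq r.rep r.density_ne
    have h5 : 𝒮.normalT (Φ 0) ((extChartAt 𝓘(ℝ, E2) p₀).symm y) = _ := normalT_eq r.rep r.density_ne
    have ht := (tilt_pos (𝒮.repSlope Φ p₀ x₀ (0, y))).ne'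
    rw [(e 1).fderiv_eq, (e 0).fderiv_eq]
    refine Eq.trans ?_ h1.symm
    rw [h2, h3, h4, h5, r.wedge_eq]
    field_simp
    ring

omit [OrientedAtlas S] c in
theorem continuousAt_repKappa {x₀ : M} (r : 𝒮.IsRegPoint Φ p₀ x₀ (0, y)) :
    ContinuousAt (𝒮.repKappa Φ p₀ x₀) y := by
  have h := 𝒮.isSasakianChart x₀
  have hs : ContinuousAt (fun y : E2 => ((0 : ℝ), y)) y := (Continuous.prodMk_right (0 : ℝ)).continuousAt
  have k0 : ContinuousAt (fun y => rep Φ p₀ x₀ (0, y)) y :=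
    ContinuousAt.comp (g := rep Φ p₀ x₀) r.rep.contDiffAt.continuousAt hs
  have k1 : ContinuousAt (fun y => 𝒮.repNu Φ p₀ x₀ (0, y)) y :=
    ContinuousAt.comp (g := 𝒮.repNu Φ p₀ x₀)
      (h.contDiffAt_gaussField r.rep.contDiffAt r.rep.rep_mem r.density_ne).continuousAt hs
  have k2 : ContinuousAt (fun y => 𝒮.repZ Φ p₀ x₀ (0, y)) y :=
    ContinuousAt.comp (g := 𝒮.repZ Φ p₀ x₀)
      (h.contDiffAt_charField r.rep.contDiffAt r.rep.rep_mem r.density_ne).continuousAt hs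
  have k3 : ContinuousAt (fun y => 𝒮.chartG x₀ (rep Φ p₀ x₀ (0, y))) y :=
    ContinuousAt.comp (g := 𝒮.chartG x₀) (h.contDiffAt_G r.rep.rep_mem).continuousAt k0
  have k4 : ContinuousAt (fun y => 𝒮.chartΓ x₀ (rep Φ p₀ x₀ (0, y))) y :=
    ContinuousAt.comp (g := 𝒮.chartΓ x₀) (h.contDiffAt_Γ r.rep.rep_mem).continuousAt k0
  have k5 : ContinuousAt (fun y => fderiv ℝ (𝒮.chartΓ x₀) (rep Φ p₀ x₀ (0, y))) y :=
    ContinuousAt.comp (g := fderiv ℝ (𝒮.chartΓ x₀))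
      (((h.contDiffAt_Γ r.rep.rep_mem).of_le (m := 1) (WithTop.coe_le_coe.2 le_top)).fderiv_right
        (m := 0) (by norm_num)).continuousAt k0
  unfold repKappa riem
  fun_prop

theorem contDiffAt_zd {x₀ : M} (r : 𝒮.IsRegPoint Φ p₀ x₀ (0, y)) {h : E2 → ℝ} {n : WithTop ℕ∞}
    (hn : n ≤ 1) (hh : ContDiffAt ℝ (n + 1) h y) : ContDiffAt ℝ n (𝒮.repZd Φ p₀ x₀ h) y := by
  have c' := c.coframe r
  have h1 := fun i => (IsVariationCoframe.contDiffAt_slice (c'.cd_al i)).of_le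
    (hn.trans (by norm_num : (1 : WithTop ℕ∞) ≤ 2))
  have h2 := fun i => (IsVariationCoframe.contDiffAt_slice (c'.cd_ga i)).of_le
    (hn.trans (by norm_num : (1 : WithTop ℕ∞) ≤ 2))
  have h3 := hh.fderiv_right (m := n) le_rfl
  exact ((h3.clm_apply contDiffAt_const).mul (h2 2) |>.sub
    ((h3.clm_apply contDiffAt_const).mul (h2 1))).div
    (((h1 1).mul (h2 2)).sub ((h1 2).mul (h2 1))) c'.density_ne

theorem indexIntegrand_eq {x₀ : M} (r : 𝒮.IsRegPoint Φ p₀ x₀ (0, y)) {w : S → ℝ}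
    (hw : DifferentiableAt ℝ (fun y => w ((extChartAt 𝓘(ℝ, E2) p₀).symm y)) y) :
    𝒮.indexIntegrand (Φ 0) w w ((extChartAt 𝓘(ℝ, E2) p₀).symm y)
      = (tilt (𝒮.repSlope Φ p₀ x₀ (0, y)))⁻¹
        * (𝒮.repZd Φ p₀ x₀ (fun y => w ((extChartAt 𝓘(ℝ, E2) p₀).symm y)) y ^ 2
          - 𝒮.repPot Φ p₀ x₀ H y * w ((extChartAt 𝓘(ℝ, E2) p₀).symm y) ^ 2) := by
  have h1 : 𝒮.absNormalH (Φ 0) ((extChartAt 𝓘(ℝ, E2) p₀).symm y) = _ := absNormalH_eq r.rep r.density_ne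
  rw [indexIntegrand, h1, r.Zderiv_eq (c.injective _) (Eventually.of_forall fun _ => rfl) hw,
    r.potential_eq (c.injective _) (c.mean _ (c.mem_regularSet r))]
  ring

theorem continuousAt_indexIntegrand {w : S → ℝ} (hw : ContMDiff 𝓘(ℝ, E2) 𝓘(ℝ, ℝ) 1 w)
    (hp : p ∈ 𝒮.regularSet (Φ 0)) : ContinuousAt (𝒮.indexIntegrand (Φ 0) w w) p := by
  have e := (extChartAt 𝓘(ℝ, E2) p).left_inv (mem_extChartAt_source p)
  have hy := mem_extChartAt_target (I := 𝓘(ℝ, E2)) p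
  refine continuousAt_of_chart (mem_extChartAt_source (I := 𝓘(ℝ, E2)) p) ?_
  set y := extChartAt 𝓘(ℝ, E2) p p
  obtain ⟨x₀, r⟩ := c.exists_isRegPoint hy (by rwa [e])
  have hw' := fun y (hy : y ∈ (extChartAt 𝓘(ℝ, E2) p).target) =>
    contDiffAt_chart (n := 1) (by norm_num) hy (hw _)
  have hm := IsVariationCoframe.contDiffAt_slice r.contDiffAt_slope
  have k1 : ContinuousAt (fun y => tilt (𝒮.repSlope Φ p x₀ (0, y))) y :=
    ContinuousAt.comp (g := tilt) (contDiff_tilt (n := 0)).continuous.continuousAt hm.continuousAt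
  have k2 := (c.contDiffAt_zd r (n := 0) (by norm_num)
    (h := fun y => w ((extChartAt 𝓘(ℝ, E2) p).symm y)) (by simpa using hw' y hy)).continuousAt
  have k3 := (c.contDiffAt_zd r (n := 1) le_rfl (hm.of_le (by norm_num))).continuousAt
  have k4 := continuousAt_repKappa r
  have k5 := (hw' y hy).continuousAt
  have k6 : ContinuousAt (fun y => 𝒮.repPot Φ p x₀ H y) y := by
    unfold repPot IsVariationCoframe.pot
    exact ((((continuousAt_const.sub ((k1.pow 2).mul k3)).pow 2).add
      ((continuousAt_const (y := 4 * H ^ 2)).mul (k1.pow 2))).sub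
      ((k4.add continuousAt_const).mul (k1.pow 2)))
  refine ((k1.inv₀ (tilt_pos _).ne').mul ((k2.pow 2).sub (k6.mul (k5.pow 2)))).congr ?_
  filter_upwards [r.eventually_slice] with y' r'
  exact (c.indexIntegrand_eq r' ((hw' y' r'.rep.mem).differentiableAt (by simp))).symm

end IsCMCSlice
end SasakianStructure
end SubRiem

namespace SubRiem
namespace SasakianStructure

/-! ### Positivity of the index form -/

variable {M : Type*} [TopologicalSpace M] [ChartedSpace E3 M] [IsManifold 𝓘(ℝ, E3) ∞ M]
variable {𝒮 : SasakianStructure M}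
variable {S : Type*} [TopologicalSpace S] [ChartedSpace E2 S] [IsManifold 𝓘(ℝ, E2) 3 S]
  [OrientedAtlas S] {Φ : ℝ → S → M} {H : ℝ} {p₀ p : S} {y : E2}

theorem areaMeasure_pos [MeasurableSpace S] [BorelSpace S] {φ : S → M}
    (hφ : ContMDiff 𝓘(ℝ, E2) 𝓘(ℝ, E3) 1 φ)
    (hi : ∀ p, Function.Injective (dmap φ p)) {U : Set S} (hU : IsOpen U) (hp : p ∈ U) :
    0 < 𝒮.areaMeasure φ U := by
  set e := extChartAt 𝓘(ℝ, E2) p with he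
  have hV : IsOpen (e.target ∩ e.symm ⁻¹' U) :=
    (continuousOn_extChartAt_symm p).isOpen_inter_preimage (isOpen_extChartAt_target p) hU
  have hVp : e p ∈ e.target ∩ e.symm ⁻¹' U :=
    ⟨mem_extChartAt_target p, by
      rw [Set.mem_preimage, he, (extChartAt 𝓘(ℝ, E2) p).left_inv (mem_extChartAt_source p)]; exact hp⟩
  have h1 : 𝒮.chartMeasure φ p U ≤ 𝒮.areaMeasure φ U := by
    rw [← 𝒮.areaMeasure_restrict (hφ.mdifferentiable (by simp)) p]
    exact Measure.restrict_apply_le _ _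
  refine lt_of_lt_of_le (pos_iff_ne_zero.2 fun h0 => ?_) h1
  rw [𝒮.chartMeasure_apply φ p hU.measurableSet, Set.inter_comm, lintegral_eq_zero_iff'] at h0
  · rw [Filter.EventuallyEq, ae_restrict_iff' hV.measurableSet] at h0
    refine (hV.measure_pos volume ⟨_, hVp⟩).ne' ?_
    refine measure_mono_null (fun y hy => ?_) (ae_iff.1 h0)
    have := 𝒮.areaDensity_pos hφ hi hy.1
    exact fun h => (ENNReal.ofReal_pos.2 this).ne' (h hy)
  · refine (ContinuousOn.aemeasurable (fun y hy => ?_) hV.measurableSet).ennreal_ofReal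
    exact (𝒮.continuousAt_areaDensity hφ hy.1).continuousWithinAt

omit [IsManifold 𝓘(ℝ, E2) 3 S] [OrientedAtlas S] in
theorem indexIntegrand_eq_zero {w : S → ℝ} {φ : S → M} {p : S}
    (hp : p ∉ tsupport w) : 𝒮.indexIntegrand φ w w p = 0 := by
  rw [indexIntegrand, Zderiv_eq_zero (notMem_tsupport_iff_eventuallyEq.1 hp),
    image_eq_zero_of_notMem_tsupport hp]
  ring

omit [OrientedAtlas S] in
theorem IsTestFunction.contDiffAt {φ : S → M} {w : S → ℝ} (hw : 𝒮.IsTestFunction φ w)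
    (hy : y ∈ (extChartAt 𝓘(ℝ, E2) p₀).target) :
    ContDiffAt ℝ 1 (fun y => w ((extChartAt 𝓘(ℝ, E2) p₀).symm y)) y :=
  contDiffAt_chart (by norm_num) hy (hw.contMDiff _)

namespace IsCMCSlice

variable (c : 𝒮.IsCMCSlice Φ H)
include c

variable [T2Space S] [MeasurableSpace S] [BorelSpace S] {w ψ : S → ℝ}

theorem integrable_indexIntegrand (hw : 𝒮.IsTestFunction (Φ 0) w) :
    Integrable (𝒮.indexIntegrand (Φ 0) w w) (𝒮.areaMeasure (Φ 0)) := by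
  have := 𝒮.isLocallyFiniteMeasure_areaMeasure c.contMDiff_one
  refine Continuous.integrable_of_hasCompactSupport (continuous_iff_continuousAt.2 fun p => ?_)
    (HasCompactSupport.intro hw.hasCompactSupport.isCompact fun p hp => indexIntegrand_eq_zero hp)
  by_cases hp : p ∈ tsupport w
  · exact c.continuousAt_indexIntegrand hw.contMDiff (hw.tsupport_subset hp)
  · refine (continuousAt_const (y := (0 : ℝ))).congr ?_
    filter_upwards [(isClosed_tsupport w).isOpen_compl.mem_nhds hp] with p' hp'
    exact (indexIntegrand_eq_zero hp').symm

omit [IsManifold 𝓘(ℝ, E2) 3 S] [OrientedAtlas S] [T2Space S] [BorelSpace S] c in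
theorem indexForm_eq_integral (hw : 𝒮.IsTestFunction (Φ 0) w) :
    𝒮.indexForm (Φ 0) w w = ∫ p, 𝒮.indexIntegrand (Φ 0) w w p ∂(𝒮.areaMeasure (Φ 0)) :=
  setIntegral_eq_integral_of_forall_compl_eq_zero fun _ hp =>
    indexIntegrand_eq_zero fun h => hp (hw.tsupport_subset h)

variable (hw : 𝒮.IsTestFunction (Φ 0) w)
  (hψ : ContMDiffOn 𝓘(ℝ, E2) 𝓘(ℝ, ℝ) 2 ψ (𝒮.regularSet (Φ 0)))
  (hψ0 : ∀ p ∈ 𝒮.regularSet (Φ 0), ψ p ≠ 0)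
include hψ

omit [T2Space S] [MeasurableSpace S] [BorelSpace S] [OrientedAtlas S] in
theorem contDiffAt_of_contMDiffOn (hy : y ∈ (extChartAt 𝓘(ℝ, E2) p₀).target)
    (hr : (extChartAt 𝓘(ℝ, E2) p₀).symm y ∈ 𝒮.regularSet (Φ 0)) :
    ContDiffAt ℝ 2 (fun y => ψ ((extChartAt 𝓘(ℝ, E2) p₀).symm y)) y :=
  contDiffAt_chart (by norm_num) hy (hψ.contMDiffAt (c.isOpen_regularSet.mem_nhds hr))

include hw hψ0

omit [T2Space S] [MeasurableSpace S] [BorelSpace S] hw hψ0 in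
theorem eventually_correction {x₀ : M} (r : 𝒮.IsRegPoint Φ p₀ x₀ (0, y)) :
    (fun y => w ((extChartAt 𝓘(ℝ, E2) p₀).symm y) ^ 2
      * 𝒮.Zderiv (Φ 0) ψ ((extChartAt 𝓘(ℝ, E2) p₀).symm y)
      / (𝒮.absNormalH (Φ 0) ((extChartAt 𝓘(ℝ, E2) p₀).symm y) ^ 2
        * ψ ((extChartAt 𝓘(ℝ, E2) p₀).symm y))) =ᶠ[𝓝 y] fun y =>
    w ((extChartAt 𝓘(ℝ, E2) p₀).symm y) ^ 2
      * 𝒮.repZd Φ p₀ x₀ (fun y => ψ ((extChartAt 𝓘(ℝ, E2) p₀).symm y)) y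
      / (tilt (𝒮.repSlope Φ p₀ x₀ (0, y)) ^ 2 * ψ ((extChartAt 𝓘(ℝ, E2) p₀).symm y)) := by
  filter_upwards [r.eventually_slice] with y' r'
  have h1 : 𝒮.absNormalH (Φ 0) ((extChartAt 𝓘(ℝ, E2) p₀).symm y') = _ :=
    absNormalH_eq r'.rep r'.density_ne
  rw [h1, r'.Zderiv_eq (c.injective _) (Eventually.of_forall fun _ => rfl)
    ((c.contDiffAt_of_contMDiffOn hψ r'.rep.mem (c.mem_regularSet r')).differentiableAt (by simp))]

omit [MeasurableSpace S] [BorelSpace S] in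
/-- The integrand of the index form, up to a curl, as a sum of a square and a multiple of `ψ L(ψ)`.
The curl is that of `w² Z(ψ) / (|N_h|² ψ) η`. -/
theorem exists_isCurl : ∃ ξ h, 𝒮.IsCurl (Φ 0) (tsupport w) ξ h ∧ ∀ p ∈ 𝒮.regularSet (Φ 0),
    𝒮.indexIntegrand (Φ 0) w w p - h p = (𝒮.absNormalH (Φ 0) p)⁻¹
        * (𝒮.Zderiv (Φ 0) w p - w p * 𝒮.Zderiv (Φ 0) ψ p / ψ p) ^ 2
      - w p ^ 2 / ψ p ^ 2 * (ψ p * 𝒮.jacobi (Φ 0) ψ p) := by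
  obtain ⟨g, hg⟩ : ∃ g : S → ℝ, g = fun p => w p ^ 2 * 𝒮.Zderiv (Φ 0) ψ p
    / (𝒮.absNormalH (Φ 0) p ^ 2 * ψ p) := ⟨_, rfl⟩
  have hgc : ∀ {p₀ : S} {y : E2}, y ∈ (extChartAt 𝓘(ℝ, E2) p₀).target →
      (extChartAt 𝓘(ℝ, E2) p₀).symm y ∈ 𝒮.regularSet (Φ 0) →
      ContDiffAt ℝ 1 (fun y => g ((extChartAt 𝓘(ℝ, E2) p₀).symm y)) y := by
    intro p₀ y hy hr
    obtain ⟨x₀, r⟩ := c.exists_isRegPoint hy hr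
    have k1 := c.contDiffAt_of_contMDiffOn hψ hy hr
    have k2 := c.contDiffAt_zd r le_rfl (by simpa [one_add_one_eq_two] using k1)
    have k3 : ContDiffAt ℝ 1 (fun y => tilt (𝒮.repSlope Φ p₀ x₀ (0, y))) y :=
      ContDiffAt.comp (g := tilt) y contDiff_tilt.contDiffAt
        ((IsVariationCoframe.contDiffAt_slice r.contDiffAt_slope).of_le (by norm_num))
    rw [hg]
    refine ContDiffAt.congr_of_eventuallyEq ?_ (c.eventually_correction hψ r)
    exact (((hw.contDiffAt hy).pow 2).mul k2).div ((k3.pow 2).mul (k1.of_le (by norm_num)))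
      (mul_ne_zero (pow_ne_zero _ (tilt_pos _).ne') (hψ0 _ hr))
  refine ⟨_, _, c.isCurl (g := g) hw.hasCompactSupport.isCompact hw.tsupport_subset (fun p hp => ?_)
    (fun p₀ y hy hyK => hgc hy (hw.tsupport_subset hyK)), fun p hp => ?_⟩
  · rw [hg]
    simp only [image_eq_zero_of_notMem_tsupport hp]
    simp
  obtain ⟨p₁, y, hy, rfl⟩ : ∃ p₁ : S, ∃ y ∈ (extChartAt 𝓘(ℝ, E2) p₁).target,
      (extChartAt 𝓘(ℝ, E2) p₁).symm y = p :=
    ⟨p, _, mem_extChartAt_target p, (extChartAt 𝓘(ℝ, E2) p).left_inv (mem_extChartAt_source p)⟩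
  obtain ⟨x₀, r⟩ := c.exists_isRegPoint hy hp
  have hwd := (hw.contDiffAt hy).differentiableAt (by simp)
  have k1 := c.contDiffAt_of_contMDiffOn hψ hy hp
  have k2 := (c.contDiffAt_zd r le_rfl (by simpa [one_add_one_eq_two] using k1)).differentiableAt
    (by simp)
  have k3 := (IsVariationCoframe.contDiffAt_slice r.contDiffAt_slope).differentiableAt (by simp)
  have k4 : ∀ᶠ y' in 𝓝 y, 𝒮.Zderiv (Φ 0) ψ ((extChartAt 𝓘(ℝ, E2) p₁).symm y') = 𝒮.repZd Φ p₁ x₀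
      (fun y => ψ ((extChartAt 𝓘(ℝ, E2) p₁).symm y)) y' := by
    filter_upwards [r.eventually_slice] with y' r'
    exact r'.Zderiv_eq (c.injective _) (Eventually.of_forall fun _ => rfl)
      ((c.contDiffAt_of_contMDiffOn hψ r'.rep.mem (c.mem_regularSet r')).differentiableAt (by simp))
  have e := IsVariationCoframe.positivity_eq (al := 𝒮.repAl Φ p₁ x₀) (ga := 𝒮.repEta Φ p₁ x₀)
    (m := 𝒮.repSlope Φ p₁ x₀) (κ := 𝒮.repKappa Φ p₁ x₀ y) (H := H) hwd
    (k1.differentiableAt (by simp)) k2 k3 (hψ0 _ hp) (c.eventually_correction (w := w) hψ r)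
  have h1 : 𝒮.absNormalH (Φ 0) ((extChartAt 𝓘(ℝ, E2) p₁).symm y) = _ := absNormalH_eq r.rep r.density_ne
  have h2 : 𝒮.normalT (Φ 0) ((extChartAt 𝓘(ℝ, E2) p₁).symm y) = _ := normalT_eq r.rep r.density_ne
  have h3 := r.Zderiv_eq (c.injective _) (u := w) (Eventually.of_forall fun _ => rfl) hwd
  have h4 := r.Zderiv_eq (c.injective _) (u := g) (Eventually.of_forall fun _ => rfl)
    ((hgc hy hp).differentiableAt (by simp))
  have h5 := r.jacobi_eq (c.injective _) (c.mean _ hp) (u := ψ) (Eventually.of_forall fun _ => rfl) k4 k2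
  have ht := (tilt_pos (𝒮.repSlope Φ p₁ x₀ (0, y))).ne'
  have h6 : (fun y => g ((extChartAt 𝓘(ℝ, E2) p₁).symm y)) = fun y => w ((extChartAt 𝓘(ℝ, E2) p₁).symm y) ^ 2
      * 𝒮.Zderiv (Φ 0) ψ ((extChartAt 𝓘(ℝ, E2) p₁).symm y)
      / (𝒮.absNormalH (Φ 0) ((extChartAt 𝓘(ℝ, E2) p₁).symm y) ^ 2
        * ψ ((extChartAt 𝓘(ℝ, E2) p₁).symm y)) := by rw [hg]
  have h7 := congrFun h6 y
  rw [← h6, ← h7] at e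
  rw [c.indexIntegrand_eq r hwd, h1, h2, h3, h4, h5, k4.self_of_nhds]
  have e' := congrArg (fun x => tilt (𝒮.repSlope Φ p₁ x₀ (0, y)) * x) e
  refine Eq.trans ?_ (e'.trans ?_)
  · field_simp
    ring
  · field_simp

/-- The index form is nonnegative, because its integrand is nonnegative up to a curl. -/
theorem indexForm_nonneg (hL : ∀ p ∈ 𝒮.regularSet (Φ 0), ψ p * 𝒮.jacobi (Φ 0) ψ p ≤ 0) :
    0 ≤ 𝒮.indexForm (Φ 0) w w := by
  obtain ⟨ξ, h, hc, hh⟩ := c.exists_isCurl hw hψ hψ0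
  have i1 := c.integrable_indexIntegrand hw
  have i2 := hc.integrable c.contMDiff_one c.injective
  have e : 𝒮.indexForm (Φ 0) w w = ∫ p, (𝒮.indexIntegrand (Φ 0) w w p - h p) ∂(𝒮.areaMeasure (Φ 0)) := by
    rw [integral_sub i1 i2, hc.integral_eq_zero c.contMDiff_one c.injective, sub_zero,
      indexForm_eq_integral hw]
  rw [e]
  refine integral_nonneg fun p => ?_
  by_cases hp : p ∈ tsupport w
  · have hr := hw.tsupport_subset hp
    have h1 : 0 ≤ 𝒮.absNormalH (Φ 0) p := Real.sqrt_nonneg _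
    have h2 := mul_nonneg (by positivity : 0 ≤ w p ^ 2 / ψ p ^ 2) (neg_nonneg.2 (hL p hr))
    rw [Pi.zero_apply, hh p hr]
    have h3 := mul_nonneg (inv_nonneg.2 h1)
      (sq_nonneg (𝒮.Zderiv (Φ 0) w p - w p * 𝒮.Zderiv (Φ 0) ψ p / ψ p))
    linarith
  · rw [indexIntegrand_eq_zero hp, hc.eq_zero p hp]
    simp

/-- The index form is positive: up to a curl, its integrand is nonnegative, and it is positive on the
nonempty open set where `w ≠ 0`. -/
theorem indexForm_pos (hL : ∀ p ∈ 𝒮.regularSet (Φ 0), ψ p * 𝒮.jacobi (Φ 0) ψ p < 0) (hw0 : w ≠ 0) :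
    0 < 𝒮.indexForm (Φ 0) w w := by
  obtain ⟨ξ, h, hc, hh⟩ := c.exists_isCurl hw hψ hψ0
  have i1 := c.integrable_indexIntegrand hw
  have i2 := hc.integrable c.contMDiff_one c.injective
  have e : 𝒮.indexForm (Φ 0) w w = ∫ p, (𝒮.indexIntegrand (Φ 0) w w p - h p) ∂(𝒮.areaMeasure (Φ 0)) := by
    rw [integral_sub i1 i2, hc.integral_eq_zero c.contMDiff_one c.injective, sub_zero,
      indexForm_eq_integral hw]
  have hpos : ∀ p ∈ tsupport w, 0 ≤ 𝒮.indexIntegrand (Φ 0) w w p - h p ∧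
      (w p ≠ 0 → 0 < 𝒮.indexIntegrand (Φ 0) w w p - h p) := by
    intro p hp
    have hr := hw.tsupport_subset hp
    have h1 : 0 ≤ 𝒮.absNormalH (Φ 0) p := Real.sqrt_nonneg _
    have h3 := mul_nonneg (inv_nonneg.2 h1)
      (sq_nonneg (𝒮.Zderiv (Φ 0) w p - w p * 𝒮.Zderiv (Φ 0) ψ p / ψ p))
    rw [hh p hr]
    constructor
    · have h2 := mul_nonneg (by positivity : 0 ≤ w p ^ 2 / ψ p ^ 2) (neg_pos.2 (hL p hr)).le
      linarith
    · intro hwp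
      have hψp := hψ0 p hr
      have h2 := mul_pos (by positivity : 0 < w p ^ 2 / ψ p ^ 2) (neg_pos.2 (hL p hr))
      linarith
  refine e ▸ (integral_pos_iff_support_of_nonneg ?_ (i1.sub i2)).2 ?_
  · intro p
    by_cases hp : p ∈ tsupport w
    · exact (hpos p hp).1
    · rw [Pi.zero_apply, Pi.sub_apply, indexIntegrand_eq_zero hp, hc.eq_zero p hp, sub_zero]
  · obtain ⟨p, hp⟩ := Function.ne_iff.1 hw0
    have hU : IsOpen {p | w p ≠ 0} := isOpen_ne_fun hw.contMDiff.continuous continuous_const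
    refine (areaMeasure_pos c.contMDiff_one c.injective hU hp).trans_le (measure_mono fun p' hp' => ?_)
    exact ((hpos p' (subset_tsupport _ hp')).2 hp').ne'

end IsCMCSlice
end SasakianStructure
end SubRiem

namespace SubRiem

/-! ### Integrals depending on a parameter -/

section parametric

theorem contDiffAt_two_of_hasDerivAt {L L₁ L₂ : ℝ → ℝ} {x : ℝ}
    (h1 : ∀ᶠ s in 𝓝 x, HasDerivAt L (L₁ s) s) (h2 : ∀ᶠ s in 𝓝 x, HasDerivAt L₁ (L₂ s) s)
    (h3 : ∀ᶠ s in 𝓝 x, ContinuousAt L₂ s) :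
    ContDiffAt ℝ 2 L x ∧ deriv L x = L₁ x ∧ iteratedDeriv 2 L x = L₂ x := by
  have e1 : deriv L =ᶠ[𝓝 x] L₁ := h1.mono fun _ h => h.deriv
  refine ⟨?_, e1.self_of_nhds, ?_⟩
  · obtain ⟨U, hU, hUo, hx⟩ := eventually_nhds_iff.1 (h1.and (h2.and h3))
    have c2 : ContDiffOn ℝ 0 L₂ U :=
      contDiffOn_zero.2 fun s hs => (hU s hs).2.2.continuousWithinAt
    have c1 : ContDiffOn ℝ (0 + 1) L₁ U := (contDiffOn_succ_iff_deriv_of_isOpen hUo).2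
      ⟨fun s hs => (hU s hs).2.1.differentiableAt.differentiableWithinAt, by simp,
        c2.congr fun s hs => (hU s hs).2.1.deriv⟩
    have c0 : ContDiffOn ℝ (1 + 1) L U := (contDiffOn_succ_iff_deriv_of_isOpen hUo).2
      ⟨fun s hs => (hU s hs).1.differentiableAt.differentiableWithinAt, by simp,
        (by simpa using c1 : ContDiffOn ℝ 1 L₁ U).congr fun s hs => (hU s hs).1.deriv⟩
    exact (by simpa [one_add_one_eq_two] using c0 : ContDiffOn ℝ 2 L U).contDiffAt (hUo.mem_nhds hx)
  · rw [iteratedDeriv_succ, iteratedDeriv_one, e1.deriv_eq]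
    exact h2.self_of_nhds.deriv

theorem hasDerivAt_intervalIntegral {w : ℝ → ℝ} (hw : ∀ᶠ s in 𝓝 (0 : ℝ), ContinuousAt w s) :
    ∀ᶠ s in 𝓝 (0 : ℝ), HasDerivAt (fun s => ∫ t in (0 : ℝ)..s, w t) (w s) s := by
  obtain ⟨ε, hε, h⟩ := Metric.eventually_nhds_iff_ball.1 hw
  have hc : ContinuousOn w (Metric.ball 0 ε) := fun s hs => (h s hs).continuousWithinAt
  filter_upwards [Metric.ball_mem_nhds (0 : ℝ) hε] with s hs
  have h1 : Set.uIcc 0 s ⊆ Metric.ball (0 : ℝ) ε :=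
    (convex_ball (0 : ℝ) ε).ordConnected.uIcc_subset (Metric.mem_ball_self hε) hs
  exact intervalIntegral.integral_hasDerivAt_right (hc.mono h1).intervalIntegrable
    (hc.stronglyMeasurableAtFilter Metric.isOpen_ball s hs) (h s hs)

variable {S : Type*} [TopologicalSpace S] [T2Space S] [MeasurableSpace S] [BorelSpace S]
  {μ : Measure S} [IsFiniteMeasureOnCompacts μ] {A : Set S} {g g' : ℝ → S → ℝ}

omit [T2Space S] [MeasurableSpace S] [BorelSpace S] in
theorem exists_bound_of_continuousAt (hA : IsCompact A)
    (hg : ∀ p ∈ A, ∀ᶠ q in 𝓝 ((0 : ℝ), p), ContinuousAt (fun q : ℝ × S => g q.1 q.2) q) :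
    ∀ᶠ s in 𝓝 (0 : ℝ), ∃ δ > 0, ∃ C : ℝ, ∀ t ∈ Metric.closedBall s δ,
      ContinuousOn (g t) A ∧ ∀ p ∈ A, ContinuousAt (fun t => g t p) t ∧ ‖g t p‖ ≤ C := by
  have h1 : ∀ᶠ s in 𝓝 (0 : ℝ), ∀ p ∈ A, ContinuousAt (fun q : ℝ × S => g q.1 q.2) (s, p) :=
    hA.eventually_forall_of_forall_eventually hg
  filter_upwards [h1.eventually_nhds] with s hs
  obtain ⟨δ, hδ, h2⟩ := Metric.nhds_basis_closedBall.eventually_iff.1 hs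
  obtain ⟨C, hC⟩ := ((isCompact_closedBall s δ).prod hA).exists_bound_of_continuousOn
    (f := fun q : ℝ × S => g q.1 q.2) fun q hq => (h2 hq.1 q.2 hq.2).continuousWithinAt
  refine ⟨δ, hδ, C, fun t ht => ⟨fun p hp => ?_, fun p hp => ⟨?_, hC (t, p) ⟨ht, hp⟩⟩⟩⟩
  · exact (ContinuousAt.comp (g := fun q : ℝ × S => g q.1 q.2) (f := fun p => (t, p)) (h2 ht p hp)
      (Continuous.prodMk_right t).continuousAt).continuousWithinAt
  · exact ContinuousAt.comp (g := fun q : ℝ × S => g q.1 q.2) (f := fun t => (t, p)) (h2 ht p hp)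
      (Continuous.prodMk_left p).continuousAt

theorem continuousAt_setIntegral (hA : IsCompact A)
    (hg : ∀ p ∈ A, ∀ᶠ q in 𝓝 ((0 : ℝ), p), ContinuousAt (fun q : ℝ × S => g q.1 q.2) q) :
    ∀ᶠ s in 𝓝 (0 : ℝ), ContinuousAt (fun s => ∫ p in A, g s p ∂μ) s := by
  filter_upwards [exists_bound_of_continuousAt hA hg] with s ⟨δ, hδ, C, h⟩
  have hB := Metric.closedBall_mem_nhds s hδ
  refine continuousAt_of_dominated (bound := fun _ => C) ?_ ?_ ?_ ?_
  · filter_upwards [hB] with t ht using (h t ht).1.aestronglyMeasurable hA.measurableSet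
  · filter_upwards [hB] with t ht
    exact ae_restrict_of_forall_mem hA.measurableSet fun p hp => ((h t ht).2 p hp).2
  · exact integrableOn_const hA.measure_lt_top.ne
  · exact ae_restrict_of_forall_mem hA.measurableSet fun p hp =>
      ((h s (Metric.mem_closedBall_self hδ.le)).2 p hp).1

theorem hasDerivAt_setIntegral (hA : IsCompact A)
    (hg : ∀ p ∈ A, ∀ᶠ q in 𝓝 ((0 : ℝ), p), ContinuousAt (fun q : ℝ × S => g q.1 q.2) q)
    (hg' : ∀ p ∈ A, ∀ᶠ q in 𝓝 ((0 : ℝ), p), ContinuousAt (fun q : ℝ × S => g' q.1 q.2) q)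
    (hd : ∀ p ∈ A, ∀ᶠ q in 𝓝 ((0 : ℝ), p), HasDerivAt (fun s => g s q.2) (g' q.1 q.2) q.1) :
    ∀ᶠ s in 𝓝 (0 : ℝ), HasDerivAt (fun s => ∫ p in A, g s p ∂μ) (∫ p in A, g' s p ∂μ) s := by
  have hd' : ∀ᶠ s in 𝓝 (0 : ℝ), ∀ p ∈ A, HasDerivAt (fun s => g s p) (g' s p) s :=
    hA.eventually_forall_of_forall_eventually (P := fun s p => HasDerivAt (fun s => g s p) (g' s p) s) hd
  filter_upwards [exists_bound_of_continuousAt hA hg, exists_bound_of_continuousAt hA hg',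
    hd'.eventually_nhds] with s ⟨δ, hδ, C, h⟩ ⟨δ', hδ', C', h'⟩ hs
  refine (hasDerivAt_integral_of_dominated_loc_of_deriv_le (bound := fun _ => C')
    (F' := g') (Filter.inter_mem (Metric.closedBall_mem_nhds s hδ') hs) ?_ ?_ ?_ ?_ ?_ ?_).2
  · filter_upwards [Metric.closedBall_mem_nhds s hδ] with t ht
      using (h t ht).1.aestronglyMeasurable hA.measurableSet
  · exact (h s (Metric.mem_closedBall_self hδ.le)).1.integrableOn_compact hA
  · exact (h' s (Metric.mem_closedBall_self hδ'.le)).1.aestronglyMeasurable hA.measurableSet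
  · exact ae_restrict_of_forall_mem hA.measurableSet fun p hp t ht => ((h' t ht.1).2 p hp).2
  · exact integrableOn_const hA.measure_lt_top.ne
  · exact ae_restrict_of_forall_mem hA.measurableSet fun p hp t ht => ht.2 p hp

end parametric
end SubRiem

namespace SubRiem

/-! ### Functions of a parameter in charts -/

section repBy

variable {S : Type*} [TopologicalSpace S] [ChartedSpace E2 S] {k : ℝ → S → ℝ} {p₀ : S}
  {h : ℝ × E2 → ℝ} {w : E2 → ℝ} {y : E2}

/-- Near the parameter value `0` and the point with coordinates `y` in the preferred chart at `p₀`, the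
function `k` is expressed as `h (s, y) * w y`. -/
def IsRepBy (k : ℝ → S → ℝ) (p₀ : S) (h : ℝ × E2 → ℝ) (w : E2 → ℝ) (y : E2) : Prop :=
  ∀ᶠ q in 𝓝 ((0 : ℝ), y), k q.1 ((extChartAt 𝓘(ℝ, E2) p₀).symm q.2) = h q * w q.2

theorem hasDerivAt_param {q : ℝ × E2} (hh : DifferentiableAt ℝ h q) :
    HasDerivAt (fun s => h (s, q.2)) (dd 0 h q) q.1 := by
  have h1 : HasFDerivAt (fun s : ℝ => (s, q.2)) (ContinuousLinearMap.inl ℝ ℝ E2) q.1 :=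
    hasFDerivAt_prodMk_left q.1 q.2
  have h2 : HasFDerivAt (fun s => h (s, q.2)) _ q.1 :=
    HasFDerivAt.comp (g := h) q.1 hh.hasFDerivAt h1
  simpa [dd] using h2.hasDerivAt

namespace IsRepBy

theorem eventually_hasDerivAt (hk : IsRepBy k p₀ h w y)
    (hh : ∀ᶠ q in 𝓝 ((0 : ℝ), y), DifferentiableAt ℝ h q) : ∀ᶠ q in 𝓝 ((0 : ℝ), y),
      HasDerivAt (fun s => k s ((extChartAt 𝓘(ℝ, E2) p₀).symm q.2)) (dd 0 h q * w q.2) q.1 := by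
  filter_upwards [hk.eventually_nhds, hh] with q h1 h2
  refine ((hasDerivAt_param h2).mul_const (w q.2)).congr_of_eventuallyEq ?_
  exact (Continuous.prodMk_left q.2).continuousAt.eventually h1

theorem deriv (hk : IsRepBy k p₀ h w y) (hh : ∀ᶠ q in 𝓝 ((0 : ℝ), y), DifferentiableAt ℝ h q) :
    IsRepBy (fun s p => _root_.deriv (fun s => k s p) s) p₀ (dd 0 h) w y :=
  (hk.eventually_hasDerivAt hh).mono fun _ h => h.deriv

theorem add_const_mul {k' : ℝ → S → ℝ} {h' : ℝ × E2 → ℝ} (hk : IsRepBy k p₀ h w y)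
    (hk' : IsRepBy k' p₀ h' w y) (c : ℝ) :
    IsRepBy (fun s p => k s p + c * k' s p) p₀ (fun q => h q + c * h' q) w y := by
  filter_upwards [hk, hk'] with q h1 h2
  rw [h1, h2]; ring

theorem eventually_of_chart {P : ℝ → S → Prop} {p : S}
    (hP : ∀ᶠ q in 𝓝 ((0 : ℝ), extChartAt 𝓘(ℝ, E2) p p), P q.1 ((extChartAt 𝓘(ℝ, E2) p).symm q.2)) :
    ∀ᶠ q in 𝓝 ((0 : ℝ), p), P q.1 q.2 := by
  have h1 : ContinuousAt (fun q : ℝ × S => (q.1, extChartAt 𝓘(ℝ, E2) p q.2)) (0, p) :=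
    continuousAt_fst.prodMk (ContinuousAt.comp (g := extChartAt 𝓘(ℝ, E2) p)
      (continuousAt_extChartAt (I := 𝓘(ℝ, E2)) p) continuousAt_snd)
  have h2 : ∀ᶠ q : ℝ × S in 𝓝 ((0 : ℝ), p), q.2 ∈ (extChartAt 𝓘(ℝ, E2) p).source :=
    continuousAt_snd.eventually (mem_nhds_source (mem_extChartAt_source (I := 𝓘(ℝ, E2)) p))
  filter_upwards [h1.eventually hP, h2] with q h3 h4
  rwa [(extChartAt 𝓘(ℝ, E2) p).left_inv h4] at h3

theorem eventually_continuousAt {p : S} (hk : IsRepBy k p h w (extChartAt 𝓘(ℝ, E2) p p))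
    (hh : ContDiffAt ℝ 0 h (0, extChartAt 𝓘(ℝ, E2) p p))
    (hw : ContDiffAt ℝ 0 w (extChartAt 𝓘(ℝ, E2) p p)) :
    ∀ᶠ q in 𝓝 ((0 : ℝ), p), ContinuousAt (fun q : ℝ × S => k q.1 q.2) q := by
  set e := extChartAt 𝓘(ℝ, E2) p
  have h1 : ContinuousAt (fun q : ℝ × S => (q.1, e q.2)) (0, p) :=
    continuousAt_fst.prodMk (ContinuousAt.comp (g := e)
      (continuousAt_extChartAt (I := 𝓘(ℝ, E2)) p) continuousAt_snd)
  have h2 : ∀ᶠ q : ℝ × S in 𝓝 ((0 : ℝ), p), q.2 ∈ e.source :=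
    continuousAt_snd.eventually (mem_nhds_source (mem_extChartAt_source (I := 𝓘(ℝ, E2)) p))
  have h3 : ∀ᶠ q in 𝓝 ((0 : ℝ), e p), ContinuousAt w q.2 :=
    continuousAt_snd.eventually ((hw.eventually (by simp)).mono fun _ h => h.continuousAt)
  have h4 : ∀ᶠ q : ℝ × S in 𝓝 ((0 : ℝ), p), h (q.1, e q.2) * w (e q.2) = k q.1 q.2 := by
    filter_upwards [h1.eventually hk, h2] with q k1 k2
    rw [← k1, e.left_inv k2]
  filter_upwards [h4.eventually_nhds, h2, h1.eventually h3,
    h1.eventually ((hh.eventually (by simp)).mono fun _ h => h.continuousAt)] with q k1 k2 k3 k4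
  have k5 : ContinuousAt (fun q : ℝ × S => e q.2) q :=
    ContinuousAt.comp (g := e) (continuousAt_extChartAt' (I := 𝓘(ℝ, E2)) (by simpa [e] using k2))
      continuousAt_snd
  have k6 : ContinuousAt (fun q : ℝ × S => (q.1, e q.2)) q := continuousAt_fst.prodMk k5
  exact ((ContinuousAt.comp (g := h) (f := fun q : ℝ × S => (q.1, e q.2)) k4 k6).mul
    (ContinuousAt.comp (g := w) (f := fun q : ℝ × S => e q.2) k3 k5)).congr k1

end IsRepBy
/-- Near the parameter value `0` and the points of `A`, the function `k` is expressed in charts as the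
product of a function of class `C^n` and a continuous function of the coordinates. -/
def IsParam (n : WithTop ℕ∞) (k : ℝ → S → ℝ) (A : Set S) : Prop :=
  ∀ p ∈ A, ∃ (h : ℝ × E2 → ℝ) (w : E2 → ℝ), IsRepBy k p h w (extChartAt 𝓘(ℝ, E2) p p) ∧
    ContDiffAt ℝ n h (0, extChartAt 𝓘(ℝ, E2) p p) ∧ ContDiffAt ℝ 0 w (extChartAt 𝓘(ℝ, E2) p p)

theorem contDiffAt_dd {q : ℝ × E2} {n : WithTop ℕ∞} (hh : ContDiffAt ℝ (n + 1) h q) (i : Fin 3) :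
    ContDiffAt ℝ n (dd i h) q :=
  (hh.fderiv_right le_rfl).clm_apply contDiffAt_const

theorem eventually_differentiableAt {q : ℝ × E2} (hh : ContDiffAt ℝ 1 h q) :
    ∀ᶠ q in 𝓝 q, DifferentiableAt ℝ h q :=
  (hh.eventually (by simp)).mono fun _ h => h.differentiableAt (by simp)

namespace IsParam

variable {A : Set S} {n : WithTop ℕ∞}

theorem of_le {m : WithTop ℕ∞} (hk : IsParam n k A) (h : m ≤ n) : IsParam m k A := fun p hp => by
  obtain ⟨f, w, h1, h2, h3⟩ := hk p hp
  exact ⟨f, w, h1, h2.of_le h, h3⟩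

theorem deriv (hk : IsParam (n + 1) k A) : IsParam n (fun s p => _root_.deriv (fun s => k s p) s) A := by
  intro p hp
  obtain ⟨f, w, h1, h2, h3⟩ := hk p hp
  exact ⟨dd 0 f, w, h1.deriv (eventually_differentiableAt (h2.of_le le_add_self)), contDiffAt_dd h2 0, h3⟩

variable [T2Space S] [MeasurableSpace S] [BorelSpace S] {μ : Measure S} [IsFiniteMeasureOnCompacts μ]

theorem continuousAt (hk : IsParam 0 k A) (hA : IsCompact A) :
    ∀ᶠ s in 𝓝 (0 : ℝ), ContinuousAt (fun s => ∫ p in A, k s p ∂μ) s :=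
  continuousAt_setIntegral hA fun p hp => by
    obtain ⟨f, w, h1, h2, h3⟩ := hk p hp
    exact h1.eventually_continuousAt h2 h3

theorem integrableOn (hk : IsParam 0 k A) (hA : IsCompact A) :
    ∀ᶠ s in 𝓝 (0 : ℝ), IntegrableOn (k s) A μ := by
  have h0 := exists_bound_of_continuousAt (g := k) hA fun p hp => by
    obtain ⟨f, w, h1, h2, h3⟩ := hk p hp
    exact h1.eventually_continuousAt h2 h3
  filter_upwards [h0] with s ⟨δ, hδ, C, h⟩
  exact (h s (Metric.mem_closedBall_self hδ.le)).1.integrableOn_compact hA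

theorem hasDerivAt (hk : IsParam 1 k A) (hA : IsCompact A) :
    ∀ᶠ s in 𝓝 (0 : ℝ), HasDerivAt (fun s => ∫ p in A, k s p ∂μ)
      (∫ p in A, _root_.deriv (fun s => k s p) s ∂μ) s := by
  refine hasDerivAt_setIntegral hA (fun p hp => ?_) (fun p hp => ?_) fun p hp => ?_
  · obtain ⟨f, w, h1, h2, h3⟩ := hk p hp
    exact h1.eventually_continuousAt (h2.of_le (by simp)) h3
  · obtain ⟨f, w, h1, h2, h3⟩ := deriv (n := 0) (by simpa using hk) p hp
    exact h1.eventually_continuousAt h2 h3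
  · obtain ⟨f, w, h1, h2, h3⟩ := hk p hp
    have h4 := h1.eventually_hasDerivAt (eventually_differentiableAt h2)
    exact IsRepBy.eventually_of_chart (P := fun s p => HasDerivAt (fun s => k s p)
      (_root_.deriv (fun s => k s p) s) s) (h4.mono fun q hq => hq.differentiableAt.hasDerivAt)

end IsParam
end repBy
end SubRiem

namespace SubRiem
namespace SasakianStructure

/-! ### The area and the volume of a variation -/

variable {M : Type*} [TopologicalSpace M] [ChartedSpace E3 M] [IsManifold 𝓘(ℝ, E3) ∞ M]
variable {𝒮 : SasakianStructure M}
variable {S : Type*} [TopologicalSpace S] [ChartedSpace E2 S]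
  {Φ : ℝ → S → M} {H : ℝ} {p₀ p : S} {y : E2} {I : Set ℝ} {A : Set S} {s : ℝ}

theorem inner_cross (x : M) (u v w : TangentSpace 𝓘(ℝ, E3) x) :
    𝒮.g.inner x (𝒮.cross x u v) w = 𝒮.volForm x w u v := by
  have hx := mem_extChartAt_source (I := 𝓘(ℝ, E3)) x
  have h1 : 𝒮.g.inner x (𝒮.J x u) w = -𝒮.g.inner x u (𝒮.J x w) := by
    rw [← 𝒮.inner_chartD hx, ← 𝒮.inner_chartD hx, 𝒮.chartD_J hx, 𝒮.chartD_J hx]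
    exact (𝒮.isSasakianChart x).J_skew _ (mem_extChartAt_target x) _ _
  have h2 := 𝒮.g.symm x (𝒮.J x w) u
  rw [cross, volForm, map_sub, map_add, map_smul, map_smul, map_smul, h2]
  have key : ∀ (a b c : TangentSpace 𝓘(ℝ, E3) x →L[ℝ] ℝ) (α β γ : ℝ),
      (α • a + β • b - γ • c) w = α * a w + β * b w - γ * c w := fun _ _ _ _ _ _ => rfl
  rw [key, h1, 𝒮.g_T]
  ring

theorem volForm_div_len (s : ℝ) (p : S) :
    𝒮.volForm (Φ s p) (velocity Φ s p) (tangentFrame (Φ s) 0 p) (tangentFrame (Φ s) 1 p)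
      / 𝒮.len (Φ s p) (𝒮.cross (Φ s p) (tangentFrame (Φ s) 0 p) (tangentFrame (Φ s) 1 p))
    = 𝒮.g.inner _ (𝒮.normal (Φ s) p) (velocity Φ s p) := by
  simp only [normal]
  rw [map_smul, ← inner_cross, div_eq_inv_mul]
  rfl

/-- The area element `|N_h| da` of the slices, as a density with respect to the area of the slice
`s = 0`. -/
def areaIntegrand (𝒮 : SasakianStructure M) (Φ : ℝ → S → M) (s : ℝ) (p : S) : ℝ :=
  𝒮.areaQuotient (Φ 0) (Φ s) p * 𝒮.absNormalH (Φ s) p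

/-- The volume swept out by the slices, as a density with respect to the area of the slice `s = 0`. -/
def volumeIntegrand (𝒮 : SasakianStructure M) (Φ : ℝ → S → M) (s : ℝ) (p : S) : ℝ :=
  𝒮.areaQuotient (Φ 0) (Φ s) p * 𝒮.g.inner _ (𝒮.normal (Φ s) p) (velocity Φ s p)

/-- The integrand of the derivative of `A + 2HV`. -/
def variationIntegrand (𝒮 : SasakianStructure M) (Φ : ℝ → S → M) (H : ℝ) (s : ℝ) (p : S) : ℝ :=
  deriv (fun s => 𝒮.areaIntegrand Φ s p) s + 2 * H * 𝒮.volumeIntegrand Φ s p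

namespace IsVariation

variable (hv : 𝒮.IsVariation (Φ 0) I A Φ)
include hv

theorem mem_nhds (hs : s ∈ I) : I ∈ 𝓝 s := hv.isOpen.mem_nhds hs

theorem eventuallyEq [T2Space S] (hs : s ∈ I) (hp : p ∉ A) : Φ s =ᶠ[𝓝 p] Φ 0 := by
  filter_upwards [hv.isCompact.isClosed.isOpen_compl.mem_nhds hp] with p' hp' using hv.eq_off s hs p' hp'

theorem velocity_eq_zero (hs : s ∈ I) (hp : p ∉ A) : velocity Φ s p = 0 := by
  have h1 : (fun t => Φ t p) =ᶠ[𝓝 s] fun _ => Φ 0 p := by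
    filter_upwards [hv.mem_nhds hs] with t ht using hv.eq_off t ht p hp
  have h2 := h1.mfderiv_eq (I := 𝓘(ℝ, ℝ)) (I' := 𝓘(ℝ, E3))
  have h3 : ∀ (L : ℝ →L[ℝ] E3), L = (0 : ℝ →L[ℝ] E3) → L 1 = 0 := by rintro L rfl; rfl
  exact h3 _ (h2.trans mfderiv_const)

theorem volumeIntegrand_eq_zero (hs : s ∈ I) (hp : p ∉ A) : 𝒮.volumeIntegrand Φ s p = 0 := by
  rw [volumeIntegrand, hv.velocity_eq_zero hs hp, map_zero, mul_zero]

theorem areaIntegrand_eq [T2Space S] (hs : s ∈ I) (hp : p ∉ A) :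
    𝒮.areaIntegrand Φ s p = 𝒮.areaIntegrand Φ 0 p := by
  have h1 := hv.eq_off s hs p hp
  have h2 := (hv.eventuallyEq hs hp).mfderiv_eq (I := 𝓘(ℝ, E2)) (I' := 𝓘(ℝ, E3))
  -- the integrand depends on the value and the differential of the slice at `p` only
  have key : ∀ (x : M) (L : E2 →L[ℝ] E3) (x' : M) (L' : E2 →L[ℝ] E3), x = x' → L = L' →
      √(gram (ContinuousLinearMap.bilinearComp (𝒮.g.inner x : E3 →L[ℝ] E3 →L[ℝ] ℝ) L L) (b2 0) (b2 1))
        / 𝒮.areaElement (Φ 0) p * 𝒮.len x (((𝒮.len x (𝒮.cross x (L (b2 0)) (L (b2 1))))⁻¹ •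
          𝒮.cross x (L (b2 0)) (L (b2 1)) - 𝒮.g.inner x ((𝒮.len x (𝒮.cross x (L (b2 0)) (L (b2 1))))⁻¹ •
          𝒮.cross x (L (b2 0)) (L (b2 1))) (𝒮.T x) • 𝒮.T x : TangentSpace 𝓘(ℝ, E3) x))
      = √(gram (ContinuousLinearMap.bilinearComp (𝒮.g.inner x' : E3 →L[ℝ] E3 →L[ℝ] ℝ) L' L') (b2 0) (b2 1))
        / 𝒮.areaElement (Φ 0) p * 𝒮.len x' (((𝒮.len x' (𝒮.cross x' (L' (b2 0)) (L' (b2 1))))⁻¹ •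
          𝒮.cross x' (L' (b2 0)) (L' (b2 1))
          - 𝒮.g.inner x' ((𝒮.len x' (𝒮.cross x' (L' (b2 0)) (L' (b2 1))))⁻¹ •
          𝒮.cross x' (L' (b2 0)) (L' (b2 1))) (𝒮.T x') • 𝒮.T x' : TangentSpace 𝓘(ℝ, E3) x')) := by
    rintro x L _ _ rfl rfl; rfl
  exact key _ _ _ _ h1 h2

theorem variationIntegrand_eq_zero [T2Space S] (hs : s ∈ I) (hp : p ∉ A) :
    𝒮.variationIntegrand Φ H s p = 0 := by
  have h1 : (fun t => 𝒮.areaIntegrand Φ t p) =ᶠ[𝓝 s] fun _ => 𝒮.areaIntegrand Φ 0 p := by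
    filter_upwards [hv.mem_nhds hs] with t ht using hv.areaIntegrand_eq ht hp
  rw [variationIntegrand, h1.deriv_eq, hv.volumeIntegrand_eq_zero hs hp]
  simp

variable [IsManifold 𝓘(ℝ, E2) 3 S]

omit hv in
theorem isCMCSlice {φ : S → M} (hv : 𝒮.IsVariation φ I A Φ) (hφ : ContMDiff 𝓘(ℝ, E2) 𝓘(ℝ, E3) 2 φ)
    (hi : ∀ p, Function.Injective (dmap φ p)) (c : 𝒮.IsCMCSlice (fun _ => φ) H) :
    𝒮.IsCMCSlice Φ H := by
  obtain rfl : φ = Φ 0 := funext fun p => (hv.zero_eq p).symm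
  refine ⟨hφ, hi, fun p hp => ?_, c.mean⟩
  exact hv.contMDiffOn.contMDiffAt ((hv.isOpen.prod c.isOpen_regularSet).mem_nhds ⟨hv.zero_mem, hp⟩)

variable (c : 𝒮.IsCMCSlice Φ H)
include c

theorem contMDiff_slice [T2Space S] (hs : s ∈ I) : ContMDiff 𝓘(ℝ, E2) 𝓘(ℝ, E3) 1 (Φ s) := by
  intro p
  by_cases hp : p ∈ A
  · have h1 : ContMDiffAt (𝓘(ℝ, ℝ).prod 𝓘(ℝ, E2)) 𝓘(ℝ, E3) 3 (fun q : ℝ × S => Φ q.1 q.2) (s, p) :=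
      hv.contMDiffOn.contMDiffAt ((hv.isOpen.prod c.isOpen_regularSet).mem_nhds ⟨hs, hv.subset hp⟩)
    have h2 : ContMDiffAt 𝓘(ℝ, E2) (𝓘(ℝ, ℝ).prod 𝓘(ℝ, E2)) 1 (fun p : S => (s, p)) p :=
      contMDiffAt_const.prodMk contMDiffAt_id
    exact ContMDiffAt.comp (g := fun q : ℝ × S => Φ q.1 q.2) p (h1.of_le (by norm_num)) h2
  · exact (c.contMDiff_one p).congr_of_eventuallyEq (hv.eventuallyEq hs hp)

/-- The reciprocal of the density of `da` in coordinates, for the slice `s = 0`: the density of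
`|N_h| da` is `repDensity`, and `|N_h|` is `tilt` of the slope. -/
def _root_.SubRiem.SasakianStructure.repWeight (𝒮 : SasakianStructure M) (Φ : ℝ → S → M) (p₀ : S) (x₀ : M)
    (y : E2) : ℝ := tilt (𝒮.repSlope Φ p₀ x₀ (0, y)) / 𝒮.repDensity Φ p₀ x₀ (0, y)

variable [OrientedAtlas S] [T2Space S] {x₀ : M} (r : 𝒮.IsRegPoint Φ p₀ x₀ (0, y))
include r

theorem eventually_areaQuotient_eq : ∀ᶠ q in 𝓝 ((0 : ℝ), y), q.1 ∈ I ∧ 𝒮.IsRegPoint Φ p₀ x₀ q ∧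
    𝒮.areaQuotient (Φ 0) (Φ q.1) ((extChartAt 𝓘(ℝ, E2) p₀).symm q.2)
      = 𝒮.repDensity Φ p₀ x₀ q / tilt (𝒮.repSlope Φ p₀ x₀ q) * 𝒮.repWeight Φ p₀ x₀ q.2 := by
  filter_upwards [r.eventually, continuousAt_snd.eventually r.eventually_slice,
    continuousAt_fst.eventually (hv.mem_nhds hv.zero_mem)] with q r1 r0 hs
  have hq := hv.contMDiff_slice c hs
  refine ⟨hs, r1, ?_⟩
  rw [𝒮.areaQuotient_eq c.contMDiff_one hq r1.rep.mem,
    r1.areaDensity_eq (hq.mdifferentiable (by simp)),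
    IsRegPoint.areaDensity_eq (q := (0, q.2)) r0 (c.contMDiff_one.mdifferentiable (by simp)), repWeight,
    div_div_eq_mul_div, mul_div_assoc]

theorem isRepBy_areaIntegrand : IsRepBy (𝒮.areaIntegrand Φ) p₀ (𝒮.repDensity Φ p₀ x₀)
    (𝒮.repWeight Φ p₀ x₀) y := by
  filter_upwards [hv.eventually_areaQuotient_eq c r] with q ⟨hs, r1, h1⟩
  have := (tilt_pos (𝒮.repSlope Φ p₀ x₀ q)).ne'
  rw [areaIntegrand, h1, absNormalH_eq r1.rep r1.density_ne]
  field_simp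

theorem isRepBy_volumeIntegrand : IsRepBy (𝒮.volumeIntegrand Φ) p₀
    (fun q => 𝒮.repSpeed Φ p₀ x₀ q * 𝒮.repDensity Φ p₀ x₀ q) (𝒮.repWeight Φ p₀ x₀) y := by
  filter_upwards [hv.eventually_areaQuotient_eq c r] with q ⟨hs, r1, h1⟩
  have := (tilt_pos (𝒮.repSlope Φ p₀ x₀ q)).ne'
  rw [volumeIntegrand, h1, r1.inner_normal_velocity]
  field_simp

theorem isRepBy_variationIntegrand : IsRepBy (𝒮.variationIntegrand Φ H) p₀
    (fun q => dd 0 (𝒮.repDensity Φ p₀ x₀) q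
      + 2 * H * (𝒮.repSpeed Φ p₀ x₀ q * 𝒮.repDensity Φ p₀ x₀ q)) (𝒮.repWeight Φ p₀ x₀) y :=
  ((hv.isRepBy_areaIntegrand c r).deriv (eventually_differentiableAt
    (r.contDiffAt_density.of_le (by norm_num)))).add_const_mul (hv.isRepBy_volumeIntegrand c r) _

omit hv c [OrientedAtlas S] [T2Space S] in
theorem _root_.SubRiem.SasakianStructure.IsRegPoint.contDiffAt_weight :
    ContDiffAt ℝ 0 (𝒮.repWeight Φ p₀ x₀) y := by
  have h1 := (IsVariationCoframe.contDiffAt_slice r.contDiffAt_slope).of_le (m := 0) (by simp)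
  have h2 := (IsVariationCoframe.contDiffAt_slice r.contDiffAt_density).of_le (m := 0) (by simp)
  exact (ContDiffAt.comp (g := tilt) y contDiff_tilt.contDiffAt h1).div h2 r.density_ne

omit hv c [OrientedAtlas S] [T2Space S] in
theorem _root_.SubRiem.SasakianStructure.IsRegPoint.contDiffAt_variation :
    ContDiffAt ℝ 1 (fun q => dd 0 (𝒮.repDensity Φ p₀ x₀) q
      + 2 * H * (𝒮.repSpeed Φ p₀ x₀ q * 𝒮.repDensity Φ p₀ x₀ q)) (0, y) :=
  (contDiffAt_dd (n := 1) (by simpa [one_add_one_eq_two] using r.contDiffAt_density) 0).add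
    (contDiffAt_const.mul ((r.contDiffAt_speed.mul r.contDiffAt_density).of_le (by norm_num)))

omit r

omit [OrientedAtlas S] [T2Space S] in
theorem exists_isRegPoint (hp : p ∈ A) :
    ∃ x₀, 𝒮.IsRegPoint Φ p x₀ (0, extChartAt 𝓘(ℝ, E2) p p) :=
  c.exists_isRegPoint (mem_extChartAt_target p)
    (by rw [(extChartAt 𝓘(ℝ, E2) p).left_inv (mem_extChartAt_source p)]; exact hv.subset hp)

theorem isParam_areaIntegrand : IsParam 1 (𝒮.areaIntegrand Φ) A := fun p hp => by
  obtain ⟨x₀, r⟩ := hv.exists_isRegPoint c hp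
  exact ⟨_, _, hv.isRepBy_areaIntegrand c r, r.contDiffAt_density.of_le (by norm_num), r.contDiffAt_weight⟩

theorem isParam_volumeIntegrand : IsParam 1 (𝒮.volumeIntegrand Φ) A := fun p hp => by
  obtain ⟨x₀, r⟩ := hv.exists_isRegPoint c hp
  exact ⟨_, _, hv.isRepBy_volumeIntegrand c r,
    (r.contDiffAt_speed.mul r.contDiffAt_density).of_le (by norm_num), r.contDiffAt_weight⟩

theorem isParam_variationIntegrand : IsParam 1 (𝒮.variationIntegrand Φ H) A := fun p hp => by
  obtain ⟨x₀, r⟩ := hv.exists_isRegPoint c hp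
  exact ⟨_, _, hv.isRepBy_variationIntegrand c r, r.contDiffAt_variation, r.contDiffAt_weight⟩

variable [SecondCountableTopology S] [MeasurableSpace S] [BorelSpace S]

theorem areaFunctional_eq (hs : s ∈ I) :
    𝒮.areaFunctional A Φ s = ∫ p in A, 𝒮.areaIntegrand Φ s p ∂(𝒮.areaMeasure (Φ 0)) :=
  𝒮.setIntegral_areaMeasure c.contMDiff_one c.injective (hv.contMDiff_slice c hs)
    hv.isCompact.measurableSet _

theorem volumeFunctional_eq (hs : s ∈ I) : 𝒮.volumeFunctional A Φ s
    = ∫ t in (0 : ℝ)..s, ∫ p in A, 𝒮.volumeIntegrand Φ t p ∂(𝒮.areaMeasure (Φ 0)) := by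
  rw [volumeFunctional]
  refine intervalIntegral.integral_congr fun t ht => ?_
  have ht' : t ∈ I := hv.ordConnected.uIcc_subset hv.zero_mem hs ht
  have e : ∀ p, 𝒮.volForm (Φ t p) (velocity Φ t p) (tangentFrame (Φ t) 0 p) (tangentFrame (Φ t) 1 p)
      / 𝒮.len (Φ t p) (𝒮.cross (Φ t p) (tangentFrame (Φ t) 0 p) (tangentFrame (Φ t) 1 p))
      = 𝒮.g.inner _ (𝒮.normal (Φ t) p) (velocity Φ t p) := volForm_div_len t
  refine (congrArg (fun k : S → ℝ => ∫ p in A, k p ∂(𝒮.areaMeasure (Φ t))) (funext e)).trans ?_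
  exact 𝒮.setIntegral_areaMeasure c.contMDiff_one c.injective (hv.contMDiff_slice c ht')
    hv.isCompact.measurableSet _

theorem hasDerivAt_areaVolume : ∀ᶠ s in 𝓝 (0 : ℝ), HasDerivAt (𝒮.areaVolume H A Φ)
    (∫ p in A, 𝒮.variationIntegrand Φ H s p ∂(𝒮.areaMeasure (Φ 0))) s := by
  have := 𝒮.isLocallyFiniteMeasure_areaMeasure c.contMDiff_one
  have hA := hv.isCompact
  have a1 := hv.isParam_areaIntegrand c
  have v1 := hv.isParam_volumeIntegrand c
  have a0 := IsParam.deriv (n := 0) (by simpa using a1)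
  have v0 := v1.of_le (m := 0) (by simp)
  filter_upwards [a1.hasDerivAt (μ := 𝒮.areaMeasure (Φ 0)) hA,
    hasDerivAt_intervalIntegral (v0.continuousAt (μ := 𝒮.areaMeasure (Φ 0)) hA),
    a0.integrableOn (μ := 𝒮.areaMeasure (Φ 0)) hA, v0.integrableOn (μ := 𝒮.areaMeasure (Φ 0)) hA,
    hv.mem_nhds hv.zero_mem] with s h1 h2 h3 h4 hs
  have h5 : ∫ p in A, 𝒮.variationIntegrand Φ H s p ∂(𝒮.areaMeasure (Φ 0))
      = (∫ p in A, deriv (fun s => 𝒮.areaIntegrand Φ s p) s ∂(𝒮.areaMeasure (Φ 0)))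
        + 2 * H * ∫ p in A, 𝒮.volumeIntegrand Φ s p ∂(𝒮.areaMeasure (Φ 0)) := by
    rw [← integral_const_mul]
    exact integral_add h3 (h4.const_mul _)
  rw [h5]
  refine (h1.add (h2.const_mul (2 * H))).congr_of_eventuallyEq ?_
  filter_upwards [hv.mem_nhds hs] with t ht
  rw [areaVolume, hv.areaFunctional_eq c ht, hv.volumeFunctional_eq c ht]
  rfl

/-- The first two derivatives of `A + 2HV`. -/
theorem areaVolume_derivatives : ContDiffAt ℝ 2 (𝒮.areaVolume H A Φ) 0 ∧
    deriv (𝒮.areaVolume H A Φ) 0 = ∫ p in A, 𝒮.variationIntegrand Φ H 0 p ∂(𝒮.areaMeasure (Φ 0)) ∧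
    iteratedDeriv 2 (𝒮.areaVolume H A Φ) 0
      = ∫ p in A, deriv (fun s => 𝒮.variationIntegrand Φ H s p) 0 ∂(𝒮.areaMeasure (Φ 0)) := by
  have := 𝒮.isLocallyFiniteMeasure_areaMeasure c.contMDiff_one
  have j1 := hv.isParam_variationIntegrand c
  exact contDiffAt_two_of_hasDerivAt (hv.hasDerivAt_areaVolume c) (j1.hasDerivAt hv.isCompact)
    ((IsParam.deriv (n := 0) (by simpa using j1)).continuousAt hv.isCompact)

end IsVariation
end SasakianStructure
end SubRiem

namespace SubRiem

/-! ### The first and the second variation -/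

/-- The first two derivatives in `s` of the integrand of `A + 2HV`: at `s = 0` the first one is a curl,
and the second one is a curl up to a multiple of the derivative of the mean curvature density. -/
theorem IsVariationCoframe.dd_variation {al be ga om : Fin 3 → ℝ × E2 → ℝ} {m f : ℝ × E2 → ℝ}
    {κ H : ℝ} {y : E2} (c : IsVariationCoframe al be ga om m f κ H y) :
    dd 0 (wedge al ga 1 2) (0, y) + 2 * H * (f (0, y) * wedge al ga 1 2 (0, y))
      = dd 1 (wedge al ga 0 2) (0, y) - dd 2 (wedge al ga 0 1) (0, y) ∧
    dd 0 (fun q => dd 0 (wedge al ga 1 2) q + 2 * H * (f q * wedge al ga 1 2 q)) (0, y)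
      = f (0, y) * (dd 0 (wedge om ga 1 2) (0, y) + 2 * H * dd 0 (wedge al ga 1 2) (0, y))
        + (dd 1 (dd 0 (wedge al ga 0 2)) (0, y) - dd 2 (dd 0 (wedge al ga 0 1)) (0, y)) := by
  have hX : ∀ i j, ContDiffAt ℝ 2 (wedge al ga i j) (0, y) := fun i j =>
    ((c.cd_al i).mul (c.cd_ga j)).sub ((c.cd_al j).mul (c.cd_ga i))
  have hdX : ∀ k i j, DifferentiableAt ℝ (dd k (wedge al ga i j)) (0, y) := fun k i j =>
    (contDiffAt_dd (n := 1) (by simpa [one_add_one_eq_two] using hX i j) k).differentiableAt (by simp)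
  have hW : DifferentiableAt ℝ (wedge om ga 1 2) (0, y) :=
    (((c.cd_om 1).mul ((c.cd_ga 2).of_le (by norm_num))).sub
      ((c.cd_om 2).mul ((c.cd_ga 1).of_le (by norm_num)))).differentiableAt (by simp)
  have hP := (hX 1 2).differentiableAt (by simp)
  have hf := c.cd_f.differentiableAt (by simp)
  have hm := c.mean.self_of_nhds
  have e : (fun q => dd 0 (wedge al ga 1 2) q + 2 * H * (f q * wedge al ga 1 2 q)) =ᶠ[𝓝 (0, y)]
      fun q => f q * (wedge om ga 1 2 q + 2 * H * wedge al ga 1 2 q)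
        + (dd 1 (wedge al ga 0 2) q - dd 2 (wedge al ga 0 1) q) := by
    filter_upwards [c.dd_density] with q hq
    rw [hq]; ring
  have comm : ∀ k i j, dd 0 (dd k (wedge al ga i j)) (0, y) = dd k (dd 0 (wedge al ga i j)) (0, y) :=
    fun k i j => IsSasakianChart.fderiv_fderiv_comm (hX i j) _ _
  refine ⟨?_, ?_⟩
  · have := e.self_of_nhds
    simp only at this
    rw [this, hm]
    ring
  · have e' : dd 0 (fun q => dd 0 (wedge al ga 1 2) q + 2 * H * (f q * wedge al ga 1 2 q)) (0, y) = _ :=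
      congrArg (fun L : ℝ × E2 →L[ℝ] ℝ => L (dir 0)) e.fderiv_eq
    refine e'.trans ?_
    have h1 := hW.fun_add (hP.const_mul (2 * H))
    have h2 := dd_add (hf.fun_mul h1) ((hdX 1 0 2).fun_sub (hdX 2 0 1)) 0
    rw [dd_mul hf h1, dd_add hW (hP.const_mul _), dd_const_mul hP, dd_sub (hdX 1 0 2) (hdX 2 0 1), comm,
      comm, hm] at h2
    refine h2.trans ?_
    ring

namespace SasakianStructure

variable {M : Type*} [TopologicalSpace M] [ChartedSpace E3 M] [IsManifold 𝓘(ℝ, E3) ∞ M]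
variable {𝒮 : SasakianStructure M}
variable {S : Type*} [TopologicalSpace S] [ChartedSpace E2 S]
  {Φ : ℝ → S → M} {H : ℝ} {p₀ p : S} {y : E2} {I : Set ℝ} {A : Set S} {s : ℝ} {x₀ : M} {q : ℝ × E2}

/-- The form dual to the characteristic field, on the surface. -/
def pullZ (𝒮 : SasakianStructure M) (φ : S → M) (p : S) : E2 →L[ℝ] ℝ :=
  (𝒮.g.inner (φ p) (𝒮.Z φ p)).comp (dmap φ p)

/-- The interior product of the velocity and the `2`-form `⟨Z, ·⟩ ∧ η`. -/
def fluxForm (𝒮 : SasakianStructure M) (Φ : ℝ → S → M) (s : ℝ) (p : S) : E2 →L[ℝ] ℝ :=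
  𝒮.g.inner _ (𝒮.Z (Φ s) p) (velocity Φ s p) • 𝒮.pullEta (Φ s) p
    - 𝒮.η _ (velocity Φ s p) • 𝒮.pullZ (Φ s) p

/-- The component of the velocity along the normal. -/
def normalSpeed (𝒮 : SasakianStructure M) (Φ : ℝ → S → M) (p : S) : ℝ :=
  𝒮.g.inner _ (𝒮.normal (Φ 0) p) (velocity Φ 0 p)

section chart

variable [IsManifold 𝓘(ℝ, E2) 3 S] [OrientedAtlas S]

theorem IsRegPoint.formChart_fluxForm (r : 𝒮.IsRegPoint Φ p₀ x₀ q) (i : Fin 2) :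
    formChart (𝒮.fluxForm Φ q.1) p₀ i q.2 = wedge (𝒮.repAl Φ p₀ x₀) (𝒮.repEta Φ p₀ x₀) 0 i.succ q := by
  have hZ := chartD_Z r.rep r.density_ne
  have e1 : 𝒮.g.inner _ (𝒮.Z (Φ q.1) ((extChartAt 𝓘(ℝ, E2) p₀).symm q.2))
      (velocity Φ q.1 ((extChartAt 𝓘(ℝ, E2) p₀).symm q.2)) = 𝒮.repAl Φ p₀ x₀ 0 q := by
    rw [← 𝒮.inner_chartD r.rep.mem', hZ]
    exact congrArg _ r.rep.chartD_velocity
  have e2 : 𝒮.η _ (velocity Φ q.1 ((extChartAt 𝓘(ℝ, E2) p₀).symm q.2)) = 𝒮.repEta Φ p₀ x₀ 0 q := by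
    rw [← 𝒮.η_chartD r.rep.mem']
    exact congrArg _ r.rep.chartD_velocity
  have e3 : formChart (𝒮.pullZ (Φ q.1)) p₀ i q.2 = 𝒮.repAl Φ p₀ x₀ i.succ q := by
    have h1 : 𝒮.g.inner _ (𝒮.Z (Φ q.1) ((extChartAt 𝓘(ℝ, E2) p₀).symm q.2))
        (dmap (Φ q.1) ((extChartAt 𝓘(ℝ, E2) p₀).symm q.2) (chartDinv p₀ q.2 (b2 i)))
        = 𝒮.chartG x₀ (SubRiem.rep Φ p₀ x₀ q) (𝒮.repZ Φ p₀ x₀ q)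
          (fderiv ℝ (SubRiem.rep Φ p₀ x₀) q (0, b2 i)) := by
      rw [← 𝒮.inner_chartD r.rep.mem', hZ, r.rep.fderiv_slice_eq]
      rfl
    refine Eq.trans h1 ?_
    fin_cases i <;> rfl
  have e4 := formChart_pullEta (𝒮 := 𝒮) r.rep i
  rw [wedge, ← e1, ← e2, ← e3, ← e4, mul_comm (formChart (𝒮.pullZ (Φ q.1)) p₀ i q.2)]
  rfl

/-- A covector is determined by its components in a chart. -/
theorem _root_.SubRiem.exists_eq_formChart {S : Type*} [TopologicalSpace S] [ChartedSpace E2 S]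
    [IsManifold 𝓘(ℝ, E2) 1 S] {p₀ : S} {y : E2} (hy : y ∈ (extChartAt 𝓘(ℝ, E2) p₀).target) :
    ∃ C₀ C₁ : E2 →L[ℝ] ℝ, ∀ ξ : S → E2 →L[ℝ] ℝ,
      ξ ((extChartAt 𝓘(ℝ, E2) p₀).symm y) = formChart ξ p₀ 0 y • C₀ + formChart ξ p₀ 1 y • C₁ := by
  have key : ∀ (ζ : E2 →L[ℝ] ℝ) (D D' : E2 →L[ℝ] E2), (∀ v, D' (D v) = v) →
      ζ = ζ (D' (b2 0)) • (EuclideanSpace.proj 0 : E2 →L[ℝ] ℝ).comp D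
        + ζ (D' (b2 1)) • (EuclideanSpace.proj 1 : E2 →L[ℝ] ℝ).comp D := by
    intro ζ D D' h
    ext1 v
    have h1 := h v
    rw [eq_sum_b2 (D v), map_add, map_smul, map_smul] at h1
    conv_lhs => rw [← h1]
    simp
    ring
  exact ⟨_, _, fun ξ => key (ξ _) _ _ (chartDinv_chartD hy)⟩

omit [OrientedAtlas S] in
theorem IsRegPoint.contDiffAt_wedge (r : 𝒮.IsRegPoint Φ p₀ x₀ q) (i j : Fin 3) :
    ContDiffAt ℝ 2 (wedge (𝒮.repAl Φ p₀ x₀) (𝒮.repEta Φ p₀ x₀) i j) q :=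
  ((r.contDiffAt_al i).mul (r.contDiffAt_eta j)).sub ((r.contDiffAt_al j).mul (r.contDiffAt_eta i))

theorem IsRegPoint.formChart_deriv_fluxForm (r : 𝒮.IsRegPoint Φ p₀ x₀ (0, y)) (i : Fin 2) :
    formChart (fun p => deriv (fun s => 𝒮.fluxForm Φ s p) 0) p₀ i y
      = dd 0 (wedge (𝒮.repAl Φ p₀ x₀) (𝒮.repEta Φ p₀ x₀) 0 i.succ) (0, y) := by
  have hr : ∀ᶠ s in 𝓝 (0 : ℝ), 𝒮.IsRegPoint Φ p₀ x₀ (s, y) :=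
    (Continuous.prodMk_left y).continuousAt.eventually r.eventually
  have hX := fun i : Fin 2 => hasDerivAt_param ((r.contDiffAt_wedge 0 i.succ).differentiableAt (by simp))
  obtain ⟨C₀, C₁, hC⟩ := exists_eq_formChart r.rep.mem
  have e1 : (fun s => 𝒮.fluxForm Φ s ((extChartAt 𝓘(ℝ, E2) p₀).symm y)) =ᶠ[𝓝 0] fun s =>
      wedge (𝒮.repAl Φ p₀ x₀) (𝒮.repEta Φ p₀ x₀) 0 (Fin.succ 0) (s, y) • C₀
      + wedge (𝒮.repAl Φ p₀ x₀) (𝒮.repEta Φ p₀ x₀) 0 (Fin.succ 1) (s, y) • C₁ := by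
    filter_upwards [hr] with s hs
    rw [← hs.formChart_fluxForm, ← hs.formChart_fluxForm]
    exact hC _
  have hd := ((((hX 0).smul_const C₀).add ((hX 1).smul_const C₁)).congr_of_eventuallyEq
    e1).differentiableAt.hasDerivAt
  obtain ⟨v, hv⟩ : ∃ v : E2, v = chartDinv p₀ y (b2 i) := ⟨_, rfl⟩
  have h2 := hd.clm_apply (hasDerivAt_const (0 : ℝ) v)
  have h3 : (fun s => 𝒮.fluxForm Φ s ((extChartAt 𝓘(ℝ, E2) p₀).symm y) v)
      =ᶠ[𝓝 0] fun s => wedge (𝒮.repAl Φ p₀ x₀) (𝒮.repEta Φ p₀ x₀) 0 i.succ (s, y) := by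
    filter_upwards [hr] with s hs
    rw [hv]
    exact hs.formChart_fluxForm i
  have h4 := (h2.congr_of_eventuallyEq h3.symm).unique (hX i)
  rw [map_zero, add_zero, hv] at h4
  exact h4

theorem IsRegPoint.eventually_normalSpeed (r : 𝒮.IsRegPoint Φ p₀ x₀ (0, y)) :
    ∀ᶠ y in 𝓝 y, 𝒮.normalSpeed Φ ((extChartAt 𝓘(ℝ, E2) p₀).symm y)
      = tilt (𝒮.repSlope Φ p₀ x₀ (0, y)) * 𝒮.repSpeed Φ p₀ x₀ (0, y) := by
  filter_upwards [r.eventually_slice] with y' r' using r'.inner_normal_velocity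

omit [OrientedAtlas S] in
theorem IsRegPoint.contDiffAt_normalSpeed (r : 𝒮.IsRegPoint Φ p₀ x₀ (0, y)) :
    ContDiffAt ℝ 2 (fun y => tilt (𝒮.repSlope Φ p₀ x₀ (0, y)) * 𝒮.repSpeed Φ p₀ x₀ (0, y)) y :=
  (ContDiffAt.comp (g := tilt) y contDiff_tilt.contDiffAt
    (IsVariationCoframe.contDiffAt_slice r.contDiffAt_slope)).mul
    (IsVariationCoframe.contDiffAt_slice r.contDiffAt_speed)

end chart
end SasakianStructure
end SubRiem

namespace SubRiem
namespace SasakianStructure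

variable {M : Type*} [TopologicalSpace M] [ChartedSpace E3 M] [IsManifold 𝓘(ℝ, E3) ∞ M]
variable {𝒮 : SasakianStructure M}
variable {S : Type*} [TopologicalSpace S] [ChartedSpace E2 S]
  {Φ : ℝ → S → M} {H : ℝ} {p₀ p : S} {y : E2} {I : Set ℝ} {A : Set S} {s : ℝ} {x₀ : M}

/-- The function `-|N_h|⁻² u Z(u)`, where `u` is the normal component of the velocity.  The curl of its
product with `η` is a part of the difference of the integrands of the second variation and of the
index form. -/
def speedCorrection (𝒮 : SasakianStructure M) (Φ : ℝ → S → M) (p : S) : ℝ :=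
  -(𝒮.normalSpeed Φ p * 𝒮.Zderiv (Φ 0) (𝒮.normalSpeed Φ) p / 𝒮.absNormalH (Φ 0) p ^ 2)

namespace IsVariation

variable (hv : 𝒮.IsVariation (Φ 0) I A Φ)
include hv

theorem normalSpeed_eq_zero (hp : p ∉ A) : 𝒮.normalSpeed Φ p = 0 := by
  rw [normalSpeed, hv.velocity_eq_zero hv.zero_mem hp, map_zero]

theorem fluxForm_eq_zero (hs : s ∈ I) (hp : p ∉ A) : 𝒮.fluxForm Φ s p = 0 := by
  rw [fluxForm, hv.velocity_eq_zero hs hp, map_zero, map_zero, zero_smul, zero_smul, sub_zero]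

variable [IsManifold 𝓘(ℝ, E2) 3 S] [OrientedAtlas S] [T2Space S] (c : 𝒮.IsCMCSlice Φ H)
include c

omit [OrientedAtlas S] [T2Space S] hv in
theorem areaDensity_mul_repWeight (r : 𝒮.IsRegPoint Φ p₀ x₀ (0, y)) (a : ℝ) :
    𝒮.areaDensity (Φ 0) p₀ y * (a * 𝒮.repWeight Φ p₀ x₀ y) = a := by
  rw [r.areaDensity_eq (c.contMDiff_one.mdifferentiable (by simp)), repWeight]
  have h1 := r.density_ne
  have h2 := (tilt_pos (𝒮.repSlope Φ p₀ x₀ (0, y))).ne'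
  field_simp

omit hv c [T2Space S] [OrientedAtlas S] in
theorem _root_.SubRiem.SasakianStructure.IsRegPoint.eventually_wedge_eq
    (r : 𝒮.IsRegPoint Φ p₀ x₀ (0, y)) : (fun q => dd 0 (𝒮.repDensity Φ p₀ x₀) q
      + 2 * H * (𝒮.repSpeed Φ p₀ x₀ q * 𝒮.repDensity Φ p₀ x₀ q)) =ᶠ[𝓝 (0, y)]
    fun q => dd 0 (wedge (𝒮.repAl Φ p₀ x₀) (𝒮.repEta Φ p₀ x₀) 1 2) q
      + 2 * H * (𝒮.repSpeed Φ p₀ x₀ q * wedge (𝒮.repAl Φ p₀ x₀) (𝒮.repEta Φ p₀ x₀) 1 2 q) := by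
  have e : 𝒮.repDensity Φ p₀ x₀ =ᶠ[𝓝 (0, y)] wedge (𝒮.repAl Φ p₀ x₀) (𝒮.repEta Φ p₀ x₀) 1 2 := by
    filter_upwards [r.eventually] with q hq using hq.wedge_eq.symm
  filter_upwards [e.eventuallyEq_nhds] with q hq
  rw [hq.self_of_nhds, dd, dd, hq.fderiv_eq]

/-- The integrand of the first variation is a curl. -/
theorem isCurl_variationIntegrand :
    𝒮.IsCurl (Φ 0) A (𝒮.fluxForm Φ 0) (𝒮.variationIntegrand Φ H 0) where
  isCompact := hv.isCompact
  form_eq_zero p hp := hv.fluxForm_eq_zero hv.zero_mem hp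
  eq_zero p hp := hv.variationIntegrand_eq_zero hv.zero_mem hp
  contDiffAt p₀ y hy hyA i := by
    obtain ⟨x₀, r⟩ := c.exists_isRegPoint hy (hv.subset hyA)
    refine ((IsVariationCoframe.contDiffAt_slice (r.contDiffAt_wedge 0 i.succ)).of_le
      (by norm_num)).congr_of_eventuallyEq ?_
    filter_upwards [r.eventually_slice] with y' r' using r'.formChart_fluxForm i
  curl_eq p₀ y hy hyA := by
    obtain ⟨x₀, r⟩ := c.exists_isRegPoint hy (hv.subset hyA)
    have e : ∀ i : Fin 2, formChart (𝒮.fluxForm Φ 0) p₀ i =ᶠ[𝓝 y]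
        fun y => wedge (𝒮.repAl Φ p₀ x₀) (𝒮.repEta Φ p₀ x₀) 0 i.succ (0, y) := fun i => by
      filter_upwards [r.eventually_slice] with y' r' using r'.formChart_fluxForm i
    have h1 : 𝒮.variationIntegrand Φ H 0 ((extChartAt 𝓘(ℝ, E2) p₀).symm y) = _ :=
      (hv.isRepBy_variationIntegrand c r).self_of_nhds
    have h2 := r.eventually_wedge_eq (H := H).self_of_nhds
    have hX := fun i => (r.contDiffAt_wedge 0 i).differentiableAt (by simp)
    rw [h1, areaDensity_mul_repWeight c r, (e 1).fderiv_eq, (e 0).fderiv_eq, fderiv_slice (hX _),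
      fderiv_slice (hX _)]
    exact h2.trans (c.coframe r).dd_variation.1

omit hv [T2Space S] in
theorem eventually_speedCorrection (r : 𝒮.IsRegPoint Φ p₀ x₀ (0, y)) :
    ∀ᶠ y in 𝓝 y, 𝒮.speedCorrection Φ ((extChartAt 𝓘(ℝ, E2) p₀).symm y)
      = -(tilt (𝒮.repSlope Φ p₀ x₀ (0, y)) * 𝒮.repSpeed Φ p₀ x₀ (0, y) * 𝒮.repZd Φ p₀ x₀
        (fun y => tilt (𝒮.repSlope Φ p₀ x₀ (0, y)) * 𝒮.repSpeed Φ p₀ x₀ (0, y)) y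
        / tilt (𝒮.repSlope Φ p₀ x₀ (0, y)) ^ 2) := by
  filter_upwards [r.eventually_slice] with y' r'
  have h1 : 𝒮.absNormalH (Φ 0) ((extChartAt 𝓘(ℝ, E2) p₀).symm y') = _ :=
    absNormalH_eq r'.rep r'.density_ne
  have h2 := r'.Zderiv_eq (c.injective _) r'.eventually_normalSpeed
    (r'.contDiffAt_normalSpeed.differentiableAt (by simp))
  rw [speedCorrection, h1, h2, r'.eventually_normalSpeed.self_of_nhds]

omit hv [T2Space S] in
theorem contDiffAt_speedCorrection (r : 𝒮.IsRegPoint Φ p₀ x₀ (0, y)) :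
    ContDiffAt ℝ 1 (fun y => -(tilt (𝒮.repSlope Φ p₀ x₀ (0, y)) * 𝒮.repSpeed Φ p₀ x₀ (0, y)
        * 𝒮.repZd Φ p₀ x₀
        (fun y => tilt (𝒮.repSlope Φ p₀ x₀ (0, y)) * 𝒮.repSpeed Φ p₀ x₀ (0, y)) y
        / tilt (𝒮.repSlope Φ p₀ x₀ (0, y)) ^ 2)) y := by
  have k1 := r.contDiffAt_normalSpeed
  have k2 := c.contDiffAt_zd r (n := 1) le_rfl (by simpa [one_add_one_eq_two] using k1)
  have k3 : ContDiffAt ℝ 1 (fun y => tilt (𝒮.repSlope Φ p₀ x₀ (0, y))) y :=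
    ContDiffAt.comp (g := tilt) y contDiff_tilt.contDiffAt
      ((IsVariationCoframe.contDiffAt_slice r.contDiffAt_slope).of_le (by norm_num))
  exact (((k1.of_le (by norm_num)).mul k2).div (k3.pow 2) (pow_ne_zero _ (tilt_pos _).ne')).neg

theorem isCurl_speedCorrection : ∃ ξ, 𝒮.IsCurl (Φ 0) A ξ fun p =>
    𝒮.absNormalH (Φ 0) p * 𝒮.Zderiv (Φ 0) (𝒮.speedCorrection Φ) p
      + 2 * 𝒮.normalT (Φ 0) p * 𝒮.speedCorrection Φ p :=
  ⟨_, c.isCurl hv.isCompact hv.subset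
    (fun p hp => by rw [speedCorrection, hv.normalSpeed_eq_zero hp]; simp)
    fun p₀ y hy hyA => by
      obtain ⟨x₀, r⟩ := c.exists_isRegPoint hy (hv.subset hyA)
      exact (contDiffAt_speedCorrection c r).congr_of_eventuallyEq (eventually_speedCorrection c r)⟩

/-- The normal component of the velocity is a test function. -/
theorem isTestFunction_normalSpeed : 𝒮.IsTestFunction (Φ 0) (𝒮.normalSpeed Φ) := by
  have hts : tsupport (𝒮.normalSpeed Φ) ⊆ A := closure_minimal
    (fun p hp => by_contra fun h => hp (hv.normalSpeed_eq_zero h)) hv.isCompact.isClosed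
  refine ⟨fun p => ?_, HasCompactSupport.intro hv.isCompact fun p hp => hv.normalSpeed_eq_zero hp,
    hts.trans hv.subset⟩
  by_cases hp : p ∈ A
  · obtain ⟨x₀, r⟩ := hv.exists_isRegPoint c hp
    have : IsManifold 𝓘(ℝ, E2) 1 S := IsManifold.of_le (n := 3) (by norm_num)
    have h1 := (r.contDiffAt_normalSpeed.of_le (m := 1) (by norm_num)).congr_of_eventuallyEq
      r.eventually_normalSpeed
    refine (ContMDiffAt.comp (g := fun y => 𝒮.normalSpeed Φ ((extChartAt 𝓘(ℝ, E2) p).symm y)) p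
      h1.contMDiffAt (contMDiffAt_extChartAt (x := p))).congr_of_eventuallyEq ?_
    filter_upwards [mem_nhds_source (mem_extChartAt_source (I := 𝓘(ℝ, E2)) p)] with p' hp'
    rw [Function.comp_apply, (extChartAt 𝓘(ℝ, E2) p).left_inv hp']
  · refine contMDiffAt_const (c := (0 : ℝ)).congr_of_eventuallyEq ?_
    filter_upwards [hv.isCompact.isClosed.isOpen_compl.mem_nhds hp] with p' hp'
      using hv.normalSpeed_eq_zero hp'

omit [IsManifold 𝓘(ℝ, E2) 3 S] [OrientedAtlas S] c in
theorem deriv_variationIntegrand_eq_zero (hp : p ∉ A) :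
    deriv (fun s => 𝒮.variationIntegrand Φ H s p) 0 = 0 := by
  have h : (fun s => 𝒮.variationIntegrand Φ H s p) =ᶠ[𝓝 0] fun _ => 0 := by
    filter_upwards [hv.mem_nhds hv.zero_mem] with s hs using hv.variationIntegrand_eq_zero hs hp
  rw [h.deriv_eq, deriv_const]

/-- The integrand of the second variation, up to curls, is the integrand of the index form. -/
theorem isCurl_deriv_variationIntegrand :
    𝒮.IsCurl (Φ 0) A (fun p => deriv (fun s => 𝒮.fluxForm Φ s p) 0) fun p =>
      deriv (fun s => 𝒮.variationIntegrand Φ H s p) 0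
        - 𝒮.indexIntegrand (Φ 0) (𝒮.normalSpeed Φ) (𝒮.normalSpeed Φ) p
        - (𝒮.absNormalH (Φ 0) p * 𝒮.Zderiv (Φ 0) (𝒮.speedCorrection Φ) p
          + 2 * 𝒮.normalT (Φ 0) p * 𝒮.speedCorrection Φ p) where
  isCompact := hv.isCompact
  form_eq_zero p hp := by
    have h : (fun s => 𝒮.fluxForm Φ s p) =ᶠ[𝓝 0] fun _ => 0 := by
      filter_upwards [hv.mem_nhds hv.zero_mem] with s hs using hv.fluxForm_eq_zero hs hp
    rw [h.deriv_eq, deriv_const]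
  eq_zero p hp := by
    obtain ⟨ξ, hξ⟩ := hv.isCurl_speedCorrection c
    have hu : 𝒮.normalSpeed Φ =ᶠ[𝓝 p] fun _ => 0 := by
      filter_upwards [hv.isCompact.isClosed.isOpen_compl.mem_nhds hp] with p' hp'
        using hv.normalSpeed_eq_zero hp'
    rw [hξ.eq_zero p hp, hv.deriv_variationIntegrand_eq_zero hp,
      indexIntegrand_eq_zero (notMem_tsupport_iff_eventuallyEq.2 hu)]
    simp
  contDiffAt p₀ y hy hyA i := by
    obtain ⟨x₀, r⟩ := c.exists_isRegPoint hy (hv.subset hyA)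
    refine (IsVariationCoframe.contDiffAt_slice (contDiffAt_dd (n := 1)
      (by simpa [one_add_one_eq_two] using r.contDiffAt_wedge 0 i.succ) 0)).congr_of_eventuallyEq ?_
    filter_upwards [r.eventually_slice] with y' r' using r'.formChart_deriv_fluxForm i
  curl_eq p₀ y hy hyA := by
    obtain ⟨x₀, r⟩ := c.exists_isRegPoint hy (hv.subset hyA)
    have e : ∀ i : Fin 2, formChart (fun p => deriv (fun s => 𝒮.fluxForm Φ s p) 0) p₀ i =ᶠ[𝓝 y]
        fun y => dd 0 (wedge (𝒮.repAl Φ p₀ x₀) (𝒮.repEta Φ p₀ x₀) 0 i.succ) (0, y) := fun i => by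
      filter_upwards [r.eventually_slice] with y' r' using r'.formChart_deriv_fluxForm i
    have hX := fun i => (contDiffAt_dd (n := 1)
      (by simpa [one_add_one_eq_two] using r.contDiffAt_wedge 0 i) 0).differentiableAt (by simp)
    have c' := c.coframe r
    have h1 : deriv (fun s => 𝒮.variationIntegrand Φ H s ((extChartAt 𝓘(ℝ, E2) p₀).symm y)) 0 = _ :=
      ((hv.isRepBy_variationIntegrand c r).deriv
        (eventually_differentiableAt r.contDiffAt_variation)).self_of_nhds
    have h2 : dd 0 (fun q => dd 0 (𝒮.repDensity Φ p₀ x₀) q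
      + 2 * H * (𝒮.repSpeed Φ p₀ x₀ q * 𝒮.repDensity Φ p₀ x₀ q)) (0, y) = _ :=
      (congrArg (fun L : ℝ × E2 →L[ℝ] ℝ => L (dir 0)) (r.eventually_wedge_eq (H := H)).fderiv_eq).trans
        c'.dd_variation.2
    have h3 := c'.variation_eq (u := fun y => tilt (𝒮.repSlope Φ p₀ x₀ (0, y))
      * 𝒮.repSpeed Φ p₀ x₀ (0, y)) (fun _ => rfl) (fun _ => rfl)
    beta_reduce at h3
    have h4 := r.Zderiv_eq (c.injective _) r.eventually_normalSpeed
      (r.contDiffAt_normalSpeed.differentiableAt (by simp))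
    have h5 := r.Zderiv_eq (c.injective _) (eventually_speedCorrection c r)
      ((contDiffAt_speedCorrection c r).differentiableAt (by simp))
    have h6 : 𝒮.absNormalH (Φ 0) ((extChartAt 𝓘(ℝ, E2) p₀).symm y) = _ :=
      absNormalH_eq r.rep r.density_ne
    have h7 : 𝒮.normalT (Φ 0) ((extChartAt 𝓘(ℝ, E2) p₀).symm y) = _ := normalT_eq r.rep r.density_ne
    have h8 := r.potential_eq (c.injective _) (c.mean _ (hv.subset hyA))
    have h9 := r.areaDensity_eq (c.contMDiff_one.mdifferentiable (by simp))
    have h10 := r.eventually_normalSpeed.self_of_nhds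
    have h11 := (eventually_speedCorrection c r).self_of_nhds
    rw [mul_sub, mul_sub, h1, areaDensity_mul_repWeight c r, h2, h3, (e 1).fderiv_eq,
      (e 0).fderiv_eq, fderiv_slice (hX _), fderiv_slice (hX _), r.wedge_eq, indexIntegrand, h4, h5, h6, h7,
      h8, h10, h11, h9]
    have ht := (tilt_pos (𝒮.repSlope Φ p₀ x₀ (0, y))).ne'
    refine Eq.trans ?_ (rfl : dd 1 (dd 0 (wedge (𝒮.repAl Φ p₀ x₀) (𝒮.repEta Φ p₀ x₀) 0 2)) (0, y)
      - dd 2 (dd 0 (wedge (𝒮.repAl Φ p₀ x₀) (𝒮.repEta Φ p₀ x₀) 0 1)) (0, y) = _)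
    unfold repPot repZd
    field_simp
    ring

variable [SecondCountableTopology S] [MeasurableSpace S] [BorelSpace S]

/-- The first variation vanishes, because its integrand is a curl. -/
theorem deriv_areaVolume : deriv (𝒮.areaVolume H A Φ) 0 = 0 := by
  rw [(hv.areaVolume_derivatives c).2.1, setIntegral_eq_integral_of_forall_compl_eq_zero fun p hp =>
    hv.variationIntegrand_eq_zero hv.zero_mem hp]
  exact (hv.isCurl_variationIntegrand c).integral_eq_zero c.contMDiff_one c.injective

/-- The second variation is the index form of the normal component of the velocity. -/
theorem iteratedDeriv_areaVolume : iteratedDeriv 2 (𝒮.areaVolume H A Φ) 0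
    = 𝒮.indexForm (Φ 0) (𝒮.normalSpeed Φ) (𝒮.normalSpeed Φ) := by
  have hu := hv.isTestFunction_normalSpeed c
  obtain ⟨ξ, hξ⟩ := hv.isCurl_speedCorrection c
  have hc := hv.isCurl_deriv_variationIntegrand c
  have i1 := c.integrable_indexIntegrand hu
  have i2 := hξ.integrable c.contMDiff_one c.injective
  have i3 := hc.integrable c.contMDiff_one c.injective
  have z2 := hξ.integral_eq_zero c.contMDiff_one c.injective
  have z3 := hc.integral_eq_zero c.contMDiff_one c.injective
  rw [(hv.areaVolume_derivatives c).2.2, setIntegral_eq_integral_of_forall_compl_eq_zero fun p hp =>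
    hv.deriv_variationIntegrand_eq_zero hp, IsCMCSlice.indexForm_eq_integral hu]
  have e : ∀ p, deriv (fun s => 𝒮.variationIntegrand Φ H s p) 0
      = 𝒮.indexIntegrand (Φ 0) (𝒮.normalSpeed Φ) (𝒮.normalSpeed Φ) p
        + (𝒮.absNormalH (Φ 0) p * 𝒮.Zderiv (Φ 0) (𝒮.speedCorrection Φ) p
          + 2 * 𝒮.normalT (Φ 0) p * 𝒮.speedCorrection Φ p)
        + (deriv (fun s => 𝒮.variationIntegrand Φ H s p) 0
        - 𝒮.indexIntegrand (Φ 0) (𝒮.normalSpeed Φ) (𝒮.normalSpeed Φ) p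
        - (𝒮.absNormalH (Φ 0) p * 𝒮.Zderiv (Φ 0) (𝒮.speedCorrection Φ) p
          + 2 * 𝒮.normalT (Φ 0) p * 𝒮.speedCorrection Φ p)) := fun p => by ring
  rw [integral_congr_ae (Eventually.of_forall e)]
  refine (integral_add (i1.add i2) i3).trans ?_
  rw [z3, add_zero]
  refine (integral_add i1 i2).trans ?_
  rw [z2, add_zero]

/-- The area is stationary under a volume constraint: it differs from `A + 2HV` by a constant. -/
theorem hasDerivAt_areaFunctional
    (hV : ∀ᶠ s in 𝓝 (0 : ℝ), 𝒮.volumeFunctional A Φ s = 𝒮.volumeFunctional A Φ 0) :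
    HasDerivAt (𝒮.areaFunctional A Φ) 0 0 := by
  have h1 := ((hv.areaVolume_derivatives c).1.differentiableAt (by simp)).hasDerivAt
  rw [hv.deriv_areaVolume c] at h1
  refine (h1.sub_const (2 * H * 𝒮.volumeFunctional A Φ 0)).congr_of_eventuallyEq ?_
  filter_upwards [hV] with s hs
  rw [areaVolume, hs]
  ring

omit [T2Space S] [SecondCountableTopology S] [MeasurableSpace S] [BorelSpace S] in
/-- The velocity is tangent to the surface if and only if its normal component vanishes. -/
theorem forall_exists_dmap_eq_velocity_iff : (∀ p ∈ 𝒮.regularSet (Φ 0), ∃ v,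
    dmap (Φ 0) p v = velocity Φ 0 p) ↔ 𝒮.normalSpeed Φ = 0 := by
  have key : ∀ p ∈ 𝒮.regularSet (Φ 0), (∃ v, dmap (Φ 0) p v = velocity Φ 0 p) ↔
      𝒮.normalSpeed Φ p = 0 := by
    intro p hp
    obtain ⟨p₁, y, hy, rfl⟩ : ∃ p₁ : S, ∃ y ∈ (extChartAt 𝓘(ℝ, E2) p₁).target,
        (extChartAt 𝓘(ℝ, E2) p₁).symm y = p :=
      ⟨p, _, mem_extChartAt_target p, (extChartAt 𝓘(ℝ, E2) p).left_inv (mem_extChartAt_source p)⟩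
    obtain ⟨x₀, r⟩ := c.exists_isRegPoint hy hp
    refine r.exists_dmap_eq_velocity_iff.trans ?_
    rw [r.eventually_normalSpeed.self_of_nhds, mul_eq_zero, or_iff_right (tilt_pos _).ne']
  refine ⟨fun h => funext fun p => ?_, fun h p hp => (key p hp).2 (congrFun h p)⟩
  by_cases hp : p ∈ A
  · exact (key p (hv.subset hp)).1 (h p (hv.subset hp))
  · exact hv.normalSpeed_eq_zero hp

end IsVariation
end SasakianStructure
end SubRiem

namespace SubRiem
namespace SasakianStructure

/-! ### Stability -/

variable {M : Type*} [TopologicalSpace M] [ChartedSpace E3 M] [IsManifold 𝓘(ℝ, E3) ∞ M]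
  {𝒮 : SasakianStructure M}
  {S : Type*} [TopologicalSpace S] [ChartedSpace E2 S] [IsManifold 𝓘(ℝ, E2) 3 S] [T2Space S] [SecondCountableTopology S]
  [OrientedAtlas S] [MeasurableSpace S] [BorelSpace S] {φ : S → M} {H : ℝ}

namespace IsCMCSlice

variable (c : 𝒮.IsCMCSlice (fun _ => φ) H)
include c

theorem stronglyStable (hQ : ∀ w, 𝒮.IsTestFunction φ w → 0 ≤ 𝒮.indexForm φ w w) :
    𝒮.StronglyStable φ H := by
  have key : ∀ I A Φ, 𝒮.IsVariation φ I A Φ → φ = Φ 0 := fun I A Φ hv =>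
    funext fun p => (hv.zero_eq p).symm
  refine ⟨fun I A Φ hv hV => ?_, fun I A Φ hv => ?_⟩
  · have c' := hv.isCMCSlice c.contMDiff c.injective c
    obtain rfl := key I A Φ hv
    exact hv.hasDerivAt_areaFunctional c' hV
  · have c' := hv.isCMCSlice c.contMDiff c.injective c
    obtain rfl := key I A Φ hv
    refine ⟨(hv.areaVolume_derivatives c').1, hv.deriv_areaVolume c', ?_⟩
    rw [hv.iteratedDeriv_areaVolume c']
    exact hQ _ (hv.isTestFunction_normalSpeed c')

theorem strictlyStable (hQ : ∀ w, 𝒮.IsTestFunction φ w → w ≠ 0 → 0 < 𝒮.indexForm φ w w) :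
    𝒮.StrictlyStable φ H := by
  have h0 : 𝒮.indexForm φ 0 0 = 0 := by
    rw [indexForm]
    refine integral_eq_zero_of_ae (.of_forall fun p => indexIntegrand_eq_zero ?_)
    simp [tsupport]
  refine ⟨c.stronglyStable fun w hw => ?_, fun I A Φ hv => ?_⟩
  · rcases eq_or_ne w 0 with rfl | hw0
    · exact h0.ge
    · exact (hQ w hw hw0).le
  · have c' := hv.isCMCSlice c.contMDiff c.injective c
    obtain rfl : φ = Φ 0 := funext fun p => (hv.zero_eq p).symm
    refine Iff.trans ?_ (hv.forall_exists_dmap_eq_velocity_iff c').symm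
    rw [hv.iteratedDeriv_areaVolume c']
    refine ⟨fun h => ?_, fun h => by rw [h, h0]⟩
    by_contra hu
    exact (hQ _ (hv.isTestFunction_normalSpeed c') hu).ne' h

end IsCMCSlice
end SasakianStructure
end SubRiem

end

theorem mainTheorem1
    {M : Type*} [TopologicalSpace M] [ChartedSpace SubRiem.E3 M]
    [IsManifold 𝓘(ℝ, SubRiem.E3) ∞ M] [T2Space M] [SecondCountableTopology M] [ConnectedSpace M]
    (𝒮 : SubRiem.SasakianStructure M)
    {S : Type*} [TopologicalSpace S] [ChartedSpace SubRiem.E2 S]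
    [IsManifold 𝓘(ℝ, SubRiem.E2) 3 S] [T2Space S] [SecondCountableTopology S]
    [SubRiem.OrientedAtlas S] [MeasurableSpace S] [BorelSpace S]
    (φ : S → M)
    (hφ : ContMDiff 𝓘(ℝ, SubRiem.E2) 𝓘(ℝ, SubRiem.E3) 2 φ)
    (himm : ∀ p, Function.Injective (SubRiem.dmap φ p))
    (hφ3 : ContMDiffOn 𝓘(ℝ, SubRiem.E2) 𝓘(ℝ, SubRiem.E3) 3 φ (𝒮.regularSet φ))
    (H : ℝ) (hH : ∀ p ∈ 𝒮.regularSet φ, 𝒮.meanCurvature φ p = H)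
    (ψ : S → ℝ)
    (hψ : ContMDiffOn 𝓘(ℝ, SubRiem.E2) 𝓘(ℝ, ℝ) 2 ψ (𝒮.regularSet φ))
    (hψ0 : ∀ p ∈ 𝒮.regularSet φ, ψ p ≠ 0) :
    ((∀ p ∈ 𝒮.regularSet φ, ψ p * 𝒮.jacobi φ ψ p ≤ 0) →
      (∀ w : S → ℝ, 𝒮.IsTestFunction φ w →
        IntegrableOn (𝒮.indexIntegrand φ w w) (𝒮.regularSet φ) (𝒮.areaMeasure φ) ∧
          0 ≤ 𝒮.indexForm φ w w) ∧
      𝒮.StronglyStable φ H) ∧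
    ((∀ p ∈ 𝒮.regularSet φ, ψ p * 𝒮.jacobi φ ψ p < 0) →
      (∀ w : S → ℝ, 𝒮.IsTestFunction φ w → w ≠ 0 →
        IntegrableOn (𝒮.indexIntegrand φ w w) (𝒮.regularSet φ) (𝒮.areaMeasure φ) ∧
          0 < 𝒮.indexForm φ w w) ∧
      𝒮.StrictlyStable φ H) := by
  have hopen := 𝒮.isOpen_regularSet (hφ.of_le (by norm_num)) himm
  have c : 𝒮.IsCMCSlice (fun _ => φ) H :=
    ⟨hφ, himm, fun p hp =>
      ContMDiffAt.comp (g := φ) (0, p) (hφ3.contMDiffAt (hopen.mem_nhds hp)) contMDiffAt_snd, hH⟩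
  refine ⟨fun hL => ?_, fun hL => ?_⟩
  · have hQ : ∀ w, 𝒮.IsTestFunction φ w → 0 ≤ 𝒮.indexForm φ w w := fun w hw =>
      c.indexForm_nonneg hw hψ hψ0 hL
    exact ⟨fun w hw => ⟨(c.integrable_indexIntegrand hw).integrableOn, hQ w hw⟩,
      c.stronglyStable hQ⟩
  · have hQ : ∀ w, 𝒮.IsTestFunction φ w → w ≠ 0 → 0 < 𝒮.indexForm φ w w := fun w hw hw0 =>
      c.indexForm_pos hw hψ hψ0 hL hw0
    exact ⟨fun w hw hw0 => ⟨(c.integrable_indexIntegrand hw).integrableOn, hQ w hw hw0⟩,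
      c.strictlyStable hQ⟩
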